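/- Let $k$ be a finite field with $q$ elements, let $A=k[t]$, and let $X$ be a smooth projective geometrically connected curve over $k$ with a surjective morphism $\pi\colon X\to\mathbf P^1_k$ of $k$-schemes. Let $t$ be the coordinate on $\mathbf P^1_k$, write $\infty$ for its pole, and denote also by $t$ its pullback to $X$; put $Y=\pi^{-1}(\mathbf P^1\setminus\{\infty\})$, let $\mathcal O_X(\infty)=\pi^*\mathcal O_{\mathbf P^1}(\infty)$, and for a closed point $z$ of $X$ let $K_z$ be the completion at $z$ of the function field of $X$. The Carlitz exponential is the unique power series $\exp x=x+e_1x^q+e_2x^{q^2}+\cdots$ over $k(t)$ with $\exp(tx)=t\exp x+(\exp x)^q$; it converges on $K_z$ for every $z\in X\setminus Y$. Let $C$ be the sheaf of $A$-modules on $X$ (for the Zariski topology) given by $$C(U)=\Big\{(c,(\gamma_z)_z)\in\Gamma(U\cap Y,\mathcal O_X)\times\prod_{z\in U\setminus Y}K_z\ \Big|\ \exp\gamma_z=c\text{ in }K_z\text{ for all }z\Big\},$$ where $k$ acts by scalar multiplication and $t\in A$ acts by $(c,(\gamma_z)_z)\mapsto(tc+c^q,(t\gamma_z)_z)$. Let $X_A=X\times_k\operatorname{Spec}A$,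 and let $\tau_A\colon X_A\to X_A$ be the base change of the $q$-power Frobenius endomorphism $\tau$ of $X$. An $A$-shtuka on $X$ is a diagram $[\mathcal M\xrightarrow{\sigma}\mathcal M'\xleftarrow{j}\tau_A^*\mathcal M]$ of quasi-coherent $\mathcal O_{X_A}$-modules; a morphism of shtukas is a pair of morphisms $f\colon\mathcal M_1\to\mathcal M_2$, $f'\colon\mathcal M'_1\to\mathcal M'_2$ with $f'\sigma_1=\sigma_2f$ and $f'j_1=j_2\,\tau_A^*(f)$. The $A$-shtukas on $X$ form an $A$-linear abelian category, and $\operatorname{Ext}^i$ denotes the Yoneda extension groups in it, which are $A$-modules. Identify $\tau_A^*\mathcal O_{X_A}$ with $\mathcal O_{X_A}$, and let $\mathbb 1$ be the unit shtuka $[\mathcal O_{X_A}\xrightarrow{1}\mathcal O_{X_A}\xleftarrow{1}\tau_A^*\mathcal O_{X_A}]$ and $\mathcal C$ the Carlitz shtuka $$\mathcal C=\big[\mathcal O_X\boxtimes A\xrightarrow{\ \sigma\ }\mathcal O_X(\infty)\boxtimes A\xleftarrow{\ 1\ }\tau^*\mathcal O_X\boxtimes A\big],\qquad\sigma=1\otimes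 t-t\otimes1 .$$ Then for every integer $i$ there is an isomorphism of $A$-modules $$\operatorname{Ext}^i(\mathbb 1,\mathcal C)\;\cong\;\mathrm H^{i-1}(X,C).$$ In particular $\operatorname{Ext}^0(\mathbb 1,\mathcal C)=\operatorname{Hom}(\mathbb 1,\mathcal C)=0$. -/

import Mathlib

open CategoryTheory Limits AlgebraicGeometry TopologicalSpace
open scoped TensorProduct

universe w v u

/-- Diagrams `M ⟶ M' ⟵ T M` in a category, for an endofunctor `T`. -/
structure FrobDiagram {D : Type u} [Category.{v} D] (T : D ⥤ D) where
  M : D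
  M' : D
  σ : M ⟶ M'
  j : T.obj M ⟶ M'

namespace FrobDiagram

variable {D : Type u} [Category.{v} D] {T : D ⥤ D}

/-- Morphisms of diagrams: `(f, f')` with `f' σ = σ f` and `f' j = j (T f)`. -/
@[ext]
structure Hom (X Y : FrobDiagram T) where
  f : X.M ⟶ Y.M
  f' : X.M' ⟶ Y.M'
  comm_σ : X.σ ≫ f' = f ≫ Y.σ
  comm_j : X.j ≫ f' = T.map f ≫ Y.j

instance : Category (FrobDiagram T) where
  Hom := Hom
  id X := { f := 𝟙 _, f' := 𝟙 _, comm_σ := by simp, comm_j := by simp }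
  comp α β :=
    { f := α.f ≫ β.f
      f' := α.f' ≫ β.f'
      comm_σ := by rw [← Category.assoc, α.comm_σ, Category.assoc, β.comm_σ, Category.assoc]
      comm_j := by rw [← Category.assoc, α.comm_j, Category.assoc, β.comm_j, T.map_comp, Category.assoc] }

@[ext]
lemma hom_ext {X Y : FrobDiagram T} {α β : X ⟶ Y} (h : α.f = β.f) (h' : α.f' = β.f') : α = β :=
  Hom.ext h h'

@[simp] lemma id_f (X : FrobDiagram T) : Hom.f (𝟙 X) = 𝟙 X.M := rfl
@[simp] lemma id_f' (X : FrobDiagram T) : Hom.f' (𝟙 X) = 𝟙 X.M' := rfl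
@[simp] lemma comp_f {X Y Z : FrobDiagram T} (α : X ⟶ Y) (β : Y ⟶ Z) :
    (α ≫ β).f = α.f ≫ β.f := rfl
@[simp] lemma comp_f' {X Y Z : FrobDiagram T} (α : X ⟶ Y) (β : Y ⟶ Z) :
    (α ≫ β).f' = α.f' ≫ β.f' := rfl

variable (T) in
@[simps]
def fst : FrobDiagram T ⥤ D where
  obj X := X.M
  map α := α.f

variable (T) in
@[simps]
def snd : FrobDiagram T ⥤ D where
  obj X := X.M'
  map α := α.f'

lemma isIso_of_components {X Y : FrobDiagram T} (α : X ⟶ Y) [IsIso α.f] [IsIso α.f'] :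
    IsIso α :=
  ⟨{ f := inv α.f
     f' := inv α.f'
     comm_σ := by rw [IsIso.eq_inv_comp, ← Category.assoc, ← α.comm_σ, Category.assoc, IsIso.hom_inv_id,
      Category.comp_id]
     comm_j := by
      rw [Functor.map_inv, IsIso.eq_inv_comp, ← Category.assoc, ← α.comm_j, Category.assoc,
        IsIso.hom_inv_id, Category.comp_id] }, by ext <;> simp, by ext <;> simp⟩

section Limits

lemma aux₁ {a b b' c c' : D} {p : a ⟶ b} {m : b ⟶ b'} {p' : a ⟶ b'} {s : b ⟶ c}
    {m' : c ⟶ c'} {s' : b' ⟶ c'} (h : p ≫ m = p') (h' : s ≫ m' = m ≫ s') :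
    𝟙 a ≫ p' ≫ s' = (p ≫ s) ≫ m' := by
  rw [Category.id_comp, ← h, Category.assoc, Category.assoc, h']

lemma aux₂ {b b' c c' d : D} {m : b ⟶ b'} {s : b ⟶ c} {m' : c ⟶ c'} {s' : b' ⟶ c'}
    {i : c ⟶ d} {i' : c' ⟶ d} (h : m' ≫ i' = i) (h' : s ≫ m' = m ≫ s') :
    m ≫ s' ≫ i' = (s ≫ i) ≫ 𝟙 d := by
  rw [Category.comp_id, ← h, reassoc_of% h']

lemma aux₃ {a b c d e : D} {s : a ⟶ b} {l' : b ⟶ c} {p' : c ⟶ d} {l : a ⟶ e}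
    {s₁ : e ⟶ c} {q : b ⟶ d} {e' : D} {p : e ⟶ e'} {q' : a ⟶ e'} {s₂ : e' ⟶ d}
    (h1 : l ≫ p = q') (h2 : l' ≫ p' = q) (h3 : s₁ ≫ p' = p ≫ s₂) (h4 : s ≫ q = q' ≫ s₂) :
    (s ≫ l') ≫ p' = (l ≫ s₁) ≫ p' := by
  rw [Category.assoc, Category.assoc, h2, h3, reassoc_of% h1, h4]

lemma aux₄ {a b c d e x : D} {i : a ⟶ b} {s₁ : b ⟶ c} {l' : c ⟶ d} {l : b ⟶ e}
    {s : e ⟶ d} {s₂ : a ⟶ x} {i' : x ⟶ c} {q : a ⟶ e} {q' : x ⟶ d}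
    (h1 : i ≫ l = q) (h2 : i' ≫ l' = q') (h3 : i ≫ s₁ = s₂ ≫ i') (h4 : s₂ ≫ q' = q ≫ s) :
    i ≫ s₁ ≫ l' = i ≫ l ≫ s := by
  rw [reassoc_of% h3, reassoc_of% h1, h2, h4]

variable {J : Type*} [Category* J] (F : J ⥤ FrobDiagram T)

/-- The cones over the two components of a diagram of diagrams. -/
abbrev coneFst (s : Cone F) : Cone (F ⋙ fst T) where
  pt := s.pt.M
  π := { app := fun i => (s.π.app i).f
         naturality := fun _ _ a => congrArg Hom.f (s.π.naturality a) }

/-- See `coneFst`. -/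
abbrev coneSnd (s : Cone F) : Cone (F ⋙ snd T) where
  pt := s.pt.M'
  π := { app := fun i => (s.π.app i).f'
         naturality := fun _ _ a => congrArg Hom.f' (s.π.naturality a) }

/-- The cone with vertex `c.pt` given by the maps `σ`. -/
abbrev coneσ (c : Cone (F ⋙ fst T)) : Cone (F ⋙ snd T) where
  pt := c.pt
  π := { app := fun i => c.π.app i ≫ (F.obj i).σ
         naturality := fun i i' a => by
          have h : c.π.app i ≫ (F.map a).f = c.π.app i' := c.w a
          exact aux₁ h (F.map a).comm_σ }

/-- The cone with vertex `T c.pt` given by the maps `j`. -/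
abbrev conej (c : Cone (F ⋙ fst T)) : Cone (F ⋙ snd T) where
  pt := T.obj c.pt
  π := { app := fun i => T.map (c.π.app i) ≫ (F.obj i).j
         naturality := fun i i' a => by
          have h : c.π.app i ≫ (F.map a).f = c.π.app i' := c.w a
          exact aux₁ ((T.map_comp _ _).symm.trans (congrArg T.map h)) (F.map a).comm_j }

/-- Limits are computed componentwise. -/
abbrev limitCone (c : Cone (F ⋙ fst T)) {c' : Cone (F ⋙ snd T)} (hc' : IsLimit c') :
    Cone F where
  pt :=
    { M := c.pt
      M' := c'.pt
      σ := hc'.lift (coneσ F c)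
      j := hc'.lift (conej F c) }
  π :=
    { app := fun i => { f := c.π.app i, f' := c'.π.app i
                        comm_σ := hc'.fac _ i, comm_j := hc'.fac _ i }
      naturality := fun i i' a => by
        ext
        · exact c.π.naturality a
        · exact c'.π.naturality a }

/-- Limits are computed componentwise. -/
def isLimitLimitCone {c : Cone (F ⋙ fst T)} (hc : IsLimit c) {c' : Cone (F ⋙ snd T)}
    (hc' : IsLimit c') : IsLimit (limitCone F c hc') where
  lift s :=
    { f := hc.lift (coneFst F s)
      f' := hc'.lift (coneSnd F s)
      comm_σ := hc'.hom_ext fun i => aux₃ (hc.fac (coneFst F s) i) (hc'.fac (coneSnd F s) i)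
        (hc'.fac (coneσ F c) i) (s.π.app i).comm_σ
      comm_j := hc'.hom_ext fun i => aux₃
        ((T.map_comp _ _).symm.trans (congrArg T.map (hc.fac (coneFst F s) i)))
        (hc'.fac (coneSnd F s) i) (hc'.fac (conej F c) i) (s.π.app i).comm_j }
  fac s i := by
    ext
    · exact hc.fac (coneFst F s) i
    · exact hc'.fac (coneSnd F s) i
  uniq s m hm := by
    ext
    · exact hc.uniq (coneFst F s) _ fun i => congrArg Hom.f (hm i)
    · exact hc'.uniq (coneSnd F s) _ fun i => congrArg Hom.f' (hm i)

instance [HasLimitsOfShape J D] : HasLimitsOfShape J (FrobDiagram T) where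
  has_limit F := ⟨⟨⟨_, isLimitLimitCone F (limit.isLimit _) (limit.isLimit _)⟩⟩⟩

instance [HasLimitsOfShape J D] : PreservesLimitsOfShape J (fst T) where
  preservesLimit {F} := preservesLimit_of_preserves_limit_cone
    (isLimitLimitCone F (limit.isLimit _) (limit.isLimit _))
    ((limit.isLimit (F ⋙ fst T)).ofIsoLimit (Cone.ext (Iso.refl _) (fun _ =>
      (Category.id_comp _).symm)))

instance [HasLimitsOfShape J D] : PreservesLimitsOfShape J (snd T) where
  preservesLimit {F} := preservesLimit_of_preserves_limit_cone
    (isLimitLimitCone F (limit.isLimit _) (limit.isLimit _))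
    ((limit.isLimit (F ⋙ snd T)).ofIsoLimit (Cone.ext (Iso.refl _) (fun _ =>
      (Category.id_comp _).symm)))

/-- The cocones over the two components of a diagram of diagrams. -/
abbrev coconeFst (s : Cocone F) : Cocone (F ⋙ fst T) where
  pt := s.pt.M
  ι := { app := fun i => (s.ι.app i).f
         naturality := fun _ _ a => congrArg Hom.f (s.ι.naturality a) }

/-- See `coconeFst`. -/
abbrev coconeSnd (s : Cocone F) : Cocone (F ⋙ snd T) where
  pt := s.pt.M'
  ι := { app := fun i => (s.ι.app i).f'
         naturality := fun _ _ a => congrArg Hom.f' (s.ι.naturality a) }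

/-- The cocone with vertex `c'.pt` given by the maps `σ`. -/
abbrev coconeσ (c' : Cocone (F ⋙ snd T)) : Cocone (F ⋙ fst T) where
  pt := c'.pt
  ι := { app := fun i => (F.obj i).σ ≫ c'.ι.app i
         naturality := fun i i' a => by
          have h : (F.map a).f' ≫ c'.ι.app i' = c'.ι.app i := c'.w a
          exact aux₂ h (F.map a).comm_σ }

/-- The cocone with vertex `c'.pt` given by the maps `j`. -/
abbrev coconej (c' : Cocone (F ⋙ snd T)) : Cocone ((F ⋙ fst T) ⋙ T) where
  pt := c'.pt
  ι := { app := fun i => (F.obj i).j ≫ c'.ι.app i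
         naturality := fun i i' a => by
          have h : (F.map a).f' ≫ c'.ι.app i' = c'.ι.app i := c'.w a
          exact aux₂ h (F.map a).comm_j }

/-- Colimits are computed componentwise if `T` preserves them. -/
abbrev colimitCocone {c : Cocone (F ⋙ fst T)} (hc : IsColimit c)
    (hT : IsColimit (T.mapCocone c)) (c' : Cocone (F ⋙ snd T)) : Cocone F where
  pt :=
    { M := c.pt
      M' := c'.pt
      σ := hc.desc (coconeσ F c')
      j := hT.desc (coconej F c') }
  ι :=
    { app := fun i => { f := c.ι.app i, f' := c'.ι.app i
                        comm_σ := (hc.fac (coconeσ F c') i).symm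
                        comm_j := (hT.fac (coconej F c') i).symm }
      naturality := fun i i' a => by
        ext
        · exact c.ι.naturality a
        · exact c'.ι.naturality a }

/-- Colimits are computed componentwise if `T` preserves them. -/
def isColimitColimitCocone {c : Cocone (F ⋙ fst T)} (hc : IsColimit c)
    (hT : IsColimit (T.mapCocone c)) {c' : Cocone (F ⋙ snd T)}
    (hc' : IsColimit c') : IsColimit (colimitCocone F hc hT c') where
  desc s :=
    { f := hc.desc (coconeFst F s)
      f' := hc'.desc (coconeSnd F s)
      comm_σ := hc.hom_ext fun i => aux₄ (hc.fac (coconeFst F s) i)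
        (hc'.fac (coconeSnd F s) i) (hc.fac (coconeσ F c') i) (s.ι.app i).comm_σ
      comm_j := hT.hom_ext fun i => aux₄
        ((T.map_comp _ _).symm.trans (congrArg T.map (hc.fac (coconeFst F s) i)))
        (hc'.fac (coconeSnd F s) i) (hT.fac (coconej F c') i) (s.ι.app i).comm_j }
  fac s i := by
    ext
    · exact hc.fac (coconeFst F s) i
    · exact hc'.fac (coconeSnd F s) i
  uniq s m hm := by
    ext
    · exact hc.uniq (coconeFst F s) _ fun i => congrArg Hom.f (hm i)
    · exact hc'.uniq (coconeSnd F s) _ fun i => congrArg Hom.f' (hm i)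

variable [HasColimitsOfShape J D] [PreservesColimitsOfShape J T]

instance : HasColimitsOfShape J (FrobDiagram T) where
  has_colimit F := ⟨⟨⟨_, isColimitColimitCocone F (colimit.isColimit _)
    (isColimitOfPreserves T (colimit.isColimit _)) (colimit.isColimit _)⟩⟩⟩

instance : PreservesColimitsOfShape J (fst T) where
  preservesColimit {F} := preservesColimit_of_preserves_colimit_cocone
    (isColimitColimitCocone F (colimit.isColimit _)
      (isColimitOfPreserves T (colimit.isColimit _)) (colimit.isColimit _))
    ((colimit.isColimit (F ⋙ fst T)).ofIsoColimit (Cocone.ext (Iso.refl _) (fun _ =>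
      Category.comp_id _)))

instance : PreservesColimitsOfShape J (snd T) where
  preservesColimit {F} := preservesColimit_of_preserves_colimit_cocone
    (isColimitColimitCocone F (colimit.isColimit _)
      (isColimitOfPreserves T (colimit.isColimit _)) (colimit.isColimit _))
    ((colimit.isColimit (F ⋙ snd T)).ofIsoColimit (Cocone.ext (Iso.refl _) (fun _ =>
      Category.comp_id _)))

end Limits

section Preadditive

variable [Preadditive D] [T.Additive]

instance {X Y : FrobDiagram T} : Zero (X ⟶ Y) := ⟨⟨0, 0, by simp, by simp⟩⟩
instance {X Y : FrobDiagram T} : Add (X ⟶ Y) :=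
  ⟨fun α β => ⟨α.f + β.f, α.f' + β.f', by simp [α.comm_σ, β.comm_σ],
    by simp [α.comm_j, β.comm_j]⟩⟩
instance {X Y : FrobDiagram T} : Neg (X ⟶ Y) :=
  ⟨fun α => ⟨-α.f, -α.f', by simp [α.comm_σ], by simp [α.comm_j]⟩⟩

@[simp] lemma zero_f (X Y : FrobDiagram T) : Hom.f (0 : X ⟶ Y) = 0 := rfl
@[simp] lemma zero_f' (X Y : FrobDiagram T) : Hom.f' (0 : X ⟶ Y) = 0 := rfl
@[simp] lemma add_f {X Y : FrobDiagram T} (α β : X ⟶ Y) : (α + β).f = α.f + β.f := rfl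
@[simp] lemma add_f' {X Y : FrobDiagram T} (α β : X ⟶ Y) : (α + β).f' = α.f' + β.f' := rfl
@[simp] lemma neg_f {X Y : FrobDiagram T} (α : X ⟶ Y) : (-α).f = -α.f := rfl
@[simp] lemma neg_f' {X Y : FrobDiagram T} (α : X ⟶ Y) : (-α).f' = -α.f' := rfl

instance {X Y : FrobDiagram T} : AddCommGroup (X ⟶ Y) where
  add_assoc _ _ _ := by ext <;> simp [add_assoc]
  zero_add _ := by ext <;> simp
  add_zero _ := by ext <;> simp
  add_comm _ _ := by ext <;> simp [add_comm]
  neg_add_cancel _ := by ext <;> simp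
  nsmul := nsmulRec
  zsmul := zsmulRec

instance : Preadditive (FrobDiagram T) where

instance : (fst T).Additive where
instance : (snd T).Additive where

variable {R : Type w} [CommRing R] [Linear R D] [T.Linear R]

instance {X Y : FrobDiagram T} : SMul R (X ⟶ Y) :=
  ⟨fun r α => ⟨r • α.f, r • α.f', by simp [α.comm_σ], by simp [α.comm_j, T.map_smul]⟩⟩

@[simp] lemma smul_f {X Y : FrobDiagram T} (r : R) (α : X ⟶ Y) : (r • α).f = r • α.f := rfl
@[simp] lemma smul_f' {X Y : FrobDiagram T} (r : R) (α : X ⟶ Y) : (r • α).f' = r • α.f' := rfl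

instance {X Y : FrobDiagram T} : Module R (X ⟶ Y) where
  one_smul _ := by ext <;> simp
  mul_smul _ _ _ := by ext <;> simp [mul_smul]
  smul_zero _ := by ext <;> simp
  smul_add _ _ _ := by ext <;> simp
  add_smul _ _ _ := by ext <;> simp [add_smul]
  zero_smul _ := by ext <;> simp

instance : Linear R (FrobDiagram T) where

end Preadditive

section Abelian

variable [Abelian D] [T.Additive] [PreservesFiniteColimits T]

instance {X Y : FrobDiagram T} (α : X ⟶ Y) : IsIso (Abelian.coimageImageComparison α) := by
  have h1 : IsIso ((fst T).map (Abelian.coimageImageComparison α)) :=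
    (Arrow.isIso_iff_isIso_of_isIso
      (Abelian.PreservesCoimageImageComparison.iso (fst T) α).inv).1
      (inferInstanceAs (IsIso (Abelian.coimageImageComparison ((fst T).map α))))
  have h2 : IsIso ((snd T).map (Abelian.coimageImageComparison α)) :=
    (Arrow.isIso_iff_isIso_of_isIso
      (Abelian.PreservesCoimageImageComparison.iso (snd T) α).inv).1
      (inferInstanceAs (IsIso (Abelian.coimageImageComparison ((snd T).map α))))
  exact @isIso_of_components _ _ _ _ _ _ h1 h2

noncomputable instance : Abelian (FrobDiagram T) :=
  have : HasFiniteProducts (FrobDiagram T) := ⟨fun _ => inferInstance⟩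
  Abelian.ofCoimageImageComparisonIsIso

end Abelian

end FrobDiagram

namespace QCoh
noncomputable section

variable {X Y : Scheme.{u}}

lemma of_presentation (M : X.Modules) {ι : Type u} (U : ι → X.Opens) (hU : IsOpenCover U)
    (P : ∀ i, (M.restrict (U i).ι).Presentation) : M.IsQuasicoherent := by
  let D : SheafOfModules.QuasicoherentData.{u} (R := X.ringCatSheaf) M :=
    { I := ι
      X := U
      coversTop := by rw [Opens.coversTop_iff]; exact hU
      presentation := fun i =>
        let e : SheafOfModules.{u} (X.ringCatSheaf.over (U i)) ≌
            SheafOfModules.{u} (U i : Scheme.{u}).ringCatSheaf := Scheme.Modules.overEquiv (U i)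
        have : PreservesColimitsOfSize.{u, u} e.inverse := inferInstance
        let i₁ : e.functor.obj (SheafOfModules.over M (U i)) ≅ M.restrict (U i).ι :=
          (Scheme.Modules.overFunctorEquiv (U i)).app M
        let i₂ : e.inverse.obj (M.restrict (U i).ι) ≅ SheafOfModules.over M (U i) :=
          e.inverse.mapIso i₁.symm ≪≫ (e.unitIso.app (SheafOfModules.over M (U i))).symm
        SheafOfModules.Presentation.ofIsIso.{u, u, u} i₂.hom
          ((P i).map e.inverse (e.unitIso.app _ ≪≫ e.inverse.mapIso (Iso.refl _))) }
  exact D.isQuasicoherent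

/-- Quasi-coherence can be checked on the members of an open cover. -/
lemma of_cover (M : X.Modules) {ι : Type u} {Z : ι → Scheme.{u}} (f : ∀ i, Z i ⟶ X)
    [∀ i, IsOpenImmersion (f i)] (hf : ∀ x, ∃ i, x ∈ (f i).opensRange)
    (h : ∀ i, (M.restrict (f i)).IsQuasicoherent) : M.IsQuasicoherent := by
  choose κ V P hV hV' using fun i => (M.restrict (f i)).exists_isOpenCover_presentation
  refine of_presentation M (ι := Σ i, κ i) (fun j => f j.1 ''ᵁ V j.1 j.2) ?_ fun j => ?_
  · refine eq_top_iff.2 fun x _ => ?_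
    obtain ⟨i, z, rfl⟩ := hf x
    obtain ⟨k, hk⟩ := (hV i).exists_mem z
    exact Opens.mem_iSup.2 ⟨⟨i, k⟩, z, hk, rfl⟩
  · let g : (f j.1 ''ᵁ V j.1 j.2 : X.Opens).toScheme ⟶ V j.1 j.2 :=
      ((f j.1).isoImage (V j.1 j.2)).inv
    have hg : g ≫ (V j.1 j.2).ι ≫ f j.1 = (f j.1 ''ᵁ V j.1 j.2).ι := by
      simp [g]
    let e₁ : ((M.restrict (f j.1)).restrict (V j.1 j.2).ι).restrict g ≅
        (M.restrict ((V j.1 j.2).ι ≫ f j.1)).restrict g :=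
      (Scheme.Modules.restrictFunctor g).mapIso
        ((Scheme.Modules.restrictFunctorComp (V j.1 j.2).ι (f j.1)).app M).symm
    let e₂ : (M.restrict ((V j.1 j.2).ι ≫ f j.1)).restrict g ≅
        M.restrict (g ≫ (V j.1 j.2).ι ≫ f j.1) :=
      ((Scheme.Modules.restrictFunctorComp g ((V j.1 j.2).ι ≫ f j.1)).app M).symm
    let e₃ : M.restrict (g ≫ (V j.1 j.2).ι ≫ f j.1) ≅ M.restrict (f j.1 ''ᵁ V j.1 j.2).ι :=
      (Scheme.Modules.restrictFunctorCongr hg).app M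
    let e : SheafOfModules.Hom _ _ := (e₁ ≪≫ e₂ ≪≫ e₃).hom
    have : @IsIso (SheafOfModules.{u} _) _ _ _ e := (e₁ ≪≫ e₂ ≪≫ e₃).isIso_hom
    exact SheafOfModules.Presentation.ofIsIso.{u, u, u} e
      (Scheme.Modules.presentationRestrict g (P j.1 j.2))

/-- On sections, the kernel of a morphism of modules is the kernel. -/
lemma kernel_sections {M N K : X.Modules} {φ : M ⟶ N} {i : K ⟶ M} (w : i ≫ φ = 0)
    (h : IsLimit (KernelFork.ofι i w)) (U : X.Opens) :
    Function.Injective (i.app U) ∧ ∀ x, φ.app U x = 0 → ∃ y, i.app U y = x := by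
  let G : X.Modules ⥤ Ab := Scheme.Modules.toPresheaf X ⋙ (evaluation _ _).obj (.op U)
  have : Mono i := mono_of_isLimit_fork h
  have : PreservesFiniteLimits ((evaluation (Opens X)ᵒᵖ Ab.{u}).obj (.op U)) :=
    ⟨fun _ => inferInstance⟩
  have hG : PreservesFiniteLimits G := comp_preservesFiniteLimits _ _
  have h1 : Mono (G.map i) := inferInstance
  let S : ShortComplex X.Modules := ShortComplex.mk i φ w
  have hS : S.Exact := ShortComplex.exact_of_f_is_kernel S h
  have hS' := hS.map_of_mono_of_preservesKernel G inferInstance inferInstance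
  rw [ShortComplex.ab_exact_iff] at hS'
  exact ⟨(AddCommGrpCat.mono_iff_injective _).1 h1, fun x hx => hS' x hx⟩

variable {R : CommRingCat.{u}}

lemma isLocalizedModule_ker {A : Type*} [CommRing A] (S : Submonoid A) {K M N K' M' N' : Type*}
    [AddCommGroup K] [AddCommGroup M] [AddCommGroup N] [AddCommGroup K'] [AddCommGroup M']
    [AddCommGroup N'] [Module A K] [Module A M] [Module A N] [Module A K'] [Module A M']
    [Module A N'] (k : K →ₗ[A] K') (m : M →ₗ[A] M') (n : N →ₗ[A] N') (i : K →ₗ[A] M)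
    (i' : K' →ₗ[A] M') (φ : M →ₗ[A] N) (φ' : M' →ₗ[A] N')
    (h1 : ∀ x, m (i x) = i' (k x)) (h2 : ∀ x, n (φ x) = φ' (m x))
    (hi : Function.Injective i) (hi' : Function.Injective i')
    (hex : ∀ x, φ x = 0 → ∃ y, i y = x) (hex' : ∀ y, φ' (i' y) = 0)
    (hM : IsLocalizedModule S m) (hN : IsLocalizedModule S n)
    (hK : ∀ x : S, IsUnit (algebraMap A (Module.End A K') x)) : IsLocalizedModule S k where
  map_units := hK
  surj y := by
    obtain ⟨⟨x, s⟩, hx⟩ := IsLocalizedModule.surj S m (i' y)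
    have h0 : n (φ x) = n 0 := by
      rw [h2, ← hx, map_zero]
      change φ' ((s : A) • i' y) = 0
      rw [map_smul, hex', smul_zero]
    obtain ⟨c, hc⟩ := IsLocalizedModule.exists_of_eq (S := S) h0
    obtain ⟨z, hz⟩ := hex ((c : A) • x) (by
      rw [map_smul]; exact hc.trans (smul_zero _))
    refine ⟨⟨z, c * s⟩, hi' ?_⟩
    rw [← h1, hz]
    change i' (((c : A) * (s : A)) • y) = m ((c : A) • x)
    rw [i'.map_smul, m.map_smul, mul_smul]
    exact congrArg _ hx
  exists_of_eq {x₁ x₂} h := by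
    obtain ⟨c, hc⟩ := IsLocalizedModule.exists_of_eq (S := S) (f := m) (x₁ := i x₁) (x₂ := i x₂)
      (by rw [h1, h1, h])
    refine ⟨c, hi ?_⟩
    change i ((c : A) • x₁) = i ((c : A) • x₂)
    rw [map_smul, map_smul]
    exact hc

lemma spec_kernel {K M N : (Spec R).Modules} {φ : M ⟶ N} {i : K ⟶ M}
    (w : ∀ U x, φ.app U (i.app U x) = 0) (hi : ∀ U, Function.Injective (i.app U))
    (h : ∀ U x, φ.app U x = 0 → ∃ y, i.app U y = x)
    (hM : M.IsQuasicoherent) (hN : N.IsQuasicoherent) : K.IsQuasicoherent := by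
  rw [isQuasicoherent_iff_isIso_fromTildeΓ, isIso_fromTildeΓ_iff_isLocalizing] at hM hN ⊢
  intro f
  let D := PrimeSpectrum.basicOpen f
  refine isLocalizedModule_ker (.powers f) _ _ _
    ((modulesSpecToSheaf.map i).hom.app (.op ⊤)).hom
    ((modulesSpecToSheaf.map i).hom.app (.op D)).hom
    ((modulesSpecToSheaf.map φ).hom.app (.op ⊤)).hom
    ((modulesSpecToSheaf.map φ).hom.app (.op D)).hom
    (fun x => ?_) (fun x => ?_) (hi ⊤) (hi D) (h ⊤) (w D) (hM f) (hN f) ?_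
  · exact (congr($((modulesSpecToSheaf.map i).hom.naturality
      (PrimeSpectrum.basicOpen f).leTop.op).hom x)).symm
  · exact (congr($((modulesSpecToSheaf.map φ).hom.naturality
      (PrimeSpectrum.basicOpen f).leTop.op).hom x)).symm
  · rintro ⟨_, n, rfl⟩
    rw [map_pow]
    exact (Scheme.Modules.isUnit_algebraMap_end_of_le_basicOpen (M := K) f le_rfl).pow n

/-- Quasi-coherence, as a property of modules over a scheme. -/
def qcoh (X : Scheme.{u}) : ObjectProperty X.Modules := fun M => M.IsQuasicoherent

instance : (qcoh X).IsClosedUnderIsomorphisms where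
  of_iso {M N} e h :=
    have : @IsIso (SheafOfModules.{u} X.ringCatSheaf) _ _ _ e.hom := e.isIso_hom
    (SheafOfModules.isQuasicoherent X.ringCatSheaf).prop_of_iso
      (@asIso (SheafOfModules.{u} X.ringCatSheaf) _ _ _ e.hom this) h

lemma qcoh_iff (M : X.Modules) :
    qcoh X M ↔ ∀ x : X.affineCover.I₀, qcoh _ (M.restrict (X.affineCover.f x)) :=
  ⟨fun h _ => @Scheme.Modules.isQuasicoherent_restrictFunctor _ _ _ _ _ h, fun h =>
    of_cover M (fun x => X.affineCover.f x) (fun x => ⟨_, X.affineCover.covers x⟩) h⟩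

instance : (qcoh X).IsClosedUnderKernels where
  kernels_le := by
    rintro K ⟨φ, c, hc, hM, hN⟩
    rw [qcoh_iff] at hM hN ⊢
    intro x
    have key := fun U : (X.affineCover.X x).Opens => kernel_sections (i := c.ι) (φ := φ) c.condition
      (hc.ofIsoLimit (Fork.isoForkOfι c)) (X.affineCover.f x ''ᵁ U)
    refine spec_kernel (φ := (Scheme.Modules.restrictFunctor (X.affineCover.f x)).map φ)
      (i := (Scheme.Modules.restrictFunctor (X.affineCover.f x)).map c.ι)
      (fun U y => ?_) (fun U => (key U).1) (fun U => (key U).2) (hM x) (hN x)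
    have := congrArg (fun α => α.app (X.affineCover.f x ''ᵁ U)) c.condition
    exact ConcreteCategory.congr_hom this y

lemma spec_qcoh : qcoh (Spec R) = (tilde.functor R).essImage := by
  ext M
  exact (isQuasicoherent_iff_isIso_fromTildeΓ M).trans isIso_fromTildeΓ_iff

lemma spec_colimit {J : Type w} [Category.{v} J] [HasColimitsOfShape J (ModuleCat.{u} R)] :
    (qcoh (Spec R)).IsClosedUnderColimitsOfShape J := by
  have h : (tilde.functor R).IsLeftAdjoint := tilde.adjunction.isLeftAdjoint
  have : PreservesColimitsOfShape J (tilde.functor R) := inferInstance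
  have h1 : (tilde.functor R).essImage.IsClosedUnderColimitsOfShape J := inferInstance
  exact spec_qcoh (R := R) ▸ h1

lemma closed_colimit {J : Type w} [Category.{v} J]
    [∀ R : CommRingCat.{u}, HasColimitsOfShape J (ModuleCat.{u} R)] :
    (qcoh X).IsClosedUnderColimitsOfShape J where
  colimitsOfShape_le := by
    rintro M ⟨p⟩
    rw [qcoh_iff]
    intro x
    let F := Scheme.Modules.restrictFunctor (X.affineCover.f x)
    have hF : F.IsLeftAdjoint := inferInstance
    have : (qcoh (X.affineCover.X x)).IsClosedUnderColimitsOfShape J := spec_colimit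
    exact (qcoh (X.affineCover.X x)).colimitsOfShape_le J _ ⟨{
      toColimitPresentation := p.toColimitPresentation.map F
      prop_diag_obj := fun j => (qcoh_iff _).1 (p.prop_diag_obj j) x }⟩

instance : (qcoh X).IsClosedUnderCokernels where
  cokernels_le := by
    rintro K ⟨φ, c, hc, hM, hN⟩
    have : (qcoh X).IsClosedUnderColimitsOfShape WalkingParallelPair := closed_colimit
    exact (qcoh X).prop_of_isColimit hc (by rintro (_ | _) <;> assumption)

/-- In a preadditive category, closure under finite coproducts gives closure under finite
products. -/
lemma closed_products {C : Type u} [Category.{v} C] [Abelian C] (P : ObjectProperty C)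
    [P.IsClosedUnderIsomorphisms]
    (h : ∀ (J : Type) [Finite J], P.IsClosedUnderColimitsOfShape (Discrete J)) :
    P.IsClosedUnderFiniteProducts where
  isClosedUnderLimitsOfShape J _ :=
    { limitsOfShape_le := by
        rintro Z ⟨p⟩
        have := h J
        let f : J → C := fun j => p.diag.obj ⟨j⟩
        have h1 : P (∐ f) := P.prop_of_isColimit (colimit.isColimit _) fun j => p.prop_diag_obj _
        have : HasFiniteBiproducts C := HasFiniteBiproducts.of_hasFiniteProducts
        have e : ∐ f ≅ Z := (biproduct.isoCoproduct f).symm ≪≫ biproduct.isoProduct f ≪≫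
          HasLimit.isoOfNatIso (G := p.diag) (Discrete.natIso (fun j => Iso.refl _)) ≪≫
          (limit.isLimit p.diag).conePointUniqueUpToIso p.isLimit
        exact P.prop_of_iso e h1 }

lemma containsZero {C : Type u} [Category.{v} C] [Abelian C] (P : ObjectProperty C)
    [P.IsClosedUnderFiniteProducts] : P.ContainsZero where
  exists_zero := ⟨∏ᶜ (PEmpty.elim : PEmpty.{1} → C),
    (IsZero.iff_id_eq_zero _).2 (Limits.Pi.hom_ext _ _ fun j => j.elim),
    P.prop_of_isLimit (limit.isLimit _) fun j => j.as.elim⟩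

instance : (qcoh X).IsClosedUnderFiniteProducts :=
  closed_products _ fun _ _ => closed_colimit

instance : (qcoh X).ContainsZero := containsZero _

end
end QCoh

noncomputable section

/-- Diagrams `M ⟶ M' ⟵ T M` of quasi-coherent modules. -/
def FrobDiagram.qcoh {X : Scheme.{u}} (T : X.Modules ⥤ X.Modules) :
    ObjectProperty (FrobDiagram T) :=
  fun Z => QCoh.qcoh X Z.M ∧ QCoh.qcoh X Z.M'

namespace FrobDiagram
variable {X : Scheme.{u}} (T : X.Modules ⥤ X.Modules)

instance : (qcoh T).IsClosedUnderIsomorphisms where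
  of_iso e h := ⟨(QCoh.qcoh X).prop_of_iso ((fst T).mapIso e) h.1,
    (QCoh.qcoh X).prop_of_iso ((snd T).mapIso e) h.2⟩

variable [T.Additive] [PreservesFiniteColimits T]

instance : (qcoh T).IsClosedUnderKernels where
  kernels_le := by
    rintro K ⟨φ, c, hc, hM, hN⟩
    exact ⟨(QCoh.qcoh X).prop_of_isLimit_kernelFork (KernelFork.mapIsLimit c hc (fst T)) hM.1 hN.1,
      (QCoh.qcoh X).prop_of_isLimit_kernelFork (KernelFork.mapIsLimit c hc (snd T)) hM.2 hN.2⟩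

instance : (qcoh T).IsClosedUnderCokernels where
  cokernels_le := by
    rintro K ⟨φ, c, hc, hM, hN⟩
    exact ⟨(QCoh.qcoh X).prop_of_isColimit_cokernelCofork
        (CokernelCofork.mapIsColimit c hc (fst T)) hM.1 hN.1,
      (QCoh.qcoh X).prop_of_isColimit_cokernelCofork
        (CokernelCofork.mapIsColimit c hc (snd T)) hM.2 hN.2⟩

instance : (qcoh T).IsClosedUnderFiniteProducts where
  isClosedUnderLimitsOfShape J _ :=
    { limitsOfShape_le := by
        rintro Z ⟨p⟩
        exact ⟨(QCoh.qcoh X).prop_of_isLimit (isLimitOfPreserves (fst T) p.isLimit)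
            fun j => (p.prop_diag_obj j).1,
          (QCoh.qcoh X).prop_of_isLimit (isLimitOfPreserves (snd T) p.isLimit)
            fun j => (p.prop_diag_obj j).2⟩ }

instance : (qcoh T).ContainsZero := QCoh.containsZero _

instance : Abelian (qcoh T).FullSubcategory := inferInstance

end FrobDiagram
end

namespace QCoh
noncomputable section
variable {X Y : Scheme.{u}}

/-- A morphism of modules from its action on sections. -/
def homMk {M N : X.Modules} (φ : ∀ U : X.Opens, Γ(M, U) →+ Γ(N, U))
    (hφ : ∀ U (r : Γ(X, U)) (x : Γ(M, U)), φ U (r • x) = r • φ U x)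
    (hφ' : ∀ (U V : X.Opens) (i : U ⟶ V) (x : Γ(M, V)),
      φ U (M.presheaf.map i.op x) = N.presheaf.map i.op (φ V x)) : M ⟶ N :=
  ⟨PresheafOfModules.homMk (M₁ := M.val) (M₂ := N.val)
    { app := fun U => AddCommGrpCat.ofHom (φ U.unop)
      naturality := fun V U i => by
        ext x
        exact hφ' U.unop V.unop i.unop x } fun U r x => hφ U.unop r x⟩

@[simp]
lemma homMk_app {M N : X.Modules} (φ : ∀ U : X.Opens, Γ(M, U) →+ Γ(N, U)) (hφ hφ') (U : X.Opens)
    (x : Γ(M, U)) : (homMk (M := M) (N := N) φ hφ hφ').app U x = φ U x := rfl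

lemma hom_ext' {M N : X.Modules} {f g : M ⟶ N} (h : ∀ U x, f.app U x = g.app U x) : f = g := by
  ext U x
  exact h U x

/-- Multiplication by a global function on a module. -/
def mulEnd (r : Γ(X, ⊤)) (M : X.Modules) : M ⟶ M :=
  homMk (fun U => DistribSMul.toAddMonoidHom Γ(M, U) (X.presheaf.map (homOfLE le_top : U ⟶ ⊤).op r))
    (fun U s x => smul_comm _ _ _) (fun U V i x => by
      refine Eq.trans ?_ (M.map_smul i _ x).symm
      rw [← ConcreteCategory.comp_apply, ← X.presheaf.map_comp]
      rfl)

lemma mulEnd_app (r : Γ(X, ⊤)) (M : X.Modules) (U : X.Opens) (x : Γ(M, U)) :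
    (mulEnd r M).app U x = X.presheaf.map (homOfLE le_top : U ⟶ ⊤).op r • x := rfl

/-- Global functions act on all modules. -/
def toCenter (X : Scheme.{u}) : Γ(X, ⊤) →+* CatCenter X.Modules where
  toFun r :=
    { app := mulEnd r
      naturality := fun M N f => hom_ext' fun U x => (f.app_smul _ x).symm }
  map_one' := by
    ext M : 1
    refine hom_ext' fun U x => ?_
    change (mulEnd 1 M).app U x = x
    rw [mulEnd_app, map_one, one_smul]
  map_mul' r s := by
    ext M : 1
    refine hom_ext' fun U x => ?_
    rw [CatCenter.mul_app]
    change (mulEnd (r * s) M).app U x = (mulEnd s M).app U ((mulEnd r M).app U x)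
    simp only [mulEnd_app, map_mul, smul_smul, mul_comm]
  map_zero' := by
    ext M : 1
    refine hom_ext' fun U x => ?_
    change (mulEnd 0 M).app U x = 0
    rw [mulEnd_app, map_zero, zero_smul]
  map_add' r s := by
    ext M : 1
    refine hom_ext' fun U x => ?_
    change (mulEnd (r + s) M).app U x = (mulEnd r M).app U x + (mulEnd s M).app U x
    simp only [mulEnd_app, map_add, add_smul]

lemma adj_aux {C D : Type*} [Category* C] [Category* D] {F : C ⥤ D} {G : D ⥤ C} (adj : F ⊣ G)
    {M : C} {c : M ⟶ M} {c' : F.obj M ⟶ F.obj M} {d : G.obj (F.obj M) ⟶ G.obj (F.obj M)}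
    (h : G.map c' = d) (h' : c ≫ adj.unit.app M = adj.unit.app M ≫ d) : F.map c = c' := by
  apply (adj.homEquiv _ _).injective
  rw [adj.homEquiv_unit, adj.homEquiv_unit, h, ← h']
  exact (adj.unit.naturality c).symm

/-- Multiplication by functions commutes with pullback. -/
lemma pullback_mulEnd (f : X ⟶ Y) (r : Γ(Y, ⊤)) (M : Y.Modules) :
    (Scheme.Modules.pullback f).map (mulEnd r M) = mulEnd (f.appTop r) _ := by
  refine adj_aux (Scheme.Modules.pullbackPushforwardAdjunction f) (d := mulEnd r _)
    (hom_ext' fun U x => ?_) (((toCenter Y) r).naturality _).symm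
  have h : X.presheaf.map (homOfLE le_top : f ⁻¹ᵁ U ⟶ ⊤).op (f.appTop r) =
      f.app U (Y.presheaf.map (homOfLE le_top : U ⟶ ⊤).op r) := by
    rw [← ConcreteCategory.comp_apply, ← ConcreteCategory.comp_apply]
    exact congr($((f.naturality (homOfLE le_top : U ⟶ ⊤).op).symm) r)
  exact congrArg (fun s => s • (show Γ((Scheme.Modules.pullback f).obj M, f ⁻¹ᵁ U) from x)) h

/-- The `R`-linear structure on modules over a scheme whose functions receive `R`. -/
abbrev modulesLinear {R : Type w} [CommRing R] (ρ : R →+* Γ(X, ⊤)) : Linear R X.Modules :=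
  Linear.ofRingMorphism ((toCenter X).comp ρ)

lemma pullback_linear {R : Type w} [CommRing R] (ρ : R →+* Γ(X, ⊤)) (f : X ⟶ X)
    (hf : ∀ r, f.appTop (ρ r) = ρ r) :
    letI := modulesLinear ρ
    (Scheme.Modules.pullback f).Linear R := by
  letI := modulesLinear ρ
  refine ⟨fun {M N} φ r => ?_⟩
  change (Scheme.Modules.pullback f).map (mulEnd (ρ r) M ≫ φ) =
    mulEnd (ρ r) _ ≫ (Scheme.Modules.pullback f).map φ
  rw [Functor.map_comp, pullback_mulEnd, hf]

end
end QCoh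

noncomputable section

namespace Carlitz

section Frobenius

variable (k : Type u) [Field k] [Fintype k]

/-- The `q`-power map on a ring receiving `k`, where `q` is the cardinality of `k`. -/
def frobRingHom {R : Type*} [CommRing R] (φ : k →+* R) : R →+* R :=
  letI := φ.toAlgebra
  (FiniteField.frobeniusAlgHom k R).toRingHom

lemma frobRingHom_apply {R : Type*} [CommRing R] (φ : k →+* R) (x : R) :
    frobRingHom k φ x = x ^ Fintype.card k := rfl

variable {k} {S : Scheme.{u}} (p : S ⟶ Spec (CommRingCat.of k))

/-- The structure map `k → Γ(S, U)` of a `k`-scheme. -/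
def scalars (U : S.Opens) : k →+* Γ(S, U) :=
  ((Scheme.ΓSpecIso (CommRingCat.of k)).inv ≫ p.appLE ⊤ U le_top).hom

/-- The underlying morphism of ringed spaces of `frob`. -/
def frobHom : S.toPresheafedSpace ⟶ S.toPresheafedSpace where
  base := 𝟙 _
  c :=
    { app := fun U => CommRingCat.ofHom (frobRingHom k (scalars p U.unop))
      naturality := fun U V i => by
        ext x
        exact (map_pow (S.presheaf.map i).hom x _).symm }

/-- The `q`-power Frobenius endomorphism of a `k`-scheme: the identity on the underlying space,
and `f ↦ f ^ q` on functions. -/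
def frob : S ⟶ S where
  base := (frobHom p).base
  c := (frobHom p).c
  prop x := by
    constructor
    intro a ha
    obtain ⟨U, hU, f, rfl⟩ := S.presheaf.exists_germ_eq a
    have h := ConcreteCategory.congr_hom (PresheafedSpace.stalkMap_germ
      (X := S.toPresheafedSpace) (Y := S.toPresheafedSpace) (frobHom p) U x hU) f
    have h' : (S.presheaf.germ U x hU) f ^ Fintype.card k =
      ((frobHom p).stalkMap x).hom ((S.presheaf.germ U x hU) f) :=
      Eq.trans (map_pow (S.presheaf.germ U x hU).hom f _).symm h.symm
    exact (isUnit_pow_iff Fintype.card_ne_zero).1 (h' ▸ ha)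

lemma frob_app (U : S.Opens) (x : Γ(S, U)) : (frob p).app U x = x ^ Fintype.card k := rfl

lemma frob_comp : frob p ≫ p = p := by
  apply ext_of_isAffine
  ext x
  rw [Scheme.Hom.comp_appTop, ConcreteCategory.comp_apply]
  refine (frob_app p ⊤ _).trans ?_
  rw [← map_pow]
  obtain ⟨y, rfl⟩ := ((Scheme.ΓSpecIso (CommRingCat.of k)).symm.commRingCatIsoToRingEquiv).surjective x
  rw [← map_pow]
  congr 2
  exact FiniteField.pow_card y

end Frobenius
section ProjLine
variable (k : Type u) [Field k]

/-- The homogeneous coordinate ring `k[X₀, X₁]` with its grading. -/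
abbrev coordGrading : ℕ → Submodule k (MvPolynomial (Fin 2) k) :=
  MvPolynomial.homogeneousSubmodule (Fin 2) k

instance : GradedAlgebra (coordGrading k) := MvPolynomial.gradedAlgebra

/-- The projective line over `k`. -/
abbrev ProjLine : Scheme.{u} := Proj (coordGrading k)

/-- The structure morphism of the projective line. -/
def ProjLine.toSpec : ProjLine k ⟶ Spec (CommRingCat.of k) :=
  Proj.toSpecZero (coordGrading k) ≫ Spec.map (CommRingCat.ofHom (algebraMap k (coordGrading k 0)))

/-- The complement of the point `∞ = (1 : 0)`, where `t = X₀ / X₁` is a function. -/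
def ProjLine.finite : (ProjLine k).Opens := Proj.basicOpen (coordGrading k) (MvPolynomial.X 1)

/-- The complement of the point `0 = (0 : 1)`, where `1 / t = X₁ / X₀` is a function. -/
def ProjLine.infinite : (ProjLine k).Opens := Proj.basicOpen (coordGrading k) (MvPolynomial.X 0)

/-- The coordinate `t = X₀ / X₁`. -/
def ProjLine.t : Γ(ProjLine k, ProjLine.finite k) :=
  Proj.awayToSection (coordGrading k) (MvPolynomial.X 1)
    (HomogeneousLocalization.Away.mk _ (MvPolynomial.isHomogeneous_X k 1) 1 (MvPolynomial.X 0)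
      (MvPolynomial.isHomogeneous_X k 0))

/-- The coordinate `1 / t = X₁ / X₀`. -/
def ProjLine.tInv : Γ(ProjLine k, ProjLine.infinite k) :=
  Proj.awayToSection (coordGrading k) (MvPolynomial.X 0)
    (HomogeneousLocalization.Away.mk _ (MvPolynomial.isHomogeneous_X k 0) 1 (MvPolynomial.X 1)
      (MvPolynomial.isHomogeneous_X k 1))

lemma ProjLine.cover : ProjLine.finite k ⊔ ProjLine.infinite k = ⊤ := by
  have := Proj.iSup_basicOpen_eq_top' (coordGrading k) (MvPolynomial.X : Fin 2 → _)
    (fun i => ⟨1, MvPolynomial.isHomogeneous_X k i⟩) (by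
      refine eq_top_iff.2 fun p _ => ?_
      induction p using MvPolynomial.induction_on with
      | C a =>
        exact Subalgebra.algebraMap_mem _
          (⟨MvPolynomial.C a, MvPolynomial.isHomogeneous_C _ a⟩ : coordGrading k 0)
      | add p q hp hq => exact add_mem (hp trivial) (hq trivial)
      | mul_X p i hp => exact mul_mem (hp trivial) (Algebra.subset_adjoin ⟨i, rfl⟩))
  refine Eq.trans ?_ this
  refine le_antisymm (sup_le
    (le_iSup (fun i => Proj.basicOpen (coordGrading k) (MvPolynomial.X i)) 1)
    (le_iSup (fun i => Proj.basicOpen (coordGrading k) (MvPolynomial.X i)) 0)) (iSup_le fun i => ?_)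
  fin_cases i
  · exact le_sup_right
  · exact le_sup_left

set_option maxHeartbeats 1000000 in
lemma ProjLine.t_mul_tInv (V : (ProjLine k).Opens) (h : V ≤ ProjLine.finite k) (h' : V ≤ ProjLine.infinite k) :
    (ProjLine k).presheaf.map (homOfLE h).op (ProjLine.t k) * (ProjLine k).presheaf.map (homOfLE h').op (ProjLine.tInv k)
      = 1 := by
  have hV : V ≤ Proj.basicOpen (coordGrading k) (MvPolynomial.X 0 * MvPolynomial.X 1) := by
    rw [Proj.basicOpen_mul]
    exact le_inf h' h
  let x₁ : HomogeneousLocalization.Away (coordGrading k) (MvPolynomial.X 1) :=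
    .mk _ (MvPolynomial.isHomogeneous_X k 1) 1 (MvPolynomial.X 0) (MvPolynomial.isHomogeneous_X k 0)
  let x₀ : HomogeneousLocalization.Away (coordGrading k) (MvPolynomial.X 0) :=
    .mk _ (MvPolynomial.isHomogeneous_X k 0) 1 (MvPolynomial.X 1) (MvPolynomial.isHomogeneous_X k 1)
  let a₁ := HomogeneousLocalization.awayMap (coordGrading k) (MvPolynomial.isHomogeneous_X k 0)
    (mul_comm (MvPolynomial.X 0) (MvPolynomial.X 1)) x₁
  let a₀ := HomogeneousLocalization.awayMap (coordGrading k) (MvPolynomial.isHomogeneous_X k 1)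
    (rfl : (MvPolynomial.X 0 : MvPolynomial (Fin 2) k) * MvPolynomial.X 1 = _) x₀
  have ha : a₁ * a₀ = 1 := by
    have h₁ := HomogeneousLocalization.awayMap_mk (coordGrading k)
      (MvPolynomial.isHomogeneous_X k 0) (mul_comm (MvPolynomial.X 0) (MvPolynomial.X 1)) 1
      (MvPolynomial.isHomogeneous_X k 1) _ (MvPolynomial.isHomogeneous_X k 0)
    have h₀ := HomogeneousLocalization.awayMap_mk (coordGrading k)
      (MvPolynomial.isHomogeneous_X k 1) (rfl : (MvPolynomial.X 0 : MvPolynomial (Fin 2) k) *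
      MvPolynomial.X 1 = _) 1 (MvPolynomial.isHomogeneous_X k 0) _
      (MvPolynomial.isHomogeneous_X k 1)
    have : a₁ * a₀ = _ := congrArg₂ (· * ·) h₁ h₀
    rw [this]
    ext
    simp only [HomogeneousLocalization.val_mul, HomogeneousLocalization.Away.val_mk,
      HomogeneousLocalization.val_one, Localization.mk_mul]
    refine Eq.trans (congrArg₂ Localization.mk ?_ rfl) (Localization.mk_self _)
    simp only [Submonoid.coe_mul]
    ring
  have e₁ : (ProjLine k).presheaf.map (homOfLE h).op (t k) = (ProjLine k).presheaf.map
      (homOfLE hV).op (Proj.awayToSection (coordGrading k) _ a₁) := by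
    have := congr($(Proj.awayMap_awayToSection (coordGrading k) (f := MvPolynomial.X 1)
      (MvPolynomial.isHomogeneous_X k 0) (mul_comm (MvPolynomial.X 0) (MvPolynomial.X 1))) x₁)
    refine Eq.trans ?_ (congrArg ((ProjLine k).presheaf.map (homOfLE hV).op) this.symm)
    rw [ConcreteCategory.comp_apply]
    refine Eq.trans ?_ (ConcreteCategory.comp_apply _ _ _)
    exact congr($(((ProjLine k).presheaf.map_comp (homOfLE _).op (homOfLE hV).op)) (t k))
  have e₀ : (ProjLine k).presheaf.map (homOfLE h').op (tInv k) = (ProjLine k).presheaf.map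
      (homOfLE hV).op (Proj.awayToSection (coordGrading k) _ a₀) := by
    have := congr($(Proj.awayMap_awayToSection (coordGrading k) (f := MvPolynomial.X 0)
      (MvPolynomial.isHomogeneous_X k 1) rfl) x₀)
    refine Eq.trans ?_ (congrArg ((ProjLine k).presheaf.map (homOfLE hV).op) this.symm)
    rw [ConcreteCategory.comp_apply]
    refine Eq.trans ?_ (ConcreteCategory.comp_apply _ _ _)
    exact congr($(((ProjLine k).presheaf.map_comp (homOfLE _).op (homOfLE hV).op)) (tInv k))
  rw [e₁, e₀, ← map_mul, ← map_mul, ha, map_one, map_one]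
end ProjLine

section Shtuka
open Polynomial

variable {k : Type u} [Field k] {S : Scheme.{u}} (p : S ⟶ Spec (CommRingCat.of k))

/-- `S_A = S × Spec A` for a `k`-scheme `S`, with `A = k[t]`. -/
def timesA : Scheme.{u} :=
  pullback p (Spec.map (CommRingCat.ofHom (C : k →+* k[X])))

/-- The projection `S_A ⟶ S`. -/
def prS : timesA p ⟶ S := pullback.fst _ _

/-- The projection `S_A ⟶ Spec A`. -/
def prA : timesA p ⟶ Spec (CommRingCat.of k[X]) := pullback.snd _ _

/-- The map `A → Γ(S_A, 𝒪)`, `a ↦ 1 ⊗ a`. -/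
def coeffA : k[X] →+* Γ(timesA p, ⊤) :=
  ((Scheme.ΓSpecIso (CommRingCat.of k[X])).inv ≫ (prA p).appTop).hom

/-- Modules on `S_A` form an `A`-linear category. -/
instance : Linear k[X] (timesA p).Modules := QCoh.modulesLinear (coeffA p)

variable [Fintype k]

/-- The base change `τ_A = τ × id : S_A ⟶ S_A` of the `q`-power Frobenius `τ` of `S`. -/
def frobA : timesA p ⟶ timesA p :=
  pullback.lift (prS p ≫ frob p) (prA p)
    (by rw [Category.assoc, frob_comp]; exact pullback.condition)

lemma frobA_prA : frobA p ≫ prA p = prA p := pullback.lift_snd _ _ _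

lemma frobA_prS : frobA p ≫ prS p = prS p ≫ frob p := pullback.lift_fst _ _ _

lemma frobA_coeffA (a : k[X]) : (frobA p).appTop (coeffA p a) = coeffA p a := by
  have h : (prA p).appTop ≫ (frobA p).appTop = (prA p).appTop := by
    rw [← Scheme.Hom.comp_appTop, frobA_prA]
  exact congr($h ((Scheme.ΓSpecIso (CommRingCat.of k[X])).inv a))

/-- The functor `τ_A^*` on modules over `S_A`. -/
abbrev frobPullback : (timesA p).Modules ⥤ (timesA p).Modules :=
  Scheme.Modules.pullback (frobA p)

instance : (frobPullback p).Linear k[X] :=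
  QCoh.pullback_linear (coeffA p) (frobA p) (frobA_coeffA p)

instance : PreservesFiniteColimits (frobPullback p) :=
  ⟨fun _ => inferInstance⟩

/-- The category of `A`-shtukas on `S`: diagrams `M ⟶ M' ⟵ τ_A^* M` of quasi-coherent modules
on `S_A`. It is an `A`-linear abelian category. -/
abbrev Shtuka := (FrobDiagram.qcoh (frobPullback p)).FullSubcategory

instance : Abelian (Shtuka p) := inferInstance

instance : Linear k[X] (Shtuka p) := inferInstance

end Shtuka

end Carlitz
end

noncomputable section

namespace Carlitz

section Glue

variable {X : Scheme.{u}}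

/-- Restriction of functions. -/
def res {U V : X.Opens} (h : V ≤ U) : Γ(X, U) →+* Γ(X, V) := (X.presheaf.map (homOfLE h).op).hom

lemma res_res {U V W : X.Opens} (h : V ≤ U) (h' : W ≤ V) (x : Γ(X, U)) :
    res h' (res h x) = res (h'.trans h) x :=
  congr($((X.presheaf.map_comp (homOfLE h).op (homOfLE h').op).symm) x)

lemma res_self {U : X.Opens} (h : U ≤ U) (x : Γ(X, U)) : res h x = x :=
  congr($(X.presheaf.map_id (.op U)) x)

lemma exists_glue {ι : Type u} {W : ι → X.Opens} {V : X.Opens} (hV : V ≤ iSup W)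
    (hW : ∀ i, W i ≤ V) (s : ∀ i, Γ(X, W i))
    (hs : ∀ i j, ∀ O : X.Opens, ∀ (h : O ≤ W i) (h' : O ≤ W j), res h (s i) = res h' (s j)) :
    ∃ x : Γ(X, V), ∀ i, res (hW i) x = s i :=
  (TopCat.Sheaf.existsUnique_gluing' X.sheaf W V (fun i => homOfLE (hW i)) hV s
    fun i j => hs i j _ inf_le_left inf_le_right).exists

lemma eq_of_res {ι : Type u} {W : ι → X.Opens} {V : X.Opens} (hV : V ≤ iSup W)
    (hW : ∀ i, W i ≤ V) {x y : Γ(X, V)} (h : ∀ i, res (hW i) x = res (hW i) y) : x = y :=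
  TopCat.Sheaf.eq_of_locally_eq' X.sheaf W V (fun i => homOfLE (hW i)) hV x y h

variable (U₁ U₀ : X.Opens) (u : Γ(X, U₁ ⊓ U₀))

/-- Sections over `V` of the module obtained by gluing `𝒪` on `U₁` and `𝒪` on `U₀` along
multiplication by `u` on `U₁ ⊓ U₀`: pairs `(f, g)` with `f = u g` on the overlap. -/
def glueSections (V : X.Opens) : AddSubgroup (Γ(X, V ⊓ U₁) × Γ(X, V ⊓ U₀)) where
  carrier := {f | res (inf_le_inf_left V inf_le_left) f.1 =
    res (inf_le_right : V ⊓ (U₁ ⊓ U₀) ≤ _) u * res (inf_le_inf_left V inf_le_right) f.2}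
  zero_mem' := by simp
  add_mem' {f g} hf hg := by
    simp only [Set.mem_ofPred_eq] at hf hg ⊢
    simp [hf, hg, mul_add]
  neg_mem' {f} hf := by
    simp only [Set.mem_ofPred_eq] at hf ⊢
    simp [hf]

instance (V : X.Opens) : Module Γ(X, V) (glueSections U₁ U₀ u V) where
  smul r f := ⟨(res inf_le_left r * f.1.1, res inf_le_left r * f.1.2), by
    have := f.2
    simp only [glueSections, AddSubgroup.mem_mk, AddSubmonoid.mem_mk, AddSubsemigroup.mem_mk,
      Set.mem_ofPred_eq] at this ⊢
    change _ = _ at this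
    change res _ _ = _
    rw [map_mul, map_mul, this, res_res, res_res]
    ring⟩
  one_smul f := Subtype.ext (Prod.ext ((congrArg (· * _) (map_one _)).trans (one_mul _))
    ((congrArg (· * _) (map_one _)).trans (one_mul _)))
  mul_smul r s f := Subtype.ext (Prod.ext
    ((congrArg (· * _) (map_mul _ r s)).trans (mul_assoc _ _ _))
    ((congrArg (· * _) (map_mul _ r s)).trans (mul_assoc _ _ _)))
  smul_zero r := Subtype.ext (Prod.ext (mul_zero _) (mul_zero _))
  smul_add r f g := Subtype.ext (Prod.ext (mul_add _ _ _) (mul_add _ _ _))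
  add_smul r s f := Subtype.ext (Prod.ext
    ((congrArg (· * _) (map_add _ r s)).trans (add_mul _ _ _))
    ((congrArg (· * _) (map_add _ r s)).trans (add_mul _ _ _)))
  zero_smul f := Subtype.ext (Prod.ext ((congrArg (· * _) (map_zero _)).trans (zero_mul _))
    ((congrArg (· * _) (map_zero _)).trans (zero_mul _)))

/-- Restriction maps of the glued module. -/
def glueRes {V W : X.Opens} (h : W ≤ V) :
    glueSections U₁ U₀ u V →+ glueSections U₁ U₀ u W where
  toFun f := ⟨(res (inf_le_inf_right U₁ h) f.1.1, res (inf_le_inf_right U₀ h) f.1.2), by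
    have := congrArg (res (inf_le_inf_right (U₁ ⊓ U₀) h)) f.2
    rw [map_mul, res_res, res_res, res_res] at this
    change res _ (res _ _) = _ * res _ (res _ _)
    rw [res_res, res_res]
    exact this⟩
  map_zero' := Subtype.ext (Prod.ext (map_zero _) (map_zero _))
  map_add' f g := Subtype.ext (Prod.ext (map_add _ _ _) (map_add _ _ _))

lemma glueRes_self {V : X.Opens} (h : V ≤ V) (f : glueSections U₁ U₀ u V) :
    glueRes U₁ U₀ u h f = f :=
  Subtype.ext (Prod.ext (res_self (inf_le_inf_right U₁ h) f.1.1)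
    (res_self (inf_le_inf_right U₀ h) f.1.2))

lemma glueRes_glueRes {V W O : X.Opens} (h : W ≤ V) (h' : O ≤ W) (f : glueSections U₁ U₀ u V) :
    glueRes U₁ U₀ u h' (glueRes U₁ U₀ u h f) = glueRes U₁ U₀ u (h'.trans h) f :=
  Subtype.ext (Prod.ext (res_res _ _ f.1.1) (res_res _ _ f.1.2))

/-- The underlying presheaf of the glued module. -/
def gluePresheaf : TopCat.Presheaf Ab.{u} X where
  obj V := AddCommGrpCat.of (glueSections U₁ U₀ u V.unop)
  map i := AddCommGrpCat.ofHom (glueRes U₁ U₀ u i.unop.le)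
  map_id V := by
    exact AddCommGrpCat.hom_ext (AddMonoidHom.ext fun f => glueRes_self U₁ U₀ u le_rfl f)
  map_comp i j := by
    exact AddCommGrpCat.hom_ext (AddMonoidHom.ext fun f =>
      (glueRes_glueRes U₁ U₀ u i.unop.le j.unop.le f).symm)

lemma gluePresheaf_isSheaf : (gluePresheaf U₁ U₀ u).IsSheaf := by
  rw [TopCat.Presheaf.isSheaf_iff_isSheafUniqueGluing]
  intro ι W sf hsf
  let f : ∀ i, glueSections U₁ U₀ u (W i) := sf
  have hf : ∀ i j, glueRes U₁ U₀ u inf_le_left (f i) =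
    glueRes U₁ U₀ u (inf_le_right : W i ⊓ W j ≤ W j) (f j) := hsf
  obtain ⟨x, hx⟩ := exists_glue (V := iSup W ⊓ U₁) (W := fun i => W i ⊓ U₁)
    (iSup_inf_eq W U₁).le (fun i => inf_le_inf_right _ (le_iSup W i)) (fun i => (f i).1.1)
    (fun i j O h h' => by
      have := congrArg (fun z => res (le_inf (le_inf (h.trans inf_le_left) (h'.trans inf_le_left))
        (h.trans inf_le_right) : O ≤ W i ⊓ W j ⊓ U₁) z.1.1) (hf i j)
      exact (res_res _ _ _).symm.trans (this.trans (res_res _ _ _)))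
  obtain ⟨y, hy⟩ := exists_glue (V := iSup W ⊓ U₀) (W := fun i => W i ⊓ U₀)
    (iSup_inf_eq W U₀).le (fun i => inf_le_inf_right _ (le_iSup W i)) (fun i => (f i).1.2)
    (fun i j O h h' => by
      have := congrArg (fun z => res (le_inf (le_inf (h.trans inf_le_left) (h'.trans inf_le_left))
        (h.trans inf_le_right) : O ≤ W i ⊓ W j ⊓ U₀) z.1.2) (hf i j)
      exact (res_res _ _ _).symm.trans (this.trans (res_res _ _ _)))
  refine ⟨(⟨(x, y), ?_⟩ : glueSections U₁ U₀ u (iSup W)), fun i => ?_, fun z hz => ?_⟩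
  · refine eq_of_res (W := fun i => W i ⊓ (U₁ ⊓ U₀)) (iSup_inf_eq W _).le
      (fun i => inf_le_inf_right _ (le_iSup W i)) fun i => ?_
    have := (f i).2
    change res _ _ = _ * res _ _ at this
    rw [← hx, ← hy] at this
    rw [map_mul, res_res, res_res, res_res]
    rw [res_res, res_res] at this
    exact this
  · exact Subtype.ext (Prod.ext (hx i) (hy i))
  · refine Subtype.ext (Prod.ext ?_ ?_)
    · refine eq_of_res (W := fun i => W i ⊓ U₁) (iSup_inf_eq W _).le
        (fun i => inf_le_inf_right _ (le_iSup W i)) fun i => ?_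
      exact Eq.trans (congrArg (fun z : glueSections U₁ U₀ u (W i) => z.1.1) (hz i)) (hx i).symm
    · refine eq_of_res (W := fun i => W i ⊓ U₀) (iSup_inf_eq W _).le
        (fun i => inf_le_inf_right _ (le_iSup W i)) fun i => ?_
      exact Eq.trans (congrArg (fun z : glueSections U₁ U₀ u (W i) => z.1.2) (hz i)) (hy i).symm

/-- The module obtained by gluing `𝒪` on `U₁` and `𝒪` on `U₀` along multiplication by `u`. -/
def glueModule : X.Modules where
  val :=
    letI : ∀ V, Module (X.ringCatSheaf.obj.obj V) ((gluePresheaf U₁ U₀ u).obj V) :=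
      fun V => inferInstanceAs (Module Γ(X, V.unop) (glueSections U₁ U₀ u V.unop))
    PresheafOfModules.ofPresheaf (R := X.ringCatSheaf.obj) (gluePresheaf U₁ U₀ u)
      fun V W i r f => Subtype.ext (Prod.ext
        ((map_mul (res _) _ _).trans (congrArg (· * _) ((res_res _ _ _).trans (res_res _ _ _).symm)))
        ((map_mul (res _) _ _).trans (congrArg (· * _) ((res_res _ _ _).trans (res_res _ _ _).symm))))
  isSheaf := gluePresheaf_isSheaf U₁ U₀ u

end Glue

section Unit

variable {X : Scheme.{u}}

/-- The structure sheaf as a module. -/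
def structureSheaf (X : Scheme.{u}) : X.Modules := SheafOfModules.unit X.ringCatSheaf

/-- A global section of a module, as a morphism from the structure sheaf. -/
def ofSection (M : X.Modules) (x : Γ(M, ⊤)) : structureSheaf X ⟶ M :=
  QCoh.homMk
    (fun U => (AddMonoidHom.mk' (fun r : Γ(X, U) =>
      r • (M.presheaf.map (homOfLE le_top : U ⟶ ⊤).op x : Γ(M, U)))
      fun r s => add_smul _ _ _ : Γ(X, U) →+ Γ(M, U)))
    (fun U r s => mul_smul (α := Γ(X, U)) r s _)
    (fun U V i r => by
      refine Eq.trans ?_ (M.map_smul i _ _).symm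
      refine congrArg (fun z => (_ : Γ(X, U)) • (z : Γ(M, U))) ?_
      exact congr($(M.presheaf.map_comp (homOfLE le_top : V ⟶ ⊤).op i.op) x))

lemma structureSheaf_qcoh_spec (R : CommRingCat.{u}) :
    QCoh.qcoh (Spec R) (structureSheaf (Spec R)) :=
  (inferInstance : (tilde (ModuleCat.of R R)).IsQuasicoherent)

lemma structureSheaf_qcoh (X : Scheme.{u}) : QCoh.qcoh X (structureSheaf X) := by
  rw [QCoh.qcoh_iff]
  intro x
  refine (QCoh.qcoh _).prop_of_iso (Scheme.Modules.restrictUnitIso (X.affineCover.f x)).symm ?_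
  exact structureSheaf_qcoh_spec _

lemma qcoh_restrict_of_gen (M : X.Modules) (U : X.Opens) (x : Γ(M, U))
    (h : ∀ W (hW : W ≤ U), Function.Bijective
      (fun r : Γ(X, W) => r • (M.presheaf.map (homOfLE hW).op x : Γ(M, W)))) :
    QCoh.qcoh _ (M.restrict U.ι) := by
  have hU : ∀ V : (U : Scheme.{u}).Opens, U.ι ''ᵁ V ≤ U := fun V => U.ι_image_le V
  let x' : Γ(M.restrict U.ι, ⊤) := M.presheaf.map (homOfLE (hU ⊤)).op x
  have : IsIso (ofSection (M.restrict U.ι) x') := by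
    rw [Scheme.Modules.Hom.isIso_iff_isIso_app]
    intro V
    rw [ConcreteCategory.isIso_iff_bijective]
    have h1 := (h (U.ι ''ᵁ V) (hU V)).comp
      ((U.ι.appIso V).symm.commRingCatIsoToRingEquiv).bijective
    refine (congrArg Function.Bijective (funext fun r => ?_)).mp h1
    refine congrArg (fun z => ((U.ι.appIso V).inv r) • (z : Γ(M, U.ι ''ᵁ V))) ?_
    exact congr($(M.presheaf.map_comp (homOfLE (hU ⊤)).op
      (homOfLE (U.ι.image_mono (le_top : V ≤ ⊤))).op) x)
  exact (QCoh.qcoh _).prop_of_iso (asIso (ofSection (M.restrict U.ι) x')) (structureSheaf_qcoh _)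

end Unit

section

variable {X : Scheme.{u}} {U₁ U₀ : X.Opens} {u v : Γ(X, U₁ ⊓ U₀)}

/-- The local generator `(1, u⁻¹)` on `U₁`. -/
def glueGen₁ (h : u * v = 1) : glueSections U₁ U₀ u U₁ :=
  ⟨(1, v), by
    change res _ _ = _ * res _ v
    rw [map_one]
    have h' := congrArg (res (inf_le_right : U₁ ⊓ (U₁ ⊓ U₀) ≤ _)) h
    rw [map_mul, map_one] at h'
    exact h'.symm⟩

/-- The local generator `(u, 1)` on `U₀`. -/
def glueGen₀ : glueSections U₁ U₀ u U₀ :=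
  ⟨(res (le_inf inf_le_right inf_le_left) u, 1), by
    change res _ (res _ u) = _ * res _ 1
    rw [map_one, mul_one, res_res]⟩

lemma glueGen₁_bijective (h : u * v = 1) {W : X.Opens} (hW : W ≤ U₁) : Function.Bijective
    (fun r : Γ(X, W) => r • glueRes U₁ U₀ u hW (glueGen₁ h)) := by
  have hW' : W ≤ W ⊓ U₁ := le_inf le_rfl hW
  refine ⟨fun r s hrs => ?_, fun f => ⟨res hW' f.1.1, ?_⟩⟩
  · have h1 := congrArg (fun z => res hW' z.1.1) hrs
    change res _ (res _ r * res _ 1) = res _ (res _ s * res _ 1) at h1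
    rwa [map_one, mul_one, mul_one, res_res, res_res, res_self, res_self] at h1
  · have hf : res _ f.1.1 = res _ u * res _ f.1.2 := f.2
    have hO : W ⊓ U₀ ≤ W ⊓ (U₁ ⊓ U₀) := le_inf inf_le_left (inf_le_inf_right _ hW)
    refine Subtype.ext (Prod.ext ?_ ?_)
    · change res _ (res _ _) * res _ 1 = f.1.1
      rw [map_one, mul_one, res_res, res_self]
    · change res _ (res _ f.1.1) * res _ v = f.1.2
      have hf' := congrArg (res hO) hf
      have h' := congrArg (res (inf_le_inf_right U₀ hW)) h
      rw [map_mul, res_res, res_res, res_res, res_self] at hf'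
      rw [map_mul, map_one] at h'
      rw [res_res, hf', mul_right_comm, h', one_mul]

lemma glueGen₀_bijective {W : X.Opens} (hW : W ≤ U₀) : Function.Bijective
    (fun r : Γ(X, W) => r • glueRes U₁ U₀ u hW glueGen₀) := by
  have hW' : W ≤ W ⊓ U₀ := le_inf le_rfl hW
  refine ⟨fun r s hrs => ?_, fun f => ⟨res hW' f.1.2, ?_⟩⟩
  · have h1 := congrArg (fun z => res hW' z.1.2) hrs
    change res _ (res _ r * res _ 1) = res _ (res _ s * res _ 1) at h1
    rwa [map_one, mul_one, mul_one, res_res, res_res, res_self, res_self] at h1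
  · have hf : res _ f.1.1 = res _ u * res _ f.1.2 := f.2
    have hO : W ⊓ U₁ ≤ W ⊓ (U₁ ⊓ U₀) := le_inf inf_le_left (le_inf inf_le_right
      (inf_le_left.trans hW))
    refine Subtype.ext (Prod.ext ?_ ?_)
    · change res _ (res _ f.1.2) * res _ (res _ u) = f.1.1
      have hf' := congrArg (res hO) hf
      rw [map_mul, res_res, res_res, res_res, res_self] at hf'
      rw [res_res, hf', res_res, mul_comm]
    · change res _ (res _ f.1.2) * res _ 1 = f.1.2
      rw [map_one, mul_one, res_res, res_self]

lemma glueModule_qcoh (h : u * v = 1) (hU : U₁ ⊔ U₀ = ⊤) :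
    QCoh.qcoh X (glueModule U₁ U₀ u) := by
  refine QCoh.of_cover _ (ι := ULift Bool) (Z := fun i => (bif i.down then U₁ else U₀).toScheme)
    (fun i => (bif i.down then U₁ else U₀).ι) (fun x => ?_) ?_
  · have hx : x ∈ U₁ ⊔ U₀ := hU ▸ trivial
    rcases hx with hx | hx
    · exact ⟨⟨true⟩, by simpa using hx⟩
    · exact ⟨⟨false⟩, by simpa using hx⟩
  · rintro ⟨_ | _⟩
    · exact qcoh_restrict_of_gen (glueModule U₁ U₀ u) U₀ (glueGen₀ (u := u))
        fun W hW => glueGen₀_bijective hW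
    · exact qcoh_restrict_of_gen (glueModule U₁ U₀ u) U₁ (glueGen₁ h)
        fun W hW => glueGen₁_bijective h hW
end
end Carlitz
end

noncomputable section

namespace Carlitz

section Twist

variable {k : Type u} [Field k] {S : Scheme.{u}} (h : S ⟶ ProjLine k)

/-- The preimage of `ℙ¹ ∖ {∞}`. -/
def finitePart : S.Opens := h ⁻¹ᵁ ProjLine.finite k

/-- The preimage of `ℙ¹ ∖ {0}`. -/
def infinitePart : S.Opens := h ⁻¹ᵁ ProjLine.infinite k

/-- The function `t` on the preimage of `ℙ¹ ∖ {∞}`. -/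
def tFun : Γ(S, finitePart h) := h.app (ProjLine.finite k) (ProjLine.t k)

/-- The function `1 / t` on the preimage of `ℙ¹ ∖ {0}`. -/
def tInvFun : Γ(S, infinitePart h) := h.app (ProjLine.infinite k) (ProjLine.tInv k)

lemma finitePart_sup_infinitePart : finitePart h ⊔ infinitePart h = ⊤ := by
  refine Eq.trans ?_ (congrArg (fun U => h ⁻¹ᵁ U) (ProjLine.cover k))
  rfl

lemma tFun_mul_tInvFun :
    res (inf_le_left : finitePart h ⊓ infinitePart h ≤ _) (tFun h) *
      res (inf_le_right : finitePart h ⊓ infinitePart h ≤ _) (tInvFun h) = 1 := by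
  have h1 := congrArg (h.app (ProjLine.finite k ⊓ ProjLine.infinite k))
    (ProjLine.t_mul_tInv k (ProjLine.finite k ⊓ ProjLine.infinite k) inf_le_left inf_le_right)
  rw [map_one, map_mul] at h1
  refine Eq.trans (congrArg₂ (· * ·) ?_ ?_) h1
  · exact congr($((h.naturality (homOfLE (inf_le_left :
      ProjLine.finite k ⊓ ProjLine.infinite k ≤ _)).op).symm) (ProjLine.t k))
  · exact congr($((h.naturality (homOfLE (inf_le_right :
      ProjLine.finite k ⊓ ProjLine.infinite k ≤ _)).op).symm) (ProjLine.tInv k))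

/-- The line bundle `𝒪_S(∞)`, the pullback of `𝒪_{ℙ¹}(∞)`. A section over `V` is a pair of a
function `f` on `V ∖ h⁻¹(∞)` and a function `g` on `V ∖ h⁻¹(0)` with `f = t g` on the overlap. -/
def twist : S.Modules :=
  glueModule (finitePart h) (infinitePart h) (res inf_le_left (tFun h))

lemma twist_qcoh : QCoh.qcoh S (twist h) :=
  glueModule_qcoh (tFun_mul_tInvFun h) (finitePart_sup_infinitePart h)

/-- The section `1` of `𝒪_S(∞)`. -/
def twistOne : Γ(twist h, ⊤) :=
  (⟨(1, res inf_le_right (tInvFun h)), by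
    have := congrArg (res (inf_le_right : ⊤ ⊓ (finitePart h ⊓ infinitePart h) ≤ _))
      (tFun_mul_tInvFun h)
    change res _ 1 = res _ (res _ _) * res _ (res _ _)
    rw [map_mul, map_one, res_res, res_res] at this
    rw [map_one, res_res, res_res]
    exact this.symm⟩ : glueSections _ _ _ ⊤)

/-- The section `t` of `𝒪_S(∞)`. -/
def twistT : Γ(twist h, ⊤) :=
  (⟨(res inf_le_right (tFun h), 1), by
    change res _ (res _ _) = res _ (res _ _) * res _ 1
    rw [map_one, mul_one, res_res, res_res]⟩ : glueSections _ _ _ ⊤)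

end Twist

section Shtukas
open Polynomial

variable {k : Type u} [Field k] [Fintype k]

/-- The morphism `τ_A^* 𝒪 ⟶ M` given by a global section of `M`: it sends `1` to the section. -/
def ofSectionFrob {S : Scheme.{u}} (p : S ⟶ Spec (CommRingCat.of k))
    (M : (timesA p).Modules) (x : Γ(M, ⊤)) :
    (frobPullback p).obj (structureSheaf (timesA p)) ⟶ M :=
  ((Scheme.Modules.pullbackPushforwardAdjunction (frobA p)).homEquiv _ _).symm
    (ofSection ((Scheme.Modules.pushforward (frobA p)).obj M) x)

/-- The unit shtuka `[𝒪 ⟶ 𝒪 ⟵ τ_A^* 𝒪]`, both maps being the canonical isomorphisms. -/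
def unitShtuka {S : Scheme.{u}} (p : S ⟶ Spec (CommRingCat.of k)) : Shtuka p where
  obj :=
    { M := structureSheaf (timesA p)
      M' := structureSheaf (timesA p)
      σ := 𝟙 _
      j := ofSectionFrob p (structureSheaf (timesA p)) (1 : Γ(timesA p, ⊤)) }
  property := ⟨structureSheaf_qcoh _, structureSheaf_qcoh _⟩

variable {X : Scheme.{u}} (π : X ⟶ ProjLine k)

/-- The structure morphism of a scheme over `ℙ¹` as a scheme over `k`. -/
abbrev toK : X ⟶ Spec (CommRingCat.of k) := π ≫ ProjLine.toSpec k

/-- The line bundle `𝒪_X(∞) ⊠ A` on `X_A`. -/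
def twistA : (timesA (toK π)).Modules := twist (prS (toK π) ≫ π)

/-- The Carlitz shtuka `[𝒪_X ⊠ A ⟶ 𝒪_X(∞) ⊠ A ⟵ τ_A^* (𝒪_X ⊠ A)]`, where the first map is
multiplication by `1 ⊗ t - t ⊗ 1` and the second one sends `1` to `1`. -/
def carlitzShtuka : Shtuka (toK π) where
  obj :=
    { M := structureSheaf (timesA (toK π))
      M' := twistA π
      σ := ofSection (twistA π)
        (coeffA (toK π) Polynomial.X • twistOne (prS (toK π) ≫ π) - twistT (prS (toK π) ≫ π))
      j := ofSectionFrob (toK π) (twistA π) (twistOne (prS (toK π) ≫ π)) }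
  property := ⟨structureSheaf_qcoh _, twist_qcoh _⟩

end Shtukas
end Carlitz
end

noncomputable section

namespace Carlitz

section Exp

variable {L : Type*} [CommRing L] (O : Subring L) (t : L) (e : ℕ → L) (q : ℕ)

/-- `c = ∑ e_i γ ^ (q ^ i)`, the series converging in the topology on `L` for which the sets
`t ^ (-n) O` form a basis of neighbourhoods of `0`. -/
def IsSum (γ c : L) : Prop :=
  ∀ n : ℕ, ∃ N : ℕ, ∀ m ≥ N, t ^ n * (c - ∑ i ∈ Finset.range m, e i * γ ^ q ^ i) ∈ O

variable {O t e q}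

lemma IsSum.add (hq : ∀ x y : L, (x + y) ^ q = x ^ q + y ^ q) {γ c γ' c' : L}
    (h : IsSum O t e q γ c) (h' : IsSum O t e q γ' c') :
    IsSum O t e q (γ + γ') (c + c') := by
  intro n
  obtain ⟨N, hN⟩ := h n
  obtain ⟨N', hN'⟩ := h' n
  refine ⟨max N N', fun m hm => ?_⟩
  have hp : ∀ i, (γ + γ') ^ q ^ i = γ ^ q ^ i + γ' ^ q ^ i := by
    intro i
    induction i with
    | zero => simp
    | succ i ih => rw [pow_succ, pow_mul, ih, hq, ← pow_mul, ← pow_mul]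
  have := O.add_mem (hN m (le_of_max_le_left hm)) (hN' m (le_of_max_le_right hm))
  convert! this using 1
  simp only [hp, mul_add, Finset.sum_add_distrib]
  ring

lemma IsSum.zero (hq : q ≠ 0) : IsSum O t e q 0 0 := by
  intro n
  refine ⟨0, fun m _ => ?_⟩
  simp [hq]

lemma IsSum.smul {a : L} (ha : a ∈ O) (haq : a ^ q = a) {γ c : L} (h : IsSum O t e q γ c) :
    IsSum O t e q (a * γ) (a * c) := by
  have hp : ∀ i, a ^ q ^ i = a := by
    intro i
    induction i with
    | zero => simp
    | succ i ih => rw [pow_succ, pow_mul, ih, haq]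
  intro n
  obtain ⟨N, hN⟩ := h n
  refine ⟨N, fun m hm => ?_⟩
  convert! O.mul_mem ha (hN m hm) using 1
  simp only [mul_pow, hp, mul_sub, Finset.mul_sum]
  congr 1
  · ring
  · exact Finset.sum_congr rfl fun i _ => by ring

lemma IsSum.step (hq : ∀ x y : L, (x - y) ^ q = x ^ q - y ^ q)
    (hqs : ∀ (f : ℕ → L) (m : ℕ), (∑ i ∈ Finset.range m, f i) ^ q =
      ∑ i ∈ Finset.range m, f i ^ q) (hq1 : 1 ≤ q)
    {s : L} (hs : s ∈ O) (hts : t * s = 1) (he : e 0 = 1)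
    (he' : ∀ i, e (i + 1) * (t ^ q ^ (i + 1) - t) = e i ^ q)
    {γ c : L} (h : IsSum O t e q γ c) :
    IsSum O t e q (t * γ) (t * c + c ^ q) := by
  have key : ∀ m, ∑ i ∈ Finset.range (m + 1), e i * (t * γ) ^ q ^ i =
      t * ∑ i ∈ Finset.range (m + 1), e i * γ ^ q ^ i +
        (∑ i ∈ Finset.range m, e i * γ ^ q ^ i) ^ q := by
    intro m
    rw [Finset.sum_range_succ', Finset.sum_range_succ', hqs, mul_add, Finset.mul_sum,
      add_right_comm, ← Finset.sum_add_distrib]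
    congr 1
    · refine Finset.sum_congr rfl fun i _ => ?_
      rw [mul_pow, mul_pow, ← he', ← pow_mul, ← pow_succ]
      ring
    · rw [he]; simp
  intro n
  obtain ⟨N, hN⟩ := h (n + 1)
  obtain ⟨N', hN'⟩ := h n
  refine ⟨max N N' + 1, fun m hm => ?_⟩
  obtain ⟨m, rfl⟩ : ∃ m', m = m' + 1 := ⟨m - 1, by omega⟩
  have h1 := hN (m + 1) (by omega)
  have h2 := O.mul_mem (O.pow_mem (hN' m (by omega)) q) (O.pow_mem (O.pow_mem hs n) (q - 1))
  have h3 : (t ^ n) ^ q * (s ^ n) ^ (q - 1) = t ^ n := by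
    obtain ⟨r, rfl⟩ : ∃ r, q = r + 1 := ⟨q - 1, by omega⟩
    rw [Nat.add_sub_cancel, pow_succ, mul_right_comm, ← mul_pow, ← mul_pow, hts, one_pow, one_pow,
      one_mul]
  convert! O.add_mem h1 h2 using 1
  rw [key, mul_pow, mul_right_comm, h3, hq]
  ring

end Exp

section Coeff

/-- The coefficients of the Carlitz exponential `∑ e_i x ^ (q ^ i)`, which is determined by
`e_0 = 1` and `exp (t x) = t exp x + (exp x) ^ q`. -/
def expCoeff {K : Type*} [Field K] (t : K) (q : ℕ) : ℕ → K
  | 0 => 1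
  | i + 1 => expCoeff t q i ^ q / (t ^ q ^ (i + 1) - t)

end Coeff
end Carlitz
end

noncomputable section

namespace Carlitz
section
variable (k : Type u) [Field k]

lemma ProjLine.not_isUnit_germ (x : ProjLine k) (hx : x ∈ infinite k) (hx' : x ∉ finite k) :
    ¬ IsUnit ((ProjLine k).presheaf.germ _ x hx (tInv k)) := by
  intro h
  have h1 := h.map (stalkToFiberRingHom (coordGrading k) x).hom
  have h2 : IsUnit ((tInv k).1 ⟨x, hx⟩) := stalkToFiberRingHom_germ
    (coordGrading k) (infinite k) x hx (tInv k) ▸ h1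
  obtain ⟨b, hb⟩ := isUnit_iff_exists_inv.1 h2
  have h3 := congrArg HomogeneousLocalization.val hb
  rw [HomogeneousLocalization.val_mul, HomogeneousLocalization.val_one] at h3
  have h4 := ProjectiveSpectrum.Proj.awayToSection_apply (coordGrading k) (MvPolynomial.X 0)
    (HomogeneousLocalization.Away.mk _ (MvPolynomial.isHomogeneous_X k 0) 1 (MvPolynomial.X 1)
      (MvPolynomial.isHomogeneous_X k 1)) ⟨x, hx⟩
  replace h4 := h4.trans (congrArg _ (HomogeneousLocalization.Away.val_mk (coordGrading k) 1
    (MvPolynomial.isHomogeneous_X k 0) (MvPolynomial.X 1) (MvPolynomial.isHomogeneous_X k 1)))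
  rw [Localization.mk_eq_mk', IsLocalization.map_mk'] at h4
  have h5 := IsUnit.of_mul_eq_one _ ((congrArg (· * b.val) h4.symm).trans h3)
  have : x.asHomogeneousIdeal.toIdeal.IsPrime := x.isPrime
  exact hx' ((IsLocalization.AtPrime.isUnit_mk'_iff (Localization.AtPrime
    x.asHomogeneousIdeal.toIdeal) x.asHomogeneousIdeal.toIdeal _ _).1 h5)

lemma ProjLine.finite_nonempty : ∃ x, x ∈ finite k := by
  have h : Nontrivial (HomogeneousLocalization.Away (coordGrading k) (MvPolynomial.X 1)) := by
    refine ⟨⟨0, 1, fun h => ?_⟩⟩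
    have h' := congrArg HomogeneousLocalization.val h
    rw [HomogeneousLocalization.val_zero, HomogeneousLocalization.val_one] at h'
    have : IsDomain (Localization.Away (MvPolynomial.X 1 : MvPolynomial (Fin 2) k)) :=
      IsLocalization.isDomain_localization (powers_le_nonZeroDivisors_of_noZeroDivisors
        (MvPolynomial.X_ne_zero 1))
    exact zero_ne_one h'
  obtain ⟨y⟩ : Nonempty (Spec (CommRingCat.of
    (HomogeneousLocalization.Away (coordGrading k) (MvPolynomial.X 1)))) :=
    inferInstanceAs (Nonempty (PrimeSpectrum _))
  exact ⟨_, (Proj.opensRange_awayι (coordGrading k) (MvPolynomial.X 1)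
    (MvPolynomial.isHomogeneous_X k 1) one_pos).le ⟨y, rfl⟩⟩
end

section Local

variable {k : Type u} [Field k] {X : Scheme.{u}} [IsIntegral X] (π : X ⟶ ProjLine k)

lemma generic_mem {V : X.Opens} {z : X} (hz : z ∈ V) : genericPoint X ∈ V :=
  ((genericPoint_spec X).mem_open_set_iff V.isOpen).2 ⟨z, trivial, hz⟩

/-- The image of a function in the function field. -/
def toField {V : X.Opens} (hV : genericPoint X ∈ V) : Γ(X, V) →+* X.functionField :=
  (X.presheaf.germ V (genericPoint X) hV).hom

lemma toField_res {V W : X.Opens} (h : W ≤ V) (hW : genericPoint X ∈ W) (x : Γ(X, V)) :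
    toField hW (res h x) = toField (h hW) x :=
  X.presheaf.germ_res_apply (homOfLE h) _ hW x

lemma generic_mem_finitePart [Surjective π] : genericPoint X ∈ finitePart π := by
  obtain ⟨x, hx⟩ := ProjLine.finite_nonempty k
  obtain ⟨y, rfl⟩ := π.surjective x
  exact generic_mem (V := finitePart π) hx

/-- The function `t` in the function field of `X`. -/
def tField [Surjective π] : X.functionField := toField (generic_mem_finitePart π) (tFun π)

/-- Functions on `V`, as a `k`-algebra. -/
def RegFun (_ : X ⟶ ProjLine k) (V : X.Opens) : Type u := Γ(X, V)

instance (V : X.Opens) : CommRing (RegFun π V) := inferInstanceAs (CommRing Γ(X, V))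

instance (V : X.Opens) : Algebra k (RegFun π V) := (scalars (toK π) V).toAlgebra

/-- The completed local ring at `z`. -/
abbrev CompletedStalk (z : X) : Type u :=
  AdicCompletion (IsLocalRing.maximalIdeal (X.presheaf.stalk z)) (X.presheaf.stalk z)

/-- The completion `K_z` of the function field `K` of `X` at `z`, the ring of fractions of the
completed local ring at `z`. -/
def LocalField (_ : X ⟶ ProjLine k) (z : X) : Type u :=
  X.functionField ⊗[X.presheaf.stalk z] CompletedStalk z

instance (z : X) : CommRing (LocalField π z) :=
  inferInstanceAs (CommRing (X.functionField ⊗[X.presheaf.stalk z] CompletedStalk z))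

/-- The embedding of `K` in `K_z`. -/
def toLocalField (z : X) : X.functionField →+* LocalField π z :=
  Algebra.TensorProduct.includeLeftRingHom

/-- The ring of integers of `K_z`. -/
def integers (z : X) : Subring (LocalField π z) :=
  (Algebra.TensorProduct.includeRight : CompletedStalk z →ₐ[X.presheaf.stalk z]
    X.functionField ⊗[X.presheaf.stalk z] CompletedStalk z).toRingHom.range

instance (z : X) : Algebra k (LocalField π z) :=
  ((toLocalField π z).comp ((toField (Opens.mem_top _)).comp (scalars (toK π) ⊤))).toAlgebra

lemma toLocalField_mem (z : X) (f : X.presheaf.stalk z) :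
    toLocalField π z (algebraMap _ _ f) ∈ integers π z :=
  ⟨algebraMap _ _ f, (Algebra.TensorProduct.includeRight : CompletedStalk z →ₐ[X.presheaf.stalk z]
    X.functionField ⊗[X.presheaf.stalk z] CompletedStalk z).commutes f⟩

lemma toField_eq {V : X.Opens} {z : X} (hz : z ∈ V) (hV : genericPoint X ∈ V) (f : Γ(X, V)) :
    toField hV f = algebraMap (X.presheaf.stalk z) X.functionField
      (X.presheaf.germ V z hz f) :=
  have : Nonempty V := ⟨⟨z, hz⟩⟩
  (Scheme.algebraMap_germ_eq_germToFunctionField (X := X) hz f).symm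

lemma mem_infinitePart {z : X} (hz : z ∉ finitePart π) : z ∈ infinitePart π := by
  have h : z ∈ finitePart π ⊔ infinitePart π := finitePart_sup_infinitePart π ▸ Opens.mem_top z
  exact h.resolve_left hz

/-- The function `1 / t` in the local ring at a point above `∞`. -/
def tInvStalk {z : X} (hz : z ∉ finitePart π) : X.presheaf.stalk z :=
  X.presheaf.germ _ z (mem_infinitePart π hz) (tInvFun π)

lemma not_isUnit_tInvStalk {z : X} (hz : z ∉ finitePart π) : ¬ IsUnit (tInvStalk π hz) := by
  intro h
  have h1 : (π.stalkMap z) ((ProjLine k).presheaf.germ _ (π z) (mem_infinitePart π hz)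
      (ProjLine.tInv k)) = tInvStalk π hz :=
    Scheme.Hom.germ_stalkMap_apply π _ z (mem_infinitePart π hz) (ProjLine.tInv k)
  exact ProjLine.not_isUnit_germ k (π z) (mem_infinitePart π hz) hz
    (isUnit_of_map_unit (π.stalkMap z).hom _ (h1 ▸ h))

lemma tField_mul_tInvStalk [Surjective π] {z : X} (hz : z ∉ finitePart π) :
    tField π * algebraMap _ X.functionField (tInvStalk π hz) = 1 := by
  have h1 := generic_mem_finitePart π
  have h2 := generic_mem (mem_infinitePart π hz)
  have h12 : genericPoint X ∈ finitePart π ⊓ infinitePart π := ⟨h1, h2⟩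
  have h := congrArg (toField h12) (tFun_mul_tInvFun π)
  rw [map_mul, map_one, toField_res, toField_res] at h
  rwa [toField_eq (mem_infinitePart π hz) h2] at h

lemma tField_pow_ne [Surjective π] {z : X} (hz : z ∉ finitePart π) {m : ℕ} (hm : 2 ≤ m) :
    tField π ^ m - tField π ≠ 0 := by
  intro h
  obtain ⟨n, rfl⟩ : ∃ n, m = n + 2 := ⟨m - 2, by omega⟩
  have hts := tField_mul_tInvStalk π hz
  have h0 : tField π ≠ 0 := left_ne_zero_of_mul_eq_one hts
  have h1 : tField π ^ (n + 1) = 1 := by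
    apply mul_right_cancel₀ h0
    rw [one_mul, ← pow_succ]
    exact sub_eq_zero.1 h
  have h2 : algebraMap _ X.functionField (tInvStalk π hz ^ (n + 1)) = 1 := by
    rw [map_pow, ← one_mul (algebraMap _ _ _ ^ _), ← h1, ← mul_pow, hts, one_pow, h1]
  have h3 : tInvStalk π hz ^ (n + 1) = 1 :=
    IsFractionRing.injective (X.presheaf.stalk z) X.functionField (h2.trans (map_one _).symm)
  exact not_isUnit_tInvStalk π hz (IsUnit.of_pow_eq_one h3 (Nat.succ_ne_zero n))

end Local

section Sections

variable {k : Type u} [Field k] [Fintype k] {X : Scheme.{u}} [IsIntegral X] (π : X ⟶ ProjLine k)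
  [Surjective π]

/-- The points of `U` above `∞`. -/
abbrev PointsAtInfinity (U : X.Opens) : Type u := {z : X // z ∈ U ∧ z ∉ finitePart π}

/-- The image in `K_z` of a function on `U ∖ π⁻¹(∞)`, where `z ∈ U`. -/
def localize {U : X.Opens} {z : X} (hz : z ∈ U) : RegFun π (U ⊓ finitePart π) →+* LocalField π z :=
  (toLocalField π z).comp (toField ⟨generic_mem hz, generic_mem_finitePart π⟩)

/-- The relation `exp γ = c` in `K_z`, for the Carlitz exponential
`exp x = ∑ e_i x ^ (q ^ i)`. As `1 / t` is a non-zero element of the maximal ideal at `z`,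
the sets `t ^ (-n) O_z`, with `O_z` the integers of `K_z`, are a basis of neighbourhoods of
`0` in `K_z`. -/
def IsExp (z : X) (γ c : LocalField π z) : Prop :=
  IsSum (integers π z) (toLocalField π z (tField π))
    (fun i => toLocalField π z (expCoeff (tField π) (Fintype.card k) i)) (Fintype.card k) γ c

/-- The function `t` on `V ∖ π⁻¹(∞)`. -/
def tReg (V : X.Opens) : RegFun π (V ⊓ finitePart π) := res inf_le_right (tFun π)

variable (k) in
/-- The `q`-power map of a `k`-algebra as a `k`-linear map. -/
def frobLinear (R : Type*) [CommRing R] [Algebra k R] : R →ₗ[k] R :=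
  (FiniteField.frobeniusAlgHom k R).toLinearMap

/-- The endomorphism `(c, (γ_z)) ↦ (t c + c ^ q, (t γ_z))`. -/
def carlitzEnd (U : X.Opens) :
    (RegFun π (U ⊓ finitePart π) × (∀ z : PointsAtInfinity π U, LocalField π z)) →ₗ[k]
      (RegFun π (U ⊓ finitePart π) × (∀ z : PointsAtInfinity π U, LocalField π z)) :=
  LinearMap.prodMap (LinearMap.mulLeft k (tReg π U) + frobLinear k _)
    (LinearMap.pi fun z => LinearMap.mulLeft k (toLocalField π z (tField π)) ∘ₗ LinearMap.proj z)

lemma localize_algebraMap {U : X.Opens} {z : X} (hz : z ∈ U) (a : k) :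
    localize π hz (algebraMap k _ a) = algebraMap k _ a := by
  have hU : genericPoint X ∈ U ⊓ finitePart π := ⟨generic_mem hz, generic_mem_finitePart π⟩
  have h : res le_top (scalars (toK π) ⊤ a) = scalars (toK π) (U ⊓ finitePart π) a :=
    congr($(Scheme.Hom.appLE_map (toK π) le_top (homOfLE (le_top : U ⊓ finitePart π ≤ ⊤)).op)
      ((Scheme.ΓSpecIso (CommRingCat.of k)).inv a))
  have h' := toField_res le_top hU (scalars (toK π) ⊤ a)
  rw [h] at h'
  exact congrArg (toLocalField π z) h'

lemma algebraMap_mem (z : X) (a : k) : algebraMap k (LocalField π z) a ∈ integers π z := by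
  have h := toField_eq (Opens.mem_top z) (Opens.mem_top _) (scalars (toK π) ⊤ a)
  have h' := toLocalField_mem π z (X.presheaf.germ ⊤ z (Opens.mem_top z) (scalars (toK π) ⊤ a))
  rw [← h] at h'
  exact h'

lemma localize_tReg {U : X.Opens} {z : X} (hz : z ∈ U) :
    localize π hz (tReg π U) = toLocalField π z (tField π) :=
  have hU : genericPoint X ∈ U ⊓ finitePart π := ⟨generic_mem hz, generic_mem_finitePart π⟩
  congrArg (toLocalField π z) (toField_res inf_le_right hU (tFun π))

lemma IsExp.step {z : X} (hz : z ∉ finitePart π) {γ c : LocalField π z} (h : IsExp π z γ c) :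
    IsExp π z (toLocalField π z (tField π) * γ)
      (toLocalField π z (tField π) * c + c ^ Fintype.card k) := by
  refine IsSum.step (fun x y => map_sub (frobLinear k (LocalField π z)) x y)
    (fun f m => map_sum (frobLinear k (LocalField π z)) f _) Fintype.card_pos
    (toLocalField_mem π z (tInvStalk π hz)) ?_ (map_one _) (fun i => ?_) h
  · rw [← map_mul, tField_mul_tInvStalk, map_one]
  · rw [← map_pow, ← map_sub, ← map_mul, ← map_pow]
    congr 1
    refine div_mul_cancel₀ _ (tField_pow_ne π hz ?_)
    calc 2 ≤ Fintype.card k := Fintype.one_lt_card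
      _ = Fintype.card k ^ 1 := (pow_one _).symm
      _ ≤ _ := Nat.pow_le_pow_right Fintype.card_pos (Nat.succ_le_succ (Nat.zero_le i))

/-- The pairs `(c, (γ_z))` of a function `c` on `U ∖ π⁻¹(∞)` and elements `γ_z ∈ K_z` for the
points `z ∈ U` above `∞`, with `exp γ_z = c` for all `z`. -/
def carlitzSections (U : X.Opens) : Submodule k
    (RegFun π (U ⊓ finitePart π) × (∀ z : PointsAtInfinity π U, LocalField π z)) where
  carrier := {x | ∀ z : PointsAtInfinity π U, IsExp π z (x.2 z) (localize π z.2.1 x.1)}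
  zero_mem' z := by
    have h : localize π z.2.1 (0 : RegFun π (U ⊓ finitePart π)) = 0 := map_zero _
    exact h ▸ IsSum.zero Fintype.card_ne_zero
  add_mem' {x y} hx hy z := by
    have h : localize π z.2.1 (x.1 + y.1) = _ := map_add _ _ _
    exact h ▸ (hx z).add (fun a b => map_add (frobLinear k (LocalField π z)) a b) (hy z)
  smul_mem' a x hx z := by
    have h : localize π z.2.1 (a • x.1) = algebraMap k _ a * localize π z.2.1 x.1 := by
      rw [Algebra.smul_def, map_mul, localize_algebraMap]
    have h' : a • x.2 z = algebraMap k _ a * x.2 z := Algebra.smul_def _ _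
    change IsExp π z (a • x.2 z) (localize π z.2.1 (a • x.1))
    rw [h, h']
    exact IsSum.smul (algebraMap_mem π z a) (by rw [← map_pow, FiniteField.pow_card]) (hx z)

lemma carlitzEnd_mem (U : X.Opens) (x) (hx : x ∈ carlitzSections π U) :
    carlitzEnd π U x ∈ carlitzSections π U := by
  intro z
  have h : localize π z.2.1 (tReg π U * x.1 + x.1 ^ Fintype.card k) =
      toLocalField π z (tField π) * localize π z.2.1 x.1 +
        localize π z.2.1 x.1 ^ Fintype.card k := by
    rw [map_add, map_mul, map_pow, localize_tReg]
  exact h ▸ (hx z).step π z.2.2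

/-- The action of `t ∈ A` on `C(U)`. -/
def tAct (U : X.Opens) : carlitzSections π U →ₗ[k] carlitzSections π U :=
  (carlitzEnd π U).restrict (carlitzEnd_mem π U)

/-- The `A`-module `C(U)`. Here `t ∈ A` acts by `(c, (γ_z)) ↦ (t c + c ^ q, (t γ_z))`. -/
abbrev CarlitzModule (U : X.Opens) : Type u :=
  Module.AEval' (tAct π U)

/-- The sections of `C` over `U` as elements of the `A`-module `C(U)`. -/
abbrev ofSections (U : X.Opens) : carlitzSections π U ≃ₗ[k] CarlitzModule π U :=
  Module.AEval'.of (tAct π U)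

/-- Restriction of functions as a `k`-linear map. -/
def regRes {U V : X.Opens} (h : V ≤ U) : RegFun π U →ₗ[k] RegFun π V where
  toFun := res h
  map_add' := map_add (res h)
  map_smul' a x := by
    have h' : res h (scalars (toK π) U a) = scalars (toK π) V a :=
      congr($(Scheme.Hom.appLE_map (toK π) le_top (homOfLE h).op)
        ((Scheme.ΓSpecIso (CommRingCat.of k)).inv a))
    exact (map_mul (res h) (scalars (toK π) U a) x).trans (congrArg (· * res h x) h')

lemma localize_res {U V : X.Opens} (h : V ≤ U) {z : X} (hz : z ∈ V)
    (c : RegFun π (U ⊓ finitePart π)) :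
    localize π hz (regRes π (inf_le_inf_right _ h) c) = localize π (h hz) c :=
  have hV : genericPoint X ∈ V ⊓ finitePart π := ⟨generic_mem hz, generic_mem_finitePart π⟩
  congrArg (toLocalField π z) (toField_res (inf_le_inf_right _ h) hV c)

/-- The restriction maps of the sheaf `C`. -/
def carlitzRes {U V : X.Opens} (h : V ≤ U) : carlitzSections π U →ₗ[k] carlitzSections π V :=
  LinearMap.restrict (p := carlitzSections π U) (q := carlitzSections π V)
    (LinearMap.prodMap (regRes π (inf_le_inf_right (finitePart π) h))
      (LinearMap.pi fun z : PointsAtInfinity π V =>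
        LinearMap.proj (⟨z, h z.2.1, z.2.2⟩ : PointsAtInfinity π U)))
    fun x hx z => (localize_res π h z.2.1 x.1).symm ▸ hx ⟨z, h z.2.1, z.2.2⟩

lemma carlitzRes_self {U : X.Opens} (h : U ≤ U) (x : carlitzSections π U) :
    carlitzRes π h x = x :=
  Subtype.ext (Prod.ext (res_self (inf_le_inf_right _ h) x.1.1) rfl)

lemma carlitzRes_res {U V W : X.Opens} (h : V ≤ U) (h' : W ≤ V) (x : carlitzSections π U) :
    carlitzRes π h' (carlitzRes π h x) = carlitzRes π (h'.trans h) x :=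
  Subtype.ext (Prod.ext (res_res (inf_le_inf_right _ h) (inf_le_inf_right _ h') x.1.1) rfl)

lemma carlitzRes_end {U V : X.Opens} (h : V ≤ U) (x : carlitzSections π U) :
    carlitzRes π h (tAct π U x) =
      tAct π V (carlitzRes π h x) := by
  refine Subtype.ext (Prod.ext ?_ rfl)
  let c : Γ(X, U ⊓ finitePart π) := x.1.1
  change res (inf_le_inf_right _ h) (res inf_le_right (tFun π) * c + c ^ Fintype.card k) =
    res inf_le_right (tFun π) * res (inf_le_inf_right _ h) c +
      res (inf_le_inf_right _ h) c ^ Fintype.card k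
  rw [map_add, map_mul, map_pow, res_res]

open Polynomial

/-- The restriction maps of the sheaf `C`, as `A`-linear maps. -/
def carlitzMap {U V : X.Opens} (h : V ≤ U) : CarlitzModule π U →ₗ[k[X]] CarlitzModule π V :=
  LinearMap.ofAEval _ ((ofSections π V).toLinearMap ∘ₗ carlitzRes π h) fun x =>
    (congrArg (ofSections π V) (carlitzRes_end π h x)).trans
      (Module.AEval'.X_smul_of _ _).symm

lemma carlitzMap_of {U V : X.Opens} (h : V ≤ U) (x : carlitzSections π U) :
    carlitzMap π h (ofSections π U x) = ofSections π V (carlitzRes π h x) := rfl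

/-- The presheaf of `A`-modules `U ↦ C(U)`. -/
def carlitzPresheaf : TopCat.Presheaf (ModuleCat.{u} k[X]) X where
  obj U := ModuleCat.of k[X] (CarlitzModule π U.unop)
  map i := ModuleCat.ofHom (carlitzMap π i.unop.le)
  map_id U := ModuleCat.hom_ext (LinearMap.ext fun x : CarlitzModule π U.unop =>
    (congrArg (ofSections π U.unop) (carlitzRes_self π le_rfl ((ofSections π U.unop).symm x))))
  map_comp {U V W} i j := ModuleCat.hom_ext (LinearMap.ext fun x : CarlitzModule π U.unop =>
    (congrArg (ofSections π W.unop)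
      (carlitzRes_res π i.unop.le j.unop.le ((ofSections π U.unop).symm x)).symm))

lemma carlitzPresheaf_isSheaf : (carlitzPresheaf π).IsSheaf := by
  rw [TopCat.Presheaf.isSheaf_iff_isSheafUniqueGluing]
  intro ι W sf hsf
  let f : ∀ i, carlitzSections π (W i) := fun i => (ofSections π (W i)).symm (sf i)
  have hf : ∀ i j, carlitzRes π inf_le_left (f i) =
    carlitzRes π (inf_le_right : W i ⊓ W j ≤ W j) (f j) := hsf
  obtain ⟨c, hc⟩ := exists_glue (V := iSup W ⊓ finitePart π) (W := fun i => W i ⊓ finitePart π)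
    (iSup_inf_eq W _).le (fun i => inf_le_inf_right _ (le_iSup W i)) (fun i => (f i).1.1)
    (fun i j O h h' => by
      have := congrArg (fun z => res (le_inf (le_inf (h.trans inf_le_left) (h'.trans inf_le_left))
        (h.trans inf_le_right) : O ≤ W i ⊓ W j ⊓ finitePart π) z.1.1) (hf i j)
      exact (res_res _ _ _).symm.trans (this.trans (res_res _ _ _)))
  choose idx hidx using fun z : PointsAtInfinity π (iSup W) => Opens.mem_iSup.1 z.2.1
  let γ : ∀ z : PointsAtInfinity π (iSup W), LocalField π z :=
    fun z => (f (idx z)).1.2 ⟨z, hidx z, z.2.2⟩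
  have hγ : ∀ (z : PointsAtInfinity π (iSup W)) (i : ι) (hi : z.1 ∈ W i),
      γ z = (f i).1.2 ⟨z, hi, z.2.2⟩ := fun z i hi =>
    congrArg (fun y : carlitzSections π (W (idx z) ⊓ W i) => y.1.2 ⟨z, ⟨hidx z, hi⟩, z.2.2⟩)
      (hf (idx z) i)
  have hx : ((c, γ) : RegFun π (iSup W ⊓ finitePart π) × _) ∈ carlitzSections π (iSup W) := by
    intro z
    have h1 := (f (idx z)).2 ⟨z, hidx z, z.2.2⟩
    have h2 := localize_res π (le_iSup W (idx z)) (hidx z) c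
    have h3 : regRes π (inf_le_inf_right _ (le_iSup W (idx z))) c = (f (idx z)).1.1 := hc (idx z)
    rw [h3] at h2
    exact h2 ▸ h1
  refine ⟨ofSections π (iSup W) (⟨(c, γ), hx⟩ : carlitzSections π (iSup W)), fun i => ?_,
    fun y hy => ?_⟩
  · exact congrArg (ofSections π (W i)) (Subtype.ext (Prod.ext (hc i)
      (funext fun z => hγ ⟨z, le_iSup W i z.2.1, z.2.2⟩ i z.2.1)) :
        carlitzRes π (le_iSup W i) ⟨(c, γ), hx⟩ = f i)
  · let y' : carlitzSections π (iSup W) := (ofSections π (iSup W)).symm y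
    have hy' : ∀ i, carlitzRes π (le_iSup W i) y' = f i := hy
    refine congrArg (ofSections π (iSup W)) (Subtype.ext (Prod.ext ?_ (funext fun z => ?_)) :
      y' = ⟨(c, γ), hx⟩)
    · refine eq_of_res (W := fun i => W i ⊓ finitePart π) (iSup_inf_eq W _).le
        (fun i => inf_le_inf_right _ (le_iSup W i)) fun i => ?_
      exact Eq.trans (congrArg (fun z : carlitzSections π (W i) => z.1.1) (hy' i)) (hc i).symm
    · exact congrArg (fun y : carlitzSections π (W (idx z)) => y.1.2 ⟨z, hidx z, z.2.2⟩)
        (hy' (idx z))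

/-- The sheaf of `A`-modules `C` on `X`. -/
def carlitzSheaf : TopCat.Sheaf (ModuleCat.{u} k[X]) X :=
  ⟨carlitzPresheaf π, carlitzPresheaf_isSheaf π⟩

end Sections

end Carlitz
end

noncomputable section

namespace Carlitz

section Cohomology

/-- Scalars act on morphisms of sheaves of modules through sections. -/
instance sheafLinear (R : Type u) [CommRing R] (T : TopCat.{u}) :
    Linear R (TopCat.Sheaf (ModuleCat.{u} R) T) where
  homModule F G :=
    { smul := fun a f => ⟨a • f.hom⟩
      one_smul := fun f => Sheaf.hom_ext (one_smul R f.hom)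
      mul_smul := fun a b f => Sheaf.hom_ext (mul_smul a b f.hom)
      smul_zero := fun a => Sheaf.hom_ext (smul_zero (A := F.obj ⟶ G.obj) a)
      smul_add := fun a f g => Sheaf.hom_ext (smul_add a f.hom g.hom)
      add_smul := fun a b f => Sheaf.hom_ext (add_smul a b f.hom)
      zero_smul := fun f => Sheaf.hom_ext (zero_smul R f.hom) }
  smul_comp _ _ _ a f g := Sheaf.hom_ext (Linear.smul_comp _ _ _ a f.hom g.hom)
  comp_smul _ _ _ f a g := Sheaf.hom_ext (Linear.comp_smul _ _ _ f.hom a g.hom)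

/-- The constant sheaf `R` on `T`. -/
def constantRing (R : Type u) [CommRing R] (T : TopCat.{u}) : TopCat.Sheaf (ModuleCat.{u} R) T :=
  (constantSheaf (Opens.grothendieckTopology T) (ModuleCat.{u} R)).obj (ModuleCat.of R R)

attribute [local instance] CategoryTheory.HasExt.standard

/-- The cohomology `Hⁱ(T, F)` of a sheaf of `R`-modules: the derived functors of
`Γ(T, -) = Hom(R, -)`, computed as Yoneda extensions of the constant sheaf `R` by `F`. -/
abbrev cohomology {R : Type u} [CommRing R] {T : TopCat.{u}} (F : TopCat.Sheaf (ModuleCat.{u} R) T)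
    (i : ℕ) : Type (u + 1) :=
  Abelian.Ext (constantRing R T) F i

/-- The extension groups `Extⁱ(M, N)` in the abelian category of shtukas. -/
abbrev Shtuka.Ext {k : Type u} [Field k] [Fintype k] {S : Scheme.{u}}
    {p : S ⟶ Spec (CommRingCat.of k)} (M N : Shtuka p) (i : ℕ) : Type (u + 1) :=
  Abelian.Ext M N i

end Cohomology

end Carlitz
end

section ExtComputation

open Abelian DerivedCategory

variable {C : Type u} [Category.{v} C] [Abelian C]

open HomologicalComplex in
lemma CochainComplex.mono_f_of_isStrictlyGE {N : C} {L : CochainComplex C ℤ} {i : ℤ}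
    (ι : (single C (ComplexShape.up ℤ) i).obj N ⟶ L) [L.IsStrictlyGE i] [QuasiIsoAt ι i] :
    Mono (ι.f i) := by
  let e := L.pOpcyclesIso (i - 1) i (by simp)
    ((L.isZero_of_isStrictlyGE i (i - 1) (by simp)).eq_of_src _ _)
  let α := (singleObjHomologySelfIso _ _ _).inv ≫ homologyMap ι i ≫ L.homologyι i ≫ e.inv
  have : ι.f i = (singleObjXSelf (ComplexShape.up ℤ) i N).hom ≫ α := by
    rw [← cancel_mono e.hom]
    have he : e.hom = L.pOpcycles i := rfl
    dsimp only [α]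
    rw [Category.assoc, Category.assoc, Category.assoc, Category.assoc, Iso.inv_hom_id,
      Category.comp_id, homologyι_naturality, singleObjHomologySelfIso_inv_homologyι_assoc,
      ← pOpcycles_singleObjOpcyclesSelfIso_inv_assoc, Iso.inv_hom_id_assoc, he, p_opcyclesMap]
  rw [this]
  exact mono_comp _ _

namespace CategoryTheory.Abelian.Ext

variable [HasExt.{w} C]

/-- Every class of positive degree is killed by a monomorphism. -/
lemma exists_mono_comp_eq_zero {P N : C} {n : ℕ} (x : Ext P N (n + 1)) :
    ∃ (E : C) (i : N ⟶ E), Mono i ∧ x.comp (mk₀ i) (add_zero _) = 0 := by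
  let := HasDerivedCategory.standard C
  let K := (CochainComplex.singleFunctor C 0).obj P
  let a : ℤ := -(n + 1)
  let e := fun Y : C => ((singleFunctors C).shiftIso ((n + 1 : ℕ) : ℤ) a 0 (by simp [a])).app Y
  let φ : Q.obj K ⟶ Q.obj ((CochainComplex.singleFunctor C a).obj N) := x.hom ≫ (e N).hom
  obtain ⟨L, _, g, s, hs, hφ⟩ := left_fac_of_isStrictlyGE φ a
  let s' : (HomologicalComplex.single C (ComplexShape.up ℤ) a).obj N ⟶ L := s
  let r' : L ⟶ (HomologicalComplex.single C (ComplexShape.up ℤ) a).obj (L.X a) :=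
    HomologicalComplex.mkHomToSingle (𝟙 _) (by
      rintro j hj
      apply (L.isZero_of_isStrictlyGE a j (by simp at hj; lia)).eq_of_src)
  let r : L ⟶ (CochainComplex.singleFunctor C a).obj (L.X a) := r'
  let i : N ⟶ L.X a := (HomologicalComplex.singleObjXSelf (ComplexShape.up ℤ) a N).inv ≫ s'.f a
  have hi' : s' ≫ r' = (HomologicalComplex.single C (ComplexShape.up ℤ) a).map i := by
    apply HomologicalComplex.to_single_hom_ext
    rw [HomologicalComplex.single_map_f_self]
    simp [r', i]
  have hi : s ≫ r = (CochainComplex.singleFunctor C a).map i := hi'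
  have hr : g ≫ r = 0 := by
    apply HomologicalComplex.to_single_hom_ext
    exact (K.isZero_of_isStrictlyGE 0 a (by simp [a]; lia)).eq_of_src _ _
  refine ⟨L.X a, i, ?_, ?_⟩
  · rw [isIso_Q_map_iff_quasiIso] at hs
    have : QuasiIso s' := hs
    have := CochainComplex.mono_f_of_isStrictlyGE s'
    exact mono_comp _ _
  · apply homEquiv.injective
    rw [← cancel_mono (e _).hom]
    change (x.comp (mk₀ i) _).hom ≫ _ = (0 : Ext P _ (n + 1)).hom ≫ _
    rw [← hom_comp_singleFunctor_map_shift, zero_hom, Limits.zero_comp, Category.assoc]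
    have h1 : ((DerivedCategory.singleFunctor C 0).map i)⟦((n + 1 : ℕ) : ℤ)⟧' ≫ (e _).hom =
      (e _).hom ≫ (DerivedCategory.singleFunctor C a).map i :=
      ((singleFunctors C).shiftIso ((n + 1 : ℕ) : ℤ) a 0 (by simp [a])).hom.naturality i
    rw [h1]
    change x.hom ≫ (e N).hom ≫ Q.map ((CochainComplex.singleFunctor C a).map i) = 0
    rw [← hi]
    refine (Category.assoc x.hom (e N).hom (Q.map (s ≫ r))).symm.trans ?_
    change φ ≫ _ = 0
    rw [hφ, Functor.map_comp, Category.assoc, IsIso.inv_hom_id_assoc, ← Functor.map_comp, hr,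
      Functor.map_zero]

/-- Vanishing of `Ext` on a class of objects which lift morphisms from `P`, contain every object
as a subobject, and are stable under quotients by members of the class. -/
lemma subsingleton_of_class (P : C) (A : ObjectProperty C)
    (lift : ∀ (S : ShortComplex C), S.ShortExact → A S.X₁ →
      ∀ f : P ⟶ S.X₃, ∃ g : P ⟶ S.X₂, g ≫ S.g = f)
    (emb : ∀ E : C, ∃ (E' : C) (i : E ⟶ E'), Mono i ∧ A E')
    (quot : ∀ (S : ShortComplex C), S.ShortExact → A S.X₁ → A S.X₂ → A S.X₃)
    (n : ℕ) (N : C) (hN : A N) : Subsingleton (Ext P N (n + 1)) := by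
  induction n generalizing N with
  | zero =>
    refine subsingleton_of_forall_eq 0 fun x => ?_
    obtain ⟨E, i, _, hx⟩ := exists_mono_comp_eq_zero x
    let S := ShortComplex.mk i (cokernel.π i) (cokernel.condition i)
    have hS : S.ShortExact := { exact := ShortComplex.exact_cokernel i }
    obtain ⟨y, rfl⟩ := covariant_sequence_exact₁ P hS x hx (zero_add 1)
    obtain ⟨f, rfl⟩ := (mk₀_bijective _ _).surjective y
    obtain ⟨g, rfl⟩ := lift S hS hN f
    rw [← mk₀_comp_mk₀, comp_assoc_of_second_deg_zero, hS.comp_extClass, comp_zero]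
  | succ n ih =>
    refine subsingleton_of_forall_eq 0 fun x => ?_
    obtain ⟨E, i, _, hx⟩ := exists_mono_comp_eq_zero x
    obtain ⟨E', i', _, hE'⟩ := emb E
    let S := ShortComplex.mk (i ≫ i') (cokernel.π (i ≫ i')) (cokernel.condition (i ≫ i'))
    have hS : S.ShortExact := { exact := ShortComplex.exact_cokernel (i ≫ i') }
    have hx' : x.comp (mk₀ (i ≫ i')) (add_zero _) = 0 := by
      rw [← mk₀_comp_mk₀, ← comp_assoc_of_third_deg_zero, hx, zero_comp]
    obtain ⟨y, rfl⟩ := covariant_sequence_exact₁ P hS x hx' rfl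
    have := ih _ (quot S hS hN hE')
    rw [Subsingleton.elim y 0, zero_comp]

variable {R : Type*} [CommRing R] [Linear R C]

/-- Postcomposition with the class of a short exact sequence, as a linear map. -/
noncomputable def connecting (P : C) {S : ShortComplex C} (hS : S.ShortExact) (n : ℕ) :
    Ext P S.X₃ n →ₗ[R] Ext P S.X₁ (n + 1) where
  toFun x := x.comp hS.extClass rfl
  map_add' x y := add_comp _ _ _ _
  map_smul' r x := smul_comp _ _ _ _

/-- Dimension shifting in positive degrees. -/
noncomputable def dimensionShift (P : C) {S : ShortComplex C} (hS : S.ShortExact) (n : ℕ)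
    (h : Subsingleton (Ext P S.X₂ n)) (h' : Subsingleton (Ext P S.X₂ (n + 1))) :
    Ext P S.X₃ n ≃ₗ[R] Ext P S.X₁ (n + 1) :=
  LinearEquiv.ofBijective (connecting P hS n) ⟨by
    rw [injective_iff_map_eq_zero]
    intro x hx
    obtain ⟨y, rfl⟩ := covariant_sequence_exact₃ P hS x rfl hx
    rw [Subsingleton.elim y 0, zero_comp], fun x => by
    obtain ⟨y, rfl⟩ := covariant_sequence_exact₁ P hS x (Subsingleton.elim _ _) rfl
    exact ⟨y, rfl⟩⟩

variable (R) in
/-- Postcomposition, as a linear map on morphisms. -/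
abbrev homMap (P : C) {X Y : C} (f : X ⟶ Y) : (P ⟶ X) →ₗ[R] (P ⟶ Y) := Linear.rightComp R P f

/-- Dimension shifting from degree zero to degree one. -/
noncomputable def dimensionShiftOne (P : C) {S : ShortComplex C} (hS : S.ShortExact)
    (h : Subsingleton (Ext P S.X₂ 1)) :
    ((P ⟶ S.X₃) ⧸ LinearMap.range (homMap R P S.g)) ≃ₗ[R] Ext P S.X₁ 1 :=
  (Submodule.quotEquivOfEq _ _ (by
    ext f
    constructor
    · rintro ⟨g, rfl⟩
      change (mk₀ (g ≫ S.g)).comp hS.extClass rfl = 0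
      rw [← mk₀_comp_mk₀, comp_assoc_of_second_deg_zero, hS.comp_extClass, comp_zero]
    · intro hf
      obtain ⟨y, hy⟩ := covariant_sequence_exact₃ P hS (mk₀ f) rfl hf
      obtain ⟨g, rfl⟩ := (mk₀_bijective _ _).surjective y
      rw [mk₀_comp_mk₀] at hy
      exact ⟨g, (mk₀_bijective _ _).injective hy⟩)).trans
  (((connecting P hS 0).comp (linearEquiv₀ (R := R)).symm.toLinearMap).quotKerEquivOfSurjective
    fun x => by
      obtain ⟨y, rfl⟩ := covariant_sequence_exact₁ P hS x (Subsingleton.elim _ _) (zero_add 1)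
      exact ⟨linearEquiv₀ (R := R) y, congrArg (connecting (R := R) P hS 0)
        (LinearEquiv.symm_apply_apply _ _)⟩)

end CategoryTheory.Abelian.Ext
end ExtComputation

section SheafSections

open Opposite Carlitz

variable {R : Type u} [CommRing R] {T : TopCat.{u}}

namespace ModSheaf

/-- Sections over an open set, as a functor on sheaves of modules. -/
noncomputable abbrev sectionsFunctor (U : Opens T) :
    TopCat.Sheaf (ModuleCat.{u} R) T ⥤ ModuleCat.{u} R :=
  (sheafToPresheaf (Opens.grothendieckTopology T) (ModuleCat.{u} R)) ⋙ (evaluation _ _).obj (op U)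

noncomputable instance (U : Opens T) : PreservesFiniteLimits (sectionsFunctor (R := R) U) :=
  have : PreservesFiniteLimits ((evaluation (Opens T)ᵒᵖ (ModuleCat.{u} R)).obj (op U)) :=
    ⟨fun _ => inferInstance⟩
  have : PreservesFiniteLimits
      (sheafToPresheaf (Opens.grothendieckTopology T) (ModuleCat.{u} R)) := inferInstance
  comp_preservesFiniteLimits (sheafToPresheaf (Opens.grothendieckTopology T) (ModuleCat.{u} R)) _

instance (U : Opens T) : (sectionsFunctor (R := R) U).Additive where

variable {F G : TopCat.Sheaf (ModuleCat.{u} R) T}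

lemma injective_of_mono (f : F ⟶ G) [Mono f] (U : Opens T) :
    Function.Injective (f.hom.app (op U)) :=
  (ModuleCat.mono_iff_injective _).1
    (inferInstanceAs (Mono ((sectionsFunctor (R := R) U).map f)))

lemma mono_of_injective (f : F ⟶ G) (h : ∀ U : Opens T, Function.Injective (f.hom.app (op U))) :
    Mono f := by
  have : ∀ U, Mono (f.hom.app U) := fun U => (ModuleCat.mono_iff_injective _).2 (h U.unop)
  have : Mono f.hom := NatTrans.mono_of_mono_app _
  exact (sheafToPresheaf _ _).mono_of_mono_map (f := f) this

lemma exists_of_exact {S : ShortComplex (TopCat.Sheaf (ModuleCat.{u} R) T)} (hS : S.Exact)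
    [_inst : Mono S.f] (U : Opens T) (x : S.X₂.obj.obj (op U)) (hx : S.g.hom.app (op U) x = 0) :
    ∃ y, S.f.hom.app (op U) y = x := by
  have h := hS.map_of_mono_of_preservesKernel (sectionsFunctor U) inferInstance inferInstance
  rw [ShortComplex.moduleCat_exact_iff] at h
  exact h x hx

lemma exists_local_lift (f : F ⟶ G) [Epi f] (U : Opens T) (x : G.obj.obj (op U)) (z : T)
    (hz : z ∈ U) : ∃ (V : Opens T) (h : V ≤ U) (y : F.obj.obj (op V)), z ∈ V ∧
      f.hom.app (op V) y = G.obj.map (homOfLE h).op x := by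
  have h := (TopCat.Presheaf.isLocallySurjective_iff _).1
    ((TopCat.Sheaf.isLocallySurjective_iff_epi f).2 inferInstance) U x z hz
  obtain ⟨V, hV, ⟨y, hy⟩, hz⟩ := h
  exact ⟨V, hV, y, hz, hy⟩

lemma epi_of_local_lift (f : F ⟶ G) (h : ∀ (U : Opens T) (x : G.obj.obj (op U)) (z : T),
    z ∈ U → ∃ (V : Opens T) (h : V ≤ U) (y : F.obj.obj (op V)), z ∈ V ∧
      f.hom.app (op V) y = G.obj.map (homOfLE h).op x) : Epi f := by
  refine (TopCat.Sheaf.isLocallySurjective_iff_epi f).1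
    ((TopCat.Presheaf.isLocallySurjective_iff _).2 fun U x z hz => ?_)
  obtain ⟨V, hV, y, hz, hy⟩ := h U x z hz
  exact ⟨V, hV, ⟨y, hy⟩, hz⟩

lemma epi_of_surjective (f : F ⟶ G) (h : ∀ U : Opens T, Function.Surjective (f.hom.app (op U))) :
    Epi f :=
  epi_of_local_lift f fun U x _ hz =>
    let ⟨y, hy⟩ := h U x
    ⟨U, le_rfl, y, hz, hy.trans (congr($(G.obj.map_id (op U)) x)).symm⟩

lemma exact_of_sections (S : ShortComplex (TopCat.Sheaf (ModuleCat.{u} R) T))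
    (h : ∀ (U : Opens T) x, S.g.hom.app (op U) x = 0 → ∃ y, S.f.hom.app (op U) y = x) :
    S.Exact := by
  rw [S.exact_iff_epi_kernel_lift]
  refine epi_of_surjective _ fun U x => ?_
  have h1 : (kernel.ι S.g ≫ S.g).hom.app (op U) x = 0 := by rw [kernel.condition]; rfl
  obtain ⟨y, hy⟩ := h U _ h1
  refine ⟨y, injective_of_mono (kernel.ι S.g) U ?_⟩
  have h2 := congr(($(kernel.lift_ι S.g S.f S.zero)).hom.app (op U) y)
  exact h2.trans hy

lemma shortExact_of_sections (S : ShortComplex (TopCat.Sheaf (ModuleCat.{u} R) T))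
    (h1 : ∀ U : Opens T, Function.Injective (S.f.hom.app (op U)))
    (h2 : ∀ (U : Opens T) x, S.g.hom.app (op U) x = 0 → ∃ y, S.f.hom.app (op U) y = x)
    (h3 : ∀ (U : Opens T) (x : S.X₃.obj.obj (op U)) (z : T),
      z ∈ U → ∃ (V : Opens T) (h : V ≤ U) (y : S.X₂.obj.obj (op V)), z ∈ V ∧
      S.g.hom.app (op V) y = S.X₃.obj.map (homOfLE h).op x) : S.ShortExact where
  exact := exact_of_sections S h2
  mono_f := mono_of_injective _ h1
  epi_g := epi_of_local_lift _ h3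

/-- All restriction maps are surjective. -/
def Flasque (F : TopCat.Sheaf (ModuleCat.{u} R) T) : Prop :=
  ∀ ⦃V U : Opens T⦄ (h : V ≤ U), Function.Surjective (F.obj.map (homOfLE h).op)

lemma res_res (F : TopCat.Sheaf (ModuleCat.{u} R) T) {U V W : Opens T} (h : V ≤ U) (h' : W ≤ V)
    (x : F.obj.obj (op U)) : F.obj.map (homOfLE h').op (F.obj.map (homOfLE h).op x) =
      F.obj.map (homOfLE (h'.trans h)).op x :=
  congr($(F.obj.map_comp (homOfLE h).op (homOfLE h').op) x).symm

lemma res_self (F : TopCat.Sheaf (ModuleCat.{u} R) T) {U : Opens T} (h : U ≤ U)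
    (x : F.obj.obj (op U)) : F.obj.map (homOfLE h).op x = x :=
  congr($(F.obj.map_id (op U)) x)

lemma res_app (f : F ⟶ G) {U V : Opens T} (h : V ≤ U) (x : F.obj.obj (op U)) :
    f.hom.app (op V) (F.obj.map (homOfLE h).op x) =
      G.obj.map (homOfLE h).op (f.hom.app (op U) x) :=
  congr($(f.hom.naturality (homOfLE h).op) x)

lemma exists_glue₂ (F : TopCat.Sheaf (ModuleCat.{u} R) T) {U V W : Opens T} (hU : U ≤ W)
    (hV : V ≤ W) (hW : W ≤ U ⊔ V) (x : F.obj.obj (op U)) (y : F.obj.obj (op V))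
    (h : F.obj.map (homOfLE (inf_le_left : U ⊓ V ≤ U)).op x =
      F.obj.map (homOfLE (inf_le_right : U ⊓ V ≤ V)).op y) :
    ∃ w : F.obj.obj (op W), F.obj.map (homOfLE hU).op w = x ∧ F.obj.map (homOfLE hV).op w = y := by
  let O : ULift.{u} Bool → Opens T := fun i => bif i.down then U else V
  let sf : ∀ i, F.obj.obj (op (O i)) := fun i => match i with
    | ⟨true⟩ => x
    | ⟨false⟩ => y
  have hO : ∀ i, O i ≤ W := by rintro ⟨_ | _⟩ <;> assumption
  obtain ⟨w, hw, -⟩ := F.existsUnique_gluing' O W (fun i => homOfLE (hO i))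
    (hW.trans (sup_le (le_iSup O ⟨true⟩) (le_iSup O ⟨false⟩))) sf (by
      rintro ⟨_ | _⟩ ⟨_ | _⟩
      · rfl
      · have h' := congrArg (F.obj.map (homOfLE (le_inf inf_le_right inf_le_left :
          V ⊓ U ≤ U ⊓ V)).op) h
        rw [res_res, res_res] at h'
        exact h'.symm
      · exact h
      · rfl)
  exact ⟨w, hw ⟨true⟩, hw ⟨false⟩⟩

lemma subsingleton_bot (F : TopCat.Sheaf (ModuleCat.{u} R) T) {V : Opens T} (hV : V = ⊥) :
    Subsingleton (F.obj.obj (op V)) :=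
  ⟨fun a b => TopCat.Sheaf.eq_of_locally_eq' F (PEmpty.elim : PEmpty.{1} → Opens T) V
    (fun i => i.elim) (hV.le.trans bot_le) a b fun i => i.elim⟩

lemma Flasque.exists_lift [NoetherianSpace T]
    {S : ShortComplex (TopCat.Sheaf (ModuleCat.{u} R) T)} (hS : S.ShortExact) (h : Flasque S.X₁)
    (U : Opens T) : Function.Surjective (S.g.hom.app (op U)) := by
  intro s
  have := hS.mono_f
  have := hS.epi_g
  let A : Set (Opens T) := {V | ∃ (hV : V ≤ U) (y : S.X₂.obj.obj (op V)),
    S.g.hom.app (op V) y = S.X₃.obj.map (homOfLE hV).op s}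
  have hA : A.Nonempty := by
    refine ⟨⊥, bot_le, 0, ?_⟩
    have := subsingleton_bot S.X₃ rfl
    exact Subsingleton.elim _ _
  obtain ⟨V, ⟨hV, y, hy⟩, hmax⟩ :=
    (wellFounded_gt (α := Opens T)).has_min A hA
  suffices hU : V = U by
    subst hU
    exact ⟨y, hy.trans (res_self _ _ _)⟩
  refine le_antisymm hV fun z hz => ?_
  by_contra hzV
  obtain ⟨W, hW, y', hzW, hy'⟩ := exists_local_lift S.g U s z hz
  obtain ⟨d, hd⟩ := exists_of_exact hS.exact (V ⊓ W)
    (S.X₂.obj.map (homOfLE inf_le_left).op y - S.X₂.obj.map (homOfLE inf_le_right).op y') (by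
      rw [map_sub, res_app, res_app, hy, hy', res_res, res_res, sub_self])
  obtain ⟨d', rfl⟩ := h (inf_le_right : V ⊓ W ≤ W) d
  rw [res_app] at hd
  obtain ⟨w, hw1, hw2⟩ := exists_glue₂ S.X₂ (le_sup_left : V ≤ V ⊔ W) le_sup_right le_rfl y
    (y' + S.f.hom.app (op W) d') (by rw [map_add, hd]; abel)
  refine hmax (V ⊔ W) ⟨sup_le hV hW, w, ?_⟩ (lt_of_le_of_ne le_sup_left fun h => hzV ?_)
  · refine TopCat.Sheaf.eq_of_locally_eq₂ S.X₃ (homOfLE le_sup_left) (homOfLE le_sup_right) le_rfl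
      _ _ ?_ ?_
    · rw [← res_app, hw1, hy, res_res]
    · rw [← res_app, hw2, map_add, hy', res_res]
      have : (S.f ≫ S.g).hom.app (op W) d' = 0 := by rw [S.zero]; rfl
      exact (congrArg (_ + ·) this).trans (add_zero _)
  · exact h ▸ (le_sup_right : W ≤ V ⊔ W) hzW

lemma Flasque.of_shortExact [NoetherianSpace T]
    {S : ShortComplex (TopCat.Sheaf (ModuleCat.{u} R) T)} (hS : S.ShortExact) (h₁ : Flasque S.X₁)
    (h₂ : Flasque S.X₂) : Flasque S.X₃ := by
  intro V U h x
  obtain ⟨y, rfl⟩ := h₁.exists_lift hS V x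
  obtain ⟨y, rfl⟩ := h₂ h y
  exact ⟨_, (res_app S.g h y).symm⟩

/-- The free presheaf of modules on an open set, restricted to a smaller open set. -/
noncomputable def freeRes {V U : Opens T} (h : V ≤ U) (M : ModuleCat.{u} R) :
    Presheaf.freeYoneda V M ⟶ Presheaf.freeYoneda U M where
  app W := Limits.Sigma.map' (fun i => i ≫ homOfLE h) fun _ => 𝟙 M
  naturality W W' i := by
    refine Sigma.hom_ext _ _ fun j => ?_
    simp [Presheaf.freeYoneda]

instance {V U : Opens T} (h : V ≤ U) (M : ModuleCat.{u} R) : Mono (freeRes h M) := by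
  have : ∀ W, Mono ((freeRes h M).app W) := by
    rintro ⟨W⟩
    let φ : (∐ fun _ : W ⟶ V => M) ⟶ ∐ fun _ : W ⟶ U => M :=
      Limits.Sigma.map' (fun i => i ≫ homOfLE h) fun _ => 𝟙 M
    suffices hφ : Mono φ from hφ
    by_cases hW : W ≤ V
    · let g : (∐ fun _ : W ⟶ U => M) ⟶ ∐ fun _ : W ⟶ V => M :=
        Sigma.desc fun _ => Sigma.ι (fun _ : W ⟶ V => M) (homOfLE hW)
      suffices hg : φ ≫ g = 𝟙 _ from mono_of_mono_fac hg
      refine Sigma.hom_ext _ _ fun i => ?_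
      obtain rfl : i = homOfLE hW := Subsingleton.elim _ _
      simp [φ, g]
    · have : IsEmpty (W ⟶ V) := ⟨fun i => hW (leOfHom i)⟩
      have h0 : 𝟙 (∐ fun _ : W ⟶ V => M) = 0 := Sigma.hom_ext _ _ fun i => isEmptyElim i
      exact ⟨fun a b _ => ((IsZero.iff_id_eq_zero _).2 h0).eq_of_tgt a b⟩
  exact NatTrans.mono_of_mono_app _

lemma freeRes_comp {V U : Opens T} (h : V ≤ U) (M : ModuleCat.{u} R)
    {F : (Opens T)ᵒᵖ ⥤ ModuleCat.{u} R} (b : Presheaf.freeYoneda U M ⟶ F) :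
    Presheaf.freeYonedaHomEquiv (freeRes h M ≫ b) =
      Presheaf.freeYonedaHomEquiv b ≫ F.map (homOfLE h).op := by
  have hb : (Presheaf.freeYoneda U M).map (homOfLE h).op ≫ b.app (op V) =
    b.app (op U) ≫ F.map (homOfLE h).op := b.naturality (homOfLE h).op
  have h1 : Sigma.ι (fun _ : V ⟶ V => M) (𝟙 V) ≫ (freeRes h M).app (op V) =
      Sigma.ι (fun _ : V ⟶ U => M) (homOfLE h) := by
    refine (Sigma.ι_comp_map' _ _ _).trans ((Category.id_comp _).trans ?_)
    rfl
  have h2 : Sigma.ι (fun _ : U ⟶ U => M) (𝟙 U) ≫ (Presheaf.freeYoneda U M).map (homOfLE h).op =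
      Sigma.ι (fun _ : V ⟶ U => M) (homOfLE h) := by
    refine (Sigma.ι_comp_map' _ _ _).trans ((Category.id_comp _).trans ?_)
    rfl
  exact (Category.assoc _ _ _).symm.trans ((congrArg (· ≫ b.app (op V)) (h1.trans h2.symm)).trans
    ((Category.assoc _ _ _).trans ((congrArg (_ ≫ ·) hb).trans (Category.assoc _ _ _).symm)))

lemma Flasque.of_injective (F : TopCat.Sheaf (ModuleCat.{u} R) T) [hF : Injective F] :
    Flasque F := by
  intro V U h x
  let M := ModuleCat.of R R
  let adj := sheafificationAdjunction (Opens.grothendieckTopology T) (ModuleCat.{u} R)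
  let a : Presheaf.freeYoneda V M ⟶ F.obj :=
    Presheaf.freeYonedaHomEquiv.symm (ModuleCat.ofHom (LinearMap.toSpanSingleton R _ x))
  let ψ := (presheafToSheaf (Opens.grothendieckTopology T) (ModuleCat.{u} R)).map (freeRes h M)
  have hψ : Mono ψ := (presheafToSheaf (Opens.grothendieckTopology T) (ModuleCat.{u} R)).map_mono _
  obtain ⟨b, hb⟩ := @Injective.factors _ _ _ hF _ _ ((adj.homEquiv _ _).symm a) ψ hψ
  have hb' := (adj.homEquiv_naturality_left (freeRes h M) b).symm.trans
    ((congrArg (adj.homEquiv _ _) hb).trans (Equiv.apply_symm_apply _ _))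
  let b' : Presheaf.freeYoneda U M ⟶ F.obj := adj.homEquiv _ _ b
  refine ⟨(Presheaf.freeYonedaHomEquiv b').hom (1 : R), ?_⟩
  have h1 := (freeRes_comp h M b').symm.trans ((congrArg Presheaf.freeYonedaHomEquiv hb').trans
    (Equiv.apply_symm_apply _ _))
  have h3 := congr(($h1).hom (1 : R))
  exact h3.trans (one_smul R x)

/-- The section `1` of the constant sheaf. -/
noncomputable def constantOne : (constantRing R T).obj.obj (op ⊤) :=
  ((constantSheafAdj (Opens.grothendieckTopology T) (ModuleCat.{u} R)
    isTerminalTop).unit.app (ModuleCat.of R R)).hom (1 : R)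

/-- Morphisms from the constant sheaf are global sections. -/
noncomputable def homConstant (F : TopCat.Sheaf (ModuleCat.{u} R) T) :
    (constantRing R T ⟶ F) ≃ₗ[R] F.obj.obj (op ⊤) :=
  LinearEquiv.ofBijective
    ({ toFun := fun f => (f.hom.app (op ⊤)).hom constantOne
       map_add' := fun _ _ => rfl
       map_smul' := fun _ _ => rfl } : (constantRing R T ⟶ F) →ₗ[R] F.obj.obj (op ⊤)) <| by
    let e := ((constantSheafAdj (Opens.grothendieckTopology T) (ModuleCat.{u} R)
      isTerminalTop).homEquiv (ModuleCat.of R R) F).trans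
      (ModuleCat.homEquiv.trans (LinearMap.ringLmapEquivSelf R R _).toEquiv)
    refine (congrArg Function.Bijective (funext fun f => ?_)).mp e.bijective
    exact congr(($((constantSheafAdj (Opens.grothendieckTopology T) (ModuleCat.{u} R)
      isTerminalTop).homEquiv_unit (ModuleCat.of R R) F f)).hom (1 : R))

lemma homConstant_comp (f : constantRing R T ⟶ F) (g : F ⟶ G) :
    homConstant G (f ≫ g) = g.hom.app (op ⊤) (homConstant F f) := rfl

attribute [local instance] CategoryTheory.HasExt.standard

lemma Flasque.subsingleton_cohomology [NoetherianSpace T] (hF : Flasque F) (n : ℕ) :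
    Subsingleton (cohomology F (n + 1)) := by
  refine Abelian.Ext.subsingleton_of_class (constantRing R T) Flasque (fun S hS h f => ?_)
    (fun E => ⟨Injective.under E, Injective.ι E, inferInstance, .of_injective _⟩)
    (fun S hS h h' => h.of_shortExact hS h') n F hF
  obtain ⟨y, hy⟩ := h.exists_lift hS ⊤ (homConstant _ f)
  refine ⟨(homConstant S.X₂).symm y, (homConstant S.X₃).injective ?_⟩
  rw [homConstant_comp, LinearEquiv.apply_symm_apply, hy]

/-- A topological space in which the complement of a non-empty open subset of an open subset
`U` is closed in the whole space. -/
def CurveLike (T : TopCat.{u}) : Prop :=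
  ∀ ⦃V U : Opens T⦄, V ≤ U → (V : Set T).Nonempty → ∃ W : Opens T, U ⊔ W = ⊤ ∧ U ⊓ W ≤ V

lemma Flasque.of_epi (hT : CurveLike T) (hF : Flasque F) (f : F ⟶ G) (hf : Epi f) : Flasque G := by
  intro V U h x
  suffices hx : ∃ y : G.obj.obj (op ⊤), G.obj.map (homOfLE le_top).op y = x by
    obtain ⟨y, rfl⟩ := hx
    exact ⟨G.obj.map (homOfLE le_top).op y, res_res _ _ _ _⟩
  obtain hV | ⟨v, hv⟩ := (V : Set T).eq_empty_or_nonempty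
  · have := subsingleton_bot G (V := V) (Opens.ext hV)
    exact ⟨0, Subsingleton.elim _ _⟩
  obtain ⟨V', hV', y, hv', hy⟩ := exists_local_lift f V x v hv
  obtain ⟨y, rfl⟩ := hF (le_top : V' ≤ ⊤) y
  rw [res_app] at hy
  obtain ⟨W, hW, hW'⟩ := hT hV' ⟨v, hv'⟩
  obtain ⟨w, hw, -⟩ := exists_glue₂ G (le_top : V ≤ ⊤) (le_top : W ≤ ⊤) hW.ge
    (x - G.obj.map (homOfLE le_top).op (f.hom.app (op ⊤) y)) 0 (by
      rw [← res_res _ hV' hW', map_sub, ← hy, res_res, sub_self, map_zero, map_zero])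
  exact ⟨w + f.hom.app (op ⊤) y, by rw [map_add, hw, sub_add_cancel]⟩

end ModSheaf
end SheafSections

namespace QCoh

noncomputable section

variable {X Y : Scheme.{u}}

/-- Restriction of sections of a module. -/
def sres (M : X.Modules) {U V : X.Opens} (h : V ≤ U) : Γ(M, U) →+ Γ(M, V) :=
  (M.presheaf.map (homOfLE h).op).hom

lemma sres_sres (M : X.Modules) {U V W : X.Opens} (h : V ≤ U) (h' : W ≤ V) (x : Γ(M, U)) :
    sres M h' (sres M h x) = sres M (h'.trans h) x :=
  congr($((M.presheaf.map_comp (homOfLE h).op (homOfLE h').op).symm) x)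

lemma sres_self (M : X.Modules) {U : X.Opens} (h : U ≤ U) (x : Γ(M, U)) : sres M h x = x :=
  congr($(M.presheaf.map_id (.op U)) x)

lemma sres_smul (M : X.Modules) {U V : X.Opens} (h : V ≤ U) (r : Γ(X, U)) (x : Γ(M, U)) :
    sres M h (r • x) = Carlitz.res h r • sres M h x :=
  M.map_smul (homOfLE h) r x

lemma app_sres {M N : X.Modules} (φ : M ⟶ N) {U V : X.Opens} (h : V ≤ U) (x : Γ(M, U)) :
    φ.app V (sres M h x) = sres N h (φ.app U x) :=
  congr($(φ.mapPresheaf.naturality (homOfLE h).op) x)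

lemma eq_of_sres (M : X.Modules) {ι : Type*} {W : ι → X.Opens} {V : X.Opens} (hV : V ≤ iSup W)
    (hW : ∀ i, W i ≤ V) {x y : Γ(M, V)} (h : ∀ i, sres M (hW i) x = sres M (hW i) y) : x = y :=
  TopCat.Sheaf.eq_of_locally_eq' ⟨M.presheaf, M.isSheaf⟩ W V (fun i => homOfLE (hW i)) hV x y h

lemma exists_sglue₂ (M : X.Modules) {U V W : X.Opens} (hU : U ≤ W)
    (hV : V ≤ W) (hW : W ≤ U ⊔ V) (x : Γ(M, U)) (y : Γ(M, V))
    (h : sres M (inf_le_left : U ⊓ V ≤ U) x = sres M (inf_le_right : U ⊓ V ≤ V) y) :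
    ∃ w : Γ(M, W), sres M hU w = x ∧ sres M hV w = y := by
  let O : ULift.{u} Bool → X.Opens := fun i => bif i.down then U else V
  let sf : ∀ i, Γ(M, O i) := fun i => match i with
    | ⟨true⟩ => x
    | ⟨false⟩ => y
  have hO : ∀ i, O i ≤ W := by rintro ⟨_ | _⟩ <;> assumption
  obtain ⟨w, hw, -⟩ := TopCat.Sheaf.existsUnique_gluing' ⟨M.presheaf, M.isSheaf⟩
    O W (fun i => homOfLE (hO i))
    (hW.trans (sup_le (le_iSup O ⟨true⟩) (le_iSup O ⟨false⟩))) sf (by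
      rintro ⟨_ | _⟩ ⟨_ | _⟩
      · rfl
      · have h' := congrArg (sres M (le_inf inf_le_right inf_le_left : V ⊓ U ≤ U ⊓ V)) h
        rw [sres_sres, sres_sres] at h'
        exact h'.symm
      · exact h
      · rfl)
  exact ⟨w, hw ⟨true⟩, hw ⟨false⟩⟩

/-- Restriction to `W ⊆ V` has the properties of the localization at a function on `V`. -/
def LocAt (M : X.Modules) {V W : X.Opens} (h : W ≤ V) (a : Γ(X, V)) : Prop :=
  (∀ y : Γ(M, W), ∃ (n : ℕ) (x : Γ(M, V)), sres M h x = Carlitz.res h a ^ n • y) ∧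
    ∀ x : Γ(M, V), sres M h x = 0 → ∃ n : ℕ, a ^ n • x = 0

section Spec

variable {R : CommRingCat.{u}}

/-- An element of `R` as a function on `Spec R`. -/
abbrev specFun (r : R) : Γ(Spec R, ⊤) := (Scheme.ΓSpecIso R).inv r

/-- The basic open subset of `Spec R` given by an element of `R`. -/
def specD (r : R) : (Spec R).Opens := PrimeSpectrum.basicOpen r

lemma specFun_smul (M : (Spec R).Modules) (r : R) (U : (Spec R).Opens) (n : ℕ) (y : Γ(M, U)) :
    Carlitz.res (le_top : U ≤ ⊤) (specFun r) ^ n • y = r ^ n • y := by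
  rw [← map_pow, ← map_pow]
  exact (Scheme.Modules.smul_Spec_def (r ^ n) y).symm

lemma spec_qcoh_iff (M : (Spec R).Modules) : qcoh (Spec R) M ↔
    ∀ r : R, LocAt M (le_top : specD r ≤ _) (specFun r) := by
  refine (isQuasicoherent_iff_isIso_fromTildeΓ M).trans
    ((isIso_fromTildeΓ_iff_isLocalizing M).trans (forall_congr' fun r => ?_))
  have hpow' : ∀ (n : ℕ) (y : Γ(M, (⊤ : (Spec R).Opens))), specFun r ^ n • y = r ^ n • y :=
    fun n y => by rw [← specFun_smul, Carlitz.res_self]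
  constructor
  · intro h
    refine ⟨fun y => ?_, fun x hx => ?_⟩
    · obtain ⟨⟨x, ⟨_, n, rfl⟩⟩, hx⟩ := h.surj y
      have hx' : r ^ n • y = sres M (le_top : specD r ≤ _) x := hx
      exact ⟨n, x, hx'.symm.trans (specFun_smul M r _ n y).symm⟩
    · obtain ⟨⟨_, n, rfl⟩, hc⟩ := h.exists_of_eq (x₁ := x) (x₂ := 0) (hx.trans (map_zero _).symm)
      have hc' : r ^ n • x = 0 := hc.trans (smul_zero _)
      exact ⟨n, (hpow' n x).trans hc'⟩
  · intro h
    refine IsLocalizedModule.Away.mk_of_addCommGroup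
      (Scheme.Modules.isUnit_algebraMap_end_of_le_basicOpen (M := M) r le_rfl)
      (fun (y : Γ(M, specD r)) => ?_) fun (x : Γ(M, (⊤ : (Spec R).Opens))) hx => ?_
    · obtain ⟨n, x, hx⟩ := h.1 y
      exact ⟨n, x, (specFun_smul M r _ n y).symm.trans hx.symm⟩
    · obtain ⟨n, hn⟩ := h.2 x hx
      exact ⟨n, (hpow' n x).symm.trans hn⟩

lemma spec_surjective_of_epi {M N : (Spec R).Modules} (hM : qcoh _ M) (hN : qcoh _ N)
    (ψ : M ⟶ N) [Epi ψ] : Function.Surjective (ψ.app ⊤) := by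
  have hM' : IsIso (Scheme.Modules.fromTildeΓNatTrans.app M) :=
    (isQuasicoherent_iff_isIso_fromTildeΓ M).1 hM
  have hN' : IsIso (Scheme.Modules.fromTildeΓNatTrans.app N) :=
    (isQuasicoherent_iff_isIso_fromTildeΓ N).1 hN
  have nat := Scheme.Modules.fromTildeΓNatTrans.naturality ψ
  have hψ : Epi ((𝟭 _).map ψ) := ‹_›
  have h1 : Epi ((moduleSpecΓFunctor ⋙ tilde.functor R).map ψ) := by
    have h2 : (moduleSpecΓFunctor ⋙ tilde.functor R).map ψ = _ := (IsIso.eq_comp_inv _).2 nat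
    rw [h2]
    infer_instance
  have h2 : Epi (moduleSpecΓFunctor.map ψ) := (tilde.functor R).epi_of_epi_map h1
  exact (ModuleCat.epi_iff_surjective (moduleSpecΓFunctor.map ψ)).1 h2

end Spec

lemma locAt_congr (M : X.Modules) {V W W' : X.Opens} (h : W ≤ V) (a : Γ(X, V)) (e : W = W') :
    LocAt M h a ↔ LocAt M (e ▸ h) a := by
  subst e
  rfl

lemma locAt_restrict (M : Y.Modules) (f : X ⟶ Y) [IsOpenImmersion f] {V W : X.Opens}
    (h : W ≤ V) (a : Γ(X, V)) :
    LocAt (M.restrict f) h a ↔ LocAt M (f.image_mono h) ((f.appIso V).inv a) := by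
  have key : Carlitz.res (f.image_mono h) ((f.appIso V).inv a) =
      (f.appIso W).inv (Carlitz.res h a) :=
    congr($(f.appIso_inv_naturality (homOfLE h).op) a).symm
  unfold LocAt
  rw [key]
  simp only [← map_pow]
  rfl

lemma qcoh_restrict_iff {R : CommRingCat.{u}} (M : Y.Modules) (f : Spec R ⟶ Y)
    [IsOpenImmersion f] : qcoh (Spec R) (M.restrict f) ↔
      ∀ a : Γ(Y, f ''ᵁ ⊤), LocAt M (Y.basicOpen_le a) a := by
  let e : R ≃ Γ(Y, f ''ᵁ ⊤) :=
    ((Scheme.ΓSpecIso R).symm ≪≫ (f.appIso ⊤).symm).commRingCatIsoToRingEquiv.toEquiv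
  rw [spec_qcoh_iff, ← e.forall_congr_right]
  refine forall_congr' fun r => (locAt_restrict M f _ _).trans (locAt_congr M _ _ ?_)
  have h1 : specD r = (Spec R).basicOpen (specFun r) := (basicOpen_eq_of_affine r).symm
  rw [h1]
  exact Scheme.image_basicOpen f _

lemma qcoh.locAt {M : X.Modules} (hM : qcoh X M) {U : X.Opens} (hU : IsAffineOpen U)
    (a : Γ(X, U)) : LocAt M (X.basicOpen_le a) a := by
  have h := (qcoh_restrict_iff M hU.fromSpec).1
    (@Scheme.Modules.isQuasicoherent_restrictFunctor _ _ _ _ _ hM)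
  have e : hU.fromSpec ''ᵁ ⊤ = U := by
    rw [Scheme.Hom.image_top_eq_opensRange, hU.opensRange_fromSpec]
  rw [e] at h
  exact h a

lemma qcoh_of_locAt {M : X.Modules} (h : ∀ x : X, ∃ U : X.Opens, x ∈ U ∧ IsAffineOpen U ∧
    ∀ a : Γ(X, U), LocAt M (X.basicOpen_le a) a) : qcoh X M := by
  choose U hxU hU hloc using h
  refine of_cover M (fun x => (hU x).fromSpec) (fun x => ⟨x, ?_⟩) fun x => ?_
  · have h1 : x ∈ (hU x).fromSpec.opensRange := by
      rw [(hU x).opensRange_fromSpec]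
      exact hxU x
    exact h1
  · refine (qcoh_restrict_iff M _).2 ?_
    have e : (hU x).fromSpec ''ᵁ ⊤ = U x := by
      rw [Scheme.Hom.image_top_eq_opensRange, (hU x).opensRange_fromSpec]
    rw [e]
    exact hloc x

lemma exists_basicOpen {U V : X.Opens} (hU : IsAffineOpen U) (z : X) (hz : z ∈ U) (hzV : z ∈ V) :
    ∃ a : Γ(X, U), X.basicOpen a ≤ V ∧ z ∈ X.basicOpen a :=
  hU.exists_basicOpen_le ⟨z, hzV⟩ hz

lemma isUnit_res_basicOpen {U : X.Opens} (a : Γ(X, U)) :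
    IsUnit (Carlitz.res (X.basicOpen_le a) a) :=
  RingedSpace.isUnit_res_basicOpen _ a

/-- A morphism of quasi-coherent modules that is injective on sections over an affine cover is
injective on all sections. -/
lemma injective_of_cover {M N : X.Modules} (hM : qcoh X M) (hN : qcoh X N) (φ : M ⟶ N)
    (h : ∀ x : X, ∃ U : X.Opens, x ∈ U ∧ IsAffineOpen U ∧ Function.Injective (φ.app U))
    (W : X.Opens) : Function.Injective (φ.app W) := by
  refine (injective_iff_map_eq_zero (φ.app W).hom).2 fun x hx => ?_
  choose U hzU hU hφ using h
  choose a haW hza using fun z : W => exists_basicOpen (hU z) z.1 (hzU z) z.2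
  refine eq_of_sres M (W := fun z : W => X.basicOpen (a z))
    (fun z hz => Opens.mem_iSup.2 ⟨⟨z, hz⟩, hza ⟨z, hz⟩⟩) (fun z => haW z) fun z => ?_
  rw [map_zero]
  obtain ⟨n, x', hx'⟩ := (hM.locAt (hU z) (a z)).1 (sres M (haW z) x)
  obtain ⟨m, hm⟩ := (hN.locAt (hU z) (a z)).2 (φ.app _ x') (by
    rw [← app_sres, hx', φ.app_smul, app_sres, show φ.app W x = 0 from hx, map_zero, smul_zero])
  have h1 : a z ^ m • x' = 0 := hφ z (by rw [φ.app_smul, hm, map_zero])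
  have h2 := congrArg (sres M (X.basicOpen_le (a z))) h1
  rw [sres_smul, hx', smul_smul, map_pow, ← pow_add, map_zero] at h2
  exact ((isUnit_res_basicOpen (a z)).pow (m + n)).smul_eq_zero.1 h2

lemma mono_of_injective {M N : X.Modules} (φ : M ⟶ N)
    (h : ∀ W, Function.Injective (φ.app W)) : Mono φ := by
  refine ⟨fun a b hab => hom_ext' fun U x => h U ?_⟩
  exact congr(($hab).app U x)

lemma injective_of_mono {M N : X.Modules} (φ : M ⟶ N) [Mono φ] (W : X.Opens) :
    Function.Injective (φ.app W) := by
  let G : X.Modules ⥤ Ab := Scheme.Modules.toPresheaf X ⋙ (evaluation _ _).obj (.op W)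
  have : PreservesFiniteLimits ((evaluation (Opens X)ᵒᵖ Ab.{u}).obj (.op W)) :=
    ⟨fun _ => inferInstance⟩
  have hG : PreservesFiniteLimits G := comp_preservesFiniteLimits _ _
  exact (AddCommGrpCat.mono_iff_injective _).1 (inferInstanceAs (Mono (G.map φ)))

/-- An epimorphism of quasi-coherent modules is surjective on sections over affine open sets. -/
lemma surjective_of_epi {M N : X.Modules} (hM : qcoh X M) (hN : qcoh X N) (φ : M ⟶ N) [Epi φ]
    {U : X.Opens} (hU : IsAffineOpen U) : Function.Surjective (φ.app U) := by
  have hψ : Epi ((Scheme.Modules.restrictFunctor hU.fromSpec).map φ) := inferInstance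
  have h3 : Function.Surjective (φ.app (hU.fromSpec ''ᵁ ⊤)) := spec_surjective_of_epi
    (@Scheme.Modules.isQuasicoherent_restrictFunctor _ _ _ _ _ hM)
    (@Scheme.Modules.isQuasicoherent_restrictFunctor _ _ _ _ _ hN)
    ((Scheme.Modules.restrictFunctor hU.fromSpec).map φ)
  have e : hU.fromSpec ''ᵁ ⊤ = U := by
    rw [Scheme.Hom.image_top_eq_opensRange, hU.opensRange_fromSpec]
  rwa [e] at h3

end
end QCoh

section Dimension

open Polynomial

lemma dimensionLEOne_of_quasiFinite {R S : Type*} [CommRing R] [IsDomain R]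
    [IsPrincipalIdealRing R] [CommRing S] [IsDomain S] [Algebra R S] [Algebra.QuasiFinite R S] :
    Ring.DimensionLEOne S where
  maximalOfPrime {p} hp0 hp := by
    obtain ⟨m, hm, hpm⟩ := p.exists_le_maximal hp.ne_top
    suffices h : p = m from h ▸ hm
    have hm' := hm.isPrime
    refine Algebra.QuasiFinite.eq_of_le_of_under_eq (R := R) p m hpm ?_
    have h0 : p.under R ≠ ⊥ := fun h => hp0 <| (Algebra.QuasiFinite.eq_of_le_of_under_eq (R := R) ⊥ p
      bot_le (le_antisymm (Ideal.comap_mono bot_le) (h ▸ bot_le))).symm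
    have : (p.under R).IsMaximal := IsPrime.to_maximal_ideal h0
    exact this.eq_of_le (Ideal.IsPrime.ne_top inferInstance) (Ideal.comap_mono hpm)

lemma dimensionLEOne_of_standardSmooth {F S : Type*} [CommRing F] (hF : IsField F) [CommRing S]
    [IsDomain S] {f : F →+* S} (hf : f.IsStandardSmoothOfRelativeDimension 1) :
    Ring.DimensionLEOne S := by
  let _ := hF.toField
  obtain ⟨g, -, hg⟩ := hf.exists_etale_mvPolynomial
  algebraize [g]
  have : IsPrincipalIdealRing (MvPolynomial (Fin 1) F) := by
    let e : F[X] ≃ₐ[F] MvPolynomial (Fin 1) F :=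
      ((MvPolynomial.uniqueAlgEquiv F (Fin 1)).symm)
    exact IsPrincipalIdealRing.of_surjective e.toRingEquiv.toRingHom e.surjective
  exact dimensionLEOne_of_quasiFinite (R := MvPolynomial (Fin 1) F)

end Dimension

namespace Carlitz

section Curve

variable {k : Type u} [Field k] {X : Scheme.{u}} [IsIntegral X] (p : X ⟶ Spec (CommRingCat.of k))

lemma exists_affine_dimensionLEOne [SmoothOfRelativeDimension 1 p] (z : X) :
    ∃ V : X.Opens, IsAffineOpen V ∧ z ∈ V ∧ Ring.DimensionLEOne Γ(X, V) := by
  obtain ⟨U, hU, V, hV, hz, e, hf⟩ :=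
    SmoothOfRelativeDimension.exists_isStandardSmoothOfRelativeDimension (n := 1) (f := p) z
  have : Nonempty V := ⟨⟨z, hz⟩⟩
  refine ⟨V, hV, hz, dimensionLEOne_of_standardSmooth ?_ hf⟩
  have hU' : U = ⊤ := top_le_iff.1 fun x _ =>
    (Subsingleton.elim (α := PrimeSpectrum k) (p z) x) ▸ e hz
  subst hU'
  exact (Scheme.ΓSpecIso (CommRingCat.of k)).commRingCatIsoToRingEquiv.toMulEquiv.isField
    (Field.toIsField k)

lemma dimensionLEOne_stalk [SmoothOfRelativeDimension 1 p] (z : X) :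
    Ring.DimensionLEOne (X.presheaf.stalk z) := by
  obtain ⟨V, hV, hz, hdim⟩ := exists_affine_dimensionLEOne p z
  have : Nonempty V := ⟨⟨z, hz⟩⟩
  let _ := TopCat.Presheaf.algebra_section_stalk X.presheaf (⟨z, hz⟩ : V)
  have := hV.isLocalization_stalk ⟨z, hz⟩
  exact Ring.DimensionLEOne.localization (M := (hV.primeIdealOf ⟨z, hz⟩).asIdeal.primeCompl) _
    (Ideal.primeCompl_le_nonZeroDivisors _)

lemma isClosed_singleton_of_ne [SmoothOfRelativeDimension 1 p] {z : X} (hz : z ≠ genericPoint X) :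
    IsClosed {z} := by
  refine isClosed_of_closure_subset fun w hw => ?_
  have hzw : z ⤳ w := specializes_iff_mem_closure.2 hw
  obtain ⟨V, hV, hwV, hdim⟩ := exists_affine_dimensionLEOne p w
  have hzV : z ∈ V := hzw.mem_open V.isOpen hwV
  have hr : ∀ x ∈ V, ∃ x', hV.fromSpec x' = x := fun x hx => by
    have : x ∈ Set.range hV.fromSpec := by rw [hV.range_fromSpec]; exact hx
    exact this
  obtain ⟨z', rfl⟩ := hr z hzV
  obtain ⟨w', rfl⟩ := hr w hwV
  obtain ⟨η, hη⟩ := hr _ (generic_mem hwV)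
  have hind := hV.fromSpec.isOpenEmbedding.isInducing
  have h1 : z'.asIdeal ≠ ⊥ := fun h => hz <| by
    refine (Specializes.antisymm ?_ ((genericPoint_spec X).specializes trivial)).eq
    rw [← hη, hind.specializes_iff]
    exact (PrimeSpectrum.le_iff_specializes z' η).1 (h.le.trans bot_le)
  have h2 : z'.asIdeal ≤ w'.asIdeal := by
    rw [hind.specializes_iff] at hzw
    exact (PrimeSpectrum.le_iff_specializes z' w').2 hzw
  have h3 := (Ring.DimensionLEOne.maximalOfPrime h1 z'.2).eq_of_le w'.2.ne_top h2
  exact congrArg hV.fromSpec (PrimeSpectrum.ext h3.symm)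

lemma isNoetherian_of_proper {X : Scheme.{u}} (p : X ⟶ Spec (CommRingCat.of k)) [IsProper p] : IsNoetherian X :=
  have := LocallyOfFiniteType.isLocallyNoetherian p
  have : CompactSpace X := QuasiCompact.compactSpace_of_compactSpace p
  {}

lemma finite_of_isClosed [IsProper p] [SmoothOfRelativeDimension 1 p] {Z : Set X} (hZ : IsClosed Z)
    (h : genericPoint X ∉ Z) : Z.Finite := by
  have := isNoetherian_of_proper p
  obtain ⟨S, hS, hcl, hirr, rfl⟩ := NoetherianSpace.exists_finite_set_isClosed_irreducible hZ
  refine hS.sUnion fun t ht => ?_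
  obtain ⟨x, hx⟩ := QuasiSober.sober (hirr t ht) (hcl t ht)
  have hx' : x ≠ genericPoint X := fun e => h ⟨t, ht, e ▸ hx.mem⟩
  rw [← hx.def, (isClosed_singleton_of_ne p hx').closure_eq]
  exact Set.finite_singleton x

lemma isClosed_of_finite [SmoothOfRelativeDimension 1 p] {Z : Set X} (hZ : Z.Finite)
    (h : genericPoint X ∉ Z) : IsClosed Z := by
  rw [← Set.biUnion_of_singleton Z]
  exact hZ.isClosed_biUnion fun z hz => isClosed_singleton_of_ne p fun e => h (e ▸ hz)

lemma curveLike [IsProper p] [SmoothOfRelativeDimension 1 p] :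
    ModSheaf.CurveLike (X : TopCat.{u}) := by
  rintro V U h ⟨v, hv⟩
  have hη : genericPoint X ∈ V := generic_mem hv
  have h1 : (Vᶜ : Set X).Finite := finite_of_isClosed p V.isOpen.isClosed_compl fun h' => h' hη
  have h2 : IsClosed (U \ V : Set X) := isClosed_of_finite p
    (h1.subset fun x hx => hx.2) fun h' => h'.2 hη
  refine ⟨⟨(U \ V : Set X)ᶜ, h2.isOpen_compl⟩, ?_, ?_⟩
  · refine top_le_iff.1 fun x _ => ?_
    by_cases hx : x ∈ U
    · exact Or.inl hx
    · exact Or.inr fun h' => hx h'.1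
  · rintro x ⟨hx, hx'⟩
    by_contra hV
    exact hx' ⟨hx, hV⟩

end Curve

section ProjLine

variable (k : Type u) [Field k]

lemma ProjLine.isAffineOpen_finite : IsAffineOpen (ProjLine.finite k) :=
  Proj.isAffineOpen_basicOpen _ _ (MvPolynomial.isHomogeneous_X k 1) one_pos

lemma ProjLine.isAffineOpen_infinite : IsAffineOpen (ProjLine.infinite k) :=
  Proj.isAffineOpen_basicOpen _ _ (MvPolynomial.isHomogeneous_X k 0) one_pos

lemma ProjLine.isAffineOpen_inf : IsAffineOpen (ProjLine.finite k ⊓ ProjLine.infinite k) :=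
  (ProjLine.isAffineOpen_finite k).inf (ProjLine.isAffineOpen_infinite k)

lemma ProjLine.exists_notMem_finite : ∃ x, x ∉ ProjLine.finite k := by
  let e := HomogeneousLocalization.Away.isLocalizationElem (𝒜 := coordGrading k)
    (MvPolynomial.isHomogeneous_X k 0) (MvPolynomial.isHomogeneous_X k 1)
  have he : ¬ IsUnit e := by
    intro h
    let ev : MvPolynomial (Fin 2) k →+* k := MvPolynomial.eval (fun i => if i = 0 then 1 else 0)
    have hev : IsUnit (ev (MvPolynomial.X 0)) := by simp [ev]
    let φ : Localization.Away (MvPolynomial.X 0 : MvPolynomial (Fin 2) k) →+* k :=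
      IsLocalization.Away.lift _ hev
    have h1 := (h.map (algebraMap _ (Localization.Away
      (MvPolynomial.X 0 : MvPolynomial (Fin 2) k)))).map φ
    have h2 : algebraMap (HomogeneousLocalization.Away (coordGrading k) (MvPolynomial.X 0))
        (Localization.Away (MvPolynomial.X 0 : MvPolynomial (Fin 2) k)) e *
        algebraMap (MvPolynomial (Fin 2) k) _ (MvPolynomial.X 0 ^ 1) =
          algebraMap (MvPolynomial (Fin 2) k) _ (MvPolynomial.X 1 ^ 1) := by
      change Localization.mk _ _ * _ = _
      rw [Localization.mk_eq_mk'_apply]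
      exact IsLocalization.mk'_spec _ _ _
    have h3 := congrArg φ h2
    rw [map_mul, IsLocalization.Away.lift_eq, IsLocalization.Away.lift_eq] at h3
    simp [ev] at h3
    exact h1.ne_zero h3
  obtain ⟨m, hm, hem⟩ := exists_max_ideal_of_mem_nonunits he
  let y : PrimeSpectrum _ := ⟨m, hm.isPrime⟩
  refine ⟨Proj.awayι (coordGrading k) (MvPolynomial.X 0) (MvPolynomial.isHomogeneous_X k 0)
    one_pos y, fun h => ?_⟩
  have h1 : y ∈ PrimeSpectrum.basicOpen e := by
    have := Proj.awayι_preimage_basicOpen (coordGrading k) (MvPolynomial.isHomogeneous_X k 0)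
      one_pos (MvPolynomial.isHomogeneous_X k 1) one_pos
    exact this ▸ h
  exact h1 hem

instance : IsSeparated (ProjLine.toSpec k) := by
  unfold ProjLine.toSpec
  infer_instance

end ProjLine

section Finite

variable {k : Type u} [Field k] {X : Scheme.{u}} [IsIntegral X] (π : X ⟶ ProjLine k)
  [Surjective π] [SmoothOfRelativeDimension 1 (toK π)] [IsProper (toK π)]

lemma finite_fibre (y : ProjLine k) : (π ⁻¹' {y}).Finite := by
  have hπ : IsProper π := IsProper.of_comp π (ProjLine.toSpec k)
  by_cases hy : IsClosed {y}
  · refine finite_of_isClosed (toK π) (hy.preimage π.continuous) fun h => ?_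
    have h1 : ∀ x, x = y := fun x => by
      obtain ⟨z, rfl⟩ := π.surjective x
      have h2 : genericPoint X ⤳ z := (genericPoint_spec X).specializes trivial
      have h3 : y ⤳ π z := h ▸ h2.map π.continuous
      exact h3.mem_closed hy rfl
    obtain ⟨a, ha⟩ := ProjLine.finite_nonempty k
    obtain ⟨b, hb⟩ := ProjLine.exists_notMem_finite k
    exact hb (h1 b ▸ h1 a ▸ ha)
  · refine (Set.finite_singleton (genericPoint X)).subset fun z hz => ?_
    by_contra hne
    refine hy ?_
    have := π.isClosedMap _ (isClosed_singleton_of_ne (toK π) hne)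
    rw [Set.image_singleton] at this
    exact hz ▸ this

lemma isFinite_toProjLine : IsFinite π := by
  have hπ : IsProper π := IsProper.of_comp π (ProjLine.toSpec k)
  have : LocallyQuasiFinite π := .of_finite_preimage_singleton _ (finite_fibre π)
  exact .of_isProper_of_locallyQuasiFinite π

lemma isAffineOpen_finitePart : IsAffineOpen (finitePart π) :=
  have := isFinite_toProjLine π
  (ProjLine.isAffineOpen_finite k).preimage π

lemma isAffineOpen_infinitePart : IsAffineOpen (infinitePart π) :=
  have := isFinite_toProjLine π
  (ProjLine.isAffineOpen_infinite k).preimage π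

lemma isAffineOpen_finitePart_inf : IsAffineOpen (finitePart π ⊓ infinitePart π) :=
  have := isFinite_toProjLine π
  (ProjLine.isAffineOpen_inf k).preimage π

end Finite

end Carlitz

namespace QCoh
noncomputable section

variable {X Y : Scheme.{u}}

lemma pushforward_qcoh (f : X ⟶ Y) [IsAffineHom f] {M : X.Modules} (hM : qcoh X M) :
    qcoh Y ((Scheme.Modules.pushforward f).obj M) := by
  refine qcoh_of_locAt fun y => ?_
  obtain ⟨U, hU, hy, -⟩ := exists_isAffineOpen_mem_and_subset (x := y) (U := ⊤) trivial
  refine ⟨U, hy, hU, fun a => ?_⟩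
  have h := hM.locAt (hU.preimage f) (f.app U a)
  have e : X.basicOpen (f.app U a) = f ⁻¹ᵁ Y.basicOpen a := (Scheme.preimage_basicOpen f a).symm
  rw [locAt_congr M _ _ e] at h
  have key : ∀ n : ℕ, Carlitz.res
      (e ▸ X.basicOpen_le (f.app U a) : f ⁻¹ᵁ Y.basicOpen a ≤ f ⁻¹ᵁ U) (f.app U a) ^ n =
      f.app (Y.basicOpen a) (Carlitz.res (Y.basicOpen_le a) a ^ n) := by
    intro n
    rw [map_pow]
    exact congrArg (· ^ n) congr($((f.naturality (homOfLE (Y.basicOpen_le a)).op).symm) a)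
  refine ⟨fun y => ?_, fun x hx => ?_⟩
  · obtain ⟨n, x, hx⟩ := h.1 y
    rw [key] at hx
    exact ⟨n, x, hx⟩
  · obtain ⟨n, hn⟩ := h.2 x hx
    rw [← map_pow] at hn
    exact ⟨n, hn⟩

/-- The module `W ↦ Γ(M, V ⊓ W)`. -/
def loc (V : X.Opens) : X.Modules ⥤ X.Modules :=
  Scheme.Modules.restrictFunctor V.ι ⋙ Scheme.Modules.pushforward V.ι

/-- Restriction to `V`, as a morphism of modules. -/
def toLoc (V : X.Opens) (M : X.Modules) : M ⟶ (loc V).obj M :=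
  (Scheme.Modules.restrictAdjunction V.ι).unit.app M

lemma loc_le_left (V W : X.Opens) : V.ι ''ᵁ V.ι ⁻¹ᵁ W ≤ V := V.ι_image_le _

lemma loc_le_right (V W : X.Opens) : V.ι ''ᵁ V.ι ⁻¹ᵁ W ≤ W := by
  rintro _ ⟨x, hx, rfl⟩
  exact hx

lemma le_loc {V W O : X.Opens} (h : O ≤ V) (h' : O ≤ W) : O ≤ V.ι ''ᵁ V.ι ⁻¹ᵁ W :=
  fun x hx => ⟨⟨x, h hx⟩, h' hx, rfl⟩

lemma toLoc_app (V : X.Opens) (M : X.Modules) (W : X.Opens) (x : Γ(M, W)) :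
    (toLoc V M).app W x = sres M (loc_le_right V W) x := by
  refine congr($(Scheme.Modules.restrictAdjunction_unit_app_app V.ι M W) x)

lemma loc_smul (V : X.Opens) (M : X.Modules) (W : X.Opens) (a : Γ(X, W))
    (x : Γ(M, V.ι ''ᵁ V.ι ⁻¹ᵁ W)) :
    (a • (show Γ((loc V).obj M, W) from x)) = Carlitz.res (loc_le_right V W) a • x := by
  refine congrArg (· • x) (?_ : (V.ι.appIso _).inv (V.ι.app W a) = _)
  exact congr($(Scheme.Hom.app_appIso_inv V.ι W) a)

lemma loc_qcoh {V : X.Opens} [IsAffineHom V.ι] {M : X.Modules} (hM : qcoh X M) :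
    qcoh X ((loc V).obj M) :=
  pushforward_qcoh V.ι (@Scheme.Modules.isQuasicoherent_restrictFunctor _ _ _ _ _ hM)

/-- The first Čech cohomology for the covering `V₁`, `V₂` vanishes. -/
def Cech (V₁ V₂ : X.Opens) (M : X.Modules) : Prop :=
  ∀ y : Γ(M, V₁ ⊓ V₂), ∃ (a : Γ(M, V₁)) (b : Γ(M, V₂)),
    y = sres M inf_le_left a - sres M inf_le_right b

lemma Cech.of_epi {V₁ V₂ : X.Opens} {M N : X.Modules} (h : Cech V₁ V₂ M) (φ : M ⟶ N)
    (hφ : Function.Surjective (φ.app (V₁ ⊓ V₂))) : Cech V₁ V₂ N := by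
  intro y
  obtain ⟨x, rfl⟩ := hφ y
  obtain ⟨a, b, rfl⟩ := h x
  exact ⟨φ.app _ a, φ.app _ b, by rw [← app_sres, ← app_sres]; exact map_sub (φ.app _).hom _ _⟩

lemma Cech.of_sum {V₁ V₂ : X.Opens} {M M₁ M₂ : X.Modules} (h₁ : Cech V₁ V₂ M₁)
    (h₂ : Cech V₁ V₂ M₂) (p₁ : M ⟶ M₁) (p₂ : M ⟶ M₂) (i₁ : M₁ ⟶ M) (i₂ : M₂ ⟶ M)
    (h : p₁ ≫ i₁ + p₂ ≫ i₂ = 𝟙 M) : Cech V₁ V₂ M := by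
  intro y
  obtain ⟨a₁, b₁, h1⟩ := h₁ (p₁.app _ y)
  obtain ⟨a₂, b₂, h2⟩ := h₂ (p₂.app _ y)
  have hy : i₁.app _ (p₁.app _ y) + i₂.app _ (p₂.app _ y) = y := congr(($h).app (V₁ ⊓ V₂) y)
  refine ⟨i₁.app _ a₁ + i₂.app _ a₂, i₁.app _ b₁ + i₂.app _ b₂, ?_⟩
  rw [map_add, map_add, ← app_sres, ← app_sres, ← app_sres, ← app_sres]
  rw [← hy, h1, h2, map_sub, map_sub]
  abel

lemma cech_loc_left (V₁ V₂ : X.Opens) (M : X.Modules) : Cech V₁ V₂ ((loc V₁).obj M) := by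
  intro y
  let y' : Γ(M, V₁.ι ''ᵁ V₁.ι ⁻¹ᵁ (V₁ ⊓ V₂)) := y
  have h : V₁.ι ''ᵁ V₁.ι ⁻¹ᵁ V₂ ≤ V₁.ι ''ᵁ V₁.ι ⁻¹ᵁ (V₁ ⊓ V₂) :=
    le_loc (loc_le_left _ _) (le_inf (loc_le_left _ _) (loc_le_right _ _))
  let b : Γ((loc V₁).obj M, V₂) := sres M h y'
  refine ⟨0, -b, ?_⟩
  rw [map_zero, map_neg, sub_neg_eq_add, zero_add]
  exact ((sres_sres M h (le_loc (loc_le_left _ _) ((loc_le_right _ _).trans inf_le_right))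
    y').trans (sres_self M _ y')).symm

lemma cech_loc_right (V₁ V₂ : X.Opens) (M : X.Modules) : Cech V₁ V₂ ((loc V₂).obj M) := by
  intro y
  let y' : Γ(M, V₂.ι ''ᵁ V₂.ι ⁻¹ᵁ (V₁ ⊓ V₂)) := y
  have h : V₂.ι ''ᵁ V₂.ι ⁻¹ᵁ V₁ ≤ V₂.ι ''ᵁ V₂.ι ⁻¹ᵁ (V₁ ⊓ V₂) :=
    le_loc (loc_le_left _ _) (le_inf (loc_le_right _ _) (loc_le_left _ _))
  refine ⟨sres M h y', 0, ?_⟩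
  rw [map_zero, sub_zero]
  exact ((sres_sres M h (le_loc (loc_le_left _ _) ((loc_le_right _ _).trans inf_le_left))
    y').trans (sres_self M _ y')).symm

lemma toLoc_injective {V₁ V₂ : X.Opens} (hV : V₁ ⊔ V₂ = ⊤) (M : X.Modules) (W : X.Opens)
    (x : Γ(M, W)) (h₁ : (toLoc V₁ M).app W x = 0) (h₂ : (toLoc V₂ M).app W x = 0) : x = 0 := by
  rw [toLoc_app] at h₁ h₂
  refine eq_of_sres M (W := fun b : Bool => bif b then V₁ ⊓ W else V₂ ⊓ W) (V := W) ?_ ?_ ?_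
  · rw [iSup_bool_eq, cond_true, cond_false, ← inf_sup_right, hV, top_inf_eq]
  · rintro (_ | _) <;> exact inf_le_right
  · rintro (_ | _)
    · have := congrArg (sres M (le_loc inf_le_left inf_le_right : V₂ ⊓ W ≤ _)) h₂
      rw [sres_sres] at this
      exact this.trans ((map_zero _).trans (map_zero _).symm)
    · have := congrArg (sres M (le_loc inf_le_left inf_le_right : V₁ ⊓ W ≤ _)) h₁
      rw [sres_sres] at this
      exact this.trans ((map_zero _).trans (map_zero _).symm)

lemma surjective_of_cech {V₁ V₂ : X.Opens} (hV : V₁ ⊔ V₂ = ⊤) (hV₁ : IsAffineOpen V₁)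
    (hV₂ : IsAffineOpen V₂) {M N K : X.Modules} (hM : qcoh X M) (hN : qcoh X N)
    {i : K ⟶ M} {φ : M ⟶ N} [Epi φ] (w : i ≫ φ = 0) (h : IsLimit (KernelFork.ofι i w))
    (hK : Cech V₁ V₂ K) : Function.Surjective (φ.app ⊤) := by
  intro y
  obtain ⟨x₁, h₁⟩ := surjective_of_epi hM hN φ hV₁ (sres N le_top y)
  obtain ⟨x₂, h₂⟩ := surjective_of_epi hM hN φ hV₂ (sres N le_top y)
  obtain ⟨z, hz⟩ := (kernel_sections w h (V₁ ⊓ V₂)).2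
    (sres M inf_le_left x₁ - sres M inf_le_right x₂) (by
      rw [map_sub, app_sres, app_sres, h₁, h₂, sres_sres, sres_sres, sub_self])
  obtain ⟨a, b, rfl⟩ := hK z
  have hw : ∀ U (u : Γ(K, U)), φ.app U (i.app U u) = 0 := fun U u => congr(($w).app U u)
  obtain ⟨x, hx₁, hx₂⟩ := exists_sglue₂ M (U := V₁) (V := V₂) (W := ⊤) le_top le_top hV.ge
    (x₁ - i.app _ a) (x₂ - i.app _ b) (by
      rw [map_sub, app_sres, app_sres] at hz
      rw [map_sub, map_sub, sub_eq_sub_iff_sub_eq_sub, hz])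
  refine ⟨x, eq_of_sres N (W := fun b : Bool => bif b then V₁ else V₂) (V := ⊤) ?_ (fun _ => le_top) ?_⟩
  · rw [iSup_bool_eq]; exact hV.ge
  · rintro (_ | _)
    · refine (app_sres φ (le_top : V₂ ≤ ⊤) x).symm.trans ?_
      rw [hx₂, map_sub, hw, sub_zero, h₂]
    · refine (app_sres φ (le_top : V₁ ≤ ⊤) x).symm.trans ?_
      rw [hx₁, map_sub, hw, sub_zero, h₁]
end
end QCoh

namespace Carlitz
noncomputable section

open Polynomial QCoh Opposite

lemma app_res {Y Z : Scheme.{u}} (f : Y ⟶ Z) {U V : Z.Opens} (h : V ≤ U) (r : Γ(Z, U)) :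
    f.app V (res h r) = res (f.preimage_mono h) (f.app U r) :=
  congr($(f.naturality (homOfLE h).op) r)

lemma app_res_top {Y Z : Scheme.{u}} (f : Y ⟶ Z) (V : Z.Opens) (r : Γ(Z, ⊤)) :
    f.app V (res le_top r) = res le_top (f.appTop r) :=
  app_res f le_top r

section Adjoint

variable {Y Z : Scheme.{u}} {f : Y ⟶ Z} {M : Z.Modules} {N : Y.Modules}

/-- The maps on sections given by a morphism to a direct image. -/
def adjSec (φ : M ⟶ (Scheme.Modules.pushforward f).obj N) (V : Z.Opens) :
    Γ(M, V) →+ Γ(N, f ⁻¹ᵁ V) :=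
  (φ.app V).hom

lemma adjSec_smul (φ : M ⟶ (Scheme.Modules.pushforward f).obj N) (V : Z.Opens) (r : Γ(Z, V))
    (x : Γ(M, V)) : adjSec φ V (r • x) = f.app V r • adjSec φ V x :=
  φ.app_smul r x

lemma adjSec_sres (φ : M ⟶ (Scheme.Modules.pushforward f).obj N) {U V : Z.Opens} (h : V ≤ U)
    (x : Γ(M, U)) : adjSec φ V (sres M h x) = sres N (f.preimage_mono h) (adjSec φ U x) :=
  app_sres φ h x

/-- A morphism to a direct image, from its action on sections. -/
def adjMk (φ : ∀ V, Γ(M, V) →+ Γ(N, f ⁻¹ᵁ V))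
    (h : ∀ V (r : Γ(Z, V)) (x : Γ(M, V)), φ V (r • x) = f.app V r • φ V x)
    (h' : ∀ (U V : Z.Opens) (h : V ≤ U) (x : Γ(M, U)),
      φ V (sres M h x) = sres N (f.preimage_mono h) (φ U x)) :
    M ⟶ (Scheme.Modules.pushforward f).obj N :=
  homMk φ h fun U V i x => h' V U i.le x

lemma adjSec_comp {M' : Z.Modules} {N' : Y.Modules}
    {φ : M ⟶ (Scheme.Modules.pushforward f).obj N}
    {φ' : M' ⟶ (Scheme.Modules.pushforward f).obj N'} {a : M ⟶ M'} {b : N ⟶ N'} :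
    φ ≫ (Scheme.Modules.pushforward f).map b = a ≫ φ' ↔
      ∀ V x, b.app _ (adjSec φ V x) = adjSec φ' V (a.app V x) :=
  ⟨fun h V x => congr(($h).app V x), fun h => hom_ext' h⟩

end Adjoint

section Direct

variable {k : Type u} [Field k] {S : Scheme.{u}} (p : S ⟶ Spec (CommRingCat.of k))

/-- Sections of a module on `S_A` form an `A`-module. -/
instance secModule (M : (timesA p).Modules) (W : (timesA p).Opens) : Module k[X] Γ(M, W) :=
  Module.compHom Γ(M, W) ((res (le_top : W ≤ ⊤)).comp (coeffA p))

variable {p}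

lemma sec_smul {M : (timesA p).Modules} {W : (timesA p).Opens} (a : k[X]) (x : Γ(M, W)) :
    a • x = res (le_top : W ≤ ⊤) (coeffA p a) • x := rfl

lemma sres_sec_smul (M : (timesA p).Modules) {V W : (timesA p).Opens} (h : V ≤ W) (a : k[X])
    (x : Γ(M, W)) : sres M h (a • x) = a • sres M h x := by
  rw [sec_smul, sres_smul, res_res, sec_smul]

lemma app_sec_smul {M N : (timesA p).Modules} (φ : M ⟶ N) (W : (timesA p).Opens) (a : k[X])
    (x : Γ(M, W)) : φ.app W (a • x) = a • φ.app W x :=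
  φ.app_smul _ x

/-- The preimage of an open set of `S` in `S_A`. -/
abbrev cyl (p : S ⟶ Spec (CommRingCat.of k)) (U : S.Opens) : (timesA p).Opens := prS p ⁻¹ᵁ U

lemma cyl_mono {U V : S.Opens} (h : V ≤ U) : cyl p V ≤ cyl p U := (prS p).preimage_mono h

/-- The direct image of a module along `S_A ⟶ S`, as a presheaf of `A`-modules. -/
def directPresheaf (M : (timesA p).Modules) : TopCat.Presheaf (ModuleCat.{u} k[X]) S where
  obj U := ModuleCat.of k[X] Γ(M, cyl p U.unop)
  map i := ModuleCat.ofHom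
    { toFun := sres M (cyl_mono i.unop.le)
      map_add' := map_add _
      map_smul' := sres_sec_smul M _ }
  map_id _ := ModuleCat.hom_ext (LinearMap.ext fun x => sres_self M _ x)
  map_comp _ _ := ModuleCat.hom_ext (LinearMap.ext fun x => (sres_sres M _ _ x).symm)

lemma directPresheaf_isSheaf (M : (timesA p).Modules) : (directPresheaf M).IsSheaf := by
  rw [TopCat.Presheaf.isSheaf_iff_isSheaf_comp' (forget₂ (ModuleCat.{u} k[X]) Ab.{u})]
  exact TopCat.Sheaf.pushforward_sheaf_of_sheaf (prS p).base M.isSheaf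

/-- The direct image along `S_A ⟶ S`, as a functor to sheaves of `A`-modules. -/
def direct (p : S ⟶ Spec (CommRingCat.of k)) :
    (timesA p).Modules ⥤ TopCat.Sheaf (ModuleCat.{u} k[X]) S where
  obj M := ⟨directPresheaf M, directPresheaf_isSheaf M⟩
  map φ := ⟨{ app := fun U => ModuleCat.ofHom
                { toFun := φ.app (cyl p U.unop)
                  map_add' := map_add _
                  map_smul' := app_sec_smul φ _ }
              naturality := fun U V i => ModuleCat.hom_ext (LinearMap.ext fun x =>
                app_sres φ (cyl_mono i.unop.le) x) }⟩

instance : (direct p).Additive where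

lemma direct_shortExact [IsAffineHom (prS p)] {T : ShortComplex (timesA p).Modules}
    (hT : T.ShortExact) (h₂ : qcoh _ T.X₂) (h₃ : qcoh _ T.X₃) :
    (T.map (direct p)).ShortExact := by
  have := hT.mono_f
  have := hT.epi_g
  refine ModSheaf.shortExact_of_sections _ (fun U => injective_of_mono T.f _)
    (fun U x hx => (kernel_sections T.zero hT.fIsKernel _).2 x hx) fun U x z hz => ?_
  obtain ⟨V, hV, hz', hVU⟩ := exists_isAffineOpen_mem_and_subset (x := z) (U := U) hz
  obtain ⟨y, hy⟩ := surjective_of_epi h₂ h₃ T.g (hV.preimage (prS p)) (sres _ (cyl_mono hVU) x)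
  exact ⟨V, hVU, y, hz', hy⟩

end Direct

section Phi

variable {k : Type u} [Field k] [Fintype k] {S : Scheme.{u}} {p : S ⟶ Spec (CommRingCat.of k)}

lemma frobA_cyl (U : S.Opens) : frobA p ⁻¹ᵁ cyl p U = cyl p U := by
  rw [← Scheme.Hom.comp_preimage, frobA_prS]
  rfl

/-- The adjoint of the map `j` of a shtuka. -/
def jAdj (N : FrobDiagram (frobPullback p)) :
    N.M ⟶ (Scheme.Modules.pushforward (frobA p)).obj N.M' :=
  (Scheme.Modules.pullbackPushforwardAdjunction (frobA p)).homEquiv _ _ N.j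

lemma jAdj_comp {N N' : FrobDiagram (frobPullback p)} (f : N ⟶ N') :
    jAdj N ≫ (Scheme.Modules.pushforward (frobA p)).map f.f' = f.f ≫ jAdj N' := by
  rw [jAdj, ← Adjunction.homEquiv_naturality_right, f.comm_j, Adjunction.homEquiv_naturality_left]
  rfl

/-- A shtuka, with the map `j` given by its adjoint. -/
abbrev mkShtuka {M M' : (timesA p).Modules} (hM : qcoh _ M) (hM' : qcoh _ M') (σ : M ⟶ M')
    (j : M ⟶ (Scheme.Modules.pushforward (frobA p)).obj M') : Shtuka p where
  obj :=
    { M := M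
      M' := M'
      σ := σ
      j := ((Scheme.Modules.pullbackPushforwardAdjunction (frobA p)).homEquiv _ _).symm j }
  property := ⟨hM, hM'⟩

lemma jAdj_mkShtuka {M M' : (timesA p).Modules} (hM : qcoh _ M) (hM' : qcoh _ M') (σ : M ⟶ M')
    (j : M ⟶ (Scheme.Modules.pushforward (frobA p)).obj M') :
    jAdj (mkShtuka hM hM' σ j).obj = j :=
  Equiv.apply_symm_apply _ _

/-- A morphism of shtukas, with the second compatibility expressed through adjoints. -/
abbrev mkShtukaHom {N N' : Shtuka p} (f : N.obj.M ⟶ N'.obj.M) (f' : N.obj.M' ⟶ N'.obj.M')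
    (h : N.obj.σ ≫ f' = f ≫ N'.obj.σ)
    (hj : jAdj N.obj ≫ (Scheme.Modules.pushforward (frobA p)).map f' = f ≫ jAdj N'.obj) : N ⟶ N' :=
  ObjectProperty.homMk
    { f := f
      f' := f'
      comm_σ := h
      comm_j := by
        apply ((Scheme.Modules.pullbackPushforwardAdjunction (frobA p)).homEquiv _ _).injective
        rw [Adjunction.homEquiv_naturality_right, Adjunction.homEquiv_naturality_left]
        exact hj }

/-- The map on sections over the preimage of `U` induced by `j`. -/
def jSec (N : FrobDiagram (frobPullback p)) (U : S.Opens) :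
    Γ(N.M, cyl p U) →ₗ[k[X]] Γ(N.M', cyl p U) where
  toFun x := sres N.M' (frobA_cyl U).ge (adjSec (jAdj N) (cyl p U) x)
  map_add' x y := by rw [map_add, map_add]
  map_smul' a x := by
    rw [sec_smul, adjSec_smul, app_res_top, frobA_coeffA, sres_smul, res_res]
    rfl

/-- The difference `σ - j` on sections. -/
def phiSec (N : FrobDiagram (frobPullback p)) (U : S.Opens) :
    Γ(N.M, cyl p U) →ₗ[k[X]] Γ(N.M', cyl p U) where
  toFun x := N.σ.app (cyl p U) x - jSec N U x
  map_add' x y := by rw [map_add, map_add]; abel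
  map_smul' a x := by rw [app_sec_smul, map_smul, RingHom.id_apply, smul_sub]

lemma phiSec_apply (N : FrobDiagram (frobPullback p)) (U : S.Opens) (x : Γ(N.M, cyl p U)) :
    phiSec N U x = N.σ.app (cyl p U) x - jSec N U x := rfl

lemma jSec_res (N : FrobDiagram (frobPullback p)) {U V : S.Opens} (h : V ≤ U)
    (x : Γ(N.M, cyl p U)) :
    jSec N V (sres _ (cyl_mono h) x) = sres _ (cyl_mono h) (jSec N U x) := by
  change sres N.M' _ (adjSec _ _ _) = sres N.M' _ (sres N.M' _ _)
  rw [adjSec_sres, sres_sres, sres_sres]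

lemma phiSec_res (N : FrobDiagram (frobPullback p)) {U V : S.Opens} (h : V ≤ U)
    (x : Γ(N.M, cyl p U)) :
    phiSec N V (sres _ (cyl_mono h) x) = sres _ (cyl_mono h) (phiSec N U x) := by
  rw [phiSec_apply, jSec_res N h, app_sres, phiSec_apply, map_sub]

lemma jSec_comp {N N' : FrobDiagram (frobPullback p)} (f : N ⟶ N') (U : S.Opens)
    (x : Γ(N.M, cyl p U)) : f.f'.app _ (jSec N U x) = jSec N' U (f.f.app _ x) := by
  change f.f'.app _ (sres _ _ _) = sres _ _ _
  rw [app_sres, adjSec_comp.1 (jAdj_comp f)]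

lemma phiSec_comp {N N' : FrobDiagram (frobPullback p)} (f : N ⟶ N') (U : S.Opens)
    (x : Γ(N.M, cyl p U)) : f.f'.app _ (phiSec N U x) = phiSec N' U (f.f.app _ x) := by
  rw [phiSec_apply, map_sub, jSec_comp, phiSec_apply]
  exact congrArg (· - _) congr(($(f.comm_σ)).app (cyl p U) x)

/-- The difference `σ - j`, as a morphism of sheaves of `A`-modules on `S`. -/
def phi (N : FrobDiagram (frobPullback p)) : (direct p).obj N.M ⟶ (direct p).obj N.M' :=
  ⟨{ app := fun U => ModuleCat.ofHom (phiSec N U.unop)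
     naturality := fun U V i => ModuleCat.hom_ext (LinearMap.ext fun x =>
      phiSec_res N i.unop.le x) }⟩

lemma phi_comp {N N' : FrobDiagram (frobPullback p)} (f : N ⟶ N') :
    phi N ≫ (direct p).map f.f' = (direct p).map f.f ≫ phi N' :=
  Sheaf.hom_ext (NatTrans.ext (funext fun U => ModuleCat.hom_ext (LinearMap.ext fun x =>
    phiSec_comp f U.unop x)))

end Phi

end
end Carlitz

section FullSubcategory

variable {C : Type u} [Category.{v} C] [Abelian C] (P : ObjectProperty C)
  [P.IsClosedUnderIsomorphisms] [P.IsClosedUnderKernels] [P.IsClosedUnderCokernels]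
  [P.IsClosedUnderFiniteProducts] [P.ContainsZero]

lemma ObjectProperty.preservesFiniteLimits_ι : PreservesFiniteLimits P.ι := by
  have : ∀ {N N' : P.FullSubcategory} (f : N ⟶ N'),
      PreservesLimit (parallelPair f 0) P.ι := by
    intro N N' f
    let e : limit (parallelPair f 0 ⋙ P.ι) ≅ kernel f.hom :=
      HasLimit.isoOfNatIso (diagramIsoParallelPair (parallelPair f 0 ⋙ P.ι))
    have := createsLimitFullSubcategoryInclusion' (P := P) (parallelPair f 0) (limit.isLimit _)
      (P.prop_of_iso e.symm (P.prop_kernel f.hom N.property N'.property))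
    infer_instance
  exact Functor.preservesFiniteLimits_of_preservesKernels _

lemma ObjectProperty.preservesFiniteColimits_ι : PreservesFiniteColimits P.ι := by
  have : ∀ {N N' : P.FullSubcategory} (f : N ⟶ N'),
      PreservesColimit (parallelPair f 0) P.ι := by
    intro N N' f
    let e : colimit (parallelPair f 0 ⋙ P.ι) ≅ cokernel f.hom :=
      HasColimit.isoOfNatIso (diagramIsoParallelPair (parallelPair f 0 ⋙ P.ι))
    have := createsColimitFullSubcategoryInclusion' (P := P) (parallelPair f 0)
      (colimit.isColimit _) (P.prop_of_iso e.symm (P.prop_cokernel f.hom N.property N'.property))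
    infer_instance
  exact Functor.preservesFiniteColimits_of_preservesCokernels _

end FullSubcategory

namespace Carlitz
noncomputable section

open Polynomial QCoh Opposite

variable {k : Type u} [Field k] [Fintype k] {S : Scheme.{u}} {p : S ⟶ Spec (CommRingCat.of k)}

section Exactness

variable (p) in
/-- The first component of a shtuka. -/
abbrev shtFst : Shtuka p ⥤ (timesA p).Modules :=
  (FrobDiagram.qcoh (frobPullback p)).ι ⋙ FrobDiagram.fst _

variable (p) in
/-- The second component of a shtuka. -/
abbrev shtSnd : Shtuka p ⥤ (timesA p).Modules :=
  (FrobDiagram.qcoh (frobPullback p)).ι ⋙ FrobDiagram.snd _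

lemma shortExact_fst {T : ShortComplex (Shtuka p)} (hT : T.ShortExact) :
    (T.map (shtFst p)).ShortExact := by
  have := ObjectProperty.preservesFiniteLimits_ι (FrobDiagram.qcoh (frobPullback p))
  have := ObjectProperty.preservesFiniteColimits_ι (FrobDiagram.qcoh (frobPullback p))
  have : PreservesFiniteLimits (FrobDiagram.fst (frobPullback p)) := ⟨fun _ => inferInstance⟩
  have : PreservesFiniteColimits (FrobDiagram.fst (frobPullback p)) := ⟨fun _ => inferInstance⟩
  have : PreservesFiniteLimits (shtFst p) := comp_preservesFiniteLimits _ _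
  have : PreservesFiniteColimits (shtFst p) := comp_preservesFiniteColimits _ _
  exact hT.map_of_exact (shtFst p)

lemma shortExact_snd {T : ShortComplex (Shtuka p)} (hT : T.ShortExact) :
    (T.map (shtSnd p)).ShortExact := by
  have := ObjectProperty.preservesFiniteLimits_ι (FrobDiagram.qcoh (frobPullback p))
  have := ObjectProperty.preservesFiniteColimits_ι (FrobDiagram.qcoh (frobPullback p))
  have : PreservesFiniteLimits (FrobDiagram.snd (frobPullback p)) := ⟨fun _ => inferInstance⟩
  have : PreservesFiniteColimits (FrobDiagram.snd (frobPullback p)) := ⟨fun _ => inferInstance⟩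
  have : PreservesFiniteLimits (shtSnd p) := comp_preservesFiniteLimits _ _
  have : PreservesFiniteColimits (shtSnd p) := comp_preservesFiniteColimits _ _
  exact hT.map_of_exact (shtSnd p)

lemma shtuka_mono {N N' : Shtuka p} (f : N ⟶ N')
    (h : ∀ W, Function.Injective (f.hom.f.app W)) (h' : ∀ W, Function.Injective (f.hom.f'.app W)) :
    Mono f := by
  have := mono_of_injective _ h
  have := mono_of_injective _ h'
  refine ⟨fun a b hab => ?_⟩
  have h1 : a.hom ≫ f.hom = b.hom ≫ f.hom := congrArg (·.hom) hab
  ext : 2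
  · exact (cancel_mono f.hom.f).1 congr(($h1).f)
  · exact (cancel_mono f.hom.f').1 congr(($h1).f')

end Exactness

section HomUnit

/-- A function, as a section of the structure sheaf. -/
def funSec {Y : Scheme.{u}} {U : Y.Opens} (x : Γ(Y, U)) : Γ(structureSheaf Y, U) := x

lemma smul_funSec {Y : Scheme.{u}} {U : Y.Opens} (a x : Γ(Y, U)) :
    a • funSec x = funSec (a * x) := rfl

lemma sres_funSec {Y : Scheme.{u}} {U V : Y.Opens} (h : V ≤ U) (x : Γ(Y, U)) :
    sres _ h (funSec x) = funSec (res h x) := rfl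

lemma ofSection_funSec {Y : Scheme.{u}} (M : Y.Modules) (x : Γ(M, ⊤)) (U : Y.Opens) (a : Γ(Y, U)) :
    (ofSection M x).app U (funSec a) = a • sres M le_top x := rfl

lemma ofSection_one {Y : Scheme.{u}} (M : Y.Modules) (x : Γ(M, ⊤)) :
    (ofSection M x).app ⊤ (funSec 1) = x := by
  rw [ofSection_funSec, one_smul, sres_self]

lemma ofSection_ext {Y : Scheme.{u}} {M : Y.Modules} {f g : structureSheaf Y ⟶ M}
    (h : f.app ⊤ (funSec 1) = g.app ⊤ (funSec 1)) : f = g := by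
  refine hom_ext' fun U (x : Γ(Y, U)) => ?_
  have key : ∀ f : structureSheaf Y ⟶ M,
      f.app U (funSec x) = x • sres M (le_top : U ≤ ⊤) (f.app ⊤ (funSec 1)) := by
    intro f
    rw [← app_sres, ← f.app_smul, sres_funSec, smul_funSec, map_one, mul_one]
  exact (key f).trans ((congrArg _ (congrArg _ h)).trans (key g).symm)

lemma jAdj_unit : jAdj (unitShtuka p).obj =
    ofSection ((Scheme.Modules.pushforward (frobA p)).obj (structureSheaf (timesA p)))
      (1 : Γ(timesA p, ⊤)) :=
  Equiv.apply_symm_apply _ _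

lemma jSec_top (N : FrobDiagram (frobPullback p)) (x : Γ(N.M, cyl p ⊤)) :
    jSec N ⊤ x = adjSec (jAdj N) ⊤ x :=
  sres_self N.M' _ _

lemma jSec_unit : jSec (unitShtuka p).obj ⊤ (funSec 1) = funSec 1 := by
  refine (jSec_top (unitShtuka p).obj _).trans ?_
  refine Eq.trans ?_ (ofSection_one ((Scheme.Modules.pushforward (frobA p)).obj
    (structureSheaf (timesA p))) (1 : Γ(timesA p, ⊤)))
  rw [← jAdj_unit]
  rfl

/-- Morphisms from the unit shtuka are global sections killed by `σ - j`. -/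
def homUnit (N : Shtuka p) :
    (unitShtuka p ⟶ N) ≃ₗ[k[X]] LinearMap.ker (phiSec N.obj ⊤) where
  toFun f := ⟨f.hom.f.app ⊤ (funSec 1), by
    have h := phiSec_comp f.hom ⊤ (funSec 1)
    rw [phiSec_apply] at h
    refine h.symm.trans ?_
    refine (congrArg (f.hom.f'.app ⊤) ?_).trans (map_zero _)
    exact sub_eq_zero.2 jSec_unit.symm⟩
  map_add' f g := rfl
  map_smul' a f := Subtype.ext (by
    refine Eq.trans ?_ (app_sec_smul f.hom.f ⊤ a (funSec 1))
    rfl)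
  invFun x := mkShtukaHom (ofSection _ x.1) (ofSection _ (N.obj.σ.app ⊤ x.1))
    (by
      refine (Category.id_comp _).trans (ofSection_ext ?_)
      rw [ofSection_one]
      exact (congrArg (N.obj.σ.app ⊤) (ofSection_one N.obj.M x.1)).symm)
    (by
      refine ofSection_ext ?_
      have h1 : N.obj.σ.app ⊤ x.1 = jSec N.obj ⊤ x.1 := sub_eq_zero.1 x.2
      rw [jSec_top] at h1
      have h2 : adjSec (jAdj N.obj) ⊤ ((ofSection _ x.1).app ⊤ (funSec 1)) =
          adjSec (jAdj N.obj) ⊤ x.1 := congrArg _ (ofSection_one N.obj.M x.1)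
      refine Eq.trans ?_ (h1.trans h2.symm)
      refine Eq.trans ?_ (ofSection_one N.obj.M' (N.obj.σ.app ⊤ x.1))
      refine congrArg ((ofSection N.obj.M' (N.obj.σ.app ⊤ x.1)).app ⊤) ?_
      exact (jSec_top _ _).symm.trans jSec_unit)
  left_inv f := by
    ext : 2
    · exact ofSection_ext (ofSection_one _ _)
    · refine ofSection_ext ((ofSection_one _ _).trans ?_)
      exact congr(($(f.hom.comm_σ)).app ⊤ (funSec 1)).symm
  right_inv x := Subtype.ext (ofSection_one _ _)

lemma homUnit_comp {N N' : Shtuka p} (f : unitShtuka p ⟶ N) (g : N ⟶ N') :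
    (homUnit N' (f ≫ g) : Γ(N'.obj.M, cyl p ⊤)) = g.hom.f.app _ (homUnit N f).1 := rfl

end HomUnit

end
end Carlitz

namespace Carlitz
noncomputable section

open Polynomial QCoh Opposite

lemma prop_biprod {Y : Scheme.{u}} {M N : Y.Modules} (hM : qcoh Y M) (hN : qcoh Y N) :
    qcoh Y (M ⊞ N) :=
  (qcoh Y).prop_of_isLimit (BinaryBiproduct.isLimit M N) (by rintro ⟨_ | _⟩ <;> assumption)

lemma biprod_section {Y : Scheme.{u}} {M N : Y.Modules} {W : Y.Opens} (x : Γ(M ⊞ N, W)) :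
    (biprod.inl : M ⟶ M ⊞ N).app W ((biprod.fst : M ⊞ N ⟶ M).app W x) +
      (biprod.inr : N ⟶ M ⊞ N).app W ((biprod.snd : M ⊞ N ⟶ N).app W x) = x :=
  congr(($(biprod.total (X := M) (Y := N))).app W x)

lemma fst_inl {Y : Scheme.{u}} {M N : Y.Modules} {W : Y.Opens} (x : Γ(M, W)) :
    (biprod.fst : M ⊞ N ⟶ M).app W ((biprod.inl : M ⟶ M ⊞ N).app W x) = x :=
  congr(($(biprod.inl_fst (X := M) (Y := N))).app W x)

lemma fst_inr {Y : Scheme.{u}} {M N : Y.Modules} {W : Y.Opens} (x : Γ(N, W)) :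
    (biprod.fst : M ⊞ N ⟶ M).app W ((biprod.inr : N ⟶ M ⊞ N).app W x) = 0 :=
  congr(($(biprod.inr_fst (X := M) (Y := N))).app W x)

lemma snd_inl {Y : Scheme.{u}} {M N : Y.Modules} {W : Y.Opens} (x : Γ(M, W)) :
    (biprod.snd : M ⊞ N ⟶ N).app W ((biprod.inl : M ⟶ M ⊞ N).app W x) = 0 :=
  congr(($(biprod.inl_snd (X := M) (Y := N))).app W x)

lemma snd_inr {Y : Scheme.{u}} {M N : Y.Modules} {W : Y.Opens} (x : Γ(N, W)) :
    (biprod.snd : M ⊞ N ⟶ N).app W ((biprod.inr : N ⟶ M ⊞ N).app W x) = x :=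
  congr(($(biprod.inr_snd (X := M) (Y := N))).app W x)

variable {k : Type u} [Field k] [Fintype k] {S : Scheme.{u}} {p : S ⟶ Spec (CommRingCat.of k)}

section Hull

/-- The shtuka `[M ⊕ M' ⟶ M' ⟵ τ^*(M ⊕ M')]` with maps `(σ, 1)` and `(j, 0)`. -/
def hull (N : Shtuka p) : Shtuka p :=
  mkShtuka (prop_biprod N.property.1 N.property.2) N.property.2
    (biprod.desc N.obj.σ (𝟙 _)) (biprod.fst ≫ jAdj N.obj)

lemma jAdj_hull (N : Shtuka p) : jAdj (hull N).obj =
    (biprod.fst : N.obj.M ⊞ N.obj.M' ⟶ _) ≫ jAdj N.obj :=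
  jAdj_mkShtuka (prop_biprod N.property.1 N.property.2) N.property.2 _ _

lemma jSec_hull (N : Shtuka p) (U : S.Opens) (x : Γ(N.obj.M ⊞ N.obj.M', cyl p U)) :
    jSec (hull N).obj U x = jSec N.obj U ((biprod.fst : N.obj.M ⊞ N.obj.M' ⟶ _).app _ x) := by
  exact congrArg (fun φ => sres N.obj.M' (frobA_cyl U).ge (adjSec φ (cyl p U) x)) (jAdj_hull N)

lemma phiSec_hull (N : Shtuka p) (U : S.Opens) (x : Γ(N.obj.M ⊞ N.obj.M', cyl p U)) :
    phiSec (hull N).obj U x = phiSec N.obj U ((biprod.fst : N.obj.M ⊞ N.obj.M' ⟶ _).app _ x) +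
      (biprod.snd : N.obj.M ⊞ N.obj.M' ⟶ _).app _ x := by
  refine (phiSec_apply (hull N).obj U x).trans ?_
  rw [jSec_hull, phiSec_apply]
  have : (biprod.desc N.obj.σ (𝟙 _)).app (cyl p U) x =
      N.obj.σ.app _ ((biprod.fst : N.obj.M ⊞ N.obj.M' ⟶ _).app _ x) +
      (biprod.snd : N.obj.M ⊞ N.obj.M' ⟶ _).app _ x := by
    refine congr(($(biprod.desc_eq (f := N.obj.σ) (g := 𝟙 N.obj.M'))).app (cyl p U) x)
  refine (congrArg (· - _) this).trans ?_
  exact add_sub_right_comm _ _ _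

lemma phiSec_hull_surjective (N : Shtuka p) (U : S.Opens) :
    Function.Surjective (phiSec (hull N).obj U) := fun (y : Γ(N.obj.M', cyl p U)) => by
  refine ⟨(biprod.inr : _ ⟶ N.obj.M ⊞ N.obj.M').app _ y, (phiSec_hull N U _).trans ?_⟩
  rw [fst_inr, snd_inr, map_zero, zero_add]

/-- The embedding of a shtuka in its hull. -/
def toHull (N : Shtuka p) : N ⟶ hull N :=
  mkShtukaHom (N' := hull N) (biprod.inl : _ ⟶ N.obj.M ⊞ N.obj.M') (𝟙 _)
    (by
      refine (Category.comp_id _).trans ?_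
      exact (biprod.inl_desc _ _).symm)
    (by
      refine Eq.trans ?_ (congrArg (biprod.inl ≫ ·) (jAdj_hull N)).symm
      refine Eq.trans ?_ (biprod.inl_fst_assoc _).symm
      exact (congrArg (jAdj N.obj ≫ ·) ((Scheme.Modules.pushforward (frobA p)).map_id
        N.obj.M')).trans (Category.comp_id _))

instance (N : Shtuka p) : Mono (toHull N) :=
  shtuka_mono _ (fun W => injective_of_mono (biprod.inl : _ ⟶ N.obj.M ⊞ N.obj.M') W)
    fun W => injective_of_mono (𝟙 N.obj.M') W

end Hull

section Loc

variable {V : (timesA p).Opens}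

lemma loc_frobA_le (hV : frobA p ⁻¹ᵁ V = V) (W : (timesA p).Opens) :
    V.ι ''ᵁ V.ι ⁻¹ᵁ (frobA p ⁻¹ᵁ W) ≤ frobA p ⁻¹ᵁ (V.ι ''ᵁ V.ι ⁻¹ᵁ W) := by
  intro z hz
  have h1 : z ∈ frobA p ⁻¹ᵁ V := hV.ge (loc_le_left V _ hz)
  exact le_loc (O := V ⊓ W) inf_le_left inf_le_right ⟨h1, loc_le_right V (frobA p ⁻¹ᵁ W) hz⟩

/-- The shtuka of sections over a `τ_A`-stable open set. -/
def locShtuka [IsAffineHom V.ι] (hV : frobA p ⁻¹ᵁ V = V) (N : Shtuka p) : Shtuka p :=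
  mkShtuka (M := (loc V).obj N.obj.M) (M' := (loc V).obj N.obj.M') (loc_qcoh N.property.1)
    (loc_qcoh N.property.2) ((loc V).map N.obj.σ)
    (adjMk (fun W => (sres N.obj.M' (loc_frobA_le hV W)).comp
        (adjSec (jAdj N.obj) (V.ι ''ᵁ V.ι ⁻¹ᵁ W)))
      (fun W r x => by
        let y : Γ(N.obj.M, V.ι ''ᵁ V.ι ⁻¹ᵁ W) := x
        refine (congrArg (fun z => sres N.obj.M' (loc_frobA_le hV W)
          (adjSec (jAdj N.obj) (V.ι ''ᵁ V.ι ⁻¹ᵁ W) z)) (loc_smul V _ W r y)).trans ?_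
        dsimp only
        rw [adjSec_smul, sres_smul, app_res, res_res]
        refine Eq.trans ?_ (loc_smul V _ (frobA p ⁻¹ᵁ W) ((frobA p).app W r) _).symm
        rfl)
      (fun U W h x => by
        let y : Γ(N.obj.M, V.ι ''ᵁ V.ι ⁻¹ᵁ U) := x
        have hUW : V.ι ''ᵁ V.ι ⁻¹ᵁ W ≤ V.ι ''ᵁ V.ι ⁻¹ᵁ U :=
          le_loc (loc_le_left _ _) ((loc_le_right _ _).trans h)
        refine (congrArg (sres N.obj.M' (loc_frobA_le hV W)) (adjSec_sres (jAdj N.obj) hUW y)).trans ?_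
        rw [sres_sres]
        exact (sres_sres N.obj.M' (loc_frobA_le hV U) (le_loc (loc_le_left _ _)
          ((loc_le_right _ _).trans ((frobA p).preimage_mono h))) _).symm))

/-- Restriction to a stable open set, as a morphism of shtukas. -/
def toLocShtuka [IsAffineHom V.ι] (hV : frobA p ⁻¹ᵁ V = V) (N : Shtuka p) : N ⟶ locShtuka hV N :=
  mkShtukaHom (N' := locShtuka hV N) (toLoc V N.obj.M) (toLoc V N.obj.M')
    ((Scheme.Modules.restrictAdjunction V.ι).unit.naturality N.obj.σ)
    (by
      rw [show jAdj (locShtuka hV N).obj = _ from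
        jAdj_mkShtuka (loc_qcoh N.property.1) (loc_qcoh N.property.2) _ _]
      refine adjSec_comp.2 fun W x => ?_
      refine (toLoc_app V N.obj.M' (frobA p ⁻¹ᵁ W) _).trans ?_
      change _ = sres N.obj.M' (loc_frobA_le hV W) (adjSec (jAdj N.obj) (V.ι ''ᵁ V.ι ⁻¹ᵁ W) _)
      refine Eq.trans ?_ (congrArg (fun z => sres N.obj.M' (loc_frobA_le hV W)
          (adjSec (jAdj N.obj) (V.ι ''ᵁ V.ι ⁻¹ᵁ W) z)) (toLoc_app V N.obj.M W x).symm)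
      rw [adjSec_sres, sres_sres])

end Loc

section Vanishing

variable (V₁ V₂ : (timesA p).Opens)

/-- A class of shtukas without higher extensions by the unit shtuka. -/
def Acyclic : ObjectProperty (Shtuka p) := fun N =>
  Cech V₁ V₂ N.obj.M ∧ Cech V₁ V₂ N.obj.M' ∧ Function.Surjective (phiSec N.obj ⊤)

variable {V₁ V₂}

lemma acyclic_hull {N : Shtuka p} (h : Cech V₁ V₂ N.obj.M) (h' : Cech V₁ V₂ N.obj.M') :
    Acyclic V₁ V₂ (hull N) :=
  ⟨h.of_sum h' _ _ _ _ biprod.total, h', phiSec_hull_surjective N ⊤⟩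

lemma surjective_fst (hV₁ : IsAffineOpen V₁) (hV₂ : IsAffineOpen V₂)
    (hV : V₁ ⊔ V₂ = ⊤) {T : ShortComplex (Shtuka p)} (hT : T.ShortExact)
    (h : Cech V₁ V₂ T.X₁.obj.M) : Function.Surjective (T.g.hom.f.app ⊤) :=
  have : Epi T.g.hom.f := (shortExact_fst hT).epi_g
  surjective_of_cech hV hV₁ hV₂ T.X₂.property.1 T.X₃.property.1 _ (shortExact_fst hT).fIsKernel h

lemma surjective_snd (hV₁ : IsAffineOpen V₁) (hV₂ : IsAffineOpen V₂)
    (hV : V₁ ⊔ V₂ = ⊤) {T : ShortComplex (Shtuka p)} (hT : T.ShortExact)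
    (h : Cech V₁ V₂ T.X₁.obj.M') : Function.Surjective (T.g.hom.f'.app ⊤) :=
  have : Epi T.g.hom.f' := (shortExact_snd hT).epi_g
  surjective_of_cech hV hV₁ hV₂ T.X₂.property.2 T.X₃.property.2 _ (shortExact_snd hT).fIsKernel h

lemma exists_lift_of_acyclic (hV₁ : IsAffineOpen V₁) (hV₂ : IsAffineOpen V₂)
    (hV : V₁ ⊔ V₂ = ⊤) {T : ShortComplex (Shtuka p)} (hT : T.ShortExact)
    (h : Acyclic V₁ V₂ T.X₁) (f : unitShtuka p ⟶ T.X₃) : ∃ g, g ≫ T.g = f := by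
  obtain ⟨y, hy⟩ := surjective_fst hV₁ hV₂ hV hT h.1 (homUnit _ f).1
  have hy' : T.g.hom.f'.app ⊤ (phiSec T.X₂.obj ⊤ y) = 0 :=
    (phiSec_comp T.g.hom ⊤ y).trans ((congrArg (phiSec T.X₃.obj ⊤) hy).trans (homUnit _ f).2)
  obtain ⟨z, hz⟩ := (kernel_sections _ (shortExact_snd hT).fIsKernel ⊤).2 (phiSec T.X₂.obj ⊤ y) hy'
  obtain ⟨n, rfl⟩ := h.2.2 z
  have hw : T.g.hom.f.app ⊤ (T.f.hom.f.app ⊤ n) = 0 :=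
    congr(($(T.zero)).hom.f.app ⊤ n)
  refine ⟨(homUnit _).symm ⟨y - T.f.hom.f.app ⊤ n, ?_⟩, (homUnit _).injective (Subtype.ext ?_)⟩
  · exact (map_sub (phiSec T.X₂.obj ⊤) _ _).trans
      (sub_eq_zero.2 (hz.symm.trans (phiSec_comp T.f.hom ⊤ n)))
  · rw [homUnit_comp, LinearEquiv.apply_symm_apply]
    refine (map_sub (T.g.hom.f.app ⊤).hom _ _).trans ?_
    exact (congrArg₂ (· - ·) hy hw).trans (sub_zero _)

lemma Acyclic.of_shortExact (hV₁ : IsAffineOpen V₁) (hV₂ : IsAffineOpen V₂)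
    (hV₁₂ : IsAffineOpen (V₁ ⊓ V₂)) (hV : V₁ ⊔ V₂ = ⊤) {T : ShortComplex (Shtuka p)} (hT : T.ShortExact)
    (h₁ : Acyclic V₁ V₂ T.X₁) (h₂ : Acyclic V₁ V₂ T.X₂) : Acyclic V₁ V₂ T.X₃ := by
  have h1 : Epi T.g.hom.f := (shortExact_fst hT).epi_g
  have h2 : Epi T.g.hom.f' := (shortExact_snd hT).epi_g
  refine ⟨h₂.1.of_epi T.g.hom.f (QCoh.surjective_of_epi T.X₂.property.1 T.X₃.property.1 _ hV₁₂),
    h₂.2.1.of_epi T.g.hom.f' (QCoh.surjective_of_epi T.X₂.property.2 T.X₃.property.2 _ hV₁₂),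
    fun y => ?_⟩
  obtain ⟨z, rfl⟩ := surjective_snd hV₁ hV₂ hV hT h₁.2.1 y
  obtain ⟨x, rfl⟩ := h₂.2.2 z
  exact ⟨T.g.hom.f.app _ x, (phiSec_comp T.g.hom ⊤ x).symm⟩

lemma exists_acyclic (hV : V₁ ⊔ V₂ = ⊤) [IsAffineHom V₁.ι] [IsAffineHom V₂.ι]
    (h₁ : frobA p ⁻¹ᵁ V₁ = V₁)
    (h₂ : frobA p ⁻¹ᵁ V₂ = V₂) (N : Shtuka p) :
    ∃ (N' : Shtuka p) (i : N ⟶ N'), Mono i ∧ Acyclic V₁ V₂ N' := by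
  let L := locShtuka h₁ N ⊞ locShtuka h₂ N
  let i : N ⟶ L := biprod.lift (toLocShtuka h₁ N) (toLocShtuka h₂ N)
  have hi₁ : i ≫ biprod.fst = toLocShtuka h₁ N := biprod.lift_fst _ _
  have hi₂ : i ≫ biprod.snd = toLocShtuka h₂ N := biprod.lift_snd _ _
  have hi : Mono i := by
    refine shtuka_mono i (fun W => ?_) fun W => ?_
    · refine (injective_iff_map_eq_zero (i.hom.f.app W).hom).2 fun x hx => ?_
      refine toLoc_injective hV N.obj.M W x ?_ ?_
      · refine congr(($hi₁).hom.f.app W x).symm.trans ?_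
        exact (congrArg ((biprod.fst : L ⟶ _).hom.f.app W) hx).trans (map_zero _)
      · refine congr(($hi₂).hom.f.app W x).symm.trans ?_
        exact (congrArg ((biprod.snd : L ⟶ _).hom.f.app W) hx).trans (map_zero _)
    · refine (injective_iff_map_eq_zero (i.hom.f'.app W).hom).2 fun x hx => ?_
      refine toLoc_injective hV N.obj.M' W x ?_ ?_
      · refine congr(($hi₁).hom.f'.app W x).symm.trans ?_
        exact (congrArg ((biprod.fst : L ⟶ _).hom.f'.app W) hx).trans (map_zero _)
      · refine congr(($hi₂).hom.f'.app W x).symm.trans ?_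
        exact (congrArg ((biprod.snd : L ⟶ _).hom.f'.app W) hx).trans (map_zero _)
  have hL := biprod.total (X := locShtuka h₁ N) (Y := locShtuka h₂ N)
  refine ⟨hull L, i ≫ toHull L, mono_comp _ _, acyclic_hull ?_ ?_⟩
  · exact (cech_loc_left V₁ V₂ N.obj.M).of_sum (cech_loc_right V₁ V₂ N.obj.M)
      (biprod.fst : L ⟶ _).hom.f (biprod.snd : L ⟶ _).hom.f (biprod.inl : _ ⟶ L).hom.f
      (biprod.inr : _ ⟶ L).hom.f congr(($hL).hom.f)
  · exact (cech_loc_left V₁ V₂ N.obj.M').of_sum (cech_loc_right V₁ V₂ N.obj.M')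
      (biprod.fst : L ⟶ _).hom.f' (biprod.snd : L ⟶ _).hom.f' (biprod.inl : _ ⟶ L).hom.f'
      (biprod.inr : _ ⟶ L).hom.f' congr(($hL).hom.f')

attribute [local instance] CategoryTheory.HasExt.standard

lemma Acyclic.subsingleton_ext (hV₁ : IsAffineOpen V₁) (hV₂ : IsAffineOpen V₂)
    (hV₁₂ : IsAffineOpen (V₁ ⊓ V₂)) (hV : V₁ ⊔ V₂ = ⊤) [IsAffineHom V₁.ι] [IsAffineHom V₂.ι]
    (h₁ : frobA p ⁻¹ᵁ V₁ = V₁)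
    (h₂ : frobA p ⁻¹ᵁ V₂ = V₂) {N : Shtuka p} (hN : Acyclic V₁ V₂ N) (n : ℕ) :
    Subsingleton (Shtuka.Ext (unitShtuka p) N (n + 1)) :=
  Abelian.Ext.subsingleton_of_class (unitShtuka p) (Acyclic V₁ V₂)
    (fun _ hT h f => exists_lift_of_acyclic hV₁ hV₂ hV hT h f)
    (fun E => exists_acyclic hV h₁ h₂ E)
    (fun _ hT h h' => h.of_shortExact hV₁ hV₂ hV₁₂ hV hT h') n N hN

end Vanishing

end
end Carlitz

section Snake

variable {A : Type u} [Category.{v} A] [Abelian A]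

lemma CategoryTheory.ShortComplex.SnakeInput.exists_shortExact (S : ShortComplex.SnakeInput A)
    [_inst : Epi S.L₂.g] {C : A} (ψ : S.L₂.X₁ ⟶ C) (w : S.v₁₂.τ₁ ≫ ψ = 0)
    (hψ : (ShortComplex.mk S.v₁₂.τ₁ ψ w).ShortExact) (hv : Epi S.v₁₂.τ₂) :
    ∃ (F G : A) (i : F ⟶ S.L₁.X₂) (j : G ⟶ S.L₁.X₃) (g : F ⟶ G) (δ : G ⟶ C)
      (hi : i ≫ S.v₁₂.τ₂ = 0) (hj : j ≫ S.v₁₂.τ₃ = 0) (hg : g ≫ δ = 0), i ≫ S.L₁.g = g ≫ j ∧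
      (ShortComplex.mk i S.v₁₂.τ₂ hi).ShortExact ∧ (ShortComplex.mk j S.v₁₂.τ₃ hj).ShortExact ∧
      (ShortComplex.mk g δ hg).ShortExact := by
  have hm : Mono S.v₁₂.τ₁ := hψ.mono_f
  have hL₁ : IsZero S.L₀.X₁ := by
    rw [IsZero.iff_id_eq_zero, ← cancel_mono S.v₀₁.τ₁, ← cancel_mono S.v₁₂.τ₁]
    simp
  have hL₂ : IsZero S.L₃.X₂ := by
    rw [IsZero.iff_id_eq_zero, ← cancel_epi S.v₂₃.τ₂, ← cancel_epi S.v₁₂.τ₂]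
    simp
  have hv₃ : Epi S.v₁₂.τ₃ := by
    have : Epi (S.L₁.g ≫ S.v₁₂.τ₃) := by
      rw [← S.v₁₂.comm₂₃]
      exact epi_comp _ _
    exact epi_of_epi S.L₁.g _
  have hm₀ : Mono S.L₀.g := S.L₀_exact.mono_g (hL₁.eq_of_src _ _)
  have he : Epi S.δ := S.L₂'_exact.epi_f (hL₂.eq_of_tgt _ _)
  let e : S.L₃.X₁ ≅ C := IsColimit.coconePointUniqueUpToIso S.h₃τ₁ hψ.gIsCokernel
  have hδ : S.L₀.g ≫ S.δ ≫ e.hom = 0 := by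
    rw [← Category.assoc]
    exact (congrArg (· ≫ e.hom) S.L₁'.zero).trans zero_comp
  refine ⟨S.L₀.X₂, S.L₀.X₃, S.v₀₁.τ₂, S.v₀₁.τ₃, S.L₀.g, S.δ ≫ e.hom, S.w₀₂_τ₂, S.w₀₂_τ₃, hδ,
    S.v₀₁.comm₂₃, { exact := S.exact_C₂_up }, { exact := S.exact_C₃_up }, ?_⟩
  have h : (ShortComplex.mk S.L₀.g S.δ S.L₁'.zero).ShortExact := { exact := S.L₁'_exact }
  exact ShortComplex.shortExact_of_iso (ShortComplex.isoMk
    (S₁ := ShortComplex.mk S.L₀.g S.δ S.L₁'.zero) (Iso.refl _) (Iso.refl _) e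
    ((Category.id_comp _).trans (Category.comp_id _).symm) (Category.id_comp _)) h

/-- The snake lemma for a morphism of short exact sequences which is a monomorphism with known
cokernel on the left and an epimorphism in the middle. -/
lemma exists_snake {L₁ L₂ : ShortComplex A} (h₁ : L₁.ShortExact) (h₂ : L₂.ShortExact)
    (v : L₁ ⟶ L₂) {C : A} (ψ : L₂.X₁ ⟶ C) (w : v.τ₁ ≫ ψ = 0)
    (hψ : (ShortComplex.mk v.τ₁ ψ w).ShortExact) (hv : Epi v.τ₂) :
    ∃ (F G : A) (i : F ⟶ L₁.X₂) (j : G ⟶ L₁.X₃) (g : F ⟶ G) (δ : G ⟶ C) (hi : i ≫ v.τ₂ = 0)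
      (hj : j ≫ v.τ₃ = 0) (hg : g ≫ δ = 0), i ≫ L₁.g = g ≫ j ∧
      (ShortComplex.mk i v.τ₂ hi).ShortExact ∧ (ShortComplex.mk j v.τ₃ hj).ShortExact ∧
      (ShortComplex.mk g δ hg).ShortExact :=
  ShortComplex.SnakeInput.exists_shortExact
    { L₀ := kernel v
      L₁ := L₁
      L₂ := L₂
      L₃ := cokernel v
      v₀₁ := kernel.ι v
      v₁₂ := v
      v₂₃ := cokernel.π v
      w₀₂ := kernel.condition v
      w₁₃ := cokernel.condition v
      h₀ := kernelIsKernel v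
      h₃ := cokernelIsCokernel v
      L₁_exact := h₁.exact
      epi_L₁_g := h₁.epi_g
      L₂_exact := h₂.exact
      mono_L₂_f := h₂.mono_f } (_inst := h₂.epi_g) ψ w hψ hv

end Snake

namespace CategoryTheory.Abelian.Ext

variable {C : Type u} [Category.{v} C] [Abelian C] [HasExt.{w} C] {R : Type*} [CommRing R]
  [Linear R C]

/-- A short exact sequence whose first term has no extensions in two consecutive degrees gives an
isomorphism. -/
noncomputable def quotientEquiv (P : C) {S : ShortComplex C} (hS : S.ShortExact) (n : ℕ)
    (h : Subsingleton (Ext P S.X₁ n)) (h' : Subsingleton (Ext P S.X₁ (n + 1))) :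
    Ext P S.X₂ n ≃ₗ[R] Ext P S.X₃ n :=
  LinearEquiv.ofBijective
    { toFun := fun x => x.comp (mk₀ S.g) (add_zero n)
      map_add' := fun _ _ => add_comp _ _ _ _
      map_smul' := fun _ _ => smul_comp _ _ _ _ } ⟨by
    rw [injective_iff_map_eq_zero]
    intro x hx
    obtain ⟨y, rfl⟩ := covariant_sequence_exact₂ P hS x hx
    rw [Subsingleton.elim y 0, zero_comp], fun x => by
    obtain ⟨y, rfl⟩ := covariant_sequence_exact₃ P hS x rfl (Subsingleton.elim _ _)
    exact ⟨y, rfl⟩⟩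

end CategoryTheory.Abelian.Ext

namespace Carlitz
noncomputable section

open Polynomial QCoh Opposite ModSheaf Abelian

attribute [local instance] CategoryTheory.HasExt.standard

variable {k : Type u} [Field k] {S : Scheme.{u}} {p : S ⟶ Spec (CommRingCat.of k)}

lemma cech_of_flasque {M : (timesA p).Modules} (h : Flasque ((direct p).obj M)) (U₁ U₂ : S.Opens) :
    Cech (cyl p U₁) (cyl p U₂) M := by
  intro y
  obtain ⟨a, ha⟩ := h (inf_le_left : U₁ ⊓ U₂ ≤ U₁) y
  refine ⟨a, 0, ?_⟩
  rw [map_zero, sub_zero]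
  exact ha.symm

lemma flasque_biprod {M N : (timesA p).Modules} (hM : Flasque ((direct p).obj M))
    (hN : Flasque ((direct p).obj N)) : Flasque ((direct p).obj (M ⊞ N)) := by
  intro V U h (x : Γ(M ⊞ N, cyl p V))
  obtain ⟨a, ha⟩ := hM h ((biprod.fst : M ⊞ N ⟶ M).app _ x)
  obtain ⟨b, hb⟩ := hN h ((biprod.snd : M ⊞ N ⟶ N).app _ x)
  change Γ(M, cyl p U) at a
  change Γ(N, cyl p U) at b
  change sres M (cyl_mono h) a = _ at ha
  change sres N (cyl_mono h) b = _ at hb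
  refine ⟨(biprod.inl : M ⟶ M ⊞ N).app _ a + (biprod.inr : N ⟶ M ⊞ N).app _ b, ?_⟩
  refine (map_add (sres (M ⊞ N) (cyl_mono h)) _ _).trans ?_
  rw [← app_sres, ← app_sres, ha, hb, biprod_section]

variable [Fintype k]

/-- The section of the hull killed by `σ - j` with a given first component. -/
def hullLift (K : Shtuka p) (U : S.Opens) (z : Γ(K.obj.M, cyl p U)) :
    Γ(K.obj.M ⊞ K.obj.M', cyl p U) :=
  (biprod.inl : _ ⟶ K.obj.M ⊞ K.obj.M').app _ z -
    (biprod.inr : _ ⟶ K.obj.M ⊞ K.obj.M').app _ (phiSec K.obj U z)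

lemma phiSec_hullLift (K : Shtuka p) (U : S.Opens) (z : Γ(K.obj.M, cyl p U)) :
    phiSec (hull K).obj U (hullLift K U z) = 0 := by
  have h1 : (biprod.fst : K.obj.M ⊞ K.obj.M' ⟶ _).app _ (hullLift K U z) = z := by
    rw [hullLift, map_sub, fst_inl, fst_inr, sub_zero]
  have h2 : (biprod.snd : K.obj.M ⊞ K.obj.M' ⟶ _).app _ (hullLift K U z) = -phiSec K.obj U z := by
    rw [hullLift, map_sub, snd_inl, snd_inr, zero_sub]
  refine (phiSec_hull K U _).trans ((congrArg₂ (fun a b => phiSec K.obj U a + b) h1 h2).trans ?_)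
  exact add_neg_cancel _

lemma hullLift_res (K : Shtuka p) {U V : S.Opens} (h : V ≤ U) (z : Γ(K.obj.M, cyl p U)) :
    sres (K.obj.M ⊞ K.obj.M') (cyl_mono h) (hullLift K U z) =
      hullLift K V (sres _ (cyl_mono h) z) := by
  rw [hullLift, hullLift, map_sub, ← app_sres, ← app_sres, ← phiSec_res _ h]

lemma snd_of_phiSec_hull {K : Shtuka p} {U : S.Opens} {y : Γ(K.obj.M ⊞ K.obj.M', cyl p U)}
    (hy : phiSec (hull K).obj U y = 0) : (biprod.snd : K.obj.M ⊞ K.obj.M' ⟶ _).app _ y =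
      -phiSec K.obj U ((biprod.fst : K.obj.M ⊞ K.obj.M' ⟶ _).app _ y) :=
  (neg_eq_of_add_eq_zero_right ((phiSec_hull K U y).symm.trans hy)).symm

lemma hullLift_fst {K : Shtuka p} {U : S.Opens} {y : Γ(K.obj.M ⊞ K.obj.M', cyl p U)}
    (hy : phiSec (hull K).obj U y = 0) :
    hullLift K U ((biprod.fst : K.obj.M ⊞ K.obj.M' ⟶ _).app _ y) = y := by
  conv_rhs => rw [← biprod_section y, snd_of_phiSec_hull hy, map_neg, ← sub_eq_add_neg]
  rfl

lemma flasque_ker_phi_hull {K : Shtuka p} (hK : Flasque ((direct p).obj K.obj.M))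
    {F : TopCat.Sheaf (ModuleCat.{u} k[X]) S} (i : F ⟶ (direct p).obj (hull K).obj.M)
    (w : i ≫ phi (hull K).obj = 0) (hi : (ShortComplex.mk i (phi (hull K).obj) w).ShortExact) :
    Flasque F := by
  intro V U h x
  have hm : Mono i := hi.mono_f
  obtain ⟨z, hz⟩ := hK h ((biprod.fst : K.obj.M ⊞ K.obj.M' ⟶ _).app _ (i.hom.app (op V) x))
  obtain ⟨x', hx'⟩ := exists_of_exact (_inst := hm) hi.exact U (hullLift K U z) (phiSec_hullLift K U z)
  refine ⟨x', ModSheaf.injective_of_mono i V ((res_app i h x').trans ?_)⟩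
  refine (congrArg (sres (K.obj.M ⊞ K.obj.M') (cyl_mono h)) hx').trans ?_
  refine (hullLift_res K h z).trans ((congrArg (hullLift K V) hz).trans (hullLift_fst ?_))
  exact congr(($w).hom.app (op V) x)

/-- The geometric conditions on a covering of `S` by two open sets. -/
structure GoodCover (p : S ⟶ Spec (CommRingCat.of k)) (U₁ U₂ : S.Opens) : Prop where
  affineHom : IsAffineHom (prS p)
  affine₁ : IsAffineOpen (cyl p U₁)
  affine₂ : IsAffineOpen (cyl p U₂)
  affine₁₂ : IsAffineOpen (cyl p U₁ ⊓ cyl p U₂)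
  cover : cyl p U₁ ⊔ cyl p U₂ = ⊤
  affineHom₁ : IsAffineHom (cyl p U₁).ι
  affineHom₂ : IsAffineHom (cyl p U₂).ι

section Comparison

variable {U₁ U₂ : S.Opens}

lemma GoodCover.subsingleton_ext (hp : GoodCover p U₁ U₂) {N : Shtuka p}
    (hN : Acyclic (cyl p U₁) (cyl p U₂) N) (n : ℕ) :
    Subsingleton (Shtuka.Ext (unitShtuka p) N (n + 1)) :=
  have := hp.affineHom₁
  have := hp.affineHom₂
  hN.subsingleton_ext hp.affine₁ hp.affine₂ hp.affine₁₂ hp.cover (frobA_cyl _) (frobA_cyl _) n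

/-- The short exact sequence defined by a monomorphism. -/
abbrev cokerSeq {A : Type*} [Category A] [Abelian A] {M N : A} (f : M ⟶ N) : ShortComplex A :=
  ShortComplex.mk f (cokernel.π f) (cokernel.condition f)

lemma cokerSeq_shortExact {A : Type*} [Category A] [Abelian A] {M N : A} (f : M ⟶ N) [Mono f] :
    (cokerSeq f).ShortExact where
  exact := ShortComplex.exact_cokernel f

lemma subsingleton_coker_toHull (D : Shtuka p) (W : (timesA p).Opens) :
    Subsingleton Γ((cokernel (toHull D)).obj.M', W) := by
  have h := shortExact_snd (cokerSeq_shortExact (toHull D))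
  have h1 : IsIso (((cokerSeq (toHull D)).map (shtSnd p)).f) :=
    inferInstanceAs (IsIso (𝟙 D.obj.M'))
  have h2 : IsZero ((cokerSeq (toHull D)).map (shtSnd p)).X₃ := by
    have := h.epi_g
    rw [IsZero.iff_id_eq_zero, ← cancel_epi ((cokerSeq (toHull D)).map (shtSnd p)).g,
      ← cancel_epi ((cokerSeq (toHull D)).map (shtSnd p)).f]
    refine (congrArg _ (Category.comp_id _)).trans (Eq.trans ?_ (congrArg _ comp_zero.symm))
    exact ((cokerSeq (toHull D)).map (shtSnd p)).zero.trans comp_zero.symm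
  refine ⟨fun x y => ?_⟩
  have h3 : ∀ z : Γ((cokernel (toHull D)).obj.M', W), z = 0 := fun z =>
    congr(($((IsZero.iff_id_eq_zero _).1 h2)).app W z)
  rw [h3 x, h3 y]

lemma GoodCover.cech_coker (hp : GoodCover p U₁ U₂) {N N' : Shtuka p} (f : N ⟶ N') [Mono f]
    (h : Cech (cyl p U₁) (cyl p U₂) N'.obj.M) (h' : Cech (cyl p U₁) (cyl p U₂) N'.obj.M') :
    Cech (cyl p U₁) (cyl p U₂) (cokernel f).obj.M ∧
      Cech (cyl p U₁) (cyl p U₂) (cokernel f).obj.M' := by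
  have h1 : Epi (cokernel.π f).hom.f := (shortExact_fst (cokerSeq_shortExact f)).epi_g
  have h2 : Epi (cokernel.π f).hom.f' := (shortExact_snd (cokerSeq_shortExact f)).epi_g
  exact ⟨h.of_epi (cokernel.π f).hom.f (QCoh.surjective_of_epi N'.property.1
      (cokernel f).property.1 _ hp.affine₁₂),
    h'.of_epi (cokernel.π f).hom.f' (QCoh.surjective_of_epi N'.property.2
      (cokernel f).property.2 _ hp.affine₁₂)⟩

lemma acyclic_coker_toHull (hp : GoodCover p U₁ U₂) {D : Shtuka p}
    (hD : Cech (cyl p U₁) (cyl p U₂) D.obj.M) (hD' : Cech (cyl p U₁) (cyl p U₂) D.obj.M') :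
    Acyclic (cyl p U₁) (cyl p U₂) (cokernel (toHull D)) := by
  have h := acyclic_hull hD hD'
  have h' := hp.cech_coker (toHull D) h.1 h.2.1
  exact ⟨h'.1, h'.2, fun y => ⟨0, (subsingleton_coker_toHull D _).elim _ _⟩⟩

/-- The map from `M'` to the first component of the cokernel of the embedding in the hull. -/
def cokerInr (D : Shtuka p) : D.obj.M' ⟶ (cokernel (toHull D)).obj.M :=
  (biprod.inr : _ ⟶ D.obj.M ⊞ D.obj.M') ≫ (cokernel.π (toHull D)).hom.f

lemma snd_cokerInr (D : Shtuka p) :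
    (biprod.snd : D.obj.M ⊞ D.obj.M' ⟶ _) ≫ cokerInr D = (cokernel.π (toHull D)).hom.f := by
  have h : (biprod.inl : _ ⟶ D.obj.M ⊞ D.obj.M') ≫ (cokernel.π (toHull D)).hom.f = 0 :=
    congr(($(cokernel.condition (toHull D))).hom.f)
  refine biprod.hom_ext' _ _ ?_ ?_
  · rw [biprod.inl_snd_assoc, Limits.zero_comp]
    exact h.symm
  · rw [biprod.inr_snd_assoc]
    rfl

lemma coker_app (D : Shtuka p) (W : (timesA p).Opens) (x : Γ(D.obj.M ⊞ D.obj.M', W)) :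
    (cokernel.π (toHull D)).hom.f.app W x =
      (cokerInr D).app W ((biprod.snd : D.obj.M ⊞ D.obj.M' ⟶ _).app W x) :=
  congr(($(snd_cokerInr D)).app W x).symm

lemma cokerInr_injective (D : Shtuka p) (W : (timesA p).Opens) (y : Γ(D.obj.M', W))
    (hy : (cokerInr D).app W y = 0) : y = 0 := by
  obtain ⟨z, hz⟩ := (kernel_sections _ (shortExact_fst
    (cokerSeq_shortExact (toHull D))).fIsKernel W).2 _ hy
  have hz' : (biprod.inl : _ ⟶ D.obj.M ⊞ D.obj.M').app W (show Γ(D.obj.M, W) from z) =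
    (biprod.inr : _ ⟶ D.obj.M ⊞ D.obj.M').app W y := hz
  rw [← snd_inr (M := D.obj.M) y, ← hz', snd_inl]

/-- The map on sections, as an `A`-linear map. -/
def appLin {M N : (timesA p).Modules} (φ : M ⟶ N) (W : (timesA p).Opens) :
    Γ(M, W) →ₗ[k[X]] Γ(N, W) where
  toFun := φ.app W
  map_add' := map_add _
  map_smul' := app_sec_smul φ W

/-- The map from global sections of `M'` to morphisms from the unit shtuka to the cokernel of the
embedding in the hull. -/
def homCokerToHull (D : Shtuka p) :
    Γ(D.obj.M', cyl p ⊤) →ₗ[k[X]] (unitShtuka p ⟶ cokernel (toHull D)) :=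
  (homUnit (cokernel (toHull D))).symm.toLinearMap.comp
    ((appLin (cokerInr D) (cyl p ⊤)).codRestrict _
      fun _ => (subsingleton_coker_toHull D _).elim _ _)

lemma homUnit_homCokerToHull (D : Shtuka p) (y : Γ(D.obj.M', cyl p ⊤)) :
    (homUnit _ (homCokerToHull D y)).1 = (cokerInr D).app (cyl p ⊤) y := by
  rw [homCokerToHull, LinearMap.comp_apply, LinearEquiv.coe_coe, LinearEquiv.apply_symm_apply]
  rfl

lemma homCokerToHull_surjective (hp : GoodCover p U₁ U₂) {D : Shtuka p}
    (hD : Cech (cyl p U₁) (cyl p U₂) D.obj.M) : Function.Surjective (homCokerToHull D) := by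
  intro f
  obtain ⟨x, hx⟩ := surjective_fst hp.affine₁ hp.affine₂ hp.cover
    (cokerSeq_shortExact (toHull D)) hD (homUnit _ f).1
  refine ⟨(biprod.snd : D.obj.M ⊞ D.obj.M' ⟶ _).app _ x, (homUnit _).injective (Subtype.ext ?_)⟩
  exact (homUnit_homCokerToHull D _).trans ((coker_app D ⊤ x).symm.trans hx)

lemma homCokerToHull_mem_range {D : Shtuka p} (y : Γ(D.obj.M', cyl p ⊤)) :
    homCokerToHull D y ∈ LinearMap.range (Ext.homMap k[X] (unitShtuka p) (cokernel.π (toHull D))) ↔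
      y ∈ LinearMap.range (phiSec D.obj ⊤) := by
  have key : ∀ x : Γ(D.obj.M ⊞ D.obj.M', cyl p ⊤), (cokernel.π (toHull D)).hom.f.app (cyl p ⊤) x =
      (cokerInr D).app (cyl p ⊤) y ↔ (biprod.snd : D.obj.M ⊞ D.obj.M' ⟶ _).app _ x = y := by
    intro x
    rw [coker_app]
    refine ⟨fun h => sub_eq_zero.1 (cokerInr_injective D _ _ ?_), fun h => congrArg _ h⟩
    rw [map_sub, h, sub_self]
  constructor
  · rintro ⟨g, hg⟩
    have hx : phiSec (hull D).obj ⊤ (homUnit _ g).1 = 0 := (homUnit _ g).2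
    have h1 := (key (homUnit _ g).1).1
      ((congrArg (fun f => (homUnit _ f).1) hg).trans (homUnit_homCokerToHull D y))
    refine ⟨-(biprod.fst : D.obj.M ⊞ D.obj.M' ⟶ _).app (cyl p ⊤) (homUnit _ g).1, ?_⟩
    rw [map_neg]
    exact (snd_of_phiSec_hull hx).symm.trans h1
  · rintro ⟨z, rfl⟩
    let x : Γ(D.obj.M ⊞ D.obj.M', cyl p ⊤) := hullLift D ⊤ (-z)
    refine ⟨(homUnit (hull D)).symm ⟨x, phiSec_hullLift D ⊤ _⟩,
      (homUnit _).injective (Subtype.ext ?_)⟩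
    refine Eq.trans ?_ (homUnit_homCokerToHull D _).symm
    refine (homUnit_comp _ _).trans ?_
    rw [LinearEquiv.apply_symm_apply]
    refine (key x).2 ?_
    simp only [x, hullLift]
    rw [map_sub, snd_inl, snd_inr, map_neg, zero_sub, neg_neg]

/-- The first extension group as the cokernel of `σ - j` on global sections. -/
def extOneEquiv (hp : GoodCover p U₁ U₂) {D : Shtuka p}
    (hD : Cech (cyl p U₁) (cyl p U₂) D.obj.M) (hD' : Cech (cyl p U₁) (cyl p U₂) D.obj.M') :
    (Γ(D.obj.M', cyl p ⊤) ⧸ LinearMap.range (phiSec D.obj ⊤)) ≃ₗ[k[X]]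
      Shtuka.Ext (unitShtuka p) D 1 :=
  LinearEquiv.trans
    (LinearEquiv.trans
      (Submodule.quotEquivOfEq _ (LinearMap.ker ((Submodule.mkQ (LinearMap.range
        (Ext.homMap k[X] (unitShtuka p) (cokernel.π (toHull D))))).comp (homCokerToHull D))) (by
          ext y
          rw [LinearMap.mem_ker, LinearMap.comp_apply, Submodule.mkQ_apply,
            Submodule.Quotient.mk_eq_zero, homCokerToHull_mem_range]))
      (LinearMap.quotKerEquivOfSurjective _ ((Submodule.mkQ_surjective _).comp
        (homCokerToHull_surjective hp hD))))
    (Ext.dimensionShiftOne (unitShtuka p) (cokerSeq_shortExact (toHull D))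
      (hp.subsingleton_ext (acyclic_hull hD hD') 0))

end Comparison
end
end Carlitz

namespace Carlitz
noncomputable section

open Polynomial QCoh Opposite ModSheaf Abelian

attribute [local instance] CategoryTheory.HasExt.standard

variable {k : Type u} [Field k] [Fintype k] {S : Scheme.{u}} {p : S ⟶ Spec (CommRingCat.of k)}
  {U₁ U₂ : S.Opens}

section Cohomology

variable {R : Type u} [CommRing R] {T : TopCat.{u}}

/-- The first cohomology of the kernel of an epimorphism of flasque sheaves. -/
def cohomologyOneEquiv [NoetherianSpace T] {L : ShortComplex (TopCat.Sheaf (ModuleCat.{u} R) T)} (hL : L.ShortExact)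
    (h : Flasque L.X₂) :
    (L.X₃.obj.obj (op ⊤) ⧸ LinearMap.range (L.g.hom.app (op ⊤)).hom) ≃ₗ[R] cohomology L.X₁ 1 :=
  LinearEquiv.trans
    (Submodule.Quotient.equiv _ (LinearMap.range (Ext.homMap R (constantRing R T) L.g))
      (homConstant L.X₃).symm (by
        ext f
        rw [Submodule.mem_map_equiv, LinearEquiv.symm_symm]
        constructor
        · rintro ⟨x, hx⟩
          refine ⟨(homConstant L.X₂).symm x, (homConstant L.X₃).injective ?_⟩
          refine (homConstant_comp _ _).trans (Eq.trans ?_ hx)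
          rw [LinearEquiv.apply_symm_apply]
        · rintro ⟨g, rfl⟩
          exact ⟨homConstant _ g, (homConstant_comp _ _).symm⟩))
    (Ext.dimensionShiftOne (constantRing R T) hL (h.subsingleton_cohomology 0))

lemma subsingleton_cohomology_of_shortExact [NoetherianSpace T]
    {L : ShortComplex (TopCat.Sheaf (ModuleCat.{u} R) T)} (hL : L.ShortExact)
    (h₂ : Flasque L.X₂) (h₃ : Flasque L.X₃) (n : ℕ) : Subsingleton (cohomology L.X₁ (n + 2)) := by
  have := h₃.subsingleton_cohomology n
  exact (Ext.dimensionShift (R := R) (constantRing R T) hL (n + 1) (h₂.subsingleton_cohomology n)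
    (h₂.subsingleton_cohomology (n + 1))).symm.toEquiv.subsingleton

/-- Global sections of a quotient by a flasque sheaf. -/
def cohomologyZeroEquiv [NoetherianSpace T] {L : ShortComplex (TopCat.Sheaf (ModuleCat.{u} R) T)} (hL : L.ShortExact)
    (h : Flasque L.X₁) :
    (L.X₂.obj.obj (op ⊤) ⧸ LinearMap.range (L.f.hom.app (op ⊤)).hom) ≃ₗ[R] cohomology L.X₃ 0 :=
  LinearEquiv.trans
    (LinearEquiv.trans
      (Submodule.quotEquivOfEq _ (LinearMap.ker (L.g.hom.app (op ⊤)).hom) (by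
        ext x
        refine ⟨?_, fun hx => exists_of_exact (_inst := hL.mono_f) hL.exact ⊤ x hx⟩
        rintro ⟨y, rfl⟩
        exact congr(($(L.zero)).hom.app (op ⊤) y)))
      (LinearMap.quotKerEquivOfSurjective _ (h.exists_lift hL ⊤)))
    ((homConstant L.X₃).symm.trans Ext.linearEquiv₀.symm)

/-- Sections of a kernel. -/
def kerSectionsEquiv {L : ShortComplex (TopCat.Sheaf (ModuleCat.{u} R) T)} (hL : L.ShortExact)
    (U : Opens T) : L.X₁.obj.obj (op U) ≃ₗ[R] LinearMap.ker (L.g.hom.app (op U)).hom :=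
  LinearEquiv.ofBijective ((L.f.hom.app (op U)).hom.codRestrict _
    fun y => congr(($(L.zero)).hom.app (op U) y))
    ⟨fun _ _ h => have := hL.mono_f
      ModSheaf.injective_of_mono L.f U (congrArg Subtype.val h), fun x =>
      have ⟨y, hy⟩ := exists_of_exact (_inst := hL.mono_f) hL.exact U x.1 x.2
      ⟨y, Subtype.ext hy⟩⟩

end Cohomology

/-- The morphism of short exact sequences of sheaves given by `σ - j`. -/
def phiSeq (T : ShortComplex (Shtuka p)) :
    (T.map (shtFst p)).map (direct p) ⟶ (T.map (shtSnd p)).map (direct p) where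
  τ₁ := phi T.X₁.obj
  τ₂ := phi T.X₂.obj
  τ₃ := phi T.X₃.obj
  comm₁₂ := phi_comp T.f.hom
  comm₂₃ := phi_comp T.g.hom

/-- Global sections of the kernel of `σ - j` are morphisms from the unit shtuka. -/
def sectionsHom {D : Shtuka p} {F : TopCat.Sheaf (ModuleCat.{u} k[X]) S}
    {b : F ⟶ (direct p).obj D.obj.M} {w : b ≫ phi D.obj = 0}
    (h : (ShortComplex.mk b (phi D.obj) w).ShortExact) :
    F.obj.obj (op ⊤) ≃ₗ[k[X]] (unitShtuka p ⟶ D) :=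
  (kerSectionsEquiv h ⊤).trans (homUnit D).symm

lemma homUnit_sectionsHom {D : Shtuka p} {F : TopCat.Sheaf (ModuleCat.{u} k[X]) S}
    {b : F ⟶ (direct p).obj D.obj.M} {w : b ≫ phi D.obj = 0}
    (h : (ShortComplex.mk b (phi D.obj) w).ShortExact) (x : F.obj.obj (op ⊤)) :
    (homUnit D (sectionsHom h x)).1 = b.hom.app (op ⊤) x :=
  congrArg Subtype.val (LinearEquiv.apply_symm_apply (homUnit D) _)

lemma sectionsHom_comp {J D : Shtuka p} {F G : TopCat.Sheaf (ModuleCat.{u} k[X]) S}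
    {a : F ⟶ (direct p).obj J.obj.M} {b : G ⟶ (direct p).obj D.obj.M} {wa : a ≫ phi J.obj = 0}
    {wb : b ≫ phi D.obj = 0} (ha : (ShortComplex.mk a (phi J.obj) wa).ShortExact)
    (hb : (ShortComplex.mk b (phi D.obj) wb).ShortExact) (f : J ⟶ D) (g : F ⟶ G)
    (hc : a ≫ (direct p).map f.hom.f = g ≫ b) (x : F.obj.obj (op ⊤)) :
    sectionsHom ha x ≫ f = sectionsHom hb (g.hom.app (op ⊤) x) := by
  apply (homUnit D).injective
  apply Subtype.ext
  rw [homUnit_sectionsHom, homUnit_comp, homUnit_sectionsHom]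
  exact congr(($hc).hom.app (op ⊤) x)

/-- The first extension group in terms of kernels of `σ - j`. -/
def extOneEquivSections {T : ShortComplex (Shtuka p)} (hT : T.ShortExact)
    (h : Subsingleton (Shtuka.Ext (unitShtuka p) T.X₂ 1))
    {F G : TopCat.Sheaf (ModuleCat.{u} k[X]) S}
    {a : F ⟶ (direct p).obj T.X₂.obj.M} {b : G ⟶ (direct p).obj T.X₃.obj.M}
    {wa : a ≫ phi T.X₂.obj = 0} {wb : b ≫ phi T.X₃.obj = 0}
    (ha : (ShortComplex.mk a (phi T.X₂.obj) wa).ShortExact)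
    (hb : (ShortComplex.mk b (phi T.X₃.obj) wb).ShortExact) (g : F ⟶ G)
    (hc : a ≫ (direct p).map T.g.hom.f = g ≫ b) :
    Shtuka.Ext (unitShtuka p) T.X₁ 1 ≃ₗ[k[X]]
      (G.obj.obj (op ⊤) ⧸ LinearMap.range (g.hom.app (op ⊤)).hom) :=
  (Ext.dimensionShiftOne (unitShtuka p) hT h).symm.trans
    (Submodule.Quotient.equiv _ _ (sectionsHom hb) (by
      ext φ
      constructor
      · rintro ⟨_, ⟨x, rfl⟩, rfl⟩
        exact ⟨sectionsHom ha x, sectionsHom_comp ha hb T.g g hc x⟩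
      · rintro ⟨φ, rfl⟩
        obtain ⟨x, rfl⟩ := (sectionsHom ha).surjective φ
        exact ⟨_, ⟨x, rfl⟩, (sectionsHom_comp ha hb T.g g hc x).symm⟩)).symm

/-- Extensions of the unit shtuka by a subobject of the hull of a flasque shtuka agree with the
cohomology of the cokernel of `σ - j`. -/
theorem nonempty_ext_equiv_cohomology [NoetherianSpace S] (hS : CurveLike S)
    (hp : GoodCover p U₁ U₂) {N K : Shtuka p} (f : N ⟶ hull K) [Mono f]
    (hK : Flasque ((direct p).obj K.obj.M)) (hK' : Flasque ((direct p).obj K.obj.M'))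
    {F : TopCat.Sheaf (ModuleCat.{u} k[X]) S} (ψ : (direct p).obj N.obj.M' ⟶ F)
    (w : phi N.obj ≫ ψ = 0) (hψ : (ShortComplex.mk (phi N.obj) ψ w).ShortExact) (i : ℕ) :
    Nonempty (Shtuka.Ext (unitShtuka p) N (i + 1) ≃ₗ[k[X]] cohomology F i) := by
  have := hp.affineHom
  let T := cokerSeq f
  have hT : T.ShortExact := cokerSeq_shortExact f
  have h₁ := direct_shortExact (shortExact_fst hT) T.X₂.property.1 T.X₃.property.1
  have h₂ := direct_shortExact (shortExact_snd hT) T.X₂.property.2 T.X₃.property.2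
  have hJ : Acyclic (cyl p U₁) (cyl p U₂) (hull K) :=
    acyclic_hull (cech_of_flasque hK _ _) (cech_of_flasque hK' _ _)
  have hD := hp.cech_coker f hJ.1 hJ.2.1
  have hDM : Flasque ((direct p).obj (cokernel f).obj.M) :=
    Flasque.of_epi hS (flasque_biprod hK hK') ((direct p).map (cokernel.π f).hom.f) h₁.epi_g
  have hDM' : Flasque ((direct p).obj (cokernel f).obj.M') :=
    Flasque.of_epi hS hK' ((direct p).map (cokernel.π f).hom.f') h₂.epi_g
  obtain ⟨FJ, FD, a, b, g, δ, ha, hb, hg, hc, hsa, hsb, hsg⟩ := exists_snake h₁ h₂ (phiSeq T) ψ w hψ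
    (epi_of_surjective _ fun U => phiSec_hull_surjective K U)
  have hFJ : Flasque FJ := flasque_ker_phi_hull hK a ha hsa
  match i with
  | 0 =>
    exact ⟨(extOneEquivSections hT (hp.subsingleton_ext hJ 0) hsa hsb g hc).trans
      (cohomologyZeroEquiv hsg hFJ)⟩
  | 1 =>
    refine ⟨((Ext.dimensionShift (R := k[X]) (unitShtuka p) hT 1 (hp.subsingleton_ext hJ 0)
      (hp.subsingleton_ext hJ 1)).symm.trans (extOneEquiv hp hD.1 hD.2).symm).trans
      ((cohomologyOneEquiv hsb hDM).trans (Ext.quotientEquiv (constantRing k[X] S) hsg 1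
        (hFJ.subsingleton_cohomology 0) (hFJ.subsingleton_cohomology 1)))⟩
  | n + 2 =>
    have h1 : Subsingleton (Shtuka.Ext (unitShtuka p) N (n + 2 + 1)) := by
      have h2 := hp.subsingleton_ext (acyclic_coker_toHull hp hD.1 hD.2) n
      have hh := acyclic_hull hD.1 hD.2
      exact ((Ext.dimensionShift (R := k[X]) (unitShtuka p)
        (cokerSeq_shortExact (toHull (cokernel f))) (n + 1) (hp.subsingleton_ext hh n)
        (hp.subsingleton_ext hh (n + 1))).trans
        (Ext.dimensionShift (R := k[X]) (unitShtuka p) hT (n + 2)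
        (hp.subsingleton_ext hJ (n + 1)) (hp.subsingleton_ext hJ (n + 2)))).symm.toEquiv.subsingleton
    have h2 : Subsingleton (cohomology F (n + 2)) := by
      have h3 := subsingleton_cohomology_of_shortExact hsb hDM hDM' n
      exact (Ext.quotientEquiv (R := k[X]) (constantRing k[X] S) hsg (n + 2)
        (hFJ.subsingleton_cohomology (n + 1))
        (hFJ.subsingleton_cohomology (n + 2))).symm.toEquiv.subsingleton
    exact ⟨LinearEquiv.ofSubsingleton _ _⟩

end
end Carlitz

namespace Carlitz
section ExpAnalysis

variable {L : Type*} [CommRing L] (O : Subring L) (t s : L)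

/-- The filtration of `L` by the sets `t ^ (1 - n) O`, where `s = t⁻¹`. -/
def fil (n : ℕ) : AddSubgroup L where
  carrier := {x | ∃ o ∈ O, x = t * s ^ n * o}
  zero_mem' := ⟨0, O.zero_mem, (mul_zero _).symm⟩
  add_mem' := by
    rintro _ _ ⟨a, ha, rfl⟩ ⟨b, hb, rfl⟩
    exact ⟨a + b, O.add_mem ha hb, (mul_add _ _ _).symm⟩
  neg_mem' := by
    rintro _ ⟨a, ha, rfl⟩
    exact ⟨-a, O.neg_mem ha, (mul_neg _ _).symm⟩

/-- The properties of a complete valued field used in the study of the exponential. -/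
structure ExpSetting (e : ℕ → L) (q : ℕ) : Prop where
  s_mem : s ∈ O
  t_mul_s : t * s = 1
  two_le : 2 ≤ q
  add_pow : ∀ x y : L, (x + y) ^ q = x ^ q + y ^ q
  sub_pow : ∀ x y : L, (x - y) ^ q = x ^ q - y ^ q
  sum_pow : ∀ (f : ℕ → L) (m : ℕ), (∑ i ∈ Finset.range m, f i) ^ q = ∑ i ∈ Finset.range m, f i ^ q
  unit : ∀ n : ℕ, n ≠ 0 → ∃ v ∈ O, (1 - s ^ n) * v = 1
  e_zero : e 0 = 1
  e_succ : ∀ i, e (i + 1) * (t ^ q ^ (i + 1) - t) = e i ^ q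
  separated : ∀ x, (∀ n, x ∈ fil O t s n) → x = 0
  complete : ∀ a : ℕ → L, (∀ i, a i ∈ fil O t s i) →
    ∃ x, ∀ m, x - ∑ i ∈ Finset.range m, a i ∈ fil O t s m

variable {O t s} {e : ℕ → L} {q : ℕ}

lemma mul_mem_fil {n : ℕ} {x o : L} (ho : o ∈ O) (hx : x ∈ fil O t s n) : o * x ∈ fil O t s n := by
  obtain ⟨a, ha, rfl⟩ := hx
  exact ⟨o * a, O.mul_mem ho ha, by ring⟩

namespace ExpSetting

lemma fil_mono (h : ExpSetting O t s e q) {m n : ℕ} (hmn : m ≤ n) : fil O t s n ≤ fil O t s m := by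
  rintro _ ⟨o, ho, rfl⟩
  obtain ⟨r, rfl⟩ := Nat.exists_eq_add_of_le hmn
  exact ⟨s ^ r * o, O.mul_mem (O.pow_mem h.s_mem r) ho, by ring⟩

lemma pow_mul_pow (h : ExpSetting O t s e q) (n : ℕ) : t ^ n * s ^ n = 1 := by rw [← mul_pow, h.t_mul_s, one_pow]

lemma mem_fil_succ (h : ExpSetting O t s e q) {n : ℕ} {x : L} : x ∈ fil O t s (n + 1) ↔ t ^ n * x ∈ O := by
  constructor
  · rintro ⟨o, ho, rfl⟩
    have : t ^ n * (t * s ^ (n + 1) * o) = o := by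
      linear_combination (t * s * o) * h.pow_mul_pow n + o * h.t_mul_s
    rwa [this]
  · intro hx
    refine ⟨_, hx, ?_⟩
    linear_combination (-(t * s * x)) * h.pow_mul_pow n - x * h.t_mul_s

lemma mem_fil_one (h : ExpSetting O t s e q) {x : L} : x ∈ fil O t s 1 ↔ x ∈ O := by
  rw [h.mem_fil_succ, pow_zero, one_mul]

lemma t_mul_mem (h : ExpSetting O t s e q) {n : ℕ} {x : L} : t * x ∈ fil O t s n ↔ x ∈ fil O t s (n + 1) := by
  constructor
  · rintro ⟨o, ho, hx⟩
    exact ⟨o, ho, by linear_combination s * hx - x * h.t_mul_s⟩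
  · rintro ⟨o, ho, rfl⟩
    exact ⟨o, ho, by linear_combination (t * s ^ n * o) * h.t_mul_s⟩

lemma isSum_iff (h : ExpSetting O t s e q) {γ c : L} : IsSum O t e q γ c ↔ ∀ n : ℕ, ∃ N : ℕ, ∀ m ≥ N,
    c - ∑ i ∈ Finset.range m, e i * γ ^ q ^ i ∈ fil O t s n := by
  constructor
  · intro hc n
    obtain ⟨N, hN⟩ := hc n
    exact ⟨N, fun m hm => h.fil_mono (Nat.le_succ n) (h.mem_fil_succ.2 (hN m hm))⟩
  · intro hc n
    obtain ⟨N, hN⟩ := hc (n + 1)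
    exact ⟨N, fun m hm => h.mem_fil_succ.1 (hN m hm)⟩

lemma isSum_unique (h : ExpSetting O t s e q) {γ c c' : L} (hc : IsSum O t e q γ c) (hc' : IsSum O t e q γ c') : c = c' := by
  refine sub_eq_zero.1 (h.separated _ fun n => ?_)
  obtain ⟨N, hN⟩ := h.isSum_iff.1 hc n
  obtain ⟨N', hN'⟩ := h.isSum_iff.1 hc' n
  have := sub_mem (hN (max N N') (le_max_left _ _)) (hN' (max N N') (le_max_right _ _))
  rwa [sub_sub_sub_cancel_right] at this

lemma exists_coeff (h : ExpSetting O t s e q) (i : ℕ) : ∃ v ∈ O, e i = s ^ (i * q ^ i) * v := by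
  induction i with
  | zero => exact ⟨1, O.one_mem, by rw [h.e_zero]; simp⟩
  | succ i ih =>
    obtain ⟨v, hv, hi⟩ := ih
    have hq : 2 ≤ q ^ (i + 1) := h.two_le.trans (Nat.le_self_pow (Nat.succ_ne_zero i) q)
    obtain ⟨w, hw, hw'⟩ := h.unit (q ^ (i + 1) - 1) (by omega)
    refine ⟨v ^ q * w, O.mul_mem (O.pow_mem hv q) hw, ?_⟩
    have h1 : t ^ q ^ (i + 1) - t = t ^ q ^ (i + 1) * (1 - s ^ (q ^ (i + 1) - 1)) := by
      obtain ⟨r, hr⟩ := Nat.exists_eq_add_of_le (show 1 ≤ q ^ (i + 1) by omega)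
      rw [hr, Nat.add_sub_cancel_left, pow_add]
      linear_combination t * h.pow_mul_pow r
    have h2 := h.e_succ i
    rw [h1, hi, mul_pow, ← pow_mul] at h2
    have h3 : s ^ ((i + 1) * q ^ (i + 1)) = s ^ (i * q ^ i * q) * s ^ q ^ (i + 1) := by
      rw [← pow_add]
      congr 1
      ring
    rw [h3]
    linear_combination (s ^ q ^ (i + 1) * w) * h2 - (e (i + 1)) * h.pow_mul_pow (q ^ (i + 1)) -
      (e (i + 1) * t ^ q ^ (i + 1) * s ^ q ^ (i + 1)) * hw'

lemma term_mem (h : ExpSetting O t s e q) {n : ℕ} {y : L} (hy : y ∈ fil O t s n) (i : ℕ) :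
    e i * y ^ q ^ i ∈ fil O t s (n + i) := by
  obtain ⟨o, ho, rfl⟩ := hy
  rcases i with _ | i
  · rw [h.e_zero, pow_zero, pow_one, one_mul]
    exact ⟨o, ho, rfl⟩
  · obtain ⟨v, hv, hi⟩ := h.exists_coeff (i + 1)
    set Q := q ^ (i + 1)
    have hQ : 1 ≤ Q := Nat.one_le_pow _ _ (by have := h.two_le; omega)
    have h1 : e (i + 1) * (t * s ^ n * o) ^ Q = t * s ^ ((i + n) * Q + 1) * (v * o ^ Q) := by
      have h2 : s ^ ((i + 1) * Q) = s ^ (i * Q) * s ^ Q := by rw [← pow_add]; congr 1; ring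
      have h3 : s ^ ((i + n) * Q + 1) = s ^ (i * Q) * s ^ (n * Q) * s := by
        rw [← pow_add, ← pow_succ]; congr 1; ring
      rw [hi, h2, h3, mul_pow, mul_pow, ← pow_mul]
      linear_combination (s ^ (i * Q) * v * s ^ (n * Q) * o ^ Q) * h.pow_mul_pow Q -
        (s ^ (i * Q) * v * s ^ (n * Q) * o ^ Q) * h.t_mul_s
    rw [h1]
    refine h.fil_mono ?_ ⟨_, O.mul_mem hv (O.pow_mem ho Q), rfl⟩
    have := Nat.le_mul_of_pos_right (i + n) hQ
    omega

lemma exists_isSum (h : ExpSetting O t s e q) {n : ℕ} {y : L} (hy : y ∈ fil O t s n) :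
    ∃ x, IsSum O t e q y x ∧ x - y ∈ fil O t s (n + 1) := by
  obtain ⟨x, hx⟩ := h.complete (fun i => e i * y ^ q ^ i)
    fun i => h.fil_mono (Nat.le_add_left i n) (h.term_mem hy i)
  refine ⟨x, h.isSum_iff.2 fun m => ⟨m, fun m' hm' => h.fil_mono hm' (hx m')⟩, ?_⟩
  have h1 := hx (n + 1)
  rw [Finset.sum_range_succ', h.e_zero, pow_zero, pow_one, one_mul] at h1
  have h2 : ∑ i ∈ Finset.range n, e (i + 1) * y ^ q ^ (i + 1) ∈ fil O t s (n + 1) :=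
    sum_mem fun i _ => h.fil_mono (by omega) (h.term_mem hy (i + 1))
  have := add_mem h1 h2
  rwa [show x - (∑ i ∈ Finset.range n, e (i + 1) * y ^ q ^ (i + 1) + y) +
    ∑ i ∈ Finset.range n, e (i + 1) * y ^ q ^ (i + 1) = x - y by ring] at this

lemma isSum_add (h : ExpSetting O t s e q) {γ c γ' c' : L} (hc : IsSum O t e q γ c) (hc' : IsSum O t e q γ' c') :
    IsSum O t e q (γ + γ') (c + c') :=
  hc.add h.add_pow hc'

lemma isSum_sub_mem (h : ExpSetting O t s e q) {n : ℕ} {y x : L} (hy : y ∈ fil O t s n) (hx : IsSum O t e q y x) :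
    x - y ∈ fil O t s (n + 1) := by
  obtain ⟨x', hx', hm⟩ := h.exists_isSum hy
  rwa [h.isSum_unique hx hx']

lemma isSum_mem (h : ExpSetting O t s e q) {n : ℕ} {y x : L} (hy : y ∈ fil O t s n) (hx : IsSum O t e q y x) :
    x ∈ fil O t s n := by
  have := add_mem (h.fil_mono (Nat.le_succ n) (h.isSum_sub_mem hy hx)) hy
  rwa [sub_add_cancel] at this

lemma isSum_zero (h : ExpSetting O t s e q) : IsSum O t e q 0 0 := IsSum.zero (by have := h.two_le; omega)

lemma isSum_neg (h : ExpSetting O t s e q) {y x : L} (hx : IsSum O t e q y x) : IsSum O t e q (-y) (-x) := by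
  have hp : ∀ i, (-y) ^ q ^ i = -y ^ q ^ i := by
    intro i
    induction i with
    | zero => simp
    | succ i ih =>
      have := h.sub_pow 0 (y ^ q ^ i)
      rw [zero_sub, zero_pow (by have := h.two_le; omega), zero_sub] at this
      rw [pow_succ, pow_mul, ih, this, ← pow_mul]
  refine h.isSum_iff.2 fun n => ?_
  obtain ⟨N, hN⟩ := h.isSum_iff.1 hx n
  refine ⟨N, fun m hm => ?_⟩
  have := neg_mem (hN m hm)
  simp only [hp, mul_neg, Finset.sum_neg_distrib]
  rwa [neg_sub'] at this

lemma isSum_sub (h : ExpSetting O t s e q) {γ c γ' c' : L} (hc : IsSum O t e q γ c) (hc' : IsSum O t e q γ' c') :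
    IsSum O t e q (γ - γ') (c - c') := by
  rw [sub_eq_add_neg, sub_eq_add_neg]
  exact h.isSum_add hc (h.isSum_neg hc')

lemma mem_of_isSum (h : ExpSetting O t s e q) {n : ℕ} {y x : L} (hy : y ∈ fil O t s 0) (hx : IsSum O t e q y x)
    (hxn : x ∈ fil O t s n) : y ∈ fil O t s n := by
  have key : ∀ m ≤ n, y ∈ fil O t s m := by
    intro m
    induction m with
    | zero => exact fun _ => hy
    | succ m ih =>
      intro hm
      have h1 := h.isSum_sub_mem (ih (by omega)) hx
      have := sub_mem (h.fil_mono hm hxn) h1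
      rwa [sub_sub_cancel] at this
  exact key n le_rfl

lemma isSum_injective (h : ExpSetting O t s e q) {y y' x : L} (hy : y ∈ fil O t s 0) (hy' : y' ∈ fil O t s 0)
    (hx : IsSum O t e q y x) (hx' : IsSum O t e q y' x) : y = y' := by
  have h1 := h.isSum_sub hx hx'
  rw [sub_self] at h1
  exact sub_eq_zero.1 (h.separated _ fun n =>
    h.mem_of_isSum (sub_mem hy hy') h1 (zero_mem _))

lemma exists_log (h : ExpSetting O t s e q) {x : L} (hx : x ∈ fil O t s 0) :
    ∃ y ∈ fil O t s 0, IsSum O t e q y x := by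
  choose E hE hE' using fun (y : fil O t s 0) => h.exists_isSum y.2
  let X : ℕ → fil O t s 0 := fun n => Nat.rec ⟨x, hx⟩
    (fun _ y => ⟨y.1 - E y, by
      have := neg_mem (h.fil_mono (Nat.zero_le 1) (hE' y))
      rwa [neg_sub] at this⟩) n
  have hX : ∀ n, (X (n + 1)).1 = (X n).1 - E (X n) := fun n => rfl
  have hXn : ∀ n, (X n).1 ∈ fil O t s n := by
    intro n
    induction n with
    | zero => exact hx
    | succ n ih =>
      rw [hX, ← neg_sub]
      exact neg_mem (h.isSum_sub_mem ih (hE _))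
  obtain ⟨y, hy⟩ := h.complete (fun n => (X n).1) hXn
  have hy0 : y ∈ fil O t s 0 := by simpa using hy 0
  refine ⟨y, hy0, ?_⟩
  have hsum : ∀ n, IsSum O t e q (∑ i ∈ Finset.range n, (X i).1) (x - (X n).1) := by
    intro n
    induction n with
    | zero =>
      have : (X 0).1 = x := rfl
      rw [Finset.sum_range_zero, this, sub_self]
      exact h.isSum_zero
    | succ n ih =>
      rw [Finset.sum_range_succ, hX, show x - ((X n).1 - E (X n)) = x - (X n).1 + E (X n) by ring]
      exact h.isSum_add ih (hE _)
  have hxy : x = E ⟨y, hy0⟩ := by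
    refine sub_eq_zero.1 (h.separated _ fun n => ?_)
    have h1 := h.isSum_mem (hy n) (h.isSum_sub (hE ⟨y, hy0⟩) (hsum n))
    have := neg_mem (sub_mem h1 (hXn n))
    rwa [show -(E ⟨y, hy0⟩ - (x - (X n).1) - (X n).1) = x - E ⟨y, hy0⟩ by ring] at this
  rw [hxy]
  exact hE _

lemma isSum_step (h : ExpSetting O t s e q) {γ c : L} (hc : IsSum O t e q γ c) : IsSum O t e q (t * γ) (t * c + c ^ q) :=
  hc.step h.sub_pow h.sum_pow (by have := h.two_le; omega) h.s_mem h.t_mul_s h.e_zero h.e_succ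

end ExpSetting
end ExpAnalysis
end Carlitz

noncomputable section

namespace Carlitz

section Completion

open IsLocalRing

variable {R : Type*} [CommRing R] [IsDomain R] [IsLocalRing R] [IsNoetherianRing R]
  [Ring.DimensionLEOne R]

lemma exists_maximalIdeal_pow_le {c : R} (hc : c ≠ 0) :
    ∃ N, maximalIdeal R ^ N ≤ Ideal.span {c} := by
  refine Ideal.exists_pow_le_of_le_radical_of_fg ?_ (maximalIdeal R).fg_of_isNoetherianRing
  rw [Ideal.radical_eq_sInf]
  refine le_sInf fun P ⟨hP, hP'⟩ => ?_
  have hP0 : P ≠ ⊥ := by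
    rintro rfl
    exact hc (by simpa using hP (Ideal.mem_span_singleton_self c))
  have := Ring.DimensionLEOne.maximalOfPrime hP0 hP'
  rw [IsLocalRing.eq_maximalIdeal this]

lemma exists_eq_mul_of_evalₐ_eq_zero {c : R} {N : ℕ} (hN : maximalIdeal R ^ N ≤ Ideal.span {c})
    {x : AdicCompletion (maximalIdeal R) R} (hx : AdicCompletion.evalₐ (maximalIdeal R) N x = 0) :
    ∃ y, x = algebraMap R _ c * y := by
  have h1 : x ∈ (maximalIdeal R ^ N • ⊤ : Submodule R (AdicCompletion (maximalIdeal R) R)) := by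
    rw [AdicCompletion.pow_smul_top_eq_ker_eval (maximalIdeal R).fg_of_isNoetherianRing,
      LinearMap.mem_ker, ← AdicCompletion.factor_evalₐ_eq_eval _ x (by simp), hx, map_zero]
  have h2 := Submodule.smul_mono_left hN h1
  rw [Submodule.ideal_span_singleton_smul, Submodule.mem_smul_pointwise_iff_exists] at h2
  obtain ⟨y, -, rfl⟩ := h2
  exact ⟨y, Algebra.smul_def _ _⟩

lemma exists_eq_add_mul {c : R} (hc : c ≠ 0) (x : AdicCompletion (maximalIdeal R) R) :
    ∃ (a : R) (y : _), x = algebraMap R _ a + algebraMap R _ c * y := by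
  obtain ⟨N, hN⟩ := exists_maximalIdeal_pow_le hc
  obtain ⟨a, ha⟩ := Ideal.Quotient.mk_surjective (AdicCompletion.evalₐ (maximalIdeal R) N x)
  obtain ⟨y, hy⟩ := exists_eq_mul_of_evalₐ_eq_zero hN (x := x - algebraMap R _ a) (by
    rw [map_sub, ← ha, AlgHom.commutes]; exact sub_self _)
  exact ⟨a, y, by rw [← hy]; ring⟩

lemma dvd_of_algebraMap_eq_mul {b c : R} (hc : c ≠ 0) {y : AdicCompletion (maximalIdeal R) R}
    (h : algebraMap R _ b = algebraMap R _ c * y) : c ∣ b := by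
  obtain ⟨N, hN⟩ := exists_maximalIdeal_pow_le hc
  obtain ⟨a, ha⟩ := Ideal.Quotient.mk_surjective (AdicCompletion.evalₐ (maximalIdeal R) N y)
  have h1 := congrArg (AdicCompletion.evalₐ (maximalIdeal R) N) h
  rw [map_mul, AlgHom.commutes, AlgHom.commutes, ← ha] at h1
  have h2 := hN (Ideal.Quotient.eq.1 (h1.trans (map_mul (Ideal.Quotient.mk _) c a).symm))
  rw [Ideal.mem_span_singleton] at h2
  exact (dvd_sub_left (Dvd.intro a rfl)).1 h2

lemma eq_zero_of_forall_eq_pow_mul {s : R} (hs : s ∈ maximalIdeal R)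
    {x : AdicCompletion (maximalIdeal R) R} (h : ∀ n : ℕ, ∃ y, x = algebraMap R _ (s ^ n) * y) :
    x = 0 := by
  refine IsHausdorff.haus (I := maximalIdeal R) inferInstance x fun n => ?_
  rw [SModEq.zero]
  obtain ⟨y, rfl⟩ := h n
  rw [← Algebra.smul_def]
  exact Submodule.smul_mem_smul (Ideal.pow_mem_pow hs n) trivial

lemma exists_sum_pow_mul {s : R} (hs : s ∈ maximalIdeal R)
    (o : ℕ → AdicCompletion (maximalIdeal R) R) :
    ∃ x, ∀ n, ∃ y, x = ∑ i ∈ Finset.range n, algebraMap R _ (s ^ i) * o i +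
      algebraMap R _ (s ^ n) * y := by
  have hcomp : IsAdicComplete (maximalIdeal R) (AdicCompletion (maximalIdeal R) R) :=
    AdicCompletion.isAdicComplete (maximalIdeal R).fg_of_isNoetherianRing
  have hmem : ∀ (n : ℕ) (y : AdicCompletion (maximalIdeal R) R), algebraMap R _ (s ^ n) * y ∈
      (maximalIdeal R ^ n • ⊤ : Submodule R (AdicCompletion (maximalIdeal R) R)) := fun n y => by
    rw [← Algebra.smul_def]
    exact Submodule.smul_mem_smul (Ideal.pow_mem_pow hs n) trivial
  have hsplit : ∀ (f : ℕ → AdicCompletion (maximalIdeal R) R) (n m : ℕ),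
      ∑ i ∈ Finset.range (n + m), algebraMap R _ (s ^ i) * f i =
        ∑ i ∈ Finset.range n, algebraMap R _ (s ^ i) * f i +
          algebraMap R _ (s ^ n) * ∑ i ∈ Finset.range m, algebraMap R _ (s ^ i) * f (n + i) := by
    intro f n m
    rw [Finset.sum_range_add, Finset.mul_sum]
    congr 1
    refine Finset.sum_congr rfl fun i _ => ?_
    rw [pow_add, map_mul, mul_assoc]
  have hlim : ∀ f : ℕ → AdicCompletion (maximalIdeal R) R, ∃ x, ∀ n,
      x - ∑ i ∈ Finset.range n, algebraMap R _ (s ^ i) * f i ∈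
        (maximalIdeal R ^ n • ⊤ : Submodule R (AdicCompletion (maximalIdeal R) R)) := by
    intro f
    obtain ⟨x, hx⟩ := IsPrecomplete.prec hcomp.toIsPrecomplete
      (f := fun n => ∑ i ∈ Finset.range n, algebraMap R _ (s ^ i) * f i) (by
        intro m n hmn
        obtain ⟨r, rfl⟩ := Nat.exists_eq_add_of_le hmn
        rw [SModEq.sub_mem, hsplit, sub_add_cancel_left]
        exact neg_mem (hmem m _))
    refine ⟨x, fun n => ?_⟩
    exact SModEq.sub_mem.1 (hx n).symm
  obtain ⟨x, hx⟩ := hlim o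
  refine ⟨x, fun n => ?_⟩
  obtain ⟨y, hy⟩ := hlim fun i => o (n + i)
  refine ⟨y, sub_eq_zero.1 (IsHausdorff.haus (I := maximalIdeal R) inferInstance _ fun m => ?_)⟩
  rw [SModEq.zero]
  have h1 := Submodule.smul_mono_left (Ideal.pow_le_pow_right (Nat.le_add_left m n)) (hx (n + m))
  have h2 := Submodule.smul_mem _ (s ^ n) (hy m)
  have := sub_mem h1 h2
  rw [hsplit, Algebra.smul_def] at this
  convert! this using 1
  ring

end Completion

section Tensor

open IsLocalRing

variable {R K : Type*} [CommRing R] [IsDomain R] [IsLocalRing R] [IsNoetherianRing R]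
  [Ring.DimensionLEOne R] [Field K] [Algebra R K] [IsFractionRing R K]

/-- The completed local ring in its ring of fractions. -/
abbrev inclCompletion (R K : Type*) [CommRing R] [IsLocalRing R] [Field K] [Algebra R K] :
    AdicCompletion (maximalIdeal R) R →ₐ[R] K ⊗[R] AdicCompletion (maximalIdeal R) R :=
  Algebra.TensorProduct.includeRight

lemma inclCompletion_injective : Function.Injective (inclCompletion R K) :=
  Algebra.TensorProduct.includeRight_injective (IsFractionRing.injective R K)

lemma exists_pow_mul_mem {s : R} (hs : s ∈ maximalIdeal R)
    (x : K ⊗[R] AdicCompletion (maximalIdeal R) R) :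
    ∃ n : ℕ, algebraMap R _ (s ^ n) * x ∈ (inclCompletion R K).range := by
  induction x with
  | zero => exact ⟨0, by rw [mul_zero]; exact zero_mem _⟩
  | add x y hx hy =>
    obtain ⟨m, hm⟩ := hx
    obtain ⟨n, hn⟩ := hy
    refine ⟨m + n, ?_⟩
    rw [mul_add]
    refine add_mem ?_ ?_
    · rw [pow_add, map_mul, mul_right_comm]
      exact mul_mem hm (Subalgebra.algebraMap_mem _ _)
    · rw [pow_add, map_mul, mul_assoc]
      exact mul_mem (Subalgebra.algebraMap_mem _ _) hn
  | tmul f o =>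
    obtain ⟨a, b, hb, rfl⟩ := IsFractionRing.div_surjective (A := R) f
    obtain ⟨N, hN⟩ := exists_maximalIdeal_pow_le (nonZeroDivisors.ne_zero hb)
    obtain ⟨r, hr⟩ := Ideal.mem_span_singleton.1 (hN (Ideal.pow_mem_pow hs N))
    refine ⟨N, algebraMap R _ (r * a) * o, ?_⟩
    have hb' : algebraMap R K b ≠ 0 := IsFractionRing.to_map_ne_zero_of_mem_nonZeroDivisors hb
    have h1 : algebraMap R (K ⊗[R] AdicCompletion (maximalIdeal R) R) (s ^ N) *
        ((algebraMap R K a / algebraMap R K b) ⊗ₜ o) = algebraMap R K (r * a) ⊗ₜ o := by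
      rw [Algebra.TensorProduct.algebraMap_apply, Algebra.TensorProduct.tmul_mul_tmul, one_mul, hr]
      congr 1
      rw [map_mul, map_mul]
      field_simp
    rw [h1, ← Algebra.smul_def]
    change 1 ⊗ₜ ((r * a) • o) = _
    rw [TensorProduct.tmul_smul, TensorProduct.smul_tmul', Algebra.smul_def, mul_one]

lemma exists_algebraMap_eq_of_mem {f : K}
    (hf : (f ⊗ₜ 1 : K ⊗[R] AdicCompletion (maximalIdeal R) R) ∈ (inclCompletion R K).range) :
    ∃ a, algebraMap R K a = f := by
  obtain ⟨a, b, hb, rfl⟩ := IsFractionRing.div_surjective (A := R) f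
  have hb' : algebraMap R K b ≠ 0 := IsFractionRing.to_map_ne_zero_of_mem_nonZeroDivisors hb
  obtain ⟨y, hy⟩ := hf
  have h1 : inclCompletion R K (algebraMap R _ a) = inclCompletion R K (algebraMap R _ b * y) := by
    rw [map_mul]
    refine Eq.trans ?_ (congrArg _ hy.symm)
    rw [AlgHom.commutes, AlgHom.commutes, Algebra.TensorProduct.algebraMap_apply,
      Algebra.TensorProduct.algebraMap_apply, Algebra.TensorProduct.tmul_mul_tmul, one_mul,
      mul_div_cancel₀ _ hb']
  obtain ⟨r, rfl⟩ := dvd_of_algebraMap_eq_mul (nonZeroDivisors.ne_zero hb)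
    (inclCompletion_injective h1)
  exact ⟨r, by rw [map_mul, mul_div_cancel_left₀ _ hb']⟩

end Tensor

section LocalField

variable {k : Type u} [Field k] [Fintype k] {X : Scheme.{u}} [IsIntegral X] (π : X ⟶ ProjLine k)
  [Surjective π]

/-- The function `1 / t` in the completion at a point above `∞`. -/
def tInvLocal {z : X} (hz : z ∉ finitePart π) : LocalField π z :=
  toLocalField π z (algebraMap _ _ (tInvStalk π hz))

variable [IsLocallyNoetherian X] [SmoothOfRelativeDimension 1 (toK π)]

lemma tInvStalk_ne_zero {z : X} (hz : z ∉ finitePart π) : tInvStalk π hz ≠ 0 := by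
  intro h
  have := tField_mul_tInvStalk π hz
  rw [h, map_zero, mul_zero] at this
  exact zero_ne_one this

lemma expSetting {z : X} (hz : z ∉ finitePart π) :
    ExpSetting (integers π z) (toLocalField π z (tField π)) (tInvLocal π hz)
      (fun i => toLocalField π z (expCoeff (tField π) (Fintype.card k) i)) (Fintype.card k) := by
  have hdim := dimensionLEOne_stalk (toK π) z
  have hs : tInvStalk π hz ∈ IsLocalRing.maximalIdeal (X.presheaf.stalk z) :=
    not_isUnit_tInvStalk π hz
  let ι : CompletedStalk z →+* LocalField π z :=
    (inclCompletion (X.presheaf.stalk z) X.functionField).toRingHom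
  have hcomm : ∀ a : X.presheaf.stalk z,
      ι (algebraMap _ _ a) = toLocalField π z (algebraMap _ _ a) :=
    (inclCompletion (X.presheaf.stalk z) X.functionField).commutes
  have hι : Function.Injective ι := inclCompletion_injective
  have hpow : ∀ n, tInvLocal π hz ^ n = ι (algebraMap _ _ (tInvStalk π hz ^ n)) := by
    intro n
    rw [map_pow, map_pow]
    exact congrArg (· ^ n) (hcomm (tInvStalk π hz)).symm
  have hts : toLocalField π z (tField π) * tInvLocal π hz = 1 := by
    rw [tInvLocal, ← map_mul, tField_mul_tInvStalk, map_one]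
  exact
  { s_mem := toLocalField_mem π z _
    t_mul_s := hts
    two_le := Fintype.one_lt_card
    add_pow := map_add (frobLinear k (LocalField π z))
    sub_pow := map_sub (frobLinear k (LocalField π z))
    sum_pow := fun f m => map_sum (frobLinear k (LocalField π z)) f _
    unit := fun n hn => by
      have h1 : IsUnit (1 - tInvStalk π hz ^ n) :=
        (IsLocalRing.isUnit_or_isUnit_one_sub_self _).resolve_left
          fun h => not_isUnit_tInvStalk π hz ((isUnit_pow_iff hn).1 h)
      obtain ⟨v, hv⟩ := isUnit_iff_exists_inv.1 h1
      refine ⟨toLocalField π z (algebraMap _ _ v), toLocalField_mem π z v, ?_⟩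
      rw [tInvLocal, ← map_pow, ← map_pow, ← map_one (toLocalField π z),
        ← map_one (algebraMap (X.presheaf.stalk z) _), ← map_sub, ← map_sub, ← map_mul, ← map_mul, hv]
    e_zero := map_one _
    e_succ := fun i => by
      rw [← map_pow, ← map_sub, ← map_mul, ← map_pow]
      congr 1
      refine div_mul_cancel₀ _ (tField_pow_ne π hz ?_)
      calc 2 ≤ Fintype.card k := Fintype.one_lt_card
        _ = Fintype.card k ^ 1 := (pow_one _).symm
        _ ≤ _ := Nat.pow_le_pow_right Fintype.card_pos (Nat.succ_le_succ (Nat.zero_le i))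
    separated := fun x hx => by
      have hx' : ∀ n, ∃ y, x = ι (algebraMap _ _ (tInvStalk π hz ^ n) * y) := by
        intro n
        obtain ⟨_, ⟨y, rfl⟩, hy⟩ := hx (n + 1)
        refine ⟨y, hy.trans ?_⟩
        rw [map_mul, ← hpow, pow_succ', ← mul_assoc, hts, one_mul]
        rfl
      obtain ⟨y, hy⟩ := hx' 0
      rw [hy, eq_zero_of_forall_eq_pow_mul hs (x := algebraMap _ _ (tInvStalk π hz ^ 0) * y)
        fun n => ?_, map_zero]
      obtain ⟨y', hy'⟩ := hx' n
      exact ⟨y', hι (hy.symm.trans hy')⟩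
    complete := fun a ha => by
      choose o ho ho' using ha
      choose b hb using ho
      obtain ⟨x, hx⟩ := exists_sum_pow_mul hs b
      refine ⟨toLocalField π z (tField π) * ι x, fun m => ?_⟩
      obtain ⟨y, hy⟩ := hx m
      refine ⟨ι y, ⟨y, rfl⟩, ?_⟩
      have hsum : ∑ i ∈ Finset.range m, a i = toLocalField π z (tField π) *
          ι (∑ i ∈ Finset.range m, algebraMap _ _ (tInvStalk π hz ^ i) * b i) := by
        rw [map_sum, Finset.mul_sum]
        refine Finset.sum_congr rfl fun i _ => ?_
        rw [ho', map_mul, ← hpow, mul_assoc, ← hb]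
        rfl
      rw [hsum, hy, map_add, map_mul, hpow]
      ring }

lemma exists_pow_mul_mem_integers {z : X} (hz : z ∉ finitePart π) (x : LocalField π z) :
    ∃ n : ℕ, tInvLocal π hz ^ n * x ∈ integers π z := by
  have hdim := dimensionLEOne_stalk (toK π) z
  obtain ⟨n, y, hy⟩ := exists_pow_mul_mem (K := X.functionField)
    (show tInvStalk π hz ∈ IsLocalRing.maximalIdeal _ from not_isUnit_tInvStalk π hz) x
  refine ⟨n, y, hy.trans ?_⟩
  rw [map_pow]
  rfl

lemma exists_algebraMap_eq_of_mem_integers {z : X} {f : X.functionField}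
    (hf : toLocalField π z f ∈ integers π z) :
    ∃ a : X.presheaf.stalk z, algebraMap _ _ a = f := by
  have hdim := dimensionLEOne_stalk (toK π) z
  obtain ⟨y, hy⟩ := hf
  exact exists_algebraMap_eq_of_mem ⟨y, hy⟩

lemma exists_sub_mem_integers {z : X} (hz : z ∉ finitePart π) {x : LocalField π z}
    (hx : x ∈ integers π z) :
    ∃ a : X.presheaf.stalk z, ∃ y ∈ integers π z,
      x = toLocalField π z (algebraMap _ _ a) + tInvLocal π hz * y := by
  have hdim := dimensionLEOne_stalk (toK π) z
  let ι : CompletedStalk z →+* LocalField π z :=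
    (inclCompletion (X.presheaf.stalk z) X.functionField).toRingHom
  have hcomm : ∀ a : X.presheaf.stalk z,
      ι (algebraMap _ _ a) = toLocalField π z (algebraMap _ _ a) :=
    (inclCompletion (X.presheaf.stalk z) X.functionField).commutes
  obtain ⟨x, rfl⟩ := hx
  obtain ⟨a, y, rfl⟩ := exists_eq_add_mul (tInvStalk_ne_zero π hz) x
  refine ⟨a, ι y, ⟨y, rfl⟩, ?_⟩
  change ι _ = _
  rw [map_add, map_mul, hcomm, hcomm]
  rfl

end LocalField

end Carlitz
end

noncomputable section

namespace Carlitz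

open Polynomial QCoh Opposite


section Cylinder

variable {k : Type u} [Field k] {S : Scheme.{u}} (p : S ⟶ Spec (CommRingCat.of k))

instance [IsSeparated p] : IsSeparated (prA p) :=
  inferInstanceAs (IsSeparated (pullback.snd p _))

instance : IsAffineHom (prS p) :=
  have : IsAffineHom (Spec.map (CommRingCat.ofHom (C : k →+* k[X]))) :=
    isAffineHom_of_isAffine _
  MorphismProperty.of_isPullback (P := @IsAffineHom)
    (IsPullback.of_hasPullback p (Spec.map (CommRingCat.ofHom (C : k →+* k[X])))).flip this

lemma isAffineHom_timesA [IsSeparated p] {Z : Scheme.{u}} [IsAffine Z]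
    (g : Z ⟶ timesA p) : IsAffineHom g :=
  have : IsAffineHom (g ≫ prA p) := inferInstance
  IsAffineHom.of_comp g (prA p)

/-- The polynomials over functions on `U`, as functions on the preimage of `U`. -/
def cylPoly (U : S.Opens) : Γ(S, U)[X] →+* Γ(timesA p, cyl p U) :=
  eval₂RingHom ((prS p).app U).hom (res le_top (coeffA p X))

lemma isPullback_cyl (U : S.Opens) :
    IsPullback (prS p ∣_ U) ((cyl p U).ι ≫ prA p) (U.ι ≫ p)
      (Spec.map (CommRingCat.ofHom (C : k →+* k[X]))) :=
  (isPullback_morphismRestrict (prS p) U).paste_vert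
    (IsPullback.of_hasPullback p (Spec.map (CommRingCat.ofHom (C : k →+* k[X]))))

lemma isPushout_cyl {U : S.Opens} (hU : IsAffineOpen U) :
    IsPushout (CommRingCat.ofHom (scalars p U)) (CommRingCat.ofHom (C : k →+* k[X]))
      ((prS p).app U) (CommRingCat.ofHom ((res (le_top : cyl p U ≤ ⊤)).comp (coeffA p))) := by
  have : IsAffine U := hU
  refine (isPushout_appTop_of_isPullback (isPullback_cyl p U)).of_iso
    (Scheme.ΓSpecIso (CommRingCat.of k)) U.topIso (Scheme.ΓSpecIso (CommRingCat.of k[X]))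
    (cyl p U).topIso ?_ ?_ ?_ ?_
  · rw [← Iso.inv_comp_eq]
    refine CommRingCat.hom_ext (RingHom.ext fun a => ?_)
    exact res_res (U.ι_image_le ⊤ |>.trans le_top) U.ι_image_top.ge
      (p.appTop ((Scheme.ΓSpecIso (CommRingCat.of k)).inv a))
  · exact Scheme.ΓSpecIso_naturality _
  · refine CommRingCat.hom_ext (RingHom.ext fun a => ?_)
    have hle : (cyl p U).ι ''ᵁ (prS p ∣_ U) ⁻¹ᵁ ⊤ ≤ prS p ⁻¹ᵁ (U.ι ''ᵁ ⊤) :=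
      ((cyl p U).ι_image_le _).trans ((prS p).preimage_mono U.ι_image_top.ge)
    have h1 : (prS p ∣_ U).appTop a = res hle ((prS p).app (U.ι ''ᵁ ⊤) a) :=
      congr($(morphismRestrict_appTop (prS p) U) a)
    refine (congrArg (res (cyl p U).ι_image_top.ge) h1).trans ?_
    refine (res_res hle _ _).trans ?_
    exact (app_res (prS p) U.ι_image_top.ge a).symm
  · rw [← Iso.inv_comp_eq]
    refine CommRingCat.hom_ext (RingHom.ext fun a => ?_)
    exact res_res ((cyl p U).ι_image_le ⊤ |>.trans le_top) (cyl p U).ι_image_top.ge (coeffA p a)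

lemma cylPoly_bijective {U : S.Opens} (hU : IsAffineOpen U) :
    Function.Bijective (cylPoly p U) := by
  algebraize [scalars p U]
  let _ : Algebra k[X] Γ(S, U)[X] := Polynomial.algebra k Γ(S, U)
  let e := (CommRingCat.isPushout_of_isPushout k Γ(S, U) k[X] Γ(S, U)[X]).isoIsPushout _ _
    (isPushout_cyl p hU)
  have he : e.hom.hom = cylPoly p U := by
    refine Polynomial.ringHom_ext (fun a => ?_) ?_
    · refine Eq.trans ?_ (eval₂_C _ _).symm
      exact congr($(IsPushout.inl_isoIsPushout_hom _ _
        (CommRingCat.isPushout_of_isPushout k Γ(S, U) k[X] Γ(S, U)[X]) (isPushout_cyl p hU)) a)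
    · refine Eq.trans ?_ (eval₂_X _ _).symm
      have h := congr($(IsPushout.inr_isoIsPushout_hom _ _
        (CommRingCat.isPushout_of_isPushout k Γ(S, U) k[X] Γ(S, U)[X]) (isPushout_cyl p hU)) 
          (X : k[X]))
      refine Eq.trans ?_ h
      exact congrArg e.hom (Polynomial.map_X _).symm
  have := e.commRingCatIsoToRingEquiv.bijective
  rw [← he]
  exact this

end Cylinder

section Cover

variable {k : Type u} [Field k] {X : Scheme.{u}} (π : X ⟶ ProjLine k)
  [IsIntegral X] [Surjective π] [SmoothOfRelativeDimension 1 (toK π)] [IsProper (toK π)]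

lemma goodCover : GoodCover (toK π) (finitePart π) (infinitePart π) where
  affineHom := inferInstance
  affine₁ := (isAffineOpen_finitePart π).preimage (prS (toK π))
  affine₂ := (isAffineOpen_infinitePart π).preimage (prS (toK π))
  affine₁₂ := (isAffineOpen_finitePart_inf π).preimage (prS (toK π))
  cover := congrArg (cyl (toK π)) (finitePart_sup_infinitePart π)
  affineHom₁ := 
    have : IsAffine (cyl (toK π) (finitePart π)) :=
      (isAffineOpen_finitePart π).preimage (prS (toK π))
    isAffineHom_timesA _ _
  affineHom₂ := 
    have : IsAffine (cyl (toK π) (infinitePart π)) :=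
      (isAffineOpen_infinitePart π).preimage (prS (toK π))
    isAffineHom_timesA _ _

end Cover
end Carlitz
end

noncomputable section

namespace Carlitz

open Polynomial QCoh Opposite

lemma app_of_eq {Y Z : Scheme.{u}} {F F' : Z ⟶ Y} (h : F = F') {V : Y.Opens} (r : Γ(Y, V))
    (hle : F' ⁻¹ᵁ V ≤ F ⁻¹ᵁ V) : F'.app V r = res hle (F.app V r) := by
  subst h
  rw [res_self]

lemma subsingleton_of_eq_bot {Y : Scheme.{u}} (M : Y.Modules) {V : Y.Opens} (hV : V = ⊥) :
    Subsingleton Γ(M, V) :=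
  ⟨fun _ _ => eq_of_sres M (W := fun e : PEmpty.{1} => e.elim) (by simp [hV]) (fun e => e.elim)
    fun e => e.elim⟩

section SpecFun

/-- A ring element as a function on an open set of its spectrum. -/
def specFun {R : CommRingCat.{u}} (V : (Spec R).Opens) : R →+* Γ(Spec R, V) :=
  (res le_top).comp (Scheme.ΓSpecIso R).inv.hom

lemma res_specFun {R : CommRingCat.{u}} {V W : (Spec R).Opens} (h : W ≤ V) (a : R) :
    res h (specFun V a) = specFun W a :=
  res_res _ _ _

lemma app_specFun {R R' : CommRingCat.{u}} (f : R ⟶ R') (V : (Spec R).Opens) (a : R) :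
    (Spec.map f).app V (specFun V a) = specFun _ (f a) := by
  refine (app_res_top (Spec.map f) V _).trans (congrArg (res le_top) ?_)
  exact congr($((Scheme.ΓSpecIso_inv_naturality f).symm) a)

lemma specFun_top {R : CommRingCat.{u}} (a : R) : specFun ⊤ a = (Scheme.ΓSpecIso R).inv a :=
  res_self le_rfl ((Scheme.ΓSpecIso R).inv a)

lemma ΓSpecIso_hom_specFun {R : CommRingCat.{u}} (a : R) :
    (Scheme.ΓSpecIso R).hom (specFun ⊤ a) = a := by
  rw [specFun_top]
  exact congr($((Scheme.ΓSpecIso R).inv_hom_id) a)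

lemma fromSpecStalk_app_apply {X : Scheme.{u}} {U : X.Opens} {x : X} (hx : x ∈ U) (a : Γ(X, U)) :
    (X.fromSpecStalk x).app U a = specFun _ (X.presheaf.germ U x hx a) :=
  congr($(Scheme.fromSpecStalk_app hx) a)

end SpecFun

section Generic

variable {k : Type u} [Field k] {X : Scheme.{u}} [IsIntegral X] (p : X ⟶ Spec (CommRingCat.of k))

/-- The structure map of the function field of a `k`-scheme. -/
def scalarsField : k →+* X.functionField := (toField (Opens.mem_top _)).comp (scalars p ⊤)

lemma fromSpecStalk_comp : X.fromSpecStalk (genericPoint X) ≫ p =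
    Spec.map (CommRingCat.ofHom (scalarsField p)) := by
  apply ext_of_isAffine
  rw [← cancel_epi (Scheme.ΓSpecIso (CommRingCat.of k)).inv]
  refine CommRingCat.hom_ext (RingHom.ext fun a => ?_)
  have h1 := congrArg ((X.fromSpecStalk (genericPoint X)).app ⊤)
    (res_self le_rfl (p.appTop ((Scheme.ΓSpecIso (CommRingCat.of k)).inv a)))
  have h2 := fromSpecStalk_app_apply (Opens.mem_top (genericPoint X)) (scalars p ⊤ a)
  have h3 := app_specFun (CommRingCat.ofHom (scalarsField p)) ⊤ a
  refine h1.symm.trans (h2.trans (h3.symm.trans ?_))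
  exact congrArg (Scheme.Hom.app _ _) (specFun_top (R := CommRingCat.of k) a)

/-- The line over the generic point of `X`. -/
abbrev genericLine (X : Scheme.{u}) [IsIntegral X] : Scheme.{u} :=
  Spec (CommRingCat.of X.functionField[X])

/-- The inclusion of the line over the generic point. -/
def lineIncl : genericLine X ⟶ timesA p :=
  pullback.lift (Spec.map (CommRingCat.ofHom (C : X.functionField →+* X.functionField[X])) ≫
      X.fromSpecStalk (genericPoint X))
    (Spec.map (CommRingCat.ofHom (mapRingHom (scalarsField p)))) (by
      rw [Category.assoc, fromSpecStalk_comp, ← Spec.map_comp, ← Spec.map_comp]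
      congr 1
      refine CommRingCat.hom_ext (RingHom.ext fun a => ?_)
      exact (Polynomial.map_C (scalarsField p)).symm)

lemma lineIncl_prS : lineIncl p ≫ prS p =
    Spec.map (CommRingCat.ofHom (C : X.functionField →+* X.functionField[X])) ≫
      X.fromSpecStalk (genericPoint X) := pullback.lift_fst _ _ _

lemma lineIncl_prA : lineIncl p ≫ prA p =
    Spec.map (CommRingCat.ofHom (mapRingHom (scalarsField p))) := pullback.lift_snd _ _ _

lemma fromSpecStalk_preimage {U : X.Opens} (hU : genericPoint X ∈ U) :
    X.fromSpecStalk (genericPoint X) ⁻¹ᵁ U = ⊤ := by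
  refine top_le_iff.1 fun x _ => ?_
  have hx : x = IsLocalRing.closedPoint X.functionField :=
    Subsingleton.elim (α := PrimeSpectrum X.functionField) _ _
  change X.fromSpecStalk (genericPoint X) x ∈ U
  rw [hx]
  exact (Scheme.fromSpecStalk_closedPoint (X := X) (x := genericPoint X)).symm ▸ hU

lemma lineIncl_cyl {U : X.Opens} (hU : genericPoint X ∈ U) : ⊤ ≤ lineIncl p ⁻¹ᵁ cyl p U := by
  rw [← Scheme.Hom.comp_preimage, lineIncl_prS, Scheme.Hom.comp_preimage, fromSpecStalk_preimage hU]
  rfl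

/-- Functions on an open set meeting the line over the generic point, as polynomials over the
function field. -/
def toPoly {W : (timesA p).Opens} (hW : ⊤ ≤ lineIncl p ⁻¹ᵁ W) :
    Γ(timesA p, W) →+* X.functionField[X] :=
  ((Scheme.ΓSpecIso (CommRingCat.of X.functionField[X])).hom.hom.comp (res hW)).comp
    ((lineIncl p).app W).hom

lemma toPoly_res {V W : (timesA p).Opens} (h : V ≤ W) (hV : ⊤ ≤ lineIncl p ⁻¹ᵁ V)
    (x : Γ(timesA p, W)) :
    toPoly p hV (res h x) = toPoly p (hV.trans ((lineIncl p).preimage_mono h)) x := by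
  simp only [toPoly, RingHom.comp_apply]
  congr 1
  refine (congrArg (res hV) (app_res (lineIncl p) h x)).trans ?_
  exact res_res _ _ _

lemma toPoly_prS {U : X.Opens} (hU : genericPoint X ∈ U) (a : Γ(X, U)) :
    toPoly p (lineIncl_cyl p hU) ((prS p).app U a) = C (toField hU a) := by
  have h1 := app_of_eq (lineIncl_prS p).symm a (by rw [lineIncl_prS])
  have h2 := fromSpecStalk_app_apply hU a
  have h3 := app_specFun (CommRingCat.ofHom (C : X.functionField →+* X.functionField[X]))
    (X.fromSpecStalk (genericPoint X) ⁻¹ᵁ U) (toField hU a)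
  have h4 := h1.trans (congrArg (res _) ((congrArg (Scheme.Hom.app _ _) h2).trans h3))
  have h5 := (congrArg (res (lineIncl_cyl p hU)) (h4.trans (res_specFun _ _))).trans
    (res_specFun _ _)
  exact (congrArg (Scheme.ΓSpecIso (CommRingCat.of X.functionField[X])).hom h5).trans
    (ΓSpecIso_hom_specFun (R := CommRingCat.of X.functionField[X]) _)

lemma toPoly_coeffA {W : (timesA p).Opens} (hW : ⊤ ≤ lineIncl p ⁻¹ᵁ W) (a : k[X]) :
    toPoly p hW (res le_top (coeffA p a)) = a.map (scalarsField p) := by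
  rw [toPoly_res]
  have h1 := app_of_eq (lineIncl_prA p).symm (specFun ⊤ a) (by rw [lineIncl_prA])
  have h2 := app_specFun (CommRingCat.ofHom (mapRingHom (scalarsField p))) ⊤ a
  have h3 := h1.trans ((congrArg (res _) h2).trans (res_specFun _ _))
  rw [specFun_top (R := CommRingCat.of k[X])] at h3
  have h5 := (congrArg (res (le_top : (⊤ : (genericLine X).Opens) ≤ ⊤)) h3).trans (res_specFun _ _)
  exact (congrArg (Scheme.ΓSpecIso (CommRingCat.of X.functionField[X])).hom h5).trans
    (ΓSpecIso_hom_specFun (R := CommRingCat.of X.functionField[X]) _)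

lemma toPoly_cylPoly {U : X.Opens} (hU : genericPoint X ∈ U) (P : Γ(X, U)[X]) :
    toPoly p (lineIncl_cyl p hU) (cylPoly p U P) = P.map (toField hU) := by
  induction P using Polynomial.induction_on' with
  | add P Q hP hQ => rw [map_add, map_add, hP, hQ, Polynomial.map_add]
  | monomial n a =>
    rw [← C_mul_X_pow_eq_monomial, map_mul, map_pow, map_mul, map_pow, Polynomial.map_mul,
      Polynomial.map_pow, map_C, map_X]
    have h1 : toPoly p (lineIncl_cyl p hU) (cylPoly p U (C a)) = C (toField hU a) :=
      (congrArg _ (eval₂_C _ _)).trans (toPoly_prS p hU a)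
    have h2 : toPoly p (lineIncl_cyl p hU) (cylPoly p U Polynomial.X) = Polynomial.X :=
      (congrArg _ (eval₂_X _ _)).trans ((toPoly_coeffA p _ Polynomial.X).trans (map_X _))
    rw [h1, h2]

lemma toField_injective {U : X.Opens} (hU : genericPoint X ∈ U) : Function.Injective (toField hU) :=
  have : Nonempty U := ⟨⟨_, hU⟩⟩
  X.germToFunctionField_injective U

lemma toPoly_injective {U : X.Opens} (hU : genericPoint X ∈ U) :
    Function.Injective (toPoly p (lineIncl_cyl p hU)) := by
  refine (injective_iff_map_eq_zero _).2 fun x hx => ?_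
  choose V hV hz hVU using fun z : U => exists_isAffineOpen_mem_and_subset (x := z.1) (U := U) z.2
  refine eq_of_res (W := fun z : U => cyl p (V z))
    (fun y hy => Opens.mem_iSup.2 ⟨⟨prS p y, hy⟩, hz _⟩) (fun z => cyl_mono (hVU z)) fun z => ?_
  rw [map_zero]
  obtain ⟨P, hP⟩ := (cylPoly_bijective p (hV z)).2 (res (cyl_mono (hVU z)) x)
  have h1 := toPoly_res p (cyl_mono (hVU z)) (lineIncl_cyl p (generic_mem (hz z))) x
  rw [hx, ← hP, toPoly_cylPoly p (generic_mem (hz z))] at h1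
  rw [← hP, (Polynomial.map_eq_zero_iff (toField_injective _)).1 h1, map_zero]

end Generic
end Carlitz
end

noncomputable section

namespace Carlitz

open Polynomial QCoh Opposite

lemma timesA_hom_ext {k : Type u} [Field k] {S : Scheme.{u}} {p : S ⟶ Spec (CommRingCat.of k)}
    {Z : Scheme.{u}} {f g : Z ⟶ timesA p} (h : f ≫ prS p = g ≫ prS p)
    (h' : f ≫ prA p = g ≫ prA p) : f = g :=
  pullback.hom_ext h h'

section GenericFrobenius

variable {k : Type u} [Field k] [Fintype k] {X : Scheme.{u}} [IsIntegral X]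
  (p : X ⟶ Spec (CommRingCat.of k))

/-- The `q`-power Frobenius of the function field. -/
def frobField : X.functionField →+* X.functionField := frobRingHom k (scalarsField p)

lemma frobField_apply (x : X.functionField) : frobField p x = x ^ Fintype.card k := rfl

lemma frobField_scalarsField (a : k) : frobField p (scalarsField p a) = scalarsField p a := by
  rw [frobField_apply, ← map_pow, FiniteField.pow_card]

lemma fromSpecStalk_frob : X.fromSpecStalk (genericPoint X) ≫ frob p =
    Spec.map (CommRingCat.ofHom (frobField p)) ≫ X.fromSpecStalk (genericPoint X) := by
  refine (Scheme.SpecMap_stalkMap_fromSpecStalk (frob p) (x := genericPoint X)).symm.trans ?_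
  congr 2
  refine CommRingCat.hom_ext (RingHom.ext fun a => ?_)
  obtain ⟨U, hU, f, rfl⟩ := X.presheaf.exists_germ_eq (x := genericPoint X) a
  refine (Scheme.Hom.germ_stalkMap_apply (frob p) U (genericPoint X) hU f).trans ?_
  exact map_pow (X.presheaf.germ U (genericPoint X) hU).hom f _

/-- The Frobenius acting on the coefficients of polynomials over the function field. -/
abbrev frobPoly : X.functionField[X] →+* X.functionField[X] := mapRingHom (frobField p)

/-- The base change of the Frobenius to the line over the generic point. -/
def frobLine : genericLine X ⟶ genericLine X :=
  Spec.map (CommRingCat.ofHom (frobPoly p))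

lemma frobLine_comp : frobLine p ≫ lineIncl p = lineIncl p ≫ frobA p := by
  refine timesA_hom_ext ?_ ?_
  · rw [Category.assoc, Category.assoc, frobA_prS, ← Category.assoc (lineIncl p), lineIncl_prS,
      Category.assoc _ _ (frob p), fromSpecStalk_frob, ← Category.assoc, ← Category.assoc]
    congr 1
    rw [frobLine, ← Spec.map_comp, ← Spec.map_comp]
    congr 1
    refine CommRingCat.hom_ext (RingHom.ext fun a => ?_)
    exact Polynomial.map_C (frobField p)
  · rw [Category.assoc, Category.assoc, frobA_prA, lineIncl_prA, frobLine, ← Spec.map_comp]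
    congr 1
    refine CommRingCat.hom_ext (RingHom.ext fun a => ?_)
    refine (Polynomial.map_map _ _ _).trans ?_
    congr 1
    exact RingHom.ext (frobField_scalarsField p)

lemma frobLine_preimage (V : (timesA p).Opens) :
    lineIncl p ⁻¹ᵁ frobA p ⁻¹ᵁ V = frobLine p ⁻¹ᵁ lineIncl p ⁻¹ᵁ V := by
  rw [← Scheme.Hom.comp_preimage, ← Scheme.Hom.comp_preimage, frobLine_comp]

lemma lineIncl_app_frobA (V : (timesA p).Opens) (r : Γ(timesA p, V)) :
    (lineIncl p).app (frobA p ⁻¹ᵁ V) ((frobA p).app V r) =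
      res (frobLine_preimage p V).le ((frobLine p).app _ ((lineIncl p).app V r)) :=
  app_of_eq (frobLine_comp p) r _

lemma toPoly_frobA {V W : (timesA p).Opens} (hV : ⊤ ≤ lineIncl p ⁻¹ᵁ V)
    (hW : ⊤ ≤ lineIncl p ⁻¹ᵁ W) (h : W ≤ frobA p ⁻¹ᵁ V) (r : Γ(timesA p, V)) :
    toPoly p hW (res h ((frobA p).app V r)) = frobPoly p (toPoly p hV r) := by
  rw [toPoly_res]
  have h1 := congrArg (res (hW.trans ((lineIncl p).preimage_mono h))) (lineIncl_app_frobA p V r)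
  rw [res_res] at h1
  have h2 : res hV ((lineIncl p).app V r) = specFun ⊤ (toPoly p hV r) := by
    rw [specFun_top]
    exact congr($((Scheme.ΓSpecIso (CommRingCat.of X.functionField[X])).hom_inv_id)
      (res hV ((lineIncl p).app V r))).symm
  have h3 := app_specFun (CommRingCat.ofHom (frobPoly p)) ⊤ (toPoly p hV r)
  have h4 := (app_res (frobLine p) hV _).symm.trans ((congrArg ((frobLine p).app ⊤) h2).trans h3)
  have h5 := h1.trans h4
  refine (congrArg (Scheme.ΓSpecIso (CommRingCat.of X.functionField[X])).hom h5).trans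
    (ΓSpecIso_hom_specFun (R := CommRingCat.of X.functionField[X]) _)

/-- The direct image of the structure sheaf of the line over the generic point. -/
def lineSheaf : (timesA p).Modules :=
  (Scheme.Modules.pushforward (lineIncl p)).obj (structureSheaf (genericLine X))

lemma lineSheaf_qcoh [IsSeparated p] : qcoh _ (lineSheaf p) :=
  have := isAffineHom_timesA p (lineIncl p)
  pushforward_qcoh (lineIncl p) (structureSheaf_qcoh _)

lemma lineSheaf_flasque : ModSheaf.Flasque ((direct p).obj (lineSheaf p)) := by
  intro V U h x
  by_cases hV : genericPoint X ∈ V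
  · let x' : Γ(genericLine X, lineIncl p ⁻¹ᵁ cyl p V) := x
    have hle : lineIncl p ⁻¹ᵁ cyl p U ≤ lineIncl p ⁻¹ᵁ cyl p V :=
      le_top.trans (lineIncl_cyl p hV)
    refine ⟨(res hle x' : Γ(genericLine X, lineIncl p ⁻¹ᵁ cyl p U)), ?_⟩
    exact (res_res hle ((lineIncl p).preimage_mono (cyl_mono h)) x').trans (res_self _ x')
  · have hV' : V = ⊥ := by
      refine le_bot_iff.1 fun z hz => (hV (generic_mem hz)).elim
    have := subsingleton_of_eq_bot (lineSheaf p) (V := cyl p V) (by rw [hV']; rfl)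
    exact ⟨0, Subsingleton.elim (α := Γ(lineSheaf p, cyl p V)) _ _⟩

/-- The Frobenius on the direct image of the structure sheaf of the generic line. -/
def lineFrob : lineSheaf p ⟶ (Scheme.Modules.pushforward (frobA p)).obj (lineSheaf p) :=
  adjMk (f := frobA p) (M := lineSheaf p) (N := lineSheaf p)
    (fun V => ((res (frobLine_preimage p V).le).comp
      ((frobLine p).app (lineIncl p ⁻¹ᵁ V)).hom).toAddMonoidHom)
    (fun V r x => by
      let x' : Γ(genericLine X, lineIncl p ⁻¹ᵁ V) := x
      change ((res (frobLine_preimage p V).le).comp ((frobLine p).app (lineIncl p ⁻¹ᵁ V)).hom)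
        ((lineIncl p).app V r * x') =
          (lineIncl p).app (frobA p ⁻¹ᵁ V) ((frobA p).app V r) * _
      rw [map_mul, lineIncl_app_frobA]
      rfl)
    (fun U V h x => by
      let x' : Γ(genericLine X, lineIncl p ⁻¹ᵁ U) := x
      have h1 := app_res (frobLine p) ((lineIncl p).preimage_mono h) x'
      exact (congrArg (res (frobLine_preimage p V).le) h1).trans ((res_res _ _ _).trans
        (res_res (frobLine_preimage p U).le
          ((lineIncl p).preimage_mono ((frobA p).preimage_mono h)) _).symm))

/-- The shtuka on the line over the generic point with `σ = 0`. -/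
def lineShtuka [IsSeparated p] : Shtuka p :=
  mkShtuka (lineSheaf_qcoh p) (lineSheaf_qcoh p) 0 (lineFrob p)

/-- Functions on `X_A` as functions on the generic line. -/
def toLineSheaf : structureSheaf (timesA p) ⟶ lineSheaf p :=
  ofSection (lineSheaf p) (1 : Γ(genericLine X, lineIncl p ⁻¹ᵁ ⊤))

lemma toLineSheaf_app (W : (timesA p).Opens) (x : Γ(timesA p, W)) :
    (toLineSheaf p).app W (funSec x) = funSec ((lineIncl p).app W x) := by
  refine (ofSection_funSec _ _ W x).trans ?_
  exact (congrArg ((lineIncl p).app W x * ·) (map_one (res _))).trans (mul_one _)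

end GenericFrobenius

section HullHom

variable {k : Type u} [Field k] [Fintype k] {S : Scheme.{u}} {p : S ⟶ Spec (CommRingCat.of k)}

/-- A morphism to a hull is determined by maps that are compatible with `j`. -/
def homHull {N K : Shtuka p} (a : N.obj.M ⟶ K.obj.M) (b : N.obj.M' ⟶ K.obj.M')
    (hσ : K.obj.σ = 0)
    (h : jAdj N.obj ≫ (Scheme.Modules.pushforward (frobA p)).map b = a ≫ jAdj K.obj) :
    N ⟶ hull K :=
  mkShtukaHom (N' := hull K) (biprod.lift a (N.obj.σ ≫ b)) b
    (by
      refine Eq.trans ?_ (biprod.lift_desc (f := a) (g := N.obj.σ ≫ b)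
        (h := K.obj.σ) (i := 𝟙 K.obj.M')).symm
      rw [hσ, Limits.comp_zero, _root_.zero_add]
      exact (Category.comp_id _).symm)
    (by
      refine Eq.trans ?_ (congrArg (biprod.lift a (N.obj.σ ≫ b) ≫ ·) (jAdj_hull K)).symm
      exact h.trans (biprod.lift_fst_assoc a (N.obj.σ ≫ b) (jAdj K.obj)).symm)

lemma mono_homHull {N K : Shtuka p} (a : N.obj.M ⟶ K.obj.M) (b : N.obj.M' ⟶ K.obj.M')
    (hσ : K.obj.σ = 0)
    (h : jAdj N.obj ≫ (Scheme.Modules.pushforward (frobA p)).map b = a ≫ jAdj K.obj)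
    [Mono a] [Mono b] : Mono (homHull a b hσ h) := by
  have : Mono (biprod.lift a (N.obj.σ ≫ b)) :=
    have : Mono (biprod.lift a (N.obj.σ ≫ b) ≫ biprod.fst) := by rwa [biprod.lift_fst]
    mono_of_mono _ biprod.fst
  exact shtuka_mono _ (fun W => injective_of_mono (biprod.lift a (N.obj.σ ≫ b)) W)
    fun W => injective_of_mono b W

end HullHom

end Carlitz
end

noncomputable section

namespace Carlitz

open Polynomial QCoh Opposite

section TwistSections

variable {k : Type u} [Field k] {S : Scheme.{u}} (h : S ⟶ ProjLine k)

/-- The function `f` of a section `(f, g)` of `𝒪(∞)`. -/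
def twFin (V : S.Opens) : Γ(twist h, V) →+ Γ(S, V ⊓ finitePart h) :=
  (AddMonoidHom.fst _ _).comp
    (glueSections (finitePart h) (infinitePart h) (res inf_le_left (tFun h)) V).subtype

/-- The function `g` of a section `(f, g)` of `𝒪(∞)`. -/
def twInf (V : S.Opens) : Γ(twist h, V) →+ Γ(S, V ⊓ infinitePart h) :=
  (AddMonoidHom.snd _ _).comp
    (glueSections (finitePart h) (infinitePart h) (res inf_le_left (tFun h)) V).subtype

lemma tw_eq {V : S.Opens} (x : Γ(twist h, V)) :
    res (inf_le_inf_left V inf_le_left : V ⊓ (finitePart h ⊓ infinitePart h) ≤ _) (twFin h V x) =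
      res (inf_le_right.trans inf_le_left) (tFun h) *
        res (inf_le_inf_left V inf_le_right) (twInf h V x) := by
  have := x.2
  refine Eq.trans this (congrArg (· * _) (res_res _ _ _))

lemma tw_ext {V : S.Opens} {x y : Γ(twist h, V)} (h1 : twFin h V x = twFin h V y)
    (h2 : twInf h V x = twInf h V y) : x = y :=
  Subtype.ext (Prod.ext h1 h2)

lemma exists_tw {V : S.Opens} (f : Γ(S, V ⊓ finitePart h)) (g : Γ(S, V ⊓ infinitePart h))
    (hfg : res (inf_le_inf_left V inf_le_left : V ⊓ (finitePart h ⊓ infinitePart h) ≤ _) f =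
      res (inf_le_right.trans inf_le_left) (tFun h) * res (inf_le_inf_left V inf_le_right) g) :
    ∃ x : Γ(twist h, V), twFin h V x = f ∧ twInf h V x = g :=
  ⟨(⟨(f, g), hfg.trans (congrArg (· * _) (res_res _ _ _).symm)⟩ : glueSections _ _ _ V), rfl, rfl⟩

lemma twFin_smul {V : S.Opens} (r : Γ(S, V)) (x : Γ(twist h, V)) :
    twFin h V (r • x) = res inf_le_left r * twFin h V x := rfl

end TwistSections

section Regular

variable {X : Scheme.{u}} [IsIntegral X]

/-- The elements of the function field that are regular at `z`. -/
def regAt (z : X) : Subring X.functionField :=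
  (algebraMap (X.presheaf.stalk z) X.functionField).range

lemma toField_mem_regAt {U : X.Opens} (hU : genericPoint X ∈ U) (a : Γ(X, U)) {z : X}
    (hz : z ∈ U) : toField hU a ∈ regAt z :=
  ⟨_, (toField_eq hz hU a).symm⟩

lemma exists_open_of_mem_regAt {z : X} {f : X.functionField} (hf : f ∈ regAt z) :
    ∃ (U : X.Opens) (_ : z ∈ U) (hU : genericPoint X ∈ U) (a : Γ(X, U)), toField hU a = f := by
  obtain ⟨a, rfl⟩ := hf
  obtain ⟨U, hz, a, rfl⟩ := X.presheaf.exists_germ_eq a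
  exact ⟨U, hz, generic_mem hz, a, toField_eq hz _ a⟩

lemma exists_toField_eq {U : X.Opens} (hU : genericPoint X ∈ U) {f : X.functionField}
    (hf : ∀ z ∈ U, f ∈ regAt z) : ∃ a, toField hU a = f := by
  choose V hz hV a ha using fun z : U => exists_open_of_mem_regAt (hf z.1 z.2)
  obtain ⟨b, hb⟩ := exists_glue (V := U) (W := fun z : U => V z ⊓ U)
    (fun z hz' => Opens.mem_iSup.2 ⟨⟨z, hz'⟩, hz _, hz'⟩) (fun z => inf_le_right)
    (fun z => res inf_le_left (a z)) (fun i j O h h' => by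
      by_cases hO : genericPoint X ∈ O
      · apply toField_injective hO
        rw [toField_res, toField_res, toField_res, toField_res, ha, ha]
      · have hO' : O = ⊥ := le_bot_iff.1 fun z hz => (hO (generic_mem hz)).elim
        have := subsingleton_of_eq_bot (structureSheaf X) hO'
        exact Subsingleton.elim (α := Γ(structureSheaf X, O)) _ _)
  refine ⟨b, ?_⟩
  have hη : genericPoint X ∈ V ⟨_, hU⟩ ⊓ U := ⟨hV _, hU⟩
  rw [← toField_res inf_le_right hη b, hb ⟨_, hU⟩, toField_res, ha]

variable {k : Type u} [Field k] (p : X ⟶ Spec (CommRingCat.of k))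

lemma coeff_toPoly_mem {U : X.Opens} (hU : genericPoint X ∈ U) (x : Γ(timesA p, cyl p U)) (i : ℕ)
    {z : X} (hz : z ∈ U) : (toPoly p (lineIncl_cyl p hU) x).coeff i ∈ regAt z := by
  obtain ⟨V, hV, hzV, hVU⟩ := exists_isAffineOpen_mem_and_subset (x := z) (U := U) hz
  obtain ⟨P, hP⟩ := (cylPoly_bijective p hV).2 (res (cyl_mono hVU) x)
  have h1 := toPoly_res p (cyl_mono hVU) (lineIncl_cyl p (generic_mem hzV)) x
  rw [← hP, toPoly_cylPoly p (generic_mem hzV)] at h1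
  rw [← h1, coeff_map]
  exact toField_mem_regAt _ _ hzV

lemma exists_toPoly_eq {U : X.Opens} (hU : genericPoint X ∈ U) {P : X.functionField[X]}
    (hP : ∀ i, ∀ z ∈ U, P.coeff i ∈ regAt z) : ∃ x, toPoly p (lineIncl_cyl p hU) x = P := by
  choose a ha using fun i => exists_toField_eq hU (hP i)
  refine ⟨cylPoly p U (∑ i ∈ Finset.range (P.natDegree + 1), monomial i (a i)), ?_⟩
  rw [toPoly_cylPoly p hU, Polynomial.map_sum]
  conv_rhs => rw [P.as_sum_range]
  refine Finset.sum_congr rfl fun i _ => ?_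
  rw [map_monomial, ha]

end Regular

section Twist

variable {k : Type u} [Field k] {X : Scheme.{u}} (π : X ⟶ ProjLine k) [IsIntegral X]
  [Surjective π]

lemma ProjLine.infinite_nonempty (k : Type u) [Field k] : ∃ x, x ∈ infinite k := by
  have h : Nontrivial (HomogeneousLocalization.Away (coordGrading k) (MvPolynomial.X 0)) := by
    refine ⟨⟨0, 1, fun h => ?_⟩⟩
    have h' := congrArg HomogeneousLocalization.val h
    rw [HomogeneousLocalization.val_zero, HomogeneousLocalization.val_one] at h'
    have : IsDomain (Localization.Away (MvPolynomial.X 0 : MvPolynomial (Fin 2) k)) :=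
      IsLocalization.isDomain_localization (powers_le_nonZeroDivisors_of_noZeroDivisors
        (MvPolynomial.X_ne_zero 0))
    exact zero_ne_one h'
  obtain ⟨y⟩ : Nonempty (Spec (CommRingCat.of
    (HomogeneousLocalization.Away (coordGrading k) (MvPolynomial.X 0)))) :=
    inferInstanceAs (Nonempty (PrimeSpectrum _))
  exact ⟨_, (Proj.opensRange_awayι (coordGrading k) (MvPolynomial.X 0)
    (MvPolynomial.isHomogeneous_X k 0) one_pos).le ⟨y, rfl⟩⟩

lemma generic_mem_infinitePart : genericPoint X ∈ infinitePart π := by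
  obtain ⟨x, hx⟩ := ProjLine.infinite_nonempty k
  obtain ⟨y, rfl⟩ := π.surjective x
  exact generic_mem (V := infinitePart π) hx

lemma tField_mul_toField :
    tField π * toField (generic_mem_infinitePart π) (tInvFun π) = 1 := by
  have h12 : genericPoint X ∈ finitePart π ⊓ infinitePart π :=
    ⟨generic_mem_finitePart π, generic_mem_infinitePart π⟩
  have h := congrArg (toField h12) (tFun_mul_tInvFun π)
  rwa [map_mul, map_one, toField_res, toField_res] at h

lemma tField_ne_zero : tField π ≠ 0 := left_ne_zero_of_mul_eq_one (tField_mul_toField π)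

lemma tField_mem_regAt {z : X} (hz : z ∈ finitePart π) : tField π ∈ regAt z :=
  toField_mem_regAt _ _ hz

lemma inv_tField_mem_regAt {z : X} (hz : z ∈ infinitePart π) : (tField π)⁻¹ ∈ regAt z := by
  rw [← eq_inv_of_mul_eq_one_right (tField_mul_toField π)]
  exact toField_mem_regAt _ _ hz

/-- A section of `𝒪_X(∞) ⊠ A` as a polynomial over the function field. -/
def twPoly {U : X.Opens} (hU : genericPoint X ∈ U) :
    Γ(twistA π, cyl (toK π) U) →+ X.functionField[X] :=
  (toPoly (toK π) (W := cyl (toK π) (U ⊓ finitePart π))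
    (lineIncl_cyl (toK π) ⟨hU, generic_mem_finitePart π⟩)).toAddMonoidHom.comp
      (twFin (prS (toK π) ≫ π) (cyl (toK π) U))

lemma twPoly_sres {U V : X.Opens} (h : V ≤ U) (hV : genericPoint X ∈ V)
    (x : Γ(twistA π, cyl (toK π) U)) :
    twPoly π hV (sres _ (cyl_mono h) x) = twPoly π (h hV) x :=
  toPoly_res (toK π) (cyl_mono (inf_le_inf_right _ h)) _ _

lemma lineIncl_inf_finitePart {U : X.Opens} (hU : genericPoint X ∈ U) :
    ⊤ ≤ lineIncl (toK π) ⁻¹ᵁ (cyl (toK π) U ⊓ finitePart (prS (toK π) ≫ π)) :=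
  lineIncl_cyl (toK π) (U := U ⊓ finitePart π) ⟨hU, generic_mem_finitePart π⟩

lemma lineIncl_inf_infinitePart {U : X.Opens} (hU : genericPoint X ∈ U) :
    ⊤ ≤ lineIncl (toK π) ⁻¹ᵁ (cyl (toK π) U ⊓ infinitePart (prS (toK π) ≫ π)) :=
  lineIncl_cyl (toK π) (U := U ⊓ infinitePart π) ⟨hU, generic_mem_infinitePart π⟩

lemma twPoly_apply {U : X.Opens} (hU : genericPoint X ∈ U) (x : Γ(twistA π, cyl (toK π) U)) :
    twPoly π hU x = toPoly (toK π) (lineIncl_inf_finitePart π hU)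
      (twFin (prS (toK π) ≫ π) (cyl (toK π) U) x) := rfl

lemma twPoly_smul {U : X.Opens} (hU : genericPoint X ∈ U) (r : Γ(timesA (toK π), cyl (toK π) U))
    (x : Γ(twistA π, cyl (toK π) U)) :
    twPoly π hU (r • x) = toPoly (toK π) (lineIncl_cyl _ hU) r * twPoly π hU x := by
  rw [twPoly_apply, twPoly_apply]
  refine (congrArg (toPoly (toK π) (lineIncl_inf_finitePart π hU)) (twFin_smul _ r x)).trans ?_
  rw [map_mul, toPoly_res]

lemma toPoly_tFun {W : (timesA (toK π)).Opens} (hW : ⊤ ≤ lineIncl (toK π) ⁻¹ᵁ W)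
    (h : W ≤ finitePart (prS (toK π) ≫ π)) :
    toPoly (toK π) hW (res h (tFun (prS (toK π) ≫ π))) = C (tField π) := by
  rw [toPoly_res]
  exact toPoly_prS (toK π) (generic_mem_finitePart π) (tFun π)

lemma twPoly_eq {U : X.Opens} (hU : genericPoint X ∈ U) (x : Γ(twistA π, cyl (toK π) U)) :
    twPoly π hU x = C (tField π) * toPoly (toK π) (lineIncl_inf_infinitePart π hU)
      (twInf (prS (toK π) ≫ π) (cyl (toK π) U) x) := by
  have h12 : ⊤ ≤ lineIncl (toK π) ⁻¹ᵁ (cyl (toK π) U ⊓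
      (finitePart (prS (toK π) ≫ π) ⊓ infinitePart (prS (toK π) ≫ π))) :=
    lineIncl_cyl (toK π) (U := U ⊓ (finitePart π ⊓ infinitePart π))
      ⟨hU, generic_mem_finitePart π, generic_mem_infinitePart π⟩
  have h := congrArg (toPoly (toK π) h12)
    (tw_eq (prS (toK π) ≫ π) (V := cyl (toK π) U) x)
  rw [map_mul, toPoly_tFun] at h
  refine (toPoly_res (toK π) _ h12 _).symm.trans (h.trans (congrArg (C (tField π) * ·) ?_))
  exact toPoly_res (toK π) _ h12 _

lemma twPoly_injective {U : X.Opens} (hU : genericPoint X ∈ U) :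
    Function.Injective (twPoly π hU) := by
  intro x y hxy
  refine tw_ext _ ?_ ?_
  · exact toPoly_injective (toK π) (U := U ⊓ finitePart π) ⟨hU, generic_mem_finitePart π⟩ hxy
  · refine toPoly_injective (toK π) (U := U ⊓ infinitePart π) ⟨hU, generic_mem_infinitePart π⟩ ?_
    rw [twPoly_eq, twPoly_eq] at hxy
    exact mul_left_cancel₀ (C_ne_zero.2 (tField_ne_zero π)) hxy

/-- The elements of the function field that are sections of `𝒪(∞)` on `U`. -/
def IsTwist (U : X.Opens) (f : X.functionField) : Prop :=
  ∀ z ∈ U, (z ∈ finitePart π → f ∈ regAt z) ∧ (z ∈ infinitePart π → (tField π)⁻¹ * f ∈ regAt z)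

lemma isTwist_coeff {U : X.Opens} (hU : genericPoint X ∈ U) (x : Γ(twistA π, cyl (toK π) U))
    (i : ℕ) : IsTwist π U ((twPoly π hU x).coeff i) := by
  intro z hz
  refine ⟨fun hz' => ?_, fun hz' => ?_⟩
  · exact coeff_toPoly_mem (toK π) (U := U ⊓ finitePart π) ⟨hU, generic_mem_finitePart π⟩
      (twFin (prS (toK π) ≫ π) (cyl (toK π) U) x) i ⟨hz, hz'⟩
  · rw [twPoly_eq, coeff_C_mul, inv_mul_cancel_left₀ (tField_ne_zero π)]
    exact coeff_toPoly_mem (toK π) (U := U ⊓ infinitePart π) ⟨hU, generic_mem_infinitePart π⟩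
      (twInf (prS (toK π) ≫ π) (cyl (toK π) U) x) i ⟨hz, hz'⟩

lemma exists_twPoly_eq {U : X.Opens} (hU : genericPoint X ∈ U) {P : X.functionField[X]}
    (hP : ∀ i, IsTwist π U (P.coeff i)) : ∃ x, twPoly π hU x = P := by
  obtain ⟨f, hf⟩ : ∃ f, toPoly (toK π) (lineIncl_inf_finitePart π hU) f = P :=
    exists_toPoly_eq (toK π) (U := U ⊓ finitePart π)
    ⟨hU, generic_mem_finitePart π⟩ (P := P) fun i z hz => (hP i z hz.1).1 hz.2
  obtain ⟨g, hg⟩ : ∃ g, toPoly (toK π) (lineIncl_inf_infinitePart π hU) g = C (tField π)⁻¹ * P :=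
    exists_toPoly_eq (toK π) (U := U ⊓ infinitePart π)
    ⟨hU, generic_mem_infinitePart π⟩ (P := C (tField π)⁻¹ * P) fun i z hz => by
      rw [coeff_C_mul]
      exact (hP i z hz.1).2 hz.2
  obtain ⟨x, hx, -⟩ := exists_tw (prS (toK π) ≫ π) (V := cyl (toK π) U) f g (by
    refine toPoly_injective (toK π) (U := U ⊓ (finitePart π ⊓ infinitePart π))
      ⟨hU, generic_mem_finitePart π, generic_mem_infinitePart π⟩ ?_
    have h12 : ⊤ ≤ lineIncl (toK π) ⁻¹ᵁ (cyl (toK π) U ⊓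
        (finitePart (prS (toK π) ≫ π) ⊓ infinitePart (prS (toK π) ≫ π))) :=
      lineIncl_cyl (toK π) (U := U ⊓ (finitePart π ⊓ infinitePart π))
        ⟨hU, generic_mem_finitePart π, generic_mem_infinitePart π⟩
    change toPoly (toK π) h12 _ = toPoly (toK π) h12 _
    rw [map_mul, toPoly_tFun, toPoly_res, toPoly_res]
    refine hf.trans (Eq.trans ?_ (congrArg (C (tField π) * ·) hg.symm))
    rw [← mul_assoc, ← C_mul, mul_inv_cancel₀ (tField_ne_zero π), C_1, one_mul])
  exact ⟨x, (congrArg (toPoly (toK π) (lineIncl_inf_finitePart π hU)) hx).trans hf⟩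

end Twist

section CarlitzShtuka

variable {k : Type u} [Field k] [Fintype k] {X : Scheme.{u}} (π : X ⟶ ProjLine k) [IsIntegral X]
  [Surjective π]

lemma jAdj_carlitz : jAdj (carlitzShtuka π).obj =
    ofSection ((Scheme.Modules.pushforward (frobA (toK π))).obj (twistA π))
      (twistOne (prS (toK π) ≫ π)) :=
  Equiv.apply_symm_apply _ _

/-- The section `1` of `𝒪_X(∞) ⊠ A`. -/
def twistAOne : Γ(twistA π, ⊤) := twistOne (prS (toK π) ≫ π)

/-- The section `t` of `𝒪_X(∞) ⊠ A`. -/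
def twistAT : Γ(twistA π, ⊤) := twistT (prS (toK π) ≫ π)

lemma twPoly_one {U : X.Opens} (hU : genericPoint X ∈ U) :
    twPoly π hU (sres (twistA π) le_top (twistAOne π)) = 1 := by
  rw [twPoly_apply]
  refine (congrArg (toPoly (toK π) (lineIncl_inf_finitePart π hU)) ?_).trans (map_one _)
  exact map_one (res _)

lemma twPoly_t {U : X.Opens} (hU : genericPoint X ∈ U) :
    twPoly π hU (sres (twistA π) le_top (twistAT π)) = C (tField π) := by
  rw [twPoly_apply]
  have h2 : twFin (prS (toK π) ≫ π) (cyl (toK π) U) (sres (twistA π) le_top (twistAT π)) =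
    res inf_le_right (tFun (prS (toK π) ≫ π)) := res_res _ _ _
  exact (congrArg _ h2).trans (toPoly_tFun π _ _)

lemma twPoly_jSec {U : X.Opens} (hU : genericPoint X ∈ U) (x : Γ(timesA (toK π), cyl (toK π) U)) :
    twPoly π hU (jSec (carlitzShtuka π).obj U (funSec x)) =
      frobPoly (toK π) (toPoly (toK π) (lineIncl_cyl _ hU) x) := by
  have h1 : jSec (carlitzShtuka π).obj U (funSec x) =
      (res (frobA_cyl U).ge ((frobA (toK π)).app (cyl (toK π) U) x)) •
        sres (twistA π) (le_top : cyl (toK π) U ≤ ⊤) (twistAOne π) := by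
    have h2 : adjSec (jAdj (carlitzShtuka π).obj) (cyl (toK π) U) (funSec x) =
        (frobA (toK π)).app (cyl (toK π) U) x • sres (twistA π) le_top (twistAOne π) := by
      rw [jAdj_carlitz]
      rfl
    refine (congrArg (sres (twistA π) (frobA_cyl U).ge) h2).trans ?_
    exact (sres_smul (twistA π) _ _ _).trans (congrArg (_ • ·) (sres_sres _ _ _ _))
  refine (congrArg (twPoly π hU) h1).trans ?_
  rw [twPoly_smul, toPoly_frobA _ (lineIncl_cyl _ hU), twPoly_one, mul_one]

lemma twPoly_σ {U : X.Opens} (hU : genericPoint X ∈ U) (x : Γ(timesA (toK π), cyl (toK π) U)) :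
    twPoly π hU ((carlitzShtuka π).obj.σ.app (cyl (toK π) U) (funSec x)) =
      (Polynomial.X - C (tField π)) * toPoly (toK π) (lineIncl_cyl _ hU) x := by
  have h1 : (carlitzShtuka π).obj.σ.app (cyl (toK π) U) (funSec x) =
      x • sres (twistA π) (le_top : cyl (toK π) U ≤ ⊤)
        (coeffA (toK π) Polynomial.X • twistAOne π - twistAT π) := rfl
  refine (congrArg (twPoly π hU) h1).trans ?_
  rw [twPoly_smul, map_sub, map_sub, sres_smul, twPoly_smul, toPoly_coeffA, map_X, twPoly_one,
    twPoly_t, mul_one, mul_comm]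

lemma twPoly_phiSec {U : X.Opens} (hU : genericPoint X ∈ U)
    (x : Γ(timesA (toK π), cyl (toK π) U)) :
    twPoly π hU (phiSec (carlitzShtuka π).obj U (funSec x)) =
      (Polynomial.X - C (tField π)) * toPoly (toK π) (lineIncl_cyl _ hU) x -
        frobPoly (toK π) (toPoly (toK π) (lineIncl_cyl _ hU) x) := by
  refine (map_sub (twPoly π hU) _ _).trans ?_
  rw [← twPoly_σ, ← twPoly_jSec]

end CarlitzShtuka

end Carlitz
end

noncomputable section

namespace Carlitz

open Polynomial QCoh Opposite

section Embedding

variable {k : Type u} [Field k] [Fintype k] {X : Scheme.{u}} (π : X ⟶ ProjLine k) [IsIntegral X]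
  [Surjective π]

lemma lineIncl_finitePart :
    lineIncl (toK π) ⁻¹ᵁ finitePart (prS (toK π) ≫ π) = ⊤ :=
  top_le_iff.1 (lineIncl_cyl (toK π) (generic_mem_finitePart π))

lemma lineIncl_le (W : (timesA (toK π)).Opens) :
    lineIncl (toK π) ⁻¹ᵁ W ≤ lineIncl (toK π) ⁻¹ᵁ (W ⊓ finitePart (prS (toK π) ≫ π)) :=
  le_inf le_rfl (le_top.trans (lineIncl_finitePart π).ge)

/-- Sections of `𝒪_X(∞) ⊠ A` as functions on the generic line. -/
def twistToLine : twistA π ⟶ lineSheaf (toK π) :=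
  adjMk (f := lineIncl (toK π)) (M := twistA π) (N := structureSheaf (genericLine X))
    (fun W => ((res (lineIncl_le π W)).comp ((lineIncl (toK π)).app _).hom).toAddMonoidHom.comp
      (twFin (prS (toK π) ≫ π) W))
    (fun W r x => by
      change ((res (lineIncl_le π W)).comp ((lineIncl (toK π)).app _).hom)
        (res inf_le_left r * twFin (prS (toK π) ≫ π) W x) = _
      rw [map_mul]
      refine congrArg (· * _) ?_
      refine (congrArg (res _) (app_res (lineIncl (toK π)) inf_le_left r)).trans ?_
      exact (res_res _ _ _).trans (res_self _ _))
    (fun U V h x => by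
      refine (congrArg (res _) (app_res (lineIncl (toK π)) (inf_le_inf_right _ h)
        (twFin (prS (toK π) ≫ π) U x))).trans ?_
      exact (res_res _ _ _).trans (res_res _ _ _).symm)

lemma mono_toLineSheaf [IsSeparated (toK π)] : Mono (toLineSheaf (toK π)) := by
  refine mono_of_injective _ (injective_of_cover (structureSheaf_qcoh _) (lineSheaf_qcoh _) _
    fun y => ?_)
  obtain ⟨V, hV, hz, -⟩ := exists_isAffineOpen_mem_and_subset (x := prS (toK π) y)
    (U := ⊤) trivial
  refine ⟨cyl (toK π) V, hz, hV.preimage (prS (toK π)), fun x x' hxx' => ?_⟩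
  refine toPoly_injective (toK π) (generic_mem hz) ?_
  have h : (lineIncl (toK π)).app (cyl (toK π) V) x = (lineIncl (toK π)).app (cyl (toK π) V) x' :=
    (toLineSheaf_app (toK π) _ x).symm.trans (hxx'.trans (toLineSheaf_app (toK π) _ x'))
  exact congrArg (fun w => (Scheme.ΓSpecIso (CommRingCat.of X.functionField[X])).hom
    (res (lineIncl_cyl (toK π) (generic_mem hz)) w)) h

lemma mono_twistToLine [IsSeparated (toK π)] : Mono (twistToLine π) := by
  refine mono_of_injective _ (injective_of_cover (twist_qcoh _) (lineSheaf_qcoh _) _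
    fun y => ?_)
  obtain ⟨V, hV, hz, -⟩ := exists_isAffineOpen_mem_and_subset (x := prS (toK π) y)
    (U := ⊤) trivial
  refine ⟨cyl (toK π) V, hz, hV.preimage (prS (toK π)), fun x x' hxx' => ?_⟩
  refine twPoly_injective π (generic_mem hz) ?_
  have key : ∀ x : Γ(twistA π, cyl (toK π) V), twPoly π (generic_mem hz) x =
      (Scheme.ΓSpecIso (CommRingCat.of X.functionField[X])).hom
        (res (lineIncl_cyl (toK π) (generic_mem hz)) (adjSec (f := lineIncl (toK π))
          (N := structureSheaf (genericLine X)) (twistToLine π) (cyl (toK π) V) x)) := fun x =>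
    congrArg (Scheme.ΓSpecIso (CommRingCat.of X.functionField[X])).hom (res_res _ _ _).symm
  refine (key x).trans (Eq.trans ?_ (key x').symm)
  exact congrArg (fun w => (Scheme.ΓSpecIso (CommRingCat.of X.functionField[X])).hom
    (res (lineIncl_cyl (toK π) (generic_mem hz)) w)) hxx'

lemma jAdj_twistToLine [IsSeparated (toK π)] :
    jAdj (carlitzShtuka π).obj ≫ (Scheme.Modules.pushforward (frobA (toK π))).map (twistToLine π) =
      toLineSheaf (toK π) ≫ jAdj (lineShtuka (toK π)).obj := by
  have h1 : jAdj (lineShtuka (toK π)).obj = lineFrob (toK π) := 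
    jAdj_mkShtuka (lineSheaf_qcoh (toK π)) (lineSheaf_qcoh (toK π)) 0 (lineFrob (toK π))
  rw [h1, jAdj_carlitz]
  refine ofSection_ext ?_
  have h2 := ofSection_one ((Scheme.Modules.pushforward (frobA (toK π))).obj (twistA π))
    (twistOne (prS (toK π) ≫ π))
  refine (congrArg (((Scheme.Modules.pushforward (frobA (toK π))).map (twistToLine π)).app ⊤)
    h2).trans ?_
  refine Eq.trans ?_ (congrArg ((lineFrob (toK π)).app ⊤)
    ((toLineSheaf_app (toK π) ⊤ 1).trans (map_one ((lineIncl (toK π)).app ⊤).hom))).symm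
  have h3 := map_one ((res (lineIncl_le π ⊤)).comp ((lineIncl (toK π)).app _).hom)
  have h4 := map_one ((res (frobLine_preimage (toK π) ⊤).le).comp
      ((frobLine (toK π)).app (lineIncl (toK π) ⁻¹ᵁ ⊤)).hom)
  exact h3.trans h4.symm

/-- The embedding of the Carlitz shtuka in the hull of a shtuka on the generic line. -/
def carlitzToHull [IsSeparated (toK π)] : carlitzShtuka π ⟶ hull (lineShtuka (toK π)) :=
  homHull (N := carlitzShtuka π) (K := lineShtuka (toK π)) (toLineSheaf (toK π)) (twistToLine π) rfl
    (jAdj_twistToLine π)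

lemma mono_carlitzToHull [IsSeparated (toK π)] : Mono (carlitzToHull π) :=
  have : Mono (C := (timesA (toK π)).Modules) (X := (carlitzShtuka π).obj.M)
    (Y := (lineShtuka (toK π)).obj.M) (toLineSheaf (toK π)) := mono_toLineSheaf π
  have : Mono (C := (timesA (toK π)).Modules) (X := (carlitzShtuka π).obj.M')
    (Y := (lineShtuka (toK π)).obj.M') (twistToLine π) := mono_twistToLine π
  mono_homHull (N := carlitzShtuka π) (K := lineShtuka (toK π)) (toLineSheaf (toK π))
    (twistToLine π) rfl (jAdj_twistToLine π)

end Embedding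

section Injective

variable {k : Type u} [Field k] [Fintype k] {X : Scheme.{u}} (π : X ⟶ ProjLine k) [IsIntegral X]
  [Surjective π]

lemma eq_zero_of_mul_sub_map_eq_zero {K : Type*} [Field K] (t : K) (σ : K →+* K) {P : K[X]}
    (h : (Polynomial.X - C t) * P - P.map σ = 0) : P = 0 := by
  by_contra hP
  have h1 := congrArg natDegree (sub_eq_zero.1 h)
  rw [natDegree_mul (X_sub_C_ne_zero t) hP, natDegree_X_sub_C, natDegree_map] at h1
  omega

lemma phiSec_carlitz_injective (U : X.Opens) :
    Function.Injective (phiSec (carlitzShtuka π).obj U) := by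
  refine (injective_iff_map_eq_zero _).2 fun x hx => ?_
  by_cases hU : genericPoint X ∈ U
  · let x' : Γ(timesA (toK π), cyl (toK π) U) := x
    refine toPoly_injective (toK π) hU (a₁ := x') (a₂ := 0) ?_
    rw [map_zero]
    refine eq_zero_of_mul_sub_map_eq_zero (tField π) (frobField (toK π)) ?_
    refine (twPoly_phiSec π hU x').symm.trans ?_
    exact (congrArg (twPoly π hU) hx).trans (map_zero _)
  · have hU' : U = ⊥ := le_bot_iff.1 fun z hz => (hU (generic_mem hz)).elim
    have := subsingleton_of_eq_bot (carlitzShtuka π).obj.M (V := cyl (toK π) U) (by rw [hU']; rfl)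
    exact Subsingleton.elim _ _

attribute [local instance] CategoryTheory.HasExt.standard

lemma subsingleton_ext_zero :
    Subsingleton (Shtuka.Ext (unitShtuka (toK π)) (carlitzShtuka π) 0) := by
  have h : Subsingleton (unitShtuka (toK π) ⟶ carlitzShtuka π) := by
    refine ⟨fun f g => (homUnit _).injective (Subtype.ext ?_)⟩
    refine phiSec_carlitz_injective π ⊤ ?_
    exact (homUnit (carlitzShtuka π) f).2.trans (homUnit (carlitzShtuka π) g).2.symm
  exact Abelian.Ext.homEquiv₀.subsingleton

end Injective

end Carlitz
end

noncomputable section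

namespace Carlitz

open Polynomial QCoh Opposite

section PolySum

variable {K L : Type*} [CommRing K] [AddCommGroup L]

/-- The sum of the elements `Φ ^ i (f P_i)`, where `P_i` are the coefficients of `P`. -/
def polySum (f : K →+ L) (Φ : AddMonoid.End L) : K[X] →+ L :=
  (lsum fun i => ((Φ ^ i : AddMonoid.End L).comp f).toNatLinearMap).toAddMonoidHom

lemma polySum_monomial (f : K →+ L) (Φ : AddMonoid.End L) (n : ℕ) (a : K) :
    polySum f Φ (monomial n a) = (Φ ^ n) (f a) := by
  change (monomial n a).sum (fun i b => (Φ ^ i) (f b)) = _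
  rw [sum_monomial_index _ _ (by rw [map_zero, map_zero])]

lemma polySum_C (f : K →+ L) (Φ : AddMonoid.End L) (a : K) : polySum f Φ (C a) = f a := by
  rw [← monomial_zero_left, polySum_monomial]
  rfl

lemma polySum_X_mul (f : K →+ L) (Φ : AddMonoid.End L) (P : K[X]) :
    polySum f Φ (X * P) = Φ (polySum f Φ P) := by
  induction P using Polynomial.induction_on' with
  | add P Q hP hQ => rw [mul_add, map_add, map_add, map_add, hP, hQ]
  | monomial n a =>
    rw [X_mul_monomial, polySum_monomial, polySum_monomial, pow_succ']
    rfl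

lemma polySum_divX (f : K →+ L) (Φ : AddMonoid.End L) (P : K[X]) :
    polySum f Φ P = Φ (polySum f Φ P.divX) + f (P.coeff 0) := by
  conv_lhs => rw [← X_mul_divX_add P]
  rw [map_add, polySum_X_mul, polySum_C]

lemma polySum_induction (f : K →+ L) (Φ : AddMonoid.End L) (S : AddSubgroup L)
    (hΦ : ∀ x ∈ S, Φ x ∈ S) {P : K[X]} (hP : ∀ i, f (P.coeff i) ∈ S) : polySum f Φ P ∈ S := by
  rw [P.as_sum_range, map_sum]
  refine sum_mem fun i _ => ?_
  rw [polySum_monomial]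
  have : ∀ n : ℕ, ∀ x ∈ S, (Φ ^ n) x ∈ S := by
    intro n
    induction n with
    | zero => exact fun x hx => hx
    | succ n ih =>
      intro x hx
      rw [pow_succ]
      exact ih _ (hΦ x hx)
  exact this i _ (hP i)

lemma polySum_C_mul (f : K →+ L) (Φ : AddMonoid.End L) (a : K) (m : AddMonoid.End L)
    (hf : ∀ x, f (a * x) = m (f x)) (hm : ∀ x, Φ (m x) = m (Φ x)) (P : K[X]) :
    polySum f Φ (C a * P) = m (polySum f Φ P) := by
  have h : ∀ n x, (Φ ^ n) (m x) = m ((Φ ^ n) x) := by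
    intro n
    induction n with
    | zero => exact fun x => rfl
    | succ n ih =>
      intro x
      rw [pow_succ]
      exact (congrArg (Φ ^ n) (hm x)).trans (ih (Φ x))
  induction P using Polynomial.induction_on' with
  | add P Q hP hQ => rw [mul_add, map_add, map_add, map_add, hP, hQ]
  | monomial n b => rw [C_mul_monomial, polySum_monomial, polySum_monomial, hf, h]

lemma coeff_divX_iterate (P : K[X]) (i j : ℕ) : (divX^[i] P).coeff j = P.coeff (j + i) := by
  induction i generalizing j with
  | zero => rfl
  | succ i ih => rw [Function.iterate_succ_apply', coeff_divX, ih]; congr 1; omega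

lemma divX_iterate_eq_zero (P : K[X]) {i : ℕ} (hi : P.natDegree < i) : divX^[i] P = 0 := by
  ext j
  rw [coeff_divX_iterate, coeff_eq_zero_of_natDegree_lt (by omega), coeff_zero]

end PolySum

section Twisted

variable {K : Type*} [CommRing K] (t : K) (σ : K →+* K)

/-- The additive map `x ↦ t x + σ x`. -/
def carlitzOp : AddMonoid.End K := AddMonoidHom.mulLeft t + σ.toAddMonoidHom

lemma carlitzOp_apply (x : K) : carlitzOp t σ x = t * x + σ x := rfl

/-- The value `∑ Φ ^ i (P_i)`, where `Φ x = t x + σ x`. -/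
def carlitzEval : K[X] →+ K := polySum (AddMonoidHom.id K) (carlitzOp t σ)

lemma carlitzEval_X_mul (P : K[X]) :
    carlitzEval t σ (X * P) = carlitzOp t σ (carlitzEval t σ P) :=
  polySum_X_mul _ _ P

lemma carlitzEval_divX (P : K[X]) :
    carlitzEval t σ P = carlitzOp t σ (carlitzEval t σ P.divX) + P.coeff 0 :=
  polySum_divX _ _ P

lemma carlitzEval_C (a : K) : carlitzEval t σ (C a) = a := polySum_C _ _ a

lemma carlitzEval_C_mul {a : K} (ha : σ a = a) (P : K[X]) :
    carlitzEval t σ (C a * P) = a * carlitzEval t σ P :=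
  polySum_C_mul (AddMonoidHom.id K) (carlitzOp t σ) a (AddMonoidHom.mulLeft a : AddMonoid.End K)
    (fun _ => rfl) (fun x => by
      have h : t * (a * x) + σ (a * x) = a * (t * x + σ x) := by
        rw [map_mul, ha]
        ring
      exact h) P

lemma carlitzEval_sub_map (G : K[X]) :
    carlitzEval t σ ((X - C t) * G - G.map σ) = 0 := by
  induction G using Polynomial.induction_on' with
  | add P Q hP hQ =>
    rw [Polynomial.map_add, mul_add, add_sub_add_comm, map_add, hP, hQ, add_zero]
  | monomial n a =>
    have h : (X - C t) * monomial n a - (monomial n a).map σ =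
        monomial (n + 1) a - monomial n (carlitzOp t σ a) := by
      rw [sub_mul, X_mul_monomial, C_mul_monomial, map_monomial, sub_sub, ← map_add]
      rfl
    rw [h, map_sub, carlitzEval, polySum_monomial, polySum_monomial, pow_succ]
    exact sub_self _

lemma carlitzEval_mem (S : Subring K) (ht : t ∈ S) (hσ : ∀ x ∈ S, σ x ∈ S) {P : K[X]}
    (hP : ∀ i, P.coeff i ∈ S) : carlitzEval t σ P ∈ S :=
  polySum_induction (AddMonoidHom.id K) (carlitzOp t σ) S.toAddSubgroup
    (fun x hx => S.add_mem (S.mul_mem ht hx) (hσ x hx)) hP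

/-- The quotient of `P` by the twisted linear polynomial. -/
def carlitzQuot (P : K[X]) : K[X] :=
  ∑ i ∈ Finset.range (P.natDegree + 1), monomial i (carlitzEval t σ (divX^[i + 1] P))

lemma coeff_carlitzQuot (P : K[X]) (i : ℕ) :
    (carlitzQuot t σ P).coeff i = carlitzEval t σ (divX^[i + 1] P) := by
  rw [carlitzQuot, finsetSum_coeff]
  simp only [coeff_monomial]
  rw [Finset.sum_ite_eq']
  split_ifs with h
  · rfl
  · rw [divX_iterate_eq_zero P (by simp at h; omega), map_zero]

lemma eq_of_carlitzEval_eq_zero {P : K[X]} (hP : carlitzEval t σ P = 0) :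
    (X - C t) * carlitzQuot t σ P - (carlitzQuot t σ P).map σ = P := by
  have key : ∀ i, carlitzEval t σ (divX^[i] P) =
      carlitzOp t σ (carlitzEval t σ (divX^[i + 1] P)) + P.coeff i := by
    intro i
    rw [carlitzEval_divX, Function.iterate_succ_apply', coeff_divX_iterate, zero_add]
  ext i
  rw [sub_mul, coeff_sub, coeff_sub, coeff_map, coeff_C_mul, sub_sub, coeff_carlitzQuot,
    ← carlitzOp_apply]
  rcases i with _ | i
  · rw [mul_coeff_zero, coeff_X_zero, zero_mul, zero_sub, neg_eq_iff_add_eq_zero]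
    exact (key 0).symm.trans hP
  · rw [coeff_X_mul, coeff_carlitzQuot, key (i + 1)]
    exact add_sub_cancel_left _ _

end Twisted

namespace ExpSetting

variable {k L : Type*} [Field k] [CommRing L] [Algebra k L] {O : Subring L} {t s : L} {e : ℕ → L}
  {q : ℕ}

/-- The logarithm extends to a linear map on `L`. -/
lemma exists_linearMap_log (h : ExpSetting O t s e q) (hk : ∀ a : k, algebraMap k L a ∈ O)
    (hq : ∀ a : k, algebraMap k L a ^ q = algebraMap k L a) :
    ∃ l : L →ₗ[k] L, ∀ x ∈ fil O t s 0, l x ∈ fil O t s 0 ∧ IsSum O t e q (l x) x := by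
  let F : Submodule k L :=
    { fil O t s 0 with
      smul_mem' := fun a x hx => by
        rw [Algebra.smul_def]
        exact mul_mem_fil (hk a) hx }
  choose l hl hl' using fun x : F => h.exists_log x.2
  let l' : F →ₗ[k] L :=
    { toFun := l
      map_add' := fun x y => h.isSum_injective (hl _) (add_mem (hl x) (hl y)) (hl' _)
        (h.isSum_add (hl' x) (hl' y))
      map_smul' := fun a x => by
        rw [RingHom.id_apply, Algebra.smul_def]
        refine h.isSum_injective (hl _) (mul_mem_fil (hk a) (hl x)) (hl' _) ?_
        have h1 := IsSum.smul (hk a) (hq a) (hl' x)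
        have h2 : ((a • x : F) : L) = algebraMap k L a * x := Algebra.smul_def _ _
        rw [h2]
        exact h1 }
  obtain ⟨g, hg⟩ := l'.exists_extend
  refine ⟨g, fun x hx => ?_⟩
  have h1 : g x = l ⟨x, hx⟩ := congr($hg ⟨x, hx⟩)
  rw [h1]
  exact ⟨hl _, hl' ⟨x, hx⟩⟩

variable {K : Type*} [Field K] {ι : K →+* L} {tK : K} {σ : K →+* K} {l : L →ₗ[k] L}

/-- The value `∑ t ^ i log (P_i)`. -/
def logEval (l : L →ₗ[k] L) (ι : K →+* L) (t : L) : K[X] →+ L :=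
  polySum (l.toAddMonoidHom.comp ι.toAddMonoidHom) (AddMonoidHom.mulLeft t)

lemma logEval_divX (l : L →ₗ[k] L) (ι : K →+* L) (t : L) (P : K[X]) :
    logEval l ι t P = t * logEval l ι t P.divX + l (ι (P.coeff 0)) :=
  polySum_divX _ _ P

lemma logEval_X_mul (l : L →ₗ[k] L) (ι : K →+* L) (t : L) (P : K[X]) :
    logEval l ι t (X * P) = t * logEval l ι t P :=
  polySum_X_mul _ _ P

lemma logEval_C (l : L →ₗ[k] L) (ι : K →+* L) (t : L) (a : K) :
    logEval l ι t (C a) = l (ι a) :=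
  polySum_C _ _ a

lemma logEval_monomial (l : L →ₗ[k] L) (ι : K →+* L) (t : L) (n : ℕ) (a : K) :
    logEval l ι t (monomial n a) = t ^ n * l (ι a) := by
  refine (polySum_monomial _ _ n a).trans ?_
  have : ∀ x, ((show AddMonoid.End L from AddMonoidHom.mulLeft t) ^ n) x = t ^ n * x := by
    induction n with
    | zero => exact fun x => (by rw [pow_zero, pow_zero, one_mul]; rfl)
    | succ n ih =>
      intro x
      rw [pow_succ]
      refine (ih (t * x)).trans ?_
      ring
  exact this _

lemma logEval_C_mul (l : L →ₗ[k] L) (ι : K →+* L) (t : L) {a : K} {b : k}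
    (hab : ι a = algebraMap k L b) (P : K[X]) :
    logEval l ι t (C a * P) = algebraMap k L b * logEval l ι t P :=
  polySum_C_mul _ _ a (AddMonoidHom.mulLeft (algebraMap k L b)) (fun x => by
    change l (ι (a * x)) = algebraMap k L b * l (ι x)
    rw [map_mul, hab, ← Algebra.smul_def, ← Algebra.smul_def, map_smul])
    (fun x => mul_left_comm t _ x) P

lemma isSum_eval (h : ExpSetting O t s e q) (ht : ι tK = t) (hσ : ∀ x, σ x = x ^ q)
    (hl : ∀ x ∈ fil O t s 0, l x ∈ fil O t s 0 ∧ IsSum O t e q (l x) x) (P : K[X])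
    (hP : ∀ i, ι (P.coeff i) ∈ fil O t s 0) :
    IsSum O t e q (logEval l ι t P) (ι (carlitzEval tK σ P)) := by
  have hmon : ∀ (n : ℕ) (a : K), ι a ∈ fil O t s 0 →
      IsSum O t e q (logEval l ι t (monomial n a)) (ι (carlitzEval tK σ (monomial n a))) := by
    intro n a ha
    induction n with
    | zero =>
      rw [monomial_zero_left, logEval_C, carlitzEval_C]
      exact (hl _ ha).2
    | succ n ih =>
      rw [← X_mul_monomial, logEval_X_mul, carlitzEval_X_mul, carlitzOp_apply, map_add, map_mul,
        hσ, map_pow, ht]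
      exact h.isSum_step ih
  rw [P.as_sum_range, map_sum, map_sum, map_sum]
  generalize Finset.range (P.natDegree + 1) = T
  induction T using Finset.induction_on with
  | empty => exact h.isSum_zero
  | insert a T ha ih =>
    rw [Finset.sum_insert ha, Finset.sum_insert ha]
    exact h.isSum_add (hmon _ _ (hP a)) ih

lemma eq_log (h : ExpSetting O t s e q)
    (hl : ∀ x ∈ fil O t s 0, l x ∈ fil O t s 0 ∧ IsSum O t e q (l x) x) {y x : L}
    (hy : y ∈ fil O t s 0) (hx : IsSum O t e q y x) : l x = y :=
  have hx' := h.isSum_mem hy hx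
  h.isSum_injective (hl x hx').1 hy (hl x hx').2 hx

lemma log_step (h : ExpSetting O t s e q)
    (hl : ∀ x ∈ fil O t s 0, l x ∈ fil O t s 0 ∧ IsSum O t e q (l x) x) {x : L}
    (hx : x ∈ O) : l (t * x + x ^ q) = t * l x := by
  have hx1 := h.mem_fil_one.2 hx
  have hx0 := h.fil_mono zero_le_one hx1
  refine h.eq_log hl (h.t_mul_mem.2 (h.mem_of_isSum (hl x hx0).1 (hl x hx0).2 hx1)) ?_
  exact h.isSum_step (hl x hx0).2

lemma logEval_sub_map (h : ExpSetting O t s e q) (ht : ι tK = t) (hσ : ∀ x, σ x = x ^ q)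
    (hl : ∀ x ∈ fil O t s 0, l x ∈ fil O t s 0 ∧ IsSum O t e q (l x) x) (G : K[X])
    (hG : ∀ i, ι (G.coeff i) ∈ O) :
    logEval l ι t ((X - C tK) * G - G.map σ) = 0 := by
  have hmon : ∀ (n : ℕ) (a : K), ι a ∈ O →
      logEval l ι t ((X - C tK) * monomial n a - (monomial n a).map σ) = 0 := by
    intro n a ha
    have h1 : (X - C tK) * monomial n a - (monomial n a).map σ =
        monomial (n + 1) a - monomial n (tK * a + a ^ q) := by
      rw [sub_mul, X_mul_monomial, C_mul_monomial, map_monomial, sub_sub, ← map_add, hσ]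
    rw [h1, map_sub, logEval_monomial, logEval_monomial, map_add, map_mul, map_pow, ht,
      h.log_step hl ha]
    ring
  rw [G.as_sum_range, Polynomial.map_sum, Finset.mul_sum, ← Finset.sum_sub_distrib, map_sum]
  exact Finset.sum_eq_zero fun i _ => hmon i _ (hG i)

lemma coeff_carlitzQuot_mem (h : ExpSetting O t s e q) (ht : ι tK = t) (hσ : ∀ x, σ x = x ^ q)
    (hl : ∀ x ∈ fil O t s 0, l x ∈ fil O t s 0 ∧ IsSum O t e q (l x) x) {P : K[X]}
    (hP : ∀ i, ι (P.coeff i) ∈ fil O t s 0) (hP' : logEval l ι t P = 0) (i : ℕ) :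
    ι ((carlitzQuot tK σ P).coeff i) ∈ O := by
  have hc : ∀ i j, ι ((divX^[i] P).coeff j) ∈ fil O t s 0 := fun i j => by
    rw [coeff_divX_iterate]
    exact hP _
  have key : ∀ i, logEval l ι t (divX^[i] P) ∈ fil O t s 0 →
      logEval l ι t (divX^[i + 1] P) ∈ fil O t s 1 := by
    intro i hi
    rw [← h.t_mul_mem, Function.iterate_succ_apply']
    have := logEval_divX l ι t (divX^[i] P)
    rw [eq_sub_of_add_eq this.symm]
    exact sub_mem hi (hl _ (hc i 0)).1
  have key' : ∀ i, logEval l ι t (divX^[i] P) ∈ fil O t s 0 := by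
    intro i
    induction i with
    | zero =>
      change logEval l ι t P ∈ _
      rw [hP']
      exact zero_mem _
    | succ i ih => exact h.fil_mono zero_le_one (key i ih)
  rw [coeff_carlitzQuot, ← h.mem_fil_one]
  exact h.isSum_mem (key i (key' i)) (h.isSum_eval ht hσ hl _ (hc (i + 1)))

/-- Approximation of `γ` by values of the logarithm on a dense subring `R` of `O`. -/
lemma exists_logEval_sub_mem (h : ExpSetting O t s e q) (ht : ι tK = t)
    (hl : ∀ x ∈ fil O t s 0, l x ∈ fil O t s 0 ∧ IsSum O t e q (l x) x) (R : Subring K)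
    (hR : ∀ a ∈ R, ι a ∈ O) (hd : ∀ x ∈ O, ∃ a ∈ R, ∃ y ∈ O, x = ι a + s * y) (n : ℕ) {γ : L}
    (hγ : s ^ n * γ ∈ O) :
    ∃ P : K[X], (∀ i, ∃ a ∈ R, P.coeff i = tK * a) ∧ γ - logEval l ι t P ∈ fil O t s 0 := by
  induction n generalizing γ with
  | zero =>
    refine ⟨0, fun i => ⟨0, R.zero_mem, by rw [coeff_zero, mul_zero]⟩, ?_⟩
    rw [map_zero, sub_zero]
    rw [pow_zero, one_mul] at hγ
    exact h.fil_mono zero_le_one (h.mem_fil_one.2 hγ)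
  | succ n ih =>
    obtain ⟨a, ha, y, hy, hxy⟩ := hd _ hγ
    have hts : ∀ m, t ^ m * s ^ m = 1 := h.pow_mul_pow
    have hf : ι (tK * a) ∈ fil O t s 0 := ⟨ι a, hR a ha, by rw [map_mul, ht, pow_zero, mul_one]⟩
    have ho := h.isSum_sub_mem (hl _ hf).1 (hl _ hf).2
    rw [h.mem_fil_one] at ho
    set b := ι (tK * a) - l (ι (tK * a)) with hb
    have hγ' : γ = t ^ (n + 1) * ι a + t ^ n * y := by
      have h1 := congrArg (t ^ (n + 1) * ·) hxy
      simp only [← mul_assoc, mul_add, hts, one_mul] at h1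
      rw [h1, pow_succ, mul_assoc (t ^ n) t s, h.t_mul_s, mul_one]
    obtain ⟨P, hP, hP'⟩ := ih (γ := γ - logEval l ι t (monomial n (tK * a))) (by
      have : s ^ n * (γ - logEval l ι t (monomial n (tK * a))) = y + b := by
        have h3 : l (ι (tK * a)) = t * ι a - b := by rw [hb, map_mul, ht]; ring
        rw [logEval_monomial, h3, hγ']
        linear_combination (y + b) * hts n
      rw [this]
      exact O.add_mem hy ho)
    refine ⟨monomial n (tK * a) + P, fun i => ?_, ?_⟩
    · obtain ⟨c, hc, hc'⟩ := hP i
      rw [coeff_add, coeff_monomial, hc']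
      split_ifs
      · exact ⟨a + c, R.add_mem ha hc, (mul_add _ _ _).symm⟩
      · exact ⟨c, hc, zero_add _⟩
    · rwa [map_add, ← sub_sub]

end ExpSetting

end Carlitz
end

noncomputable section

namespace Carlitz

open Polynomial QCoh Opposite

lemma map_smul_of_map_C_of_map_X {k M N : Type*} [CommRing k] [AddCommGroup M] [AddCommGroup N]
    [Module k[X] M] [Module k[X] N] (f : M →+ N) (hC : ∀ (a : k) x, f (C a • x) = (C a : k[X]) • f x)
    (hX : ∀ x, f ((Polynomial.X : k[X]) • x) = (Polynomial.X : k[X]) • f x) (P : k[X]) (x : M) :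
    f (P • x) = P • f x := by
  induction P using Polynomial.induction_on generalizing x with
  | C a => exact hC a x
  | add P Q hP hQ => rw [add_smul, add_smul, map_add, hP, hQ]
  | monomial n a h =>
    rw [pow_succ, ← mul_assoc, mul_smul, h, hX, ← mul_smul]

section Regular

variable {k : Type u} [Field k] {X : Scheme.{u}} [IsIntegral X]

lemma frobField_mem_regAt [Fintype k] (p : X ⟶ Spec (CommRingCat.of k)) {z : X} {f : X.functionField}
    (hf : f ∈ regAt z) : frobField p f ∈ regAt z := by
  rw [frobField_apply]
  exact pow_mem hf _

lemma toField_scalars (p : X ⟶ Spec (CommRingCat.of k)) {U : X.Opens} (hU : genericPoint X ∈ U)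
    (a : k) : toField hU (scalars p U a) = scalarsField p a := by
  have h : res le_top (scalars p ⊤ a) = scalars p U a :=
    congr($(Scheme.Hom.appLE_map p le_top (homOfLE (le_top : U ≤ ⊤)).op)
      ((Scheme.ΓSpecIso (CommRingCat.of k)).inv a))
  rw [← h, toField_res]
  rfl

variable (π : X ⟶ ProjLine k)

lemma toLocalField_mem_integers {z : X} {f : X.functionField} (hf : f ∈ regAt z) :
    toLocalField π z f ∈ integers π z := by
  obtain ⟨a, rfl⟩ := hf
  exact toLocalField_mem π z a

variable [Surjective π]

lemma twPoly_sec_smul {U : X.Opens} (hU : genericPoint X ∈ U) (P : k[X])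
    (x : Γ(twistA π, cyl (toK π) U)) :
    twPoly π hU (P • x) = P.map (scalarsField (toK π)) * twPoly π hU x := by
  refine (twPoly_smul π hU _ x).trans (congrArg (· * _) ?_)
  exact toPoly_coeffA (toK π) (lineIncl_cyl _ hU) P

variable [Fintype k]

/-- The value `∑ Φ ^ i (P_i)`, where `Φ x = t x + x ^ q`. -/
abbrev expPoly : X.functionField[X] →+ X.functionField :=
  carlitzEval (tField π) (frobField (toK π))

lemma expPoly_mem_regAt {z : X} (hz : z ∈ finitePart π) {P : X.functionField[X]}
    (hP : ∀ i, P.coeff i ∈ regAt z) : expPoly π P ∈ regAt z :=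
  carlitzEval_mem _ _ _ (tField_mem_regAt π hz) (fun _ => frobField_mem_regAt _) hP

variable [IsLocallyNoetherian X] [SmoothOfRelativeDimension 1 (toK π)]

lemma mem_regAt_of_mem_integers {z : X} {f : X.functionField}
    (hf : toLocalField π z f ∈ integers π z) : f ∈ regAt z :=
  exists_algebraMap_eq_of_mem_integers π hf

lemma toLocalField_mem_fil_iff {z : X} (hz : z ∉ finitePart π) {f : X.functionField} :
    toLocalField π z f ∈ fil (integers π z) (toLocalField π z (tField π)) (tInvLocal π hz) 0 ↔
      (tField π)⁻¹ * f ∈ regAt z := by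
  have h0 := tField_ne_zero π
  constructor
  · rintro ⟨o, ho, h⟩
    refine mem_regAt_of_mem_integers π ?_
    rw [map_mul, h, pow_zero, mul_one, ← mul_assoc, ← map_mul, inv_mul_cancel₀ h0, map_one, one_mul]
    exact ho
  · intro h
    refine ⟨_, toLocalField_mem_integers π h, ?_⟩
    rw [pow_zero, mul_one, ← map_mul, mul_inv_cancel_left₀ h0]

lemma exists_logMap {z : X} (hz : z ∉ finitePart π) :
    ∃ l : LocalField π z →ₗ[k] LocalField π z,
      ∀ x ∈ fil (integers π z) (toLocalField π z (tField π)) (tInvLocal π hz) 0,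
        l x ∈ fil (integers π z) (toLocalField π z (tField π)) (tInvLocal π hz) 0 ∧
          IsExp π z (l x) x :=
  (expSetting π hz).exists_linearMap_log (algebraMap_mem π z)
    fun a => by rw [← map_pow, FiniteField.pow_card]

/-- A linear map that inverts the exponential near `0`. -/
def logMap {z : X} (hz : z ∉ finitePart π) : LocalField π z →ₗ[k] LocalField π z :=
  (exists_logMap π hz).choose

lemma logMap_spec {z : X} (hz : z ∉ finitePart π) (x : LocalField π z)
    (hx : x ∈ fil (integers π z) (toLocalField π z (tField π)) (tInvLocal π hz) 0) :
    logMap π hz x ∈ fil (integers π z) (toLocalField π z (tField π)) (tInvLocal π hz) 0 ∧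
      IsExp π z (logMap π hz x) x :=
  (exists_logMap π hz).choose_spec x hx

/-- The value `∑ t ^ i log (P_i)` in `K_z`. -/
abbrev logPoly {z : X} (hz : z ∉ finitePart π) : X.functionField[X] →+ LocalField π z :=
  ExpSetting.logEval (logMap π hz) (toLocalField π z) (toLocalField π z (tField π))

end Regular

section Psi

variable {k : Type u} [Field k] [Fintype k] {X : Scheme.{u}} [IsIntegral X] (π : X ⟶ ProjLine k)
  [Surjective π]

lemma carlitzSections_ext {U : X.Opens} {y y' : carlitzSections π U}
    (h : ∀ hU : genericPoint X ∈ U,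
      toField (V := U ⊓ finitePart π) ⟨hU, generic_mem_finitePart π⟩ y.1.1 =
        toField (V := U ⊓ finitePart π) ⟨hU, generic_mem_finitePart π⟩ y'.1.1)
    (h' : ∀ z, y.1.2 z = y'.1.2 z) : y = y' := by
  refine Subtype.ext (Prod.ext ?_ (funext h'))
  by_cases hU : genericPoint X ∈ U
  · exact toField_injective (U := U ⊓ finitePart π) ⟨hU, generic_mem_finitePart π⟩ (h hU)
  · have hU' : U ⊓ finitePart π = ⊥ := le_bot_iff.1 fun z hz => (hU (generic_mem hz.1)).elim
    have := subsingleton_of_eq_bot (structureSheaf X) hU'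
    exact Subsingleton.elim (α := Γ(structureSheaf X, U ⊓ finitePart π)) _ _

lemma subsingleton_carlitzSections {U : X.Opens} (hU : genericPoint X ∉ U) :
    Subsingleton (carlitzSections π U) :=
  ⟨fun _ _ => carlitzSections_ext π (fun hU' => (hU hU').elim)
    fun z => (hU (generic_mem z.2.1)).elim⟩

variable [IsLocallyNoetherian X] [SmoothOfRelativeDimension 1 (toK π)]

lemma isExp_logPoly {z : X} (hz : z ∉ finitePart π) {P : X.functionField[X]}
    (hP : ∀ i, (tField π)⁻¹ * P.coeff i ∈ regAt z) :
    IsExp π z (logPoly π hz P) (toLocalField π z (expPoly π P)) :=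
  (expSetting π hz).isSum_eval rfl (frobField_apply (toK π)) (logMap_spec π hz) P
    fun i => (toLocalField_mem_fil_iff π hz).2 (hP i)

/-- The section `y` of `C` is given by the polynomial `P`. -/
def IsEval {U : X.Opens} (P : X.functionField[X]) (y : carlitzSections π U) : Prop :=
  (∀ hU : genericPoint X ∈ U,
    toField (V := U ⊓ finitePart π) ⟨hU, generic_mem_finitePart π⟩ y.1.1 = expPoly π P) ∧
  ∀ z : PointsAtInfinity π U, y.1.2 z = logPoly π z.2.2 P

variable {π}

lemma IsEval.unique {U : X.Opens} {P : X.functionField[X]} {y y' : carlitzSections π U}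
    (h : IsEval π P y) (h' : IsEval π P y') : y = y' :=
  carlitzSections_ext π (fun hU => (h.1 hU).trans (h'.1 hU).symm)
    fun z => (h.2 z).trans (h'.2 z).symm

lemma IsEval.add {U : X.Opens} {P Q : X.functionField[X]} {y y' : carlitzSections π U}
    (h : IsEval π P y) (h' : IsEval π Q y') : IsEval π (P + Q) (y + y') := by
  refine ⟨fun hU => ?_, fun z => ?_⟩
  · rw [map_add, ← h.1 hU, ← h'.1 hU]
    exact map_add _ _ _
  · rw [map_add, ← h.2, ← h'.2]
    rfl

lemma isEval_zero {U : X.Opens} : IsEval π 0 (0 : carlitzSections π U) := by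
  refine ⟨fun hU => ?_, fun z => ?_⟩
  · rw [map_zero]
    exact map_zero _
  · rw [map_zero]
    rfl

lemma IsEval.smul {U : X.Opens} {P : X.functionField[X]} {y : carlitzSections π U}
    (h : IsEval π P y) (a : k) : IsEval π (C (scalarsField (toK π) a) * P) (a • y) := by
  refine ⟨fun hU => ?_, fun z => ?_⟩
  · rw [carlitzEval_C_mul _ _ (frobField_scalarsField _ a), ← h.1 hU,
      ← toField_scalars (toK π) (U := U ⊓ finitePart π) ⟨hU, generic_mem_finitePart π⟩]
    exact map_mul _ _ _
  · have ha : toLocalField π z (scalarsField (toK π) a) = algebraMap k (LocalField π z) a := rfl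
    rw [ExpSetting.logEval_C_mul _ _ _ ha, ← h.2]
    exact Algebra.smul_def a (y.1.2 z)

lemma IsEval.tAct {U : X.Opens} {P : X.functionField[X]} {y : carlitzSections π U}
    (h : IsEval π P y) : IsEval π (Polynomial.X * P) (tAct π U y) := by
  refine ⟨fun hU => ?_, fun z => ?_⟩
  · have hU' : genericPoint X ∈ U ⊓ finitePart π := ⟨hU, generic_mem_finitePart π⟩
    rw [carlitzEval_X_mul, carlitzOp_apply, frobField_apply, ← h.1 hU]
    let c : Γ(X, U ⊓ finitePart π) := y.1.1
    change toField hU' (res inf_le_right (tFun π) * c + c ^ Fintype.card k) =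
      tField π * toField hU' c + toField hU' c ^ Fintype.card k
    rw [map_add, map_mul, map_pow, toField_res]
    rfl
  · rw [ExpSetting.logEval_X_mul, ← h.2]
    rfl

lemma IsEval.res {U V : X.Opens} (hV : V ≤ U) {P : X.functionField[X]} {y : carlitzSections π U}
    (h : IsEval π P y) : IsEval π P (carlitzRes π hV y) := by
  refine ⟨fun hU => ?_, fun z => h.2 ⟨z, hV z.2.1, z.2.2⟩⟩
  rw [← h.1 (hV hU)]
  exact toField_res (inf_le_inf_right _ hV) ⟨hU, generic_mem_finitePart π⟩ _

variable (π)

lemma exists_isEval {U : X.Opens} {P : X.functionField[X]} (hP : ∀ i, IsTwist π U (P.coeff i)) :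
    ∃ y : carlitzSections π U, IsEval π P y := by
  by_cases hU : genericPoint X ∈ U
  · have hU' : genericPoint X ∈ U ⊓ finitePart π := ⟨hU, generic_mem_finitePart π⟩
    obtain ⟨c, hc⟩ := exists_toField_eq hU' (f := expPoly π P) fun z hz =>
      expPoly_mem_regAt π hz.2 fun i => (hP i z hz.1).1 hz.2
    let y : RegFun π (U ⊓ finitePart π) × (∀ z : PointsAtInfinity π U, LocalField π z) :=
      (c, fun z => logPoly π z.2.2 P)
    refine ⟨⟨y, fun z => ?_⟩, fun _ => hc, fun z => rfl⟩
    have h1 : localize π z.2.1 y.1 = toLocalField π z (expPoly π P) :=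
      congrArg (toLocalField π z) hc
    rw [h1]
    exact isExp_logPoly π z.2.2 fun i => (hP i z z.2.1).2 (mem_infinitePart π z.2.2)
  · exact ⟨0, fun hU' => (hU hU').elim, fun z => (hU (generic_mem z.2.1)).elim⟩

lemma exists_psi (U : X.Opens) (x : Γ(twistA π, cyl (toK π) U)) :
    ∃ y : carlitzSections π U, ∀ hU : genericPoint X ∈ U, IsEval π (twPoly π hU x) y := by
  by_cases hU : genericPoint X ∈ U
  · obtain ⟨y, hy⟩ := exists_isEval π (isTwist_coeff π hU x)
    exact ⟨y, fun _ => hy⟩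
  · exact ⟨0, fun hU' => (hU hU').elim⟩

/-- The section of `C` given by a section of `𝒪_X(∞) ⊠ A`. -/
def psiFun (U : X.Opens) (x : Γ(twistA π, cyl (toK π) U)) : carlitzSections π U :=
  (exists_psi π U x).choose

lemma isEval_psiFun {U : X.Opens} (hU : genericPoint X ∈ U) (x : Γ(twistA π, cyl (toK π) U)) :
    IsEval π (twPoly π hU x) (psiFun π U x) :=
  (exists_psi π U x).choose_spec hU

lemma psiFun_eq {U : X.Opens} {x : Γ(twistA π, cyl (toK π) U)} {y : carlitzSections π U}
    (h : ∀ hU : genericPoint X ∈ U, IsEval π (twPoly π hU x) y) : psiFun π U x = y := by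
  by_cases hU : genericPoint X ∈ U
  · exact (isEval_psiFun π hU x).unique (h hU)
  · have := subsingleton_carlitzSections π hU
    exact Subsingleton.elim _ _

/-- The map `psiFun`, as an additive map to the `A`-module `C(U)`. -/
def psiHom (U : X.Opens) : Γ(twistA π, cyl (toK π) U) →+ CarlitzModule π U where
  toFun x := ofSections π U (psiFun π U x)
  map_zero' := (congrArg (ofSections π U) (psiFun_eq π fun hU => by
    rw [map_zero]
    exact isEval_zero)).trans (map_zero _)
  map_add' x x' := (congrArg (ofSections π U) (psiFun_eq π fun hU => by
    rw [map_add]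
    exact (isEval_psiFun π hU x).add (isEval_psiFun π hU x'))).trans (map_add _ _ _)

/-- The `A`-linear map from sections of `𝒪_X(∞) ⊠ A` to sections of `C`. -/
def psiSec (U : X.Opens) : Γ(twistA π, cyl (toK π) U) →ₗ[k[X]] CarlitzModule π U where
  __ := psiHom π U
  map_smul' := map_smul_of_map_C_of_map_X (psiHom π U)
    (fun a x => by
      refine (congrArg (ofSections π U) (psiFun_eq π (y := a • psiFun π U x) fun hU => ?_)).trans ?_
      · rw [twPoly_sec_smul, map_C]
        exact (isEval_psiFun π hU x).smul a
      · refine ((ofSections π U).map_smul a (psiFun π U x)).trans ?_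
        exact (algebraMap_smul k[X] a (ofSections π U (psiFun π U x))).symm)
    (fun x => by
      refine (congrArg (ofSections π U) (psiFun_eq π (y := tAct π U (psiFun π U x))
        fun hU => ?_)).trans ?_
      · rw [twPoly_sec_smul, map_X]
        exact (isEval_psiFun π hU x).tAct
      · exact (Module.AEval'.X_smul_of _ _).symm)

lemma psiSec_res {U V : X.Opens} (h : V ≤ U) (x : Γ(twistA π, cyl (toK π) U)) :
    psiSec π V (sres _ (cyl_mono h) x) = carlitzMap π h (psiSec π U x) :=
  congrArg (ofSections π V) (psiFun_eq π fun hV => by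
    rw [twPoly_sres π h hV]
    exact (isEval_psiFun π (h hV) x).res h)

/-- The morphism from the direct image of `𝒪_X(∞) ⊠ A` to `C`. -/
def psi : (direct (toK π)).obj (carlitzShtuka π).obj.M' ⟶ carlitzSheaf π :=
  ⟨{ app := fun U => ModuleCat.ofHom (psiSec π U.unop)
     naturality := fun _ _ i => ModuleCat.hom_ext (LinearMap.ext fun x =>
      psiSec_res π i.unop.le x) }⟩

end Psi

end Carlitz
end

noncomputable section

namespace Carlitz

open Polynomial QCoh Opposite

section Neighbourhoods

variable {X : Scheme.{u}} [IsIntegral X]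

lemma exists_open_forall_mem_regAt {ι : Type*} (s : Finset ι) {z : X} {f : ι → X.functionField}
    (hf : ∀ i ∈ s, f i ∈ regAt z) :
    ∃ V : X.Opens, z ∈ V ∧ ∀ i ∈ s, ∀ w ∈ V, f i ∈ regAt w := by
  classical
  induction s using Finset.induction_on with
  | empty => exact ⟨⊤, trivial, by simp⟩
  | insert a s ha ih =>
    obtain ⟨V, hV, h⟩ := ih fun i hi => hf i (Finset.mem_insert_of_mem hi)
    obtain ⟨U, hU, hη, b, hb⟩ := exists_open_of_mem_regAt (hf a (Finset.mem_insert_self a s))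
    refine ⟨V ⊓ U, ⟨hV, hU⟩, fun i hi w hw => ?_⟩
    rcases Finset.mem_insert.1 hi with rfl | hi
    · rw [← hb]
      exact toField_mem_regAt _ _ hw.2
    · exact h i hi w hw.1

variable {k : Type u} [Field k] (π : X ⟶ ProjLine k) [Surjective π]

lemma exists_open_forall_coeff_mem_regAt {z : X} {P : X.functionField[X]}
    (hP : ∀ i, (tField π)⁻¹ * P.coeff i ∈ regAt z) :
    ∃ V : X.Opens, z ∈ V ∧ ∀ i, ∀ w ∈ V, (tField π)⁻¹ * P.coeff i ∈ regAt w := by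
  obtain ⟨V, hV, h⟩ := exists_open_forall_mem_regAt P.support fun i _ => hP i
  refine ⟨V, hV, fun i w hw => ?_⟩
  by_cases hi : i ∈ P.support
  · exact h i hi w hw
  · rw [notMem_support_iff.1 hi, mul_zero]
    exact zero_mem _

/-- A neighbourhood of a point at infinity that contains no other such points. -/
lemma exists_open_inf_finitePart [IsProper (toK π)] [SmoothOfRelativeDimension 1 (toK π)] (z : X) :
    ∃ V : X.Opens, z ∈ V ∧ ∀ w ∈ V, w ∉ finitePart π → w = z := by
  have hη := generic_mem_finitePart π
  have h1 : ((finitePart π : Set X)ᶜ).Finite :=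
    finite_of_isClosed (toK π) (finitePart π).isOpen.isClosed_compl fun h => h hη
  have h2 : IsClosed ((finitePart π : Set X)ᶜ \ {z}) :=
    isClosed_of_finite (toK π) (h1.subset Set.sdiff_subset) fun h => h.1 hη
  refine ⟨⟨_, h2.isOpen_compl⟩, fun h => h.2 rfl, fun w hw hw' => ?_⟩
  by_contra hne
  exact hw ⟨hw', hne⟩

end Neighbourhoods

section Exactness

variable {k : Type u} [Field k] [Fintype k] {X : Scheme.{u}} [IsIntegral X] (π : X ⟶ ProjLine k)
  [Surjective π] [IsLocallyNoetherian X] [SmoothOfRelativeDimension 1 (toK π)]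

lemma IsEval.C_of_isEmpty {U : X.Opens} (hU : U ≤ finitePart π) (hη : genericPoint X ∈ U)
    (y : carlitzSections π U) :
    IsEval π (C (toField (V := U ⊓ finitePart π) ⟨hη, generic_mem_finitePart π⟩ y.1.1)) y :=
  ⟨fun _ => (carlitzEval_C _ _ _).symm, fun z => (z.2.2 (hU z.2.1)).elim⟩

lemma psiFun_phiSec (U : X.Opens) (x : Γ(timesA (toK π), cyl (toK π) U)) :
    psiFun π U (phiSec (carlitzShtuka π).obj U (funSec x)) = 0 := by
  refine psiFun_eq π fun hU => ?_
  rw [twPoly_phiSec π hU]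
  refine ⟨fun hU => ?_, fun z => ?_⟩
  · refine (map_zero (toField _)).trans (carlitzEval_sub_map _ _ _).symm
  · exact ((expSetting π z.2.2).logEval_sub_map rfl (frobField_apply (toK π)) (logMap_spec π z.2.2) _
      fun i => toLocalField_mem_integers π (coeff_toPoly_mem (toK π) hU x i z.2.1)).symm

lemma exists_phiSec_eq {U : X.Opens} {x : Γ(twistA π, cyl (toK π) U)} (hx : psiFun π U x = 0) :
    ∃ y : Γ(timesA (toK π), cyl (toK π) U), phiSec (carlitzShtuka π).obj U (funSec y) = x := by
  by_cases hU : genericPoint X ∈ U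
  · have h := isEval_psiFun π hU x
    rw [hx] at h
    have h1 : expPoly π (twPoly π hU x) = 0 := (h.1 hU).symm.trans (map_zero (toField _))
    obtain ⟨y, hy⟩ := exists_toPoly_eq (toK π) hU
      (P := carlitzQuot (tField π) (frobField (toK π)) (twPoly π hU x)) fun i z hz => by
        by_cases hz' : z ∈ finitePart π
        · rw [coeff_carlitzQuot]
          refine expPoly_mem_regAt π hz' fun j => ?_
          rw [coeff_divX_iterate]
          exact (isTwist_coeff π hU x _ z hz).1 hz'
        · refine mem_regAt_of_mem_integers π ?_
          refine (expSetting π hz').coeff_carlitzQuot_mem rfl (frobField_apply (toK π))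
            (logMap_spec π hz') (fun j => ?_) (h.2 ⟨z, hz, hz'⟩).symm i
          exact (toLocalField_mem_fil_iff π hz').2
            ((isTwist_coeff π hU x j z hz).2 (mem_infinitePart π hz'))
    refine ⟨y, twPoly_injective π hU ?_⟩
    rw [twPoly_phiSec π hU, hy]
    exact eq_of_carlitzEval_eq_zero _ _ h1
  · have hU' : U = ⊥ := le_bot_iff.1 fun z hz => (hU (generic_mem hz)).elim
    have := subsingleton_of_eq_bot (carlitzShtuka π).obj.M' (V := cyl (toK π) U) (by rw [hU']; rfl)
    exact ⟨0, Subsingleton.elim _ _⟩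

/-- Near a point at infinity, a pair `(c, γ)` with `exp γ = c` comes from a polynomial. -/
lemma exists_logPoly_eq {z : X} (hz : z ∉ finitePart π) {c : X.functionField} {γ : LocalField π z}
    (h : IsExp π z γ (toLocalField π z c)) :
    ∃ P : X.functionField[X], (∀ i, (tField π)⁻¹ * P.coeff i ∈ regAt z) ∧
      expPoly π P = c ∧ logPoly π hz P = γ := by
  have hs := expSetting π hz
  obtain ⟨n, hn⟩ := exists_pow_mul_mem_integers π hz γ
  obtain ⟨P, hP, hP'⟩ := hs.exists_logEval_sub_mem (ι := toLocalField π z) (tK := tField π) rfl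
    (logMap_spec π hz) (regAt z) (fun a ha => toLocalField_mem_integers π ha)
    (fun x hx => by
      obtain ⟨a, y, hy, h⟩ := exists_sub_mem_integers π hz hx
      exact ⟨_, ⟨a, rfl⟩, y, hy, h⟩) n hn
  have hP0 : ∀ i, (tField π)⁻¹ * P.coeff i ∈ regAt z := fun i => by
    obtain ⟨a, ha, h⟩ := hP i
    rwa [h, inv_mul_cancel_left₀ (tField_ne_zero π)]
  have h1 : IsExp π z (γ - logPoly π hz P) (toLocalField π z (c - expPoly π P)) := by
    rw [map_sub]
    exact hs.isSum_sub h (isExp_logPoly π hz hP0)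
  refine ⟨P + C (c - expPoly π P), fun i => ?_, ?_, ?_⟩
  · rw [coeff_add, mul_add, coeff_C]
    refine add_mem (hP0 i) ?_
    split_ifs
    · exact (toLocalField_mem_fil_iff π hz).1 (hs.isSum_mem hP' h1)
    · rw [mul_zero]
      exact zero_mem _
  · rw [map_add, carlitzEval_C]
    exact add_sub_cancel _ _
  · rw [map_add, ExpSetting.logEval_C, hs.eq_log (logMap_spec π hz) hP' h1]
    exact add_sub_cancel _ _

lemma exists_psiFun_eq [IsProper (toK π)] {U : X.Opens} (y : carlitzSections π U) {z : X}
    (hz : z ∈ U) :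
    ∃ (V : X.Opens) (h : V ≤ U) (x : Γ(twistA π, cyl (toK π) V)), z ∈ V ∧
      psiFun π V x = carlitzRes π h y := by
  have hη := generic_mem_finitePart π
  suffices H : ∃ (V : X.Opens) (h : V ≤ U) (P : X.functionField[X]), z ∈ V ∧
      (∀ i, IsTwist π V (P.coeff i)) ∧ IsEval π P (carlitzRes π h y) by
    obtain ⟨V, h, P, hzV, hP, hP'⟩ := H
    obtain ⟨x, hx⟩ := exists_twPoly_eq π (generic_mem hzV) hP
    refine ⟨V, h, x, hzV, psiFun_eq π fun hV => ?_⟩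
    rw [hx]
    exact hP'
  by_cases hz' : z ∈ finitePart π
  · have hV : genericPoint X ∈ U ⊓ finitePart π := ⟨generic_mem hz, hη⟩
    refine ⟨U ⊓ finitePart π, inf_le_left, _, ⟨hz, hz'⟩, fun i w hw => ?_,
      IsEval.C_of_isEmpty π inf_le_right hV (carlitzRes π inf_le_left y)⟩
    have h1 : (C (toField (V := U ⊓ finitePart π ⊓ finitePart π) ⟨hV, hη⟩
        (carlitzRes π inf_le_left y).1.1)).coeff i ∈ regAt w := by
      rw [coeff_C]
      split_ifs
      · exact toField_mem_regAt _ _ ⟨hw, hw.2⟩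
      · exact zero_mem _
    exact ⟨fun _ => h1, fun hw' => mul_mem (inv_tField_mem_regAt π hw') h1⟩
  · obtain ⟨P, hP, hc, hγ⟩ := exists_logPoly_eq π hz' (y.2 ⟨z, hz, hz'⟩)
    obtain ⟨V₁, hz₁, h₁⟩ := exists_open_forall_coeff_mem_regAt π hP
    obtain ⟨V₂, hz₂, h₂⟩ := exists_open_inf_finitePart π z
    refine ⟨U ⊓ (V₁ ⊓ V₂), inf_le_left, P, ⟨hz, hz₁, hz₂⟩, fun i w hw => ⟨fun hw' => ?_,
      fun _ => h₁ i w hw.2.1⟩, fun hV => ?_, fun w => ?_⟩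
    · have h3 := mul_mem (tField_mem_regAt π hw') (h₁ i w hw.2.1)
      rwa [mul_inv_cancel_left₀ (tField_ne_zero π)] at h3
    · refine Eq.trans ?_ hc.symm
      exact toField_res (inf_le_inf_right _ inf_le_left) ⟨hV, hη⟩ _
    · obtain ⟨w, hw, hw'⟩ := w
      obtain rfl := h₂ w hw.2.2 hw'
      exact hγ.symm

lemma phi_psi : phi (carlitzShtuka π).obj ≫ psi π = 0 :=
  Sheaf.hom_ext (NatTrans.ext (funext fun U => ModuleCat.hom_ext (LinearMap.ext fun x =>
    (congrArg (ofSections π U.unop) (psiFun_phiSec π U.unop x)).trans (map_zero _))))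

lemma shortExact_phi_psi [IsProper (toK π)] :
    (ShortComplex.mk (phi (carlitzShtuka π).obj) (psi π) (phi_psi π)).ShortExact := by
  refine ModSheaf.shortExact_of_sections _ (fun U => phiSec_carlitz_injective π U)
    (fun U x hx => ?_) (fun U y z hz => ?_)
  · exact exists_phiSec_eq π ((ofSections π U).injective (hx.trans (map_zero (ofSections π U)).symm))
  · obtain ⟨V, h, x, hzV, hx⟩ := exists_psiFun_eq π ((ofSections π U).symm y) hz
    exact ⟨V, h, x, hzV, congrArg (ofSections π V) hx⟩

end Exactness

end Carlitz
end

theorem theorem2 {k : Type u} [Field k] [Fintype k] {X : Scheme.{u}}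
    (π : X ⟶ Carlitz.ProjLine k) [AlgebraicGeometry.IsIntegral X] [Surjective π]
    [SmoothOfRelativeDimension 1 (Carlitz.toK π)] [IsProper (Carlitz.toK π)]
    [GeometricallyConnected (Carlitz.toK π)] :
    Subsingleton (Carlitz.Shtuka.Ext (Carlitz.unitShtuka (Carlitz.toK π))
      (Carlitz.carlitzShtuka π) 0) ∧
    ∀ i : ℕ, Nonempty
      (Carlitz.Shtuka.Ext (Carlitz.unitShtuka (Carlitz.toK π)) (Carlitz.carlitzShtuka π) (i + 1)
        ≃ₗ[Polynomial k] Carlitz.cohomology (Carlitz.carlitzSheaf π) i) := by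
  have := Carlitz.isNoetherian_of_proper (Carlitz.toK π)
  have := Carlitz.mono_carlitzToHull π
  exact ⟨Carlitz.subsingleton_ext_zero π, fun i => Carlitz.nonempty_ext_equiv_cohomology
    (Carlitz.curveLike (Carlitz.toK π)) (Carlitz.goodCover π) (Carlitz.carlitzToHull π)
    (Carlitz.lineSheaf_flasque _) (Carlitz.lineSheaf_flasque _) (Carlitz.psi π)
    (Carlitz.phi_psi π) (Carlitz.shortExact_phi_psi π) i⟩
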